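/- The traveling salesman problem (TSP) asks, for a directed or undirected simple graph $G$ on $n\ge 1$ vertices whose edges (arcs) carry non-negative integer weights, to find a Hamiltonian cycle of $G$ of minimum total weight, or to report that $G$ has no Hamiltonian cycle. Let $W$ be an upper bound on the edge weights of the instance. The average degree of $G$ is $2|E|/n$ if $G$ is undirected, and the number of arcs divided by $n$ if $G$ is directed. Running time and space are measured in bits on a logarithmic-cost random access machine; the machine reads the weighted adjacency matrix of $G$ with the weights written in binary. Theorem. There is a function $\varepsilon\colon\mathbb{R}\to(0,1)$ such that, both for undirected and for directed graphs, TSP is solved by a deterministic algorithm which on every $n$-vertex instance with weights at most $W$ uses space polynomial in $n$ and $\log W$, and which for every real $d$ runs in time \[ (W+1)\cdot(2-\varepsilon(d))^n\cdot \mathrm{poly}(n,\log W) \] on the instances of average degree at most $d$. Here the algorithm and the polynomials do not depend on $d$. In particular, if the weights are bounded by a polynomial in $n$ (for example, for the Hamiltonian cycle problem), then TSP on graphs of average degree $d$ is solved in $O^*((2-\varepsilon(d))^n)$ time and polynomial space. -/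

import Mathlib

/-! ### A logarithmic-cost random access machine

Programs are finite while-programs over natural-number registers and finitely many one-dimensional
arrays with indirect addressing.  Every instruction is charged for the binary lengths of the
numbers that it touches, and the space of a configuration is the total binary length of the
nonzero memory cells, array addresses included. -/

namespace RAM

/-- Arithmetic instructions; `sub` is truncated subtraction and `div` is integer division. -/
inductive Op
  | add
  | sub
  | mul
  | div

/-- The value of an arithmetic instruction. -/
def Op.eval : Op → ℕ → ℕ → ℕ
  | .add, a, b => a + b
  | .sub, a, b => a - b
  | .mul, a, b => a * b
  | .div, a, b => a / b

/-- Programs.  Registers and arrays are named by natural numbers; a program mentions only finitely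
many of them. -/
inductive Prog
  /-- do nothing -/
  | skip
  /-- `const x k`: register `x` receives the constant `k` -/
  | const (x k : ℕ)
  /-- `arith o x y z`: register `x` receives `o` applied to the registers `y` and `z` -/
  | arith (o : Op) (x y z : ℕ)
  /-- `load x a y`: register `x` receives the entry of the array `a` whose index is in `y` -/
  | load (x a y : ℕ)
  /-- `store a y x`: the entry of the array `a` whose index is in `y` receives register `x` -/
  | store (a y x : ℕ)
  /-- sequential composition -/
  | seq (c₁ c₂ : Prog)
  /-- `ite x c₁ c₂`: run `c₁` if register `x` is nonzero, and `c₂` otherwise -/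
  | ite (x : ℕ) (c₁ c₂ : Prog)
  /-- `while x c`: as long as register `x` is nonzero, run `c` -/
  | while (x : ℕ) (c : Prog)

/-- Memory contents: the registers, and for an array `a` and an index `i` the entry `arr (a, i)`.
All but finitely many cells hold `0`. -/
structure State where
  reg : ℕ →₀ ℕ
  arr : ℕ × ℕ →₀ ℕ

/-- Assign the value `v` to the register `x`. -/
noncomputable def State.setReg (σ : State) (x v : ℕ) : State :=
  { σ with reg := σ.reg.update x v }

/-- Assign the value `v` to the entry `i` of the array `a`. -/
noncomputable def State.setArr (σ : State) (a i v : ℕ) : State :=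
  { σ with arr := σ.arr.update (a, i) v }

/-- The memory in use, in bits: for every nonzero cell the binary length of its contents, plus,
for an array cell, the binary length of its index. -/
noncomputable def State.space (σ : State) : ℕ :=
  (σ.reg.sum fun _ v => 1 + Nat.size v) + σ.arr.sum fun p v => 1 + Nat.size p.2 + Nat.size v

/-- `Exec c σ σ' t s`: started in the memory `σ`, the program `c` halts with the memory `σ'`, after
time `t`, and `s` is the maximum of the space of the memory contents met on the way. -/
inductive Exec : Prog → State → State → ℕ → ℕ → Prop
  | skip (σ : State) : Exec .skip σ σ 1 σ.space
  | const (σ : State) (x k : ℕ) :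
      Exec (.const x k) σ (σ.setReg x k) (1 + Nat.size k) (max σ.space (σ.setReg x k).space)
  | arith (σ : State) (o : Op) (x y z : ℕ) :
      Exec (.arith o x y z) σ (σ.setReg x (o.eval (σ.reg y) (σ.reg z)))
        ((1 + Nat.size (σ.reg y)) * (1 + Nat.size (σ.reg z)))
        (max σ.space (σ.setReg x (o.eval (σ.reg y) (σ.reg z))).space)
  | load (σ : State) (x a y : ℕ) :
      Exec (.load x a y) σ (σ.setReg x (σ.arr (a, σ.reg y)))
        (1 + Nat.size (σ.reg y) + Nat.size (σ.arr (a, σ.reg y)))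
        (max σ.space (σ.setReg x (σ.arr (a, σ.reg y))).space)
  | store (σ : State) (a y x : ℕ) :
      Exec (.store a y x) σ (σ.setArr a (σ.reg y) (σ.reg x))
        (1 + Nat.size (σ.reg y) + Nat.size (σ.reg x))
        (max σ.space (σ.setArr a (σ.reg y) (σ.reg x)).space)
  | seq {c₁ c₂ : Prog} {σ σ' σ'' : State} {t₁ t₂ s₁ s₂ : ℕ} :
      Exec c₁ σ σ' t₁ s₁ → Exec c₂ σ' σ'' t₂ s₂ →
      Exec (.seq c₁ c₂) σ σ'' (t₁ + t₂) (max s₁ s₂)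
  | ite_true {x : ℕ} {c₁ c₂ : Prog} {σ σ' : State} {t s : ℕ} :
      σ.reg x ≠ 0 → Exec c₁ σ σ' t s →
      Exec (.ite x c₁ c₂) σ σ' (1 + Nat.size (σ.reg x) + t) s
  | ite_false {x : ℕ} {c₁ c₂ : Prog} {σ σ' : State} {t s : ℕ} :
      σ.reg x = 0 → Exec c₂ σ σ' t s →
      Exec (.ite x c₁ c₂) σ σ' (1 + t) s
  | while_true {x : ℕ} {c : Prog} {σ σ' σ'' : State} {t₁ t₂ s₁ s₂ : ℕ} :
      σ.reg x ≠ 0 → Exec c σ σ' t₁ s₁ → Exec (.while x c) σ' σ'' t₂ s₂ →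
      Exec (.while x c) σ σ'' (1 + Nat.size (σ.reg x) + t₁ + t₂) (max s₁ s₂)
  | while_false {x : ℕ} {c : Prog} {σ : State} :
      σ.reg x = 0 → Exec (.while x c) σ σ 1 σ.space

end RAM

/-! ### Average degree, and the traveling salesman problem -/

namespace TSP

/-- The average degree `2 |E| / n` of an undirected graph on `n` vertices. -/
noncomputable def avgDegree {n : ℕ} (G : SimpleGraph (Fin n)) : ℝ :=
  2 * (G.edgeSet.ncard : ℝ) / n

/-- The average degree of a directed graph on `n` vertices: the number of arcs divided by `n`, which
is both the average out-degree and the average in-degree. -/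
noncomputable def avgDegreeDir {n : ℕ} (G : Digraph (Fin n)) : ℝ :=
  ({p : Fin n × Fin n | G.Adj p.1 p.2}.ncard : ℝ) / n

/-- The input for a weighted (di)graph on `n` vertices with adjacency relation `adj` and weights
`w`: register `0` holds `n`, and array `0` holds the adjacency matrix, whose entry in row `u` and
column `v`, kept at the index `u * n + v`, is `w u v + 1` if `u` is adjacent to `v`, and `0`
otherwise.  All other cells hold `0`. -/
noncomputable def input {n : ℕ} (adj : Fin n → Fin n → Prop) (w : Fin n → Fin n → ℕ) :
    RAM.State where
  reg := Finsupp.single 0 n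
  arr := open Classical in
    ∑ u : Fin n, ∑ v : Fin n,
      Finsupp.single (0, (u : ℕ) * n + v) (if adj u v then w u v + 1 else 0)

/-- The input for an undirected graph with edge weights. -/
noncomputable def inputUndir {n : ℕ} (G : SimpleGraph (Fin n)) (w : Sym2 (Fin n) → ℕ) :
    RAM.State :=
  input G.Adj fun u v => w s(u, v)

/-- The input for a directed graph with arc weights. -/
noncomputable def inputDir {n : ℕ} (G : Digraph (Fin n)) (w : Fin n → Fin n → ℕ) : RAM.State :=
  input G.Adj w

/-- The total weight of the edges of a walk. -/
def walkWeight {n : ℕ} {G : SimpleGraph (Fin n)} {u v : Fin n} (w : Sym2 (Fin n) → ℕ)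
    (p : G.Walk u v) : ℕ :=
  (p.edges.map w).sum

/-- The final memory `σ` holds the answer to the traveling salesman problem on an undirected graph:
register `0` is `0` if there is no Hamiltonian cycle; otherwise register `0` is `1`, and the first
`n` entries of array `1` are the consecutive vertices of a Hamiltonian cycle of minimum weight. -/
def SolvesUndir {n : ℕ} (G : SimpleGraph (Fin n)) (w : Sym2 (Fin n) → ℕ) (σ : RAM.State) : Prop :=
  (σ.reg 0 = 0 ∧ ∀ (u : Fin n) (p : G.Walk u u), ¬ p.IsHamiltonianCycle) ∨
  (σ.reg 0 = 1 ∧ ∃ (u : Fin n) (p : G.Walk u u), p.IsHamiltonianCycle ∧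
    (∀ i : Fin n, σ.arr (1, (i : ℕ)) = (p.getVert i : ℕ)) ∧
    ∀ (v : Fin n) (q : G.Walk v v), q.IsHamiltonianCycle → walkWeight w p ≤ walkWeight w q)

/-- The sequence `t 0, t 1, …, t (n - 1), t 0` is a Hamiltonian cycle of the directed graph `G`:
it visits every vertex exactly once, and there is an arc from each vertex to the cyclically next
one. -/
def IsHamCycleDir {n : ℕ} (G : Digraph (Fin n)) (t : Fin n → Fin n) : Prop :=
  Function.Bijective t ∧ ∀ i : Fin n, G.Adj (t i) (t (finRotate n i))

/-- The total weight of the arcs of a directed cycle that is given by its sequence of vertices. -/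
def cycleWeightDir {n : ℕ} (w : Fin n → Fin n → ℕ) (t : Fin n → Fin n) : ℕ :=
  ∑ i : Fin n, w (t i) (t (finRotate n i))

/-- The final memory `σ` holds the answer to the traveling salesman problem on a directed graph, in
the same format as for an undirected graph. -/
def SolvesDir {n : ℕ} (G : Digraph (Fin n)) (w : Fin n → Fin n → ℕ) (σ : RAM.State) : Prop :=
  (σ.reg 0 = 0 ∧ ∀ t : Fin n → Fin n, ¬ IsHamCycleDir G t) ∨
  (σ.reg 0 = 1 ∧ ∃ t : Fin n → Fin n, IsHamCycleDir G t ∧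
    (∀ i : Fin n, σ.arr (1, (i : ℕ)) = (t i : ℕ)) ∧
    ∀ t' : Fin n → Fin n, IsHamCycleDir G t' → cycleWeightDir w t ≤ cycleWeightDir w t')

end TSP

/-! A Hamiltonian cycle is a closed walk of `n` steps from vertex `0` that visits every vertex.
Inclusion-exclusion over the set `S` of permitted vertices, with sign (-1)^(n - |S|), counts these
walks in time 2^n up to polynomial factors and in polynomial space, because the walks inside a fixed
`S` are counted by dynamic programming. The gain over 2^n comes from summing over fewer sets.

Let `D` be the integer part of twice the number of arcs per vertex, so that at least half of the
vertices have outdegree at most `D`. Vertices of indegree above `Δ` are hubs; let `a` be their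
number. A greedy choice gives `f` infants: vertices of outdegree at most `D` whose out-neighbors
outside the hubs (the flagged vertices) are pairwise disjoint sets that contain no infant. A set `S`
starves an infant if it contains none of its flagged out-neighbors. The sum is restricted to the
sets that starve at most `a` infants. For a closed walk with exactly `a` visits to hubs this changes
nothing (`sum_good_sgn`). If the walk visits all infants, each starved one is followed by a hub, so
all sets that contain the walk pass the test. If it misses an infant, toggling that infant in `S`
reverses the sign and does not affect the test, so the walk contributes zero. The number of hub
visits is controlled by an additional weight on arcs into hubs.

By disjointness, a random set avoids starving infants almost independently, and at most 2^a 2^n (1 -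
2^(-D-1))^f sets pass the test (`card_good_le`). By maximality of the greedy choice, f ≥ n / (2
(D+1)(Δ+1)) (`le_infants`). The degree `Δ` is the least one for which a · 8 · 2^D (D+1)(Δ+1) ≤ n;
then 2^a uses up only half of the gain (`load_le`). Minimality and a harmonic sum bound `Δ` by a
function of the average degree (`hubDegree_le`).

Weights enter as exponents of two variables. They are written in a base `s` near the square root of
the total weight; the low digit is an exponent of `ξ`, the high digit one of `η`. The relevant
coefficients are extracted by evaluation at all pairs of (p-1)-st roots of unity modulo p^(n+3), for
a prime `p` of order at most n^2 s (`sum_teichmuller`, `value_eq`). The modulus exceeds the count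
that is extracted, so nothing is lost. Both the number of pairs and the time for finding `p` by
trial division are of order p^2, that is, linear in the weights up to polynomial factors. Slack
variables turn the extraction into an oracle for tours of weight at most `T` (`value_ne_zero_iff`).
Binary search then finds the optimum, and deleting every arc that the oracle declares dispensable
leaves a single optimal tour (`search_runs`).

An undirected graph on at least three vertices is treated as the digraph with both orientations of
each edge. -/

namespace RAM

/-! ### Memory updates, and the cells that a program leaves alone -/

@[simp] theorem State.setReg_reg (σ : State) (x v y : ℕ) :
    (σ.setReg x v).reg y = if y = x then v else σ.reg y := by
  classical
  simp [State.setReg, Finsupp.update_apply]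

@[simp] theorem State.setReg_arr (σ : State) (x v : ℕ) : (σ.setReg x v).arr = σ.arr := rfl

@[simp] theorem State.setArr_reg (σ : State) (a i v : ℕ) : (σ.setArr a i v).reg = σ.reg := rfl

@[simp] theorem State.setArr_arr (σ : State) (a i v : ℕ) (q : ℕ × ℕ) :
    (σ.setArr a i v).arr q = if q = (a, i) then v else σ.arr q := by
  classical
  simp [State.setArr, Finsupp.update_apply]

/-- `c.wr x`: the program `c` has an instruction that writes the register `x`. -/
def Prog.wr : Prog → ℕ → Bool
  | .skip, _ => false
  | .const x _, y => Nat.beq x y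
  | .arith _ x _ _, y => Nat.beq x y
  | .load x _ _, y => Nat.beq x y
  | .store _ _ _, _ => false
  | .seq c d, y => c.wr y || d.wr y
  | .ite _ c d, y => c.wr y || d.wr y
  | .while _ c, y => c.wr y

/-- `c.wa a`: the program `c` has an instruction that writes the array `a`. -/
def Prog.wa : Prog → ℕ → Bool
  | .skip, _ => false
  | .const _ _, _ => false
  | .arith _ _ _ _, _ => false
  | .load _ _ _, _ => false
  | .store a _ _, y => Nat.beq a y
  | .seq c d, y => c.wa y || d.wa y
  | .ite _ c d, y => c.wa y || d.wa y
  | .while _ c, y => c.wa y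

/-- `τ` agrees with `σ` on all cells that the program `c` does not write. -/
structure Frame (c : Prog) (σ τ : State) : Prop where
  reg : ∀ x, c.wr x = false → τ.reg x = σ.reg x
  arr : ∀ a, c.wa a = false → ∀ i, τ.arr (a, i) = σ.arr (a, i)

theorem Frame.refl (c : Prog) (σ : State) : Frame c σ σ := ⟨fun _ _ => rfl, fun _ _ _ => rfl⟩

theorem Frame.trans {c : Prog} {σ τ υ : State} (h : Frame c σ τ) (h' : Frame c τ υ) :
    Frame c σ υ :=
  ⟨fun x hx => (h'.reg x hx).trans (h.reg x hx), fun a ha i => (h'.arr a ha i).trans (h.arr a ha i)⟩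

theorem Frame.mono {c d : Prog} {σ τ : State} (h : Frame c σ τ)
    (hr : ∀ x, d.wr x = false → c.wr x = false) (ha : ∀ a, d.wa a = false → c.wa a = false) :
    Frame d σ τ :=
  ⟨fun x hx => h.reg x (hr x hx), fun a h' i => h.arr a (ha a h') i⟩

theorem nat_beq_false {a b : ℕ} (h : Nat.beq a b = false) : b ≠ a := by
  rintro rfl
  simp at h

/-- Since `wr` and `wa` compute, any fact about an untouched register or array passes across a whole
subprogram by `rfl`. Specifications therefore mention only what changes. -/
theorem Exec.frame {c : Prog} {σ τ : State} {t s : ℕ} (h : Exec c σ τ t s) : Frame c σ τ := by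
  induction h with
  | skip | while_false => exact Frame.refl _ _
  | const σ x k | arith σ o x y z | load σ x a y =>
    exact ⟨fun y hy => by simp [nat_beq_false hy], fun _ _ _ => rfl⟩
  | store σ a y x =>
    exact ⟨fun _ _ => rfl, fun b hb i => by simp [nat_beq_false hb]⟩
  | seq _ _ h₁ h₂ =>
    refine Frame.trans (h₁.mono ?_ ?_) (h₂.mono ?_ ?_) <;> intro x hx <;>
      simp [Prog.wr, Prog.wa] at hx <;> simp [hx]
  | ite_true _ _ h₁ | ite_false _ _ h₁ =>
    refine h₁.mono ?_ ?_ <;> intro x hx <;> simp [Prog.wr, Prog.wa] at hx <;> simp [hx]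
  | while_true _ _ _ h₁ h₂ => exact Frame.trans (h₁.mono (fun _ h => h) fun _ h => h) h₂

/-! ### Well-formed memories, and rules for correctness with time and space bounds -/

/-- The bound for the values in memory. -/
def cap (B : ℕ) : ℕ := 2 ^ B

/-- A well-formed memory: `64` registers and `16` arrays of length `L` with values below `2 ^ B`,
where the registers `1` and `2` hold the constants `1` and `0`. -/
structure Ok (B L : ℕ) (σ : State) : Prop where
  reg_lt : ∀ x, σ.reg x < cap B
  reg_supp : ∀ x, 64 ≤ x → σ.reg x = 0
  arr_lt : ∀ q, σ.arr q < cap B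
  arr_supp : ∀ q, σ.arr q ≠ 0 → q.1 < 16 ∧ q.2 < L
  one : σ.reg 1 = 1
  zero : σ.reg 2 = 0

/-- A bound for the space of well-formed memories. -/
def spc (B L : ℕ) : ℕ := 64 * (1 + B) + 16 * L * (1 + L + B)

theorem size_le_self (n : ℕ) : Nat.size n ≤ n := Nat.size_le.2 Nat.lt_two_pow_self

/-- The constants in the registers `1` and `2` play no role here, so that the bound also covers the
initial memory, where register `1` is not yet set. The length of an index is bounded crudely by the
index itself. -/
theorem space_le {B L : ℕ} {σ : State} (h₁ : ∀ x, σ.reg x < cap B)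
    (h₂ : ∀ x, 64 ≤ x → σ.reg x = 0) (h₃ : ∀ q, σ.arr q < cap B)
    (h₄ : ∀ q, σ.arr q ≠ 0 → q.1 < 16 ∧ q.2 < L) : σ.space ≤ spc B L := by
  unfold State.space spc
  refine add_le_add ?_ ?_
  · rw [Finsupp.sum]
    calc _ ≤ ∑ x ∈ Finset.range 64, (1 + Nat.size (σ.reg x)) := by
          refine Finset.sum_le_sum_of_subset ?_
          intro x hx
          by_contra hc
          simp only [Finset.mem_range, not_lt] at hc
          exact Finsupp.mem_support_iff.1 hx (h₂ x hc)
      _ ≤ ∑ x ∈ Finset.range 64, (1 + B) :=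
          Finset.sum_le_sum fun x _ => Nat.add_le_add_left (Nat.size_le.2 (h₁ x)) 1
      _ = _ := by simp
  · rw [Finsupp.sum]
    calc _ ≤ ∑ x ∈ σ.arr.support, (1 + L + B) := by
          refine Finset.sum_le_sum fun q hq => ?_
          have := (h₄ q (Finsupp.mem_support_iff.1 hq)).2
          have := size_le_self q.2
          have := Nat.size_le.2 (h₃ q)
          omega
      _ ≤ ∑ x ∈ Finset.range 16 ×ˢ Finset.range L, (1 + L + B) := by
          refine Finset.sum_le_sum_of_subset ?_
          intro q hq
          simpa using h₄ q (Finsupp.mem_support_iff.1 hq)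
      _ = _ := by simp

theorem Ok.space_le {B L : ℕ} {σ : State} (h : Ok B L σ) : σ.space ≤ spc B L :=
  RAM.space_le h.reg_lt h.reg_supp h.arr_lt h.arr_supp

theorem Ok.setReg {B L : ℕ} {σ : State} (h : Ok B L σ) {x v : ℕ} (hx : x < 64) (h1 : x ≠ 1)
    (h2 : x ≠ 2) (hv : v < cap B) : Ok B L (σ.setReg x v) where
  reg_lt y := by
    rw [State.setReg_reg]
    split_ifs
    exacts [hv, h.reg_lt y]
  reg_supp y hy := by
    rw [State.setReg_reg, if_neg (by omega)]
    exact h.reg_supp y hy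
  arr_lt := h.arr_lt
  arr_supp := h.arr_supp
  one := by rw [State.setReg_reg, if_neg h1.symm, h.one]
  zero := by rw [State.setReg_reg, if_neg h2.symm, h.zero]

theorem Ok.setArr {B L : ℕ} {σ : State} (h : Ok B L σ) {a i v : ℕ} (ha : a < 16) (hi : i < L)
    (hv : v < cap B) : Ok B L (σ.setArr a i v) where
  reg_lt := h.reg_lt
  reg_supp := h.reg_supp
  arr_lt q := by
    rw [State.setArr_arr]
    split_ifs
    exacts [hv, h.arr_lt q]
  arr_supp q hq := by
    rw [State.setArr_arr] at hq
    split_ifs at hq with h'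
    · exact h' ▸ ⟨ha, hi⟩
    · exact h.arr_supp q hq
  one := h.one
  zero := h.zero

/-- From the memory `σ`, if it is well-formed, the program `c` halts after at most `N` steps in a
well-formed memory with the property `Q`. -/
def Runs (B L : ℕ) (c : Prog) (σ : State) (Q : State → Prop) (N : ℕ) : Prop :=
  Ok B L σ → ∃ τ t s, Exec c σ τ t s ∧ Ok B L τ ∧ Q τ ∧ t ≤ N * (1 + B) ^ 2 ∧ s ≤ spc B L

variable {B L : ℕ}

theorem Runs.of_ok {c : Prog} {σ : State} {Q : State → Prop} {N : ℕ}
    (h : Ok B L σ → Runs B L c σ Q N) : Runs B L c σ Q N := fun hσ => h hσ hσ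

theorem Runs.mono {c : Prog} {σ : State} {Q Q' : State → Prop} {N N' : ℕ}
    (h : Runs B L c σ Q N) (hQ : ∀ τ, Ok B L τ → Frame c σ τ → Q τ → Q' τ) (hN : N ≤ N') :
    Runs B L c σ Q' N' := by
  intro hσ
  obtain ⟨τ, t, s, h₁, h₂, h₃, h₄, h₅⟩ := h hσ
  exact ⟨τ, t, s, h₁, h₂, hQ τ h₂ h₁.frame h₃, h₄.trans (Nat.mul_le_mul_right _ hN), h₅⟩

theorem Runs.seq {c d : Prog} {σ : State} {Q R : State → Prop} {N M : ℕ}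
    (h : Runs B L c σ Q N)
    (h' : ∀ τ, Ok B L τ → Frame c σ τ → Q τ → Runs B L d τ R M) :
    Runs B L (.seq c d) σ R (N + M) := by
  intro hσ
  obtain ⟨τ, t, s, h₁, h₂, h₃, h₄, h₅⟩ := h hσ
  obtain ⟨υ, t', s', k₁, k₂, k₃, k₄, k₅⟩ := h' τ h₂ h₁.frame h₃ h₂
  exact ⟨υ, _, _, .seq h₁ k₁, k₂, k₃, by rw [add_mul]; exact add_le_add h₄ k₄, max_le h₅ k₅⟩

/-- The unit of time is `(1 + B) ^ 2` because the dearest instruction costs a product of two factors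
of the form one plus a binary length. -/
theorem one_le_tick : 1 ≤ (1 + B) ^ 2 := Nat.one_le_pow _ _ (by omega)

theorem one_add_size_le {v : ℕ} (h : v < cap B) : 1 + Nat.size v ≤ (1 + B) ^ 2 := by
  have := Nat.size_le.2 h
  nlinarith

theorem Runs.ite {x : ℕ} {c d : Prog} {σ : State} {Q : State → Prop} {N : ℕ}
    (h₁ : σ.reg x ≠ 0 → Runs B L c σ Q N) (h₂ : σ.reg x = 0 → Runs B L d σ Q N) :
    Runs B L (.ite x c d) σ Q (N + 1) := by
  intro hσ
  by_cases hx : σ.reg x = 0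
  · obtain ⟨υ, t', s', k₁, k₂, k₃, k₄, k₅⟩ := h₂ hx hσ
    exact ⟨υ, _, _, .ite_false hx k₁, k₂, k₃, by nlinarith [one_le_tick (B := B)], k₅⟩
  · obtain ⟨υ, t', s', k₁, k₂, k₃, k₄, k₅⟩ := h₁ hx hσ
    have := one_add_size_le (hσ.reg_lt x)
    exact ⟨υ, _, _, .ite_true hx k₁, k₂, k₃, by nlinarith, k₅⟩

/-- The index of `I` is fuel: it drops in every round, and at `0` the loop must stop. It may stop
sooner, hence the existential index in the conclusion. -/
theorem Runs.while {x : ℕ} {c : Prog} (I : ℕ → State → Prop) {N : ℕ}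
    (hz : ∀ τ, I 0 τ → τ.reg x = 0)
    (hs : ∀ k τ, Ok B L τ → I (k + 1) τ → τ.reg x ≠ 0 → Runs B L c τ (I k) N) (k : ℕ) (σ : State)
    (h0 : I k σ) :
    Runs B L (.while x c) σ (fun τ => τ.reg x = 0 ∧ ∃ j ≤ k, I j τ) (k * (N + 1) + 1) := by
  induction k generalizing σ with
  | zero =>
    intro hσ
    exact ⟨σ, _, _, .while_false (hz σ h0), hσ, ⟨hz σ h0, 0, le_rfl, h0⟩,
      by simpa using one_le_tick, hσ.space_le⟩
  | succ k ih =>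
    intro hσ
    by_cases hx : σ.reg x = 0
    · exact ⟨σ, _, _, .while_false hx, hσ, ⟨hx, k + 1, le_rfl, h0⟩,
        one_le_tick.trans (Nat.le_mul_of_pos_left _ (by omega)), hσ.space_le⟩
    · obtain ⟨τ, t, s, h₁, h₂, h₃, h₄, h₅⟩ := hs k σ hσ h0 hx hσ
      obtain ⟨υ, t', s', k₁, k₂, ⟨k₃, j, hj, hI⟩, k₄, k₅⟩ := ih τ h₃ h₂
      have := one_add_size_le (hσ.reg_lt x)
      exact ⟨υ, _, _, .while_true hx h₁ k₁, k₂, ⟨k₃, j, hj.trans (Nat.le_succ k), hI⟩,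
        by nlinarith, max_le h₅ k₅⟩

/-! ### Straight-line programs, executed by simplification -/

/-- The effect of a program without loops. -/
noncomputable def Prog.run : Prog → State → State
  | .skip, σ => σ
  | .const x k, σ => σ.setReg x k
  | .arith o x y z, σ => σ.setReg x (o.eval (σ.reg y) (σ.reg z))
  | .load x a y, σ => σ.setReg x (σ.arr (a, σ.reg y))
  | .store a y x, σ => σ.setArr a (σ.reg y) (σ.reg x)
  | .seq c d, σ => d.run (c.run σ)
  | .ite x c d, σ => if σ.reg x = 0 then d.run σ else c.run σ
  | .while _ _, σ => σ

/-- The side condition that an arithmetic result is small. -/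
def Op.small (B : ℕ) : Op → ℕ → ℕ → Prop
  | .add, a, b => a + b < cap B
  | .mul, a, b => a * b < cap B
  | _, _, _ => True

/-- A register that programs may write. -/
def okReg (x : ℕ) : Bool := decide (x < 64 ∧ x ≠ 1 ∧ x ≠ 2)

/-- The program `c` has no loops, and started in `σ` it stays within the bounds. -/
def Prog.safe (B L : ℕ) : Prog → State → Prop
  | .skip, _ => True
  | .const x k, _ => okReg x = true ∧ k < cap B
  | .arith o x y z, σ => okReg x = true ∧ o.small B (σ.reg y) (σ.reg z)
  | .load x _ _, _ => okReg x = true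
  | .store a y _, σ => a < 16 ∧ σ.reg y < L
  | .seq c d, σ => c.safe B L σ ∧ d.safe B L (c.run σ)
  | .ite _ _ _, _ => False
  | .while _ _, _ => False

/-- The number of instructions of a program. -/
def Prog.len : Prog → ℕ
  | .seq c d => c.len + d.len
  | _ => 1

theorem okReg_iff {x : ℕ} : okReg x = true ↔ x < 64 ∧ x ≠ 1 ∧ x ≠ 2 := by
  simp [okReg]

/-- Differences, quotients and loaded entries never exceed values that are already in memory. The
only bounds to check that depend on the memory are those on sums, products and stored indices; the
rest of `safe` is decided by computation. -/
theorem Runs.run {c : Prog} {σ : State} (h : c.safe B L σ) :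
    Runs B L c σ (fun τ => τ = c.run σ) c.len := by
  induction c generalizing σ with
  | skip => exact fun hσ => ⟨σ, _, _, .skip σ, hσ, rfl, by simpa [Prog.len] using one_le_tick, hσ.space_le⟩
  | const x k =>
    intro hσ
    obtain ⟨hx, hk⟩ := h
    obtain ⟨hx, h1, h2⟩ := okReg_iff.1 hx
    have h' := hσ.setReg hx h1 h2 hk
    exact ⟨_, _, _, .const σ x k, h', rfl, by simpa [Prog.len] using one_add_size_le hk,
      max_le hσ.space_le h'.space_le⟩
  | arith o x y z =>
    intro hσ
    obtain ⟨hx, hk⟩ := h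
    obtain ⟨hx, h1, h2⟩ := okReg_iff.1 hx
    have h' := hσ.setReg (v := o.eval (σ.reg y) (σ.reg z)) hx h1 h2 (by
      have := hσ.reg_lt y
      cases o
      · exact hk
      · exact (Nat.sub_le _ _).trans_lt this
      · exact hk
      · exact (Nat.div_le_self _ _).trans_lt this)
    refine ⟨_, _, _, .arith σ o x y z, h', rfl, ?_, max_le hσ.space_le h'.space_le⟩
    have h3 := Nat.size_le.2 (hσ.reg_lt y)
    have h4 := Nat.size_le.2 (hσ.reg_lt z)
    simp only [Prog.len]
    nlinarith
  | load x a y =>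
    intro hσ
    obtain ⟨hx, h1, h2⟩ := okReg_iff.1 h
    have h' := hσ.setReg (v := σ.arr (a, σ.reg y)) hx h1 h2 (hσ.arr_lt _)
    refine ⟨_, _, _, .load σ x a y, h', rfl, ?_, max_le hσ.space_le h'.space_le⟩
    have h3 := Nat.size_le.2 (hσ.reg_lt y)
    have h4 := Nat.size_le.2 (hσ.arr_lt (a, σ.reg y))
    simp only [Prog.len]
    nlinarith
  | store a y x =>
    intro hσ
    obtain ⟨ha, hi⟩ := h
    have h' := hσ.setArr (v := σ.reg x) ha hi (hσ.reg_lt _)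
    refine ⟨_, _, _, .store σ a y x, h', rfl, ?_, max_le hσ.space_le h'.space_le⟩
    have h3 := Nat.size_le.2 (hσ.reg_lt y)
    have h4 := Nat.size_le.2 (hσ.reg_lt x)
    simp only [Prog.len]
    nlinarith
  | seq c d hc hd =>
    exact Runs.seq (hc h.1) fun τ _ _ hτ => by
      subst hτ
      exact hd h.2
  | _ => exact h.elim

theorem Runs.straight {c : Prog} {σ : State} {Q : State → Prop} {N : ℕ} (h : c.safe B L σ)
    (hQ : Q (c.run σ)) (hN : c.len ≤ N) : Runs B L c σ Q N :=
  (Runs.run h).mono (fun _ _ _ e => e ▸ hQ) hN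

/-- Run `c`, and then `d` on the resulting memory; `c` has no loops. -/
theorem Runs.cons {c d : Prog} {σ : State} {Q : State → Prop} {N : ℕ} (h : c.safe B L σ)
    (hQ : Ok B L (c.run σ) → Frame c σ (c.run σ) → Runs B L d (c.run σ) Q N) :
    Runs B L (.seq c d) σ Q (c.len + N) :=
  (Runs.run h).seq fun _ hτ hf e => by
    subst e
    exact hQ hτ hf

/-- The form of `Runs.cons` with a free time bound. -/
theorem Runs.cons' {c d : Prog} {σ : State} {Q : State → Prop} (N : ℕ) {M : ℕ}
    (h : c.safe B L σ)
    (hQ : Ok B L (c.run σ) → Frame c σ (c.run σ) → Runs B L d (c.run σ) Q N)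
    (hM : c.len + N ≤ M) : Runs B L (.seq c d) σ Q M :=
  (Runs.cons h hQ).mono (fun _ _ _ h => h) hM

/-- The form of `Runs.seq` with a free time bound. -/
theorem Runs.seq' {c d : Prog} {σ : State} {Q R : State → Prop} (N M : ℕ) {K : ℕ}
    (h : Runs B L c σ Q N)
    (h' : ∀ τ, Ok B L τ → Frame c σ τ → Q τ → Runs B L d τ R M) (hK : N + M ≤ K) :
    Runs B L (.seq c d) σ R K :=
  (Runs.seq h h').mono (fun _ _ _ h => h) hK

/-! ### Counted loops -/

/-- `forDown i m c`: for `i = m - 1, …, 0`, where `m` is the content of the register `m`, run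
`c`. -/
def forDown (i m : ℕ) (c : Prog) : Prog :=
  .seq (.arith .add i m 2) (.while i (.seq (.arith .sub i i 1) c))

/-- The counter is decremented before the body, so the body that leads from `I (k + 1)` to `I k`
sees the value `k`. By `hset` the invariant ignores the counter. The frame is measured from the
start of the loop, so `I` need not repeat what the loop never writes. -/
theorem Runs.forDown {i m : ℕ} {c : Prog} {σ : State} (I : ℕ → State → Prop) {N : ℕ → ℕ}
    {Q : State → Prop} (hi : okReg i = true) (hci : c.wr i = false)
    (hset : ∀ k τ v, I k τ → I k (τ.setReg i v))
    (h0 : I (σ.reg m) σ)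
    (hs : ∀ k τ, k < σ.reg m → Ok B L τ → Frame (RAM.forDown i m c) σ τ → I (k + 1) τ →
      τ.reg i = k → Runs B L c τ (I k) (N k))
    (hQ : ∀ τ, Ok B L τ → Frame (RAM.forDown i m c) σ τ → I 0 τ → Q τ) :
    Runs B L (RAM.forDown i m c) σ Q (∑ k ∈ Finset.range (σ.reg m), (N k + 2) + 2) := by
  obtain ⟨hi64, hi1, hi2⟩ := okReg_iff.1 hi
  have key : ∀ k ≤ σ.reg m, ∀ τ, Frame (RAM.forDown i m c) σ τ → I k τ → τ.reg i = k →
      Runs B L (.while i (.seq (.arith .sub i i 1) c)) τ Q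
        (∑ k ∈ Finset.range k, (N k + 2) + 1) := by
    intro k
    induction k with
    | zero =>
      intro _ τ hf hI hτ hok
      exact ⟨τ, _, _, .while_false hτ, hok, hQ τ hok hf hI, by simpa using Nat.one_le_pow _ _ (by omega),
        hok.space_le⟩
    | succ k ih =>
      intro hk τ hf hI hτ hok
      have hx : τ.reg i ≠ 0 := by omega
      have hr : Runs B L (.seq (.arith .sub i i 1) c) τ
          (fun υ => I k υ ∧ υ.reg i = k) (1 + N k) := by
        refine Runs.cons ⟨hi, trivial⟩ fun hok' hf' => ?_
        have e : Prog.run (.arith .sub i i 1) τ = τ.setReg i k := by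
          simp [Prog.run, Op.eval, hτ, hok.one]
        rw [e] at hok' hf' ⊢
        refine (hs k _ hk hok' (hf.trans (hf'.mono ?_ ?_)) (hset _ _ _ hI) (by simp)).mono
          (fun υ _ hfr h => ⟨h, ?_⟩) le_rfl
        · intro x hx
          simp [RAM.forDown, Prog.wr] at hx ⊢
          exact hx.1
        · intro x hx
          simp [Prog.wa]
        · rw [hfr.reg i hci]
          simp
      obtain ⟨τ', t, s, h₁, h₂, ⟨h₃, h₃'⟩, h₄, h₅⟩ := hr hok
      have hf' : Frame (RAM.forDown i m c) τ τ' := h₁.frame.mono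
        (by
          intro x hx
          simp [RAM.forDown, Prog.wr] at hx ⊢
          exact hx)
        (by
          intro x hx
          simpa [RAM.forDown, Prog.wa] using hx)
      obtain ⟨υ, t', s', k₁, k₂, k₃, k₄, k₅⟩ := ih (by omega) τ' (hf.trans hf') h₃ h₃' h₂
      have := one_add_size_le (hok.reg_lt i)
      refine ⟨υ, _, _, .while_true hx h₁ k₁, k₂, k₃, ?_, max_le h₅ k₅⟩
      rw [Finset.sum_range_succ]
      nlinarith
  refine Runs.of_ok fun hok => ?_
  rw [show ∀ a, a + 2 = 1 + (a + 1) by intro a; ring]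
  have e : Prog.run (.arith .add i m 2) σ = σ.setReg i (σ.reg m) := by
    simp [Prog.run, Op.eval, hok.zero]
  refine Runs.cons ⟨hi, ?_⟩ fun hok' hf' => ?_
  · simpa [Op.small, hok.zero] using hok.reg_lt m
  · rw [e] at hok' hf' ⊢
    refine key _ le_rfl _ (hf'.mono ?_ ?_) (hset _ _ _ h0) (by simp)
    · intro x hx
      simp [RAM.forDown, Prog.wr] at hx ⊢
      exact hx.1
    · intro x hx
      simp [Prog.wa]

/-- The form of the rule for loops whose body has a uniform time bound. -/
theorem Runs.forDown' {i m : ℕ} {c : Prog} {σ : State} (I : ℕ → State → Prop) {N M : ℕ}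
    {Q : State → Prop} (hi : okReg i = true) (hci : c.wr i = false)
    (hset : ∀ k τ v, I k τ → I k (τ.setReg i v))
    (h0 : I (σ.reg m) σ)
    (hs : ∀ k τ, k < σ.reg m → Ok B L τ → Frame (RAM.forDown i m c) σ τ → I (k + 1) τ →
      τ.reg i = k → Runs B L c τ (I k) N)
    (hQ : ∀ τ, Ok B L τ → Frame (RAM.forDown i m c) σ τ → I 0 τ → Q τ)
    (hM : σ.reg m * (N + 2) + 2 ≤ M) :
    Runs B L (RAM.forDown i m c) σ Q M :=
  (Runs.forDown I hi hci hset h0 hs hQ).mono (fun _ _ _ h => h) (by simpa using hM)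

theorem Frame.left {c d : Prog} {σ τ : State} (h : Frame c σ τ) : Frame (.seq c d) σ τ :=
  h.mono (fun x hx => by simp [Prog.wr] at hx; exact hx.1)
    fun x hx => by simp [Prog.wa] at hx; exact hx.1

theorem Frame.right {c d : Prog} {σ τ : State} (h : Frame d σ τ) : Frame (.seq c d) σ τ :=
  h.mono (fun x hx => by simp [Prog.wr] at hx; exact hx.2)
    fun x hx => by simp [Prog.wa] at hx; exact hx.2

/-- The rule for a loop that is preceded by initializations. -/
theorem Runs.loop {c₀ : Prog} {i m : ℕ} {c : Prog} {σ : State} (n : ℕ) (I : ℕ → State → Prop)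
    (N : ℕ) {M : ℕ} {Q : State → Prop} (hi : okReg i = true) (hci : c.wr i = false)
    (hc : c₀.safe B L σ) (hm : (c₀.run σ).reg m = n)
    (hset : ∀ k τ v, I k τ → I k (τ.setReg i v))
    (h0 : Ok B L (c₀.run σ) → I n (c₀.run σ))
    (hs : ∀ k τ, k < n → Ok B L τ → Frame (.seq c₀ (RAM.forDown i m c)) σ τ → I (k + 1) τ →
      τ.reg i = k → Runs B L c τ (I k) N)
    (hQ : ∀ τ, Ok B L τ → Frame (.seq c₀ (RAM.forDown i m c)) σ τ → I 0 τ → Q τ)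
    (hM : c₀.len + n * (N + 2) + 2 ≤ M) :
    Runs B L (.seq c₀ (RAM.forDown i m c)) σ Q M := by
  subst hm
  refine Runs.cons' _ hc (fun hok hf => ?_) ((add_assoc _ _ _).symm.trans_le hM)
  exact Runs.forDown' I hi hci hset (h0 hok)
    (fun k τ hk hτ hf' => hs k τ hk hτ (hf.left.trans hf'.right))
    (fun τ hτ hf' => hQ τ hτ (hf.left.trans hf'.right)) le_rfl

/-- The rule for a loop that is preceded by initializations, with a time bound that depends on the
iteration. -/
theorem Runs.loop_sum {c₀ : Prog} {i m : ℕ} {c : Prog} {σ : State} (n : ℕ) (I : ℕ → State → Prop)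
    (N : ℕ → ℕ) {M : ℕ} {Q : State → Prop} (hi : okReg i = true) (hci : c.wr i = false)
    (hc : c₀.safe B L σ) (hm : (c₀.run σ).reg m = n)
    (hset : ∀ k τ v, I k τ → I k (τ.setReg i v))
    (h0 : Ok B L (c₀.run σ) → I n (c₀.run σ))
    (hs : ∀ k τ, k < n → Ok B L τ → Frame (.seq c₀ (RAM.forDown i m c)) σ τ → I (k + 1) τ →
      τ.reg i = k → Runs B L c τ (I k) (N k))
    (hQ : ∀ τ, Ok B L τ → Frame (.seq c₀ (RAM.forDown i m c)) σ τ → I 0 τ → Q τ)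
    (hM : c₀.len + ∑ k ∈ Finset.range n, (N k + 2) + 2 ≤ M) :
    Runs B L (.seq c₀ (RAM.forDown i m c)) σ Q M := by
  subst hm
  refine Runs.cons' _ hc (fun hok hf => ?_) ((add_assoc _ _ _).symm.trans_le hM)
  exact Runs.forDown I hi hci hset (h0 hok)
    (fun k τ hk hτ hf' => hs k τ hk hτ (hf.left.trans hf'.right))
    (fun τ hτ hf' => hQ τ hτ (hf.left.trans hf'.right))

/-! ### Modular arithmetic -/

/-- Sequential composition of a list of programs. -/
def blk : List Prog → Prog
  | [] => .skip
  | [c] => c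
  | c :: d :: l => .seq c (blk (d :: l))

/-- Addition. -/
abbrev add (x y z : ℕ) : Prog := .arith .add x y z
/-- Truncated subtraction. -/
abbrev sub (x y z : ℕ) : Prog := .arith .sub x y z
/-- Multiplication. -/
abbrev mul (x y z : ℕ) : Prog := .arith .mul x y z
/-- Integer division. -/
abbrev div (x y z : ℕ) : Prog := .arith .div x y z

/-- Multiplication modulo the register `19`. -/
def mulmod (x y z : ℕ) : Prog := blk [mul 60 y z, div 61 60 19, mul 61 61 19, sub x 60 61]

/-- Addition modulo the register `19`. -/
def addmod (x y z : ℕ) : Prog := blk [add 60 y z, div 61 60 19, mul 61 61 19, sub x 60 61]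

theorem sub_div_mul (a q : ℕ) : a - a / q * q = a % q := by
  rw [Nat.mod_def, mul_comm]

-- In `mulmod` and `addmod` the product `a / q * q` cannot overflow if `a` does not; as a simp lemma
-- this clears the superfluous condition from `safe` goals.
@[simp] theorem lt_and_div_mul_lt {a q c : ℕ} : (a < c ∧ a / q * q < c) ↔ a < c :=
  ⟨fun h => h.1, fun h => ⟨h, (Nat.div_mul_le_self a q).trans_lt h⟩⟩

attribute [simp] Prog.run Prog.safe Prog.len Op.eval Op.small blk okReg sub_div_mul

/-- The register `42` receives the power of the register `40` to the register `41`, modulo the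
register `19`. -/
def powmod : Prog :=
  .seq (.const 42 1) (.while 41 (blk [add 44 1 1, div 43 41 44, add 45 43 43, sub 45 41 45,
    mul 44 45 40, sub 45 1 45, add 45 44 45, mulmod 42 42 45, mulmod 40 40 40, add 41 43 2]))

theorem powmod_runs {σ : State} {Q b e : ℕ} (hQ : 1 < Q) (hB : Q * Q < cap B)
    (h19 : σ.reg 19 = Q) (h40 : σ.reg 40 = b) (hb : b < Q) (h41 : σ.reg 41 = e) :
    Runs B L powmod σ (fun τ => τ.reg 42 < Q ∧ (τ.reg 42 : ZMod Q) = (b : ZMod Q) ^ e)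
      (30 * B + 10) := by
  refine Runs.of_ok fun hok => ?_
  have hB2 : 2 < cap B := by nlinarith
  unfold powmod
  refine Runs.cons' (29 * B + 1) ⟨rfl, by omega⟩ (fun _ _ => ?_) (by simp; omega)
  -- Square and multiply. The fuel bounds the number of binary digits of the remaining exponent, so
  -- `B` rounds suffice.
  refine (Runs.while (fun k τ => τ.reg 41 < 2 ^ k ∧ τ.reg 19 = Q ∧ τ.reg 40 < Q ∧ τ.reg 42 < Q ∧
    (τ.reg 42 : ZMod Q) * (τ.reg 40 : ZMod Q) ^ τ.reg 41 = (b : ZMod Q) ^ e) (N := 20)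
    ?_ ?_ B _ ?_).mono ?_ ?_
  · rintro τ ⟨h, -⟩
    omega
  · rintro k τ hτ ⟨h₁, h₂, h₃, h₄, h₅⟩ h₆
    have h1 := hτ.one
    have h2 := hτ.zero
    have hlt := hτ.reg_lt 41
    have hd : 2 * (τ.reg 41 / 2) + τ.reg 41 % 2 = τ.reg 41 := Nat.div_add_mod _ _
    have hm := Nat.mod_two_eq_zero_or_one (τ.reg 41)
    have e1 : τ.reg 41 - (τ.reg 41 / 2 + τ.reg 41 / 2) = τ.reg 41 % 2 := by omega
    -- The multiplier is the current base for an odd exponent and `1` for an even one; the body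
    -- thereby needs no branch.
    have h₇ : τ.reg 41 % 2 * τ.reg 40 + (1 - τ.reg 41 % 2) < Q := by
      rcases hm with h | h <;> simp [h] <;> omega
    have h₈ : τ.reg 42 * (τ.reg 41 % 2 * τ.reg 40 + (1 - τ.reg 41 % 2)) < cap B :=
      (Nat.mul_lt_mul'' h₄ h₇).trans hB
    have h₉ : τ.reg 40 * τ.reg 40 < cap B := (Nat.mul_lt_mul'' h₃ h₃).trans hB
    have hQB : Q < cap B := by nlinarith
    refine Runs.straight ?_ ?_ (by simp [mulmod])
    · simp [mulmod, h1, h2, h₂, e1]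
      omega
    · simp only [mulmod, blk, Prog.run, Op.eval, State.setReg_reg, h1, h2, h₂]
      norm_num [e1]
      refine ⟨by rw [pow_succ] at h₁; omega, Nat.mod_lt _ (by omega), Nat.mod_lt _ (by omega), ?_⟩
      rw [← h₅]
      nth_rewrite 4 [← hd]
      rw [pow_add, pow_mul, sq]
      rcases hm with h | h <;> simp [h] <;> ring
  · have : e < 2 ^ B := h41 ▸ hok.reg_lt 41
    simp [h19, h40, h41, hQ, hb, this]
  · rintro τ - - ⟨h, j, -, h₁, h₂, h₃, h₄, h₅⟩
    exact ⟨h₄, by simpa [h] using h₅⟩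
  · nlinarith

/-! ### Weighted walks by dynamic programming -/

/-- `wv X E j v`: the total weight of the walks of `j` steps from `0` to `v` with arc weights `E`,
all of whose later vertices are weighted by `X`. -/
def wv {R : Type*} [CommRing R] (n : ℕ) (X : ℕ → R) (E : ℕ → R) : ℕ → ℕ → R
  | 0, v => if v = 0 then 1 else 0
  | j + 1, v => X v * ∑ u ∈ Finset.range n, wv n X E j u * E (u * n + v)

theorem mul_add_lt_mul {n u v : ℕ} (hu : u < n) (hv : v < n) : u * n + v < n * n := by
  nlinarith

/-- The inner product of the walk vector with a column of the matrix. -/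
def walkEntry : Prog :=
  .seq (.const 51 0) (forDown 37 0 (blk [.load 52 9 37, mul 53 37 0, add 53 53 36, .load 53 6 53,
    mulmod 52 52 53, addmod 51 51 52]))

theorem walkEntry_runs {σ : State} {n Q v : ℕ} (hQ : 1 < Q) (hB : 2 * (Q * Q) < cap B)
    (hn : n * n < cap B) (h0 : σ.reg 0 = n) (h19 : σ.reg 19 = Q) (h36 : σ.reg 36 = v) (hv : v < n)
    (hf : ∀ u < n, σ.arr (9, u) < Q) (hE : ∀ i < n * n, σ.arr (6, i) < Q) :
    Runs B L walkEntry σ (fun τ => τ.reg 51 < Q ∧ (τ.reg 51 : ZMod Q) =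
      ∑ u ∈ Finset.range n, (σ.arr (9, u) : ZMod Q) * (σ.arr (6, u * n + v) : ZMod Q))
      (n * 14 + 3) := by
  refine Runs.loop n (fun k τ => τ.reg 51 < Q ∧ (τ.reg 51 : ZMod Q) =
      ∑ u ∈ Finset.Ico k n, (σ.arr (9, u) : ZMod Q) * (σ.arr (6, u * n + v) : ZMod Q)) 12
      rfl rfl ⟨rfl, by omega⟩ (by simpa using h0) ?_ ?_ ?_ ?_ (by simp; omega)
  · intro k τ v h
    simpa using h
  · simp
    omega
  · rintro k τ hk hτ hfr ⟨h1, h2⟩ h37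
    have f0 := (hfr.reg 0 rfl).trans h0
    have f19 := (hfr.reg 19 rfl).trans h19
    have f36 := (hfr.reg 36 rfl).trans h36
    have f9 := hfr.arr 9 rfl
    have f6 := hfr.arr 6 rfl
    have hlt := mul_add_lt_mul hk hv
    have b1 := Nat.mul_lt_mul'' (hf k hk) (hE _ hlt)
    have b2 : σ.arr (9, k) * σ.arr (6, k * n + v) % Q < Q := Nat.mod_lt _ (by omega)
    have b3 : 2 * Q ≤ 2 * (Q * Q) := by nlinarith
    refine Runs.straight ?_ ?_ (by simp [mulmod, addmod])
    · simp [mulmod, addmod, f0, f19, h37, f36, f9, f6]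
      refine ⟨by omega, by omega, by omega, by omega⟩
    · simp [mulmod, addmod, f0, f19, h37, f36, f9, f6]
      refine ⟨Nat.mod_lt _ (by omega), ?_⟩
      rw [Finset.sum_eq_sum_Ico_succ_bot hk, h2, add_comm]
  · rintro τ - - ⟨h1, h2⟩
    exact ⟨h1, by simpa using h2⟩

/-- The array `9` receives the unit vector `0`. -/
def walkInit : Prog := .seq .skip (forDown 36 0 (blk [sub 50 1 36, .store 9 36 50]))

theorem walkInit_runs {σ : State} {n : ℕ} (hL : n ≤ L) (h0 : σ.reg 0 = n) :
    Runs B L walkInit σ (fun τ => ∀ v < n, τ.arr (9, v) = if v = 0 then 1 else 0)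
      (n * 4 + 3) := by
  refine Runs.loop n (fun k τ => ∀ v < n, k ≤ v → τ.arr (9, v) = if v = 0 then 1 else 0) 2
      rfl rfl trivial h0 ?_ ?_ ?_ ?_ (by simp; omega)
  · intro k τ v h
    simpa using h
  · intro _ v h1 h2
    omega
  · intro k τ hk hτ hfr hI h36
    refine Runs.straight ?_ ?_ (by simp)
    · simp [h36]
      omega
    · intro v hv hkv
      simp [h36, hτ.one]
      split_ifs <;> first | omega | (rw [hI v hv (by omega)]; simp [*])
  · intro τ _ _ h v hv
    exact h v hv (Nat.zero_le v)

/-- One step of the walks. -/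
def walkStep : Prog :=
  .seq (.seq .skip (forDown 36 0 (.seq walkEntry (blk [.load 52 8 36, mul 51 51 52, .store 10 36 51]))))
    (.seq .skip (forDown 36 0 (blk [.load 50 10 36, .store 9 36 50])))

theorem walkStep_runs {σ : State} {n Q : ℕ} (hQ : 1 < Q) (hB : 2 * (Q * Q) < cap B)
    (hn : n * n < cap B) (hL : n ≤ L) (h0 : σ.reg 0 = n) (h19 : σ.reg 19 = Q)
    (hf : ∀ u < n, σ.arr (9, u) < Q) (hE : ∀ i < n * n, σ.arr (6, i) < Q)
    (hX : ∀ v < n, σ.arr (8, v) ≤ 1) :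
    Runs B L walkStep σ (fun τ => ∀ v < n, τ.arr (9, v) < Q ∧ (τ.arr (9, v) : ZMod Q) =
      (σ.arr (8, v) : ZMod Q) *
        ∑ u ∈ Finset.range n, (σ.arr (9, u) : ZMod Q) * (σ.arr (6, u * n + v) : ZMod Q))
      (n * (n * 14 + 13) + 6) := by
  refine Runs.seq' (Q := fun τ => ∀ v < n, τ.arr (10, v) < Q ∧ (τ.arr (10, v) : ZMod Q) =
      (σ.arr (8, v) : ZMod Q) *
        ∑ u ∈ Finset.range n, (σ.arr (9, u) : ZMod Q) * (σ.arr (6, u * n + v) : ZMod Q))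
      (n * (n * 14 + 8) + 3) (n * 4 + 3) ?_ ?_ (by ring_nf; omega)
  · refine Runs.loop n (fun k τ => ∀ v < n, k ≤ v → τ.arr (10, v) < Q ∧ (τ.arr (10, v) : ZMod Q) =
      (σ.arr (8, v) : ZMod Q) *
        ∑ u ∈ Finset.range n, (σ.arr (9, u) : ZMod Q) * (σ.arr (6, u * n + v) : ZMod Q))
      (n * 14 + 6) rfl rfl trivial h0 ?_ ?_ ?_ ?_ (by simp; ring_nf; omega)
    · intro k τ v h
      simpa using h
    · intro _ v h1 h2
      omega
    · intro k τ hk hτ hfr hI h36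
      have f9 := hfr.arr 9 rfl
      have f6 := hfr.arr 6 rfl
      have f8 := hfr.arr 8 rfl
      refine Runs.seq' (n * 14 + 3) 3 (walkEntry_runs hQ hB hn ((hfr.reg 0 rfl).trans h0)
        ((hfr.reg 19 rfl).trans h19) h36 hk (by simpa [f9] using hf) (by simpa [f6] using hE))
        ?_ (by omega)
      rintro υ hυ hfu ⟨h1, h2⟩
      have g8 := hfu.arr 8 rfl
      have g10 := hfu.arr 10 rfl
      have g36 := (hfu.reg 36 rfl).trans h36
      have hXk := hX k hk
      have hle : υ.reg 51 * σ.arr (8, k) ≤ υ.reg 51 * 1 := Nat.mul_le_mul_left _ hXk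
      have := hυ.reg_lt 51
      refine Runs.straight ?_ ?_ (by simp)
      · simp [g36, g8, f8]
        omega
      · intro v hv hkv
        simp only [f9, f6] at h2
        by_cases hvk : v = k
        · subst hvk
          simp [g36, g8, f8, h2, mul_comm]
          omega
        · simpa [g36, g8, f8, hvk, g10] using hI v hv (by omega)
    · intro τ _ _ h v hv
      exact h v hv (Nat.zero_le v)
  · intro τ hτ hfr hQτ
    refine Runs.loop n (fun k υ => ∀ v < n, k ≤ v → υ.arr (9, v) = τ.arr (10, v))
      2 rfl rfl trivial ((hfr.reg 0 rfl).trans h0) ?_ ?_ ?_ ?_ (by simp; omega)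
    · intro k τ v h
      simpa using h
    · intro _ v h1 h2
      omega
    · intro k υ hk hυ hfu hI h36
      refine Runs.straight ?_ ?_ (by simp)
      · simp [h36]
        omega
      · intro v hv hkv
        by_cases hvk : v = k
        · subst hvk
          simp [h36, hfu.arr 10 rfl]
        · simpa [h36, hvk] using hI v hv (by omega)
    · intro υ _ _ h v hv
      rw [h v hv (Nat.zero_le v)]
      exact hQτ v hv

/-- The walk vector after `n` steps. -/
def walk : Prog := .seq walkInit (.seq .skip (forDown 38 0 walkStep))

/-- Only the current and the next vector are kept, which is where polynomial space comes from. The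
weights `X` are indicators, so multiplying by them keeps entries below `Q` without a reduction. -/
theorem walk_runs {σ : State} {n Q : ℕ} (hQ : 1 < Q) (hB : 2 * (Q * Q) < cap B)
    (hn : n * n < cap B) (hL : n ≤ L) (h0 : σ.reg 0 = n) (h19 : σ.reg 19 = Q)
    (hE : ∀ i < n * n, σ.arr (6, i) < Q) (hX : ∀ v < n, σ.arr (8, v) ≤ 1) :
    Runs B L walk σ (fun τ => ∀ v < n, τ.arr (9, v) < Q ∧ (τ.arr (9, v) : ZMod Q) =
      wv n (fun v => (σ.arr (8, v) : ZMod Q)) (fun i => (σ.arr (6, i) : ZMod Q)) n v)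
      (n * (n * (n * 14 + 13) + 12) + 6) := by
  refine Runs.seq' (n * 4 + 3) (n * (n * (n * 14 + 13) + 8) + 3) (walkInit_runs hL h0) ?_
    (by ring_nf; omega)
  intro τ hτ hfr hτ9
  refine Runs.loop n (fun k υ => k ≤ n → ∀ v < n, υ.arr (9, v) < Q ∧ (υ.arr (9, v) : ZMod Q) =
      wv n (fun v => (σ.arr (8, v) : ZMod Q)) (fun i => (σ.arr (6, i) : ZMod Q)) (n - k) v)
      (n * (n * 14 + 13) + 6) rfl rfl trivial ((hfr.reg 0 rfl).trans h0) ?_ ?_ ?_ ?_ (by simp; ring_nf; omega)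
  · intro k τ v h
    simpa using h
  · intro _ _ v hv
    simp only [Prog.run, hτ9 v hv, Nat.sub_self, wv]
    split_ifs <;> simp <;> omega
  · intro k υ hk hυ hfu hI h38
    have hf : Frame walk σ υ := hfr.left.trans hfu.right
    have f6 := hf.arr 6 rfl
    have f8 := hf.arr 8 rfl
    have hI := hI hk
    refine (walkStep_runs hQ hB hn hL ((hf.reg 0 rfl).trans h0) ((hf.reg 19 rfl).trans h19)
      (fun v hv => (hI v hv).1) (by simpa [f6] using hE) (by simpa [f8] using hX)).mono ?_ le_rfl
    intro ρ _ _ h _ v hv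
    refine ⟨(h v hv).1, ?_⟩
    rw [(h v hv).2, show n - k = n - (k + 1) + 1 by omega, wv, f8]
    refine congrArg _ (Finset.sum_congr rfl fun u hu => ?_)
    rw [(hI u (Finset.mem_range.1 hu)).2, f6]
  · intro υ _ _ h v hv
    exact h (Nat.zero_le n) v hv

/-! ### Subsets coded by binary numbers, their signs and their starved infants -/

/-- The number of flagged indices below `n` that are greater than `v`. -/
def rk (n : ℕ) (fl : ℕ → ℕ) (v : ℕ) : ℕ := ∑ u ∈ Finset.Ico (v + 1) n, fl u

/-- The binary digits of `Y`, spread over the flagged indices below `n`. -/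
def spread (n : ℕ) (fl : ℕ → ℕ) (Y v : ℕ) : ℕ := fl v * (Y / 2 ^ rk n fl v % 2)

theorem spread_le_one {n : ℕ} {fl : ℕ → ℕ} {v : ℕ} (h : fl v ≤ 1) (Y : ℕ) :
    spread n fl Y v ≤ 1 := by
  unfold spread
  have := Nat.mod_lt (Y / 2 ^ rk n fl v) two_pos
  nlinarith

theorem sub_two_mul_div (x : ℕ) : x - (x / 2 + x / 2) = x % 2 := by omega

/-- The array `7` receives the digits of the register `32`, spread over the flags in the
array `4`. -/
def decodeU : Prog := .seq (blk [add 50 32 2]) (forDown 36 0 (blk [.load 51 4 36, add 52 1 1,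
  div 53 50 52, add 54 53 53, sub 54 50 54, mul 54 54 51, .store 7 36 54, add 52 1 51,
  div 50 50 52]))

theorem decodeU_runs {σ : State} {n Y : ℕ} (hB : 2 < cap B) (hL : n ≤ L) (h0 : σ.reg 0 = n)
    (h32 : σ.reg 32 = Y) (h4 : ∀ v < n, σ.arr (4, v) ≤ 1) :
    Runs B L decodeU σ (fun τ => ∀ v < n, τ.arr (7, v) = spread n (fun v => σ.arr (4, v)) Y v)
      (n * 11 + 3) := by
  refine Runs.of_ok fun hok => ?_
  have b32 := hok.reg_lt 32
  refine Runs.loop n (fun k τ => (k ≤ n → τ.reg 50 = Y / 2 ^ ∑ u ∈ Finset.Ico k n, σ.arr (4, u)) ∧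
    ∀ v < n, k ≤ v → τ.arr (7, v) = spread n (fun v => σ.arr (4, v)) Y v) 9
    rfl rfl (by simpa [hok.zero] using b32) (by simpa using h0) ?_ ?_ ?_ ?_ (by simp; omega)
  · intro k τ v h
    simpa using h
  · simp [hok.zero, h32]
    intros
    omega
  · rintro k τ hk hτ hfr ⟨h1, h2⟩ h36
    have h1 := h1 hk
    have f4 := hfr.arr 4 rfl
    have := h4 k hk
    have b50 := hτ.reg_lt 50
    have b2 : τ.reg 50 % 2 < 2 := Nat.mod_lt _ two_pos
    have b3 : τ.reg 50 % 2 * σ.arr (4, k) ≤ 2 * 1 := Nat.mul_le_mul b2.le this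
    -- Dividing by one plus the flag shifts the code at flagged indices only. As the loop descends,
    -- the lowest digit belongs to the greatest flagged index, in accordance with `rk`.
    have hp : (1 + σ.arr (4, k)) = 2 ^ σ.arr (4, k) := by
      interval_cases σ.arr (4, k) <;> rfl
    refine Runs.straight ?_ ?_ (by simp)
    · simp [h36, f4, hτ.one, sub_two_mul_div]
      omega
    · simp [h36, f4, hτ.one, sub_two_mul_div]
      refine ⟨fun _ => ?_, fun v hv hkv => ?_⟩
      · rw [h1, hp, Nat.div_div_eq_div_mul, ← pow_add, Finset.sum_eq_sum_Ico_succ_bot hk, add_comm]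
      · split_ifs with hvk
        · subst hvk
          rw [h1, mul_comm]
          rfl
        · exact h2 v hv (by omega)
  · rintro τ - - ⟨-, h⟩ v hv
    exact h v hv (Nat.zero_le v)

/-- The array `8` receives the sum of the array `7` and the digits of the register `34`, spread
over the indices that are not flagged in the array `4`. -/
def decodeZ : Prog := .seq (blk [add 50 34 2]) (forDown 36 0 (blk [.load 51 4 36, sub 51 1 51,
  add 52 1 1, div 53 50 52, add 54 53 53, sub 54 50 54, mul 54 54 51, .load 55 7 36, add 54 54 55,
  .store 8 36 54, add 52 1 51, div 50 50 52]))

theorem decodeZ_runs {σ : State} {n Z : ℕ} (hB : 4 < cap B) (hL : n ≤ L) (h0 : σ.reg 0 = n)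
    (h34 : σ.reg 34 = Z) (h7 : ∀ v < n, σ.arr (7, v) ≤ 1) :
    Runs B L decodeZ σ (fun τ => ∀ v < n, τ.arr (8, v) = σ.arr (7, v) +
      spread n (fun v => 1 - σ.arr (4, v)) Z v) (n * 14 + 3) := by
  refine Runs.of_ok fun hok => ?_
  have b34 := hok.reg_lt 34
  refine Runs.loop n (fun k τ =>
    (k ≤ n → τ.reg 50 = Z / 2 ^ ∑ u ∈ Finset.Ico k n, (1 - σ.arr (4, u))) ∧
    ∀ v < n, k ≤ v → τ.arr (8, v) = σ.arr (7, v) + spread n (fun v => 1 - σ.arr (4, v)) Z v) 12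
    rfl rfl (by simpa [hok.zero] using b34) (by simpa using h0) ?_ ?_ ?_ ?_ (by simp; omega)
  · intro k τ v h
    simpa using h
  · simp [hok.zero, h34]
    intros
    omega
  · rintro k τ hk hτ hfr ⟨h1, h2⟩ h36
    have h1 := h1 hk
    have f4 := hfr.arr 4 rfl
    have f7 := hfr.arr 7 rfl
    have h7k := h7 k hk
    have b50 := hτ.reg_lt 50
    have b2 : τ.reg 50 % 2 < 2 := Nat.mod_lt _ two_pos
    have b4 : 1 - σ.arr (4, k) ≤ 1 := Nat.sub_le _ _
    have b3 : τ.reg 50 % 2 * (1 - σ.arr (4, k)) ≤ 2 * 1 := Nat.mul_le_mul b2.le b4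
    have hp : (1 + (1 - σ.arr (4, k))) = 2 ^ (1 - σ.arr (4, k)) := by
      interval_cases (1 - σ.arr (4, k)) <;> rfl
    refine Runs.straight ?_ ?_ (by simp)
    · simp [h36, f4, f7, hτ.one, sub_two_mul_div]
      omega
    · simp [h36, f4, f7, hτ.one, sub_two_mul_div]
      refine ⟨fun _ => ?_, fun v hv hkv => ?_⟩
      · rw [h1, hp, Nat.div_div_eq_div_mul, ← pow_add, Finset.sum_eq_sum_Ico_succ_bot hk, add_comm]
      · split_ifs with hvk
        · subst hvk
          rw [h1, mul_comm, add_comm]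
          rfl
        · exact h2 v hv (by omega)
  · rintro τ - - ⟨-, h⟩ v hv
    exact h v hv (Nat.zero_le v)

/-- The register `35` receives the sign of the set in the array `8`. -/
def sign : Prog := .seq (.const 35 1) (forDown 36 0 (blk [.load 50 8 36, sub 51 1 50, sub 52 19 1,
  mul 51 51 52, add 51 51 50, mulmod 35 35 51]))

/-- The factor of an index is `1` for a member and `Q - 1`, a representative of -1, for a nonmember;
it is computed without a branch. -/
theorem sign_runs {σ : State} {n Q : ℕ} (hQ : 1 < Q) (hB : Q * Q < cap B) (h0 : σ.reg 0 = n)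
    (h19 : σ.reg 19 = Q) (h8 : ∀ v < n, σ.arr (8, v) ≤ 1) :
    Runs B L sign σ (fun τ => τ.reg 35 < Q ∧
      (τ.reg 35 : ZMod Q) = ∏ v ∈ Finset.range n, (2 * (σ.arr (8, v) : ZMod Q) - 1))
      (n * 11 + 3) := by
  have hQ2 : Q < cap B := by nlinarith
  refine Runs.loop n (fun k τ => τ.reg 35 < Q ∧
      (τ.reg 35 : ZMod Q) = ∏ v ∈ Finset.Ico k n, (2 * (σ.arr (8, v) : ZMod Q) - 1)) 9
      rfl rfl ⟨rfl, by omega⟩ (by simpa using h0) ?_ ?_ ?_ ?_ (by simp; omega)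
  · intro k τ v h
    simpa using h
  · simpa using fun _ => hQ
  · rintro k τ hk hτ hfr ⟨h1, h2⟩ h36
    have f8 := hfr.arr 8 rfl
    have f19 := (hfr.reg 19 rfl).trans h19
    have := h8 k hk
    have b1 : (1 - σ.arr (8, k)) * (Q - 1) + σ.arr (8, k) < Q := by
      interval_cases σ.arr (8, k) <;> omega
    have b2 := (Nat.mul_lt_mul'' h1 b1).trans hB
    refine Runs.straight ?_ ?_ (by simp [mulmod])
    · simp [mulmod, h36, f8, f19, hτ.one]
      omega
    · simp only [mulmod, blk, Prog.run, Op.eval, State.setReg_reg]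
      norm_num [h36, f8, f19, hτ.one]
      refine ⟨Nat.mod_lt _ (by omega), ?_⟩
      rw [Finset.prod_eq_prod_Ico_succ_bot hk, h2, mul_comm]
      congr 1
      interval_cases σ.arr (8, k)
      · simp [Nat.cast_sub hQ.le]
      · norm_num
  · rintro τ - - ⟨h1, h2⟩
    exact ⟨h1, by simpa using h2⟩

/-- The indicator of being nonzero. -/
def nz (x : ℕ) : ℕ := 1 - (1 - x)

theorem nz_le_one (x : ℕ) : nz x ≤ 1 := Nat.sub_le _ _

theorem nz_def (x : ℕ) : 1 - (1 - x) = nz x := rfl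

/-- The number of rows `r` flagged in `inf`, for which no nonzero entry of the matrix `M` is in
a column in `x`. -/
def starved (n : ℕ) (inf M x : ℕ → ℕ) : ℕ :=
  ∑ r ∈ Finset.range n, inf r * (1 - ∑ v ∈ Finset.range n, nz (M (r * n + v)) * x v)

/-- The register `51` receives the number of neighbors of the vertex in the register `36` in
the set in the array `7`. -/
def hits : Prog := .seq (.const 51 0) (forDown 37 0 (blk [mul 52 36 0, add 52 52 37, .load 52 0 52,
  sub 52 1 52, sub 52 1 52, .load 53 7 37, mul 52 52 53, add 51 51 52]))

theorem hits_runs {σ : State} {n r : ℕ} (hB : n * n < cap B) (hr : r < n) (h0 : σ.reg 0 = n)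
    (h36 : σ.reg 36 = r) (h7 : ∀ v < n, σ.arr (7, v) ≤ 1) :
    Runs B L hits σ (fun τ => τ.reg 51 = ∑ v ∈ Finset.range n, nz (σ.arr (0, r * n + v)) *
      σ.arr (7, v)) (n * 10 + 3) := by
  have hn : 0 < n := by omega
  have hnB : n < cap B := by nlinarith
  refine Runs.loop n (fun k τ => k ≤ n → τ.reg 51 ≤ n - k ∧ τ.reg 51 = ∑ v ∈ Finset.Ico k n,
      nz (σ.arr (0, r * n + v)) * σ.arr (7, v)) 8 rfl rfl ⟨rfl, by omega⟩ (by simpa using h0)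
      ?_ ?_ ?_ ?_ (by simp; omega)
  · intro k τ v h
    simpa using h
  · simp
  · rintro k τ hk hτ hfr hI h37
    obtain ⟨h1, h2⟩ := hI hk
    have f0 := (hfr.reg 0 rfl).trans h0
    have f36 := (hfr.reg 36 rfl).trans h36
    have f7 := hfr.arr 7 rfl
    have fa := hfr.arr 0 rfl
    have hlt := mul_add_lt_mul hr hk
    have b2 : nz (σ.arr (0, r * n + k)) * σ.arr (7, k) ≤ 1 * 1 :=
      Nat.mul_le_mul (nz_le_one _) (h7 k hk)
    refine Runs.straight ?_ ?_ (by simp)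
    · simp [f0, f36, f7, fa, h37, hτ.one, nz_def]
      omega
    · simp [f0, f36, f7, fa, h37, hτ.one, nz_def]
      intro _
      refine ⟨by omega, ?_⟩
      rw [Finset.sum_eq_sum_Ico_succ_bot hk, h2, add_comm]
  · intro τ _ _ h
    simpa using (h (Nat.zero_le n)).2

/-- The register `33` receives the number of starved infants. -/
def countStarved : Prog := .seq (.const 33 0) (forDown 36 0 (.seq hits
  (blk [sub 51 1 51, .load 52 5 36, mul 51 51 52, add 33 33 51])))

theorem countStarved_runs {σ : State} {n : ℕ} (hn : 0 < n) (hB : n * n < cap B)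
    (h0 : σ.reg 0 = n) (h5 : ∀ v < n, σ.arr (5, v) ≤ 1) (h7 : ∀ v < n, σ.arr (7, v) ≤ 1) :
    Runs B L countStarved σ (fun τ => τ.reg 33 =
      starved n (fun r => σ.arr (5, r)) (fun i => σ.arr (0, i)) fun v => σ.arr (7, v))
      (n * (n * 10 + 9) + 3) := by
  have hnB : n < cap B := by nlinarith
  refine Runs.loop n (fun k τ => k ≤ n → τ.reg 33 ≤ n - k ∧ τ.reg 33 = ∑ r ∈ Finset.Ico k n,
      σ.arr (5, r) * (1 - ∑ v ∈ Finset.range n, nz (σ.arr (0, r * n + v)) * σ.arr (7, v)))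
      (n * 10 + 7) rfl rfl ⟨rfl, by omega⟩ (by simpa using h0)
      ?_ ?_ ?_ ?_ (by simp; ring_nf; omega)
  · intro k τ v h
    simpa using h
  · simp
  · rintro k τ hk hτ hfr hI h36
    obtain ⟨h1, h2⟩ := hI hk
    have f7 := hfr.arr 7 rfl
    have f5 := hfr.arr 5 rfl
    have fa := hfr.arr 0 rfl
    refine Runs.seq' (n * 10 + 3) 4 (hits_runs hB hk ((hfr.reg 0 rfl).trans h0) h36
      (by simpa [f7] using h7)) ?_ (by omega)
    intro υ hυ hfu h51
    have g5 := hfu.arr 5 rfl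
    have g33 := hfu.reg 33 rfl
    have g36 := (hfu.reg 36 rfl).trans h36
    simp only [fa, f7] at h51
    have b2 : (1 - υ.reg 51) * σ.arr (5, k) ≤ 1 * 1 :=
      Nat.mul_le_mul (Nat.sub_le _ _) (h5 k hk)
    refine Runs.straight ?_ ?_ (by simp)
    · simp [g5, g33, g36, f5, hυ.one]
      omega
    · simp [g5, g33, g36, f5, hυ.one]
      intro _
      refine ⟨by omega, ?_⟩
      rw [Finset.sum_eq_sum_Ico_succ_bot hk, h2, add_comm, mul_comm, h51]
  · intro τ _ _ h
    simpa [starved] using (h (Nat.zero_le n)).2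

/-! ### The restricted inclusion-exclusion sum -/

/-- The memory during the inclusion-exclusion sum. -/
structure Ctx (n Q a pu pz : ℕ) (M fl inf E : ℕ → ℕ) (σ : State) : Prop where
  r0 : σ.reg 0 = n
  r9 : σ.reg 9 = a
  r11 : σ.reg 11 = pu
  r12 : σ.reg 12 = pz
  r19 : σ.reg 19 = Q
  a0 : ∀ i, σ.arr (0, i) = M i
  a4 : ∀ i, σ.arr (4, i) = fl i
  a5 : ∀ i, σ.arr (5, i) = inf i
  a6 : ∀ i < n * n, σ.arr (6, i) = E i

theorem Ctx.frame {n Q a pu pz : ℕ} {M fl inf E : ℕ → ℕ} {σ τ : State} {c : Prog}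
    (h : Ctx n Q a pu pz M fl inf E σ) (hf : Frame c σ τ)
    (hr : ([0, 9, 11, 12, 19].all fun x => !c.wr x) = true)
    (ha : ([0, 4, 5, 6].all fun x => !c.wa x) = true) : Ctx n Q a pu pz M fl inf E τ := by
  simp at hr ha
  obtain ⟨h0, h9, h11, h12, h19⟩ := hr
  obtain ⟨k0, k4, k5, k6⟩ := ha
  exact ⟨(hf.reg _ h0).trans h.r0, (hf.reg _ h9).trans h.r9, (hf.reg _ h11).trans h.r11,
    (hf.reg _ h12).trans h.r12, (hf.reg _ h19).trans h.r19, fun i => (hf.arr _ k0 i).trans (h.a0 i),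
    fun i => (hf.arr _ k4 i).trans (h.a4 i), fun i => (hf.arr _ k5 i).trans (h.a5 i),
    fun i hi => (hf.arr _ k6 i).trans (h.a6 i hi)⟩

/-- The indicator function of the set that is coded by `Y` on the flagged indices and by `Z` on
the others. -/
def code (n : ℕ) (fl : ℕ → ℕ) (Y Z v : ℕ) : ℕ :=
  spread n fl Y v + spread n (fun v => 1 - fl v) Z v

theorem code_le_one {n : ℕ} {fl : ℕ → ℕ} {v : ℕ} (h : fl v ≤ 1) (Y Z : ℕ) :
    code n fl Y Z v ≤ 1 := by
  unfold code spread
  have h1 := Nat.mod_lt (Y / 2 ^ rk n fl v) two_pos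
  have h2 := Nat.mod_lt (Z / 2 ^ rk n (fun v => 1 - fl v) v) two_pos
  rcases Nat.le_one_iff_eq_zero_or_eq_one.1 h with h | h <;> simp [h] <;> omega

/-- The signed number of closed walks in the set with the indicator function `x`. -/
def signedWalks {R : Type*} [CommRing R] (n : ℕ) (E : ℕ → R) (x : ℕ → ℕ) : R :=
  (∏ v ∈ Finset.range n, (2 * (x v : R) - 1)) * wv n (fun v => (x v : R)) E n 0

theorem wv_congr {R : Type*} [CommRing R] {n : ℕ} {X X' E E' : ℕ → R}
    (hX : ∀ v < n, X v = X' v) (hE : ∀ i < n * n, E i = E' i) (j : ℕ) :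
    ∀ v < n, wv n X E j v = wv n X' E' j v := by
  induction j with
  | zero => exact fun v _ => rfl
  | succ j ih =>
    intro v hv
    rw [wv, wv, hX v hv]
    refine congrArg _ (Finset.sum_congr rfl fun u hu => ?_)
    rw [Finset.mem_range] at hu
    rw [ih u hu, hE _ (mul_add_lt_mul hu hv)]

theorem signedWalks_congr {R : Type*} [CommRing R] {n : ℕ} (hn : 0 < n) {E E' : ℕ → R}
    {x x' : ℕ → ℕ} (hx : ∀ v < n, x v = x' v) (hE : ∀ i < n * n, E i = E' i) :
    signedWalks n E x = signedWalks n E' x' := by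
  unfold signedWalks
  rw [wv_congr (fun v hv => by rw [hx v hv]) hE n 0 hn]
  congr 1
  exact Finset.prod_congr rfl fun v hv => by rw [hx v (Finset.mem_range.1 hv)]

/-- Add the term for the registers `32` and `34` to the register `31`. -/
def zTerm : Prog := .seq decodeZ (.seq sign (.seq walk (blk [.load 50 9 2, mulmod 50 50 35,
  addmod 31 31 50])))

/-- The time for one term. -/
def zCost (n : ℕ) : ℕ := n * 14 + 3 + (n * 11 + 3) + (n * (n * (n * 14 + 13) + 12) + 6) + 9

theorem zTerm_runs {σ : State} {n Q a pu pz Y Z : ℕ} {M fl inf E : ℕ → ℕ} (hn : 0 < n)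
    (hQ : 1 < Q) (hB : 2 * (Q * Q) < cap B) (hnB : n * n < cap B) (hL : n ≤ L)
    (hσ : Ctx n Q a pu pz M fl inf E σ) (hfl : ∀ v, fl v ≤ 1) (hE : ∀ i < n * n, E i < Q)
    (h34 : σ.reg 34 = Z) (h31 : σ.reg 31 < Q) (h7 : ∀ v < n, σ.arr (7, v) = spread n fl Y v) :
    Runs B L zTerm σ (fun τ => τ.reg 31 < Q ∧ (τ.reg 31 : ZMod Q) =
      σ.reg 31 + signedWalks n (fun i => (E i : ZMod Q)) (code n fl Y Z)) (zCost n) := by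
  have hQQ : Q * 2 ≤ Q * Q := Nat.mul_le_mul_left _ hQ
  refine Runs.seq' (n * 14 + 3) (n * 11 + 3 + (n * (n * (n * 14 + 13) + 12) + 6) + 9)
    (decodeZ_runs (by omega) hL hσ.r0 h34
      (fun v hv => (h7 v hv).trans_le (spread_le_one (hfl v) _))) ?_ (by unfold zCost; omega)
  intro σ₁ _ hf₁ h8
  have c₁ := hσ.frame hf₁ rfl rfl
  have h8 : ∀ v < n, σ₁.arr (8, v) = code n fl Y Z v := by
    intro v hv
    rw [h8 v hv, h7 v hv, code]
    simp only [hσ.a4]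
  have h8' : ∀ v < n, σ₁.arr (8, v) ≤ 1 :=
    fun v hv => (h8 v hv).trans_le (code_le_one (hfl v) Y Z)
  refine Runs.seq' (n * 11 + 3) ((n * (n * (n * 14 + 13) + 12) + 6) + 9)
    (sign_runs hQ (by omega) c₁.r0 c₁.r19 h8') ?_ (by omega)
  rintro σ₂ _ hf₂ ⟨h35, h35'⟩
  have c₂ := c₁.frame hf₂ rfl rfl
  have g8 := hf₂.arr 8 rfl
  refine Runs.seq' ((n * (n * (n * 14 + 13) + 12) + 6)) 9
    (walk_runs hQ hB hnB hL c₂.r0 c₂.r19 (fun i hi => by rw [c₂.a6 i hi]; exact hE i hi)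
      (by simpa [g8] using h8')) ?_ (by omega)
  intro σ₃ hok₃ hf₃ h9
  have c₃ := c₂.frame hf₃ rfl rfl
  obtain ⟨h9, h9'⟩ := h9 0 hn
  have g35 := hf₃.reg 35 rfl
  have g31 : σ₃.reg 31 = σ.reg 31 :=
    (hf₃.reg 31 rfl).trans ((hf₂.reg 31 rfl).trans (hf₁.reg 31 rfl))
  have b1 := Nat.mul_lt_mul'' h9 h35
  have b2 : σ₃.arr (9, 0) * σ₂.reg 35 % Q < Q := Nat.mod_lt _ (by omega)
  refine Runs.straight ?_ ?_ (by simp [mulmod, addmod])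
  · simp [mulmod, addmod, c₃.r19, hok₃.zero, g35, g31]
    omega
  · simp [mulmod, addmod, c₃.r19, hok₃.zero, g35, g31]
    refine ⟨Nat.mod_lt _ (by omega), ?_⟩
    rw [h9', h35', signedWalks, mul_comm]
    congr 1
    · exact Finset.prod_congr rfl fun v hv => by rw [h8 v (Finset.mem_range.1 hv)]
    · refine wv_congr (fun v hv => ?_) (fun i hi => ?_) n 0 hn
      · rw [g8, h8 v hv]
      · rw [c₂.a6 i hi]

/-- The sum over the sets with a fixed trace on the flagged indices. -/
def zLoop : Prog := .seq .skip (forDown 34 12 zTerm)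

theorem zLoop_runs {σ : State} {n Q a pu pz Y : ℕ} {M fl inf E : ℕ → ℕ} (hn : 0 < n)
    (hQ : 1 < Q) (hB : 2 * (Q * Q) < cap B) (hnB : n * n < cap B) (hL : n ≤ L)
    (hσ : Ctx n Q a pu pz M fl inf E σ) (hfl : ∀ v, fl v ≤ 1) (hE : ∀ i < n * n, E i < Q)
    (h31 : σ.reg 31 < Q) (h7 : ∀ v < n, σ.arr (7, v) = spread n fl Y v) :
    Runs B L zLoop σ (fun τ => τ.reg 31 < Q ∧ (τ.reg 31 : ZMod Q) = σ.reg 31 +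
      ∑ Z ∈ Finset.range pz, signedWalks n (fun i => (E i : ZMod Q)) (code n fl Y Z))
      (pz * (zCost n + 2) + 3) := by
  refine Runs.loop pz (fun k τ => τ.reg 31 < Q ∧ (τ.reg 31 : ZMod Q) = σ.reg 31 +
      ∑ Z ∈ Finset.Ico k pz, signedWalks n (fun i => (E i : ZMod Q)) (code n fl Y Z)) (zCost n)
    rfl rfl trivial hσ.r12 ?_ ?_ ?_ ?_ (by simp; omega)
  · intro k τ v h
    simpa using h
  · simpa using fun _ => h31
  · rintro k τ hk hτ hfr ⟨h1, h2⟩ h34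
    have f7 := hfr.arr 7 rfl
    refine (zTerm_runs hn hQ hB hnB hL (hσ.frame hfr rfl rfl) hfl hE h34 h1
      (by simpa [f7] using h7)).mono ?_ le_rfl
    rintro υ - - ⟨h3, h4⟩
    refine ⟨h3, ?_⟩
    rw [h4, h2, Finset.sum_eq_sum_Ico_succ_bot hk]
    ring
  · rintro τ - - ⟨h1, h2⟩
    exact ⟨h1, by simpa using h2⟩

/-- The trace with the code `Y` starves at most `a` infants. -/
def Good (n a : ℕ) (M fl inf : ℕ → ℕ) (Y : ℕ) : Prop := starved n inf M (spread n fl Y) ≤ a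

instance (n a : ℕ) (M fl inf : ℕ → ℕ) : DecidablePred (Good n a M fl inf) :=
  fun _ => inferInstanceAs (Decidable (_ ≤ _))

/-- The contribution of the trace in the register `32`. -/
def yStep : Prog := .seq decodeU (.seq countStarved (.seq (sub 50 33 9) (.ite 50 .skip zLoop)))

/-- The time for testing one trace. -/
def yCost (n : ℕ) : ℕ := n * 11 + 3 + (n * (n * 10 + 9) + 3) + 3

/-- Whether a set passes the test is determined by its trace on the flagged vertices, so a bad trace
is rejected once, before the loop over its extensions. The time bound keeps this case distinction:
only good traces pay for `zLoop`. -/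
theorem yStep_runs {σ : State} {n Q a pu pz Y : ℕ} {M fl inf E : ℕ → ℕ} (hn : 0 < n)
    (hQ : 1 < Q) (hB : 2 * (Q * Q) < cap B) (hnB : n * n < cap B) (hL : n ≤ L)
    (hσ : Ctx n Q a pu pz M fl inf E σ) (hfl : ∀ v, fl v ≤ 1) (hinf : ∀ v, inf v ≤ 1)
    (hE : ∀ i < n * n, E i < Q) (h31 : σ.reg 31 < Q) (h32 : σ.reg 32 = Y) :
    Runs B L yStep σ (fun τ => τ.reg 31 < Q ∧ (τ.reg 31 : ZMod Q) = σ.reg 31 +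
      if Good n a M fl inf Y then
        ∑ Z ∈ Finset.range pz, signedWalks n (fun i => (E i : ZMod Q)) (code n fl Y Z) else 0)
      (yCost n + if Good n a M fl inf Y then pz * (zCost n + 2) + 3 else 0) := by
  have hQQ : Q * 2 ≤ Q * Q := Nat.mul_le_mul_left _ hQ
  set N := if Good n a M fl inf Y then pz * (zCost n + 2) + 3 else 0 with hN
  refine Runs.seq' (n * 11 + 3) (n * (n * 10 + 9) + 3 + 3 + N)
    (decodeU_runs (by omega) hL hσ.r0 h32 (fun v _ => (hσ.a4 v).trans_le (hfl v))) ?_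
    (by unfold yCost; omega)
  intro σ₁ _ hf₁ h7
  simp only [hσ.a4] at h7
  have c₁ := hσ.frame hf₁ rfl rfl
  refine Runs.seq' (n * (n * 10 + 9) + 3) (3 + N)
    (countStarved_runs hn hnB c₁.r0 (fun v _ => (c₁.a5 v).trans_le (hinf v))
      fun v hv => (h7 v hv).trans_le (spread_le_one (hfl v) _)) ?_ (by omega)
  intro σ₂ _ hf₂ h33
  have c₂ := c₁.frame hf₂ rfl rfl
  have h33 : σ₂.reg 33 = starved n inf M (spread n fl Y) := by
    rw [h33]
    refine Finset.sum_congr rfl fun r _ => ?_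
    simp only [c₁.a5, c₁.a0]
    congr 2
    exact Finset.sum_congr rfl fun v hv => by rw [h7 v (Finset.mem_range.1 hv)]
  refine Runs.cons' (2 + N) ⟨rfl, trivial⟩ (fun _ hf₃ => ?_) (by simp; omega)
  have c₃ := c₂.frame hf₃ rfl rfl
  have g31 : σ₂.reg 31 = σ.reg 31 := (hf₂.reg 31 rfl).trans (hf₁.reg 31 rfl)
  have g7 : ∀ v < n, σ₂.arr (7, v) = spread n fl Y v :=
    fun v hv => (hf₂.arr 7 rfl v).trans (h7 v hv)
  have hite : ((Prog.run (sub 50 33 9) σ₂).reg 50 = 0) ↔ Good n a M fl inf Y := by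
    simp [h33, c₂.r9, Good, Nat.sub_eq_zero_iff_le]
  refine (Runs.ite (N := 1 + N) ?_ ?_).mono (fun _ _ _ h => h) (by omega)
  · intro h
    rw [Ne, hite] at h
    refine Runs.straight trivial ?_ (by simp)
    simpa [h, g31] using h31
  · intro h
    rw [hite] at h
    refine (zLoop_runs hn hQ hB hnB hL c₃ hfl hE (Y := Y) ?_ ?_).mono ?_ ?_
    · simpa [g31] using h31
    · simpa using g7
    · intro τ _ _
      simp [h, g31]
    · simp [hN, h]

/-- The inclusion-exclusion sum; the result is in the register `31`. -/
def inner : Prog := .seq (.const 31 0) (forDown 32 11 yStep)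

/-- The value of the inclusion-exclusion sum. -/
def innerSum {R : Type*} [CommRing R] (n a pu pz : ℕ) (M fl inf : ℕ → ℕ) (E : ℕ → R) : R :=
  ∑ Y ∈ Finset.range pu, if Good n a M fl inf Y then
    ∑ Z ∈ Finset.range pz, signedWalks n E (code n fl Y Z) else 0

/-- The time for the inclusion-exclusion sum. -/
def innerCost (n a pu pz : ℕ) (M fl inf : ℕ → ℕ) : ℕ :=
  pu * (yCost n + 2) +
    ((Finset.range pu).filter (Good n a M fl inf)).card * (pz * (zCost n + 2) + 3) + 3

theorem inner_runs {σ : State} {n Q a pu pz : ℕ} {M fl inf E : ℕ → ℕ} (hn : 0 < n)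
    (hQ : 1 < Q) (hB : 2 * (Q * Q) < cap B) (hnB : n * n < cap B) (hL : n ≤ L)
    (hσ : Ctx n Q a pu pz M fl inf E σ) (hfl : ∀ v, fl v ≤ 1) (hinf : ∀ v, inf v ≤ 1)
    (hE : ∀ i < n * n, E i < Q) :
    Runs B L inner σ (fun τ => τ.reg 31 < Q ∧ (τ.reg 31 : ZMod Q) =
      innerSum n a pu pz M fl inf fun i => (E i : ZMod Q)) (innerCost n a pu pz M fl inf) := by
  refine Runs.loop_sum pu (fun k τ => τ.reg 31 < Q ∧ (τ.reg 31 : ZMod Q) =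
      ∑ Y ∈ Finset.Ico k pu, if Good n a M fl inf Y then
        ∑ Z ∈ Finset.range pz, signedWalks n (fun i => (E i : ZMod Q)) (code n fl Y Z) else 0)
    (fun Y => yCost n + if Good n a M fl inf Y then pz * (zCost n + 2) + 3 else 0)
    rfl rfl ⟨rfl, by omega⟩ (by simpa using hσ.r11) ?_ ?_ ?_ ?_ ?_
  · intro k τ v h
    simpa using h
  · simp
    omega
  · rintro k τ hk hτ hfr ⟨h1, h2⟩ h32
    refine (yStep_runs hn hQ hB hnB hL (hσ.frame hfr rfl rfl) hfl hinf hE h1 h32).mono ?_ le_rfl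
    rintro υ - - ⟨h3, h4⟩
    refine ⟨h3, ?_⟩
    rw [h4, h2, Finset.sum_eq_sum_Ico_succ_bot hk]
    ring
  · rintro τ - - ⟨h1, h2⟩
    exact ⟨h1, by simpa [innerSum] using h2⟩
  · simp only [add_right_comm _ _ 2, Finset.sum_add_distrib, ← Finset.sum_filter, innerCost, Finset.sum_const,
      Finset.card_range, smul_eq_mul, Prog.len]
    linarith

/-! ### The parameters of the search -/

/-- The data that are computed from the instance before the search. -/
structure Par where
  /-- the number of vertices -/
  n : ℕ
  /-- the number of hubs -/
  a : ℕ
  /-- the number of traces on the flagged vertices -/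
  pu : ℕ
  /-- the number of subsets of the unflagged vertices -/
  pz : ℕ
  /-- the base in which weights are written -/
  s : ℕ
  /-- the binary length of the slack -/
  b : ℕ
  /-- the additional weight for arcs to hubs -/
  lam : ℕ
  /-- the number of evaluation points in each coordinate -/
  q : ℕ
  /-- the modulus -/
  Q : ℕ
  /-- the exponent that turns residues into roots of unity -/
  e : ℕ
  /-- the indicator function of the hubs -/
  hub : ℕ → ℕ
  /-- the indicator function of the neighbors of infants -/
  fl : ℕ → ℕ
  /-- the indicator function of the infants -/
  inf : ℕ → ℕ

/-- Bounds for the data. -/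
structure Par.Valid (P : Par) (B L : ℕ) : Prop where
  n_pos : 0 < P.n
  one_lt : 1 < P.Q
  q_lt : P.q < P.Q
  s_pos : 0 < P.s
  sq_lt : 2 * (P.Q * P.Q) < cap B
  nn_lt : P.n * P.n < cap B
  nn_le : P.n * P.n ≤ L
  s_lt : P.s + P.lam < cap B
  qa_lt : P.q + P.q * P.a < cap B
  hub_le : ∀ v, P.hub v ≤ 1
  fl_le : ∀ v, P.fl v ≤ 1
  inf_le : ∀ v, P.inf v ≤ 1

/-- The memory holds the data, and the array `0` holds `M`. -/
structure Par.Holds (P : Par) (M : ℕ → ℕ) (σ : State) : Prop where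
  r0 : σ.reg 0 = P.n
  r3 : σ.reg 3 = P.n * P.n
  r9 : σ.reg 9 = P.a
  r11 : σ.reg 11 = P.pu
  r12 : σ.reg 12 = P.pz
  r13 : σ.reg 13 = P.s
  r15 : σ.reg 15 = P.b
  r16 : σ.reg 16 = P.lam
  r18 : σ.reg 18 = P.q
  r19 : σ.reg 19 = P.Q
  r20 : σ.reg 20 = P.e
  r21 : σ.reg 21 = P.n + 1
  a0 : ∀ i, σ.arr (0, i) = M i
  a3 : ∀ i, σ.arr (3, i) = P.hub i
  a4 : ∀ i, σ.arr (4, i) = P.fl i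
  a5 : ∀ i, σ.arr (5, i) = P.inf i

theorem Par.Holds.frame' {P : Par} {M : ℕ → ℕ} {σ τ : State} {c : Prog}
    (h : P.Holds M σ) (hf : Frame c σ τ)
    (hr : ([0, 3, 9, 11, 12, 13, 15, 16, 18, 19, 20, 21].all fun x => !c.wr x) = true)
    (ha : ([3, 4, 5].all fun x => !c.wa x) = true) {M' : ℕ → ℕ} (hM : ∀ i, τ.arr (0, i) = M' i) :
    P.Holds M' τ := by
  simp at hr ha
  obtain ⟨h0, h3, h9, h11, h12, h13, h15, h16, h18, h19, h20, h21⟩ := hr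
  obtain ⟨k3, k4, k5⟩ := ha
  exact ⟨(hf.reg _ h0).trans h.r0, (hf.reg _ h3).trans h.r3, (hf.reg _ h9).trans h.r9,
    (hf.reg _ h11).trans h.r11, (hf.reg _ h12).trans h.r12, (hf.reg _ h13).trans h.r13,
    (hf.reg _ h15).trans h.r15, (hf.reg _ h16).trans h.r16, (hf.reg _ h18).trans h.r18,
    (hf.reg _ h19).trans h.r19, (hf.reg _ h20).trans h.r20, (hf.reg _ h21).trans h.r21, hM,
    fun i => (hf.arr _ k3 i).trans (h.a3 i), fun i => (hf.arr _ k4 i).trans (h.a4 i),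
    fun i => (hf.arr _ k5 i).trans (h.a5 i)⟩

theorem Par.Holds.frame {P : Par} {M : ℕ → ℕ} {σ τ : State} {c : Prog}
    (h : P.Holds M σ) (hf : Frame c σ τ)
    (hr : ([0, 3, 9, 11, 12, 13, 15, 16, 18, 19, 20, 21].all fun x => !c.wr x) = true)
    (ha : ([0, 3, 4, 5].all fun x => !c.wa x) = true) : P.Holds M τ := by
  refine h.frame' hf hr ?_ fun i => ?_
  · simp at ha ⊢
    exact ha.2
  · simp at ha
    exact (hf.arr _ ha.1 i).trans (h.a0 i)

/-! ### Evaluating the generating polynomial at one point -/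

/-- The arc weights at the evaluation point `(ξ, η)`. -/
def Par.arc {R : Type*} [CommRing R] (P : Par) (M : ℕ → ℕ) (ξ η : R) (i : ℕ) : R :=
  nz (M i) * (ξ ^ ((M i - 1) % P.s + P.lam * P.hub (i % P.n)) * η ^ ((M i - 1) / P.s))

/-- The array `6` receives the arc weights at the point in the registers `27` and `29`. -/
def fill : Prog := .seq .skip (forDown 36 3 (.seq
  (blk [.load 50 0 36, sub 51 50 1, div 52 51 13, mul 53 52 13, sub 53 51 53, div 54 36 0,
    mul 54 54 0, sub 54 36 54, .load 54 3 54, mul 54 54 16, add 53 53 54, add 40 27 2,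
    add 41 53 2]) (.seq powmod (.seq
  (blk [add 55 42 2, add 40 29 2, add 41 52 2]) (.seq powmod
  (blk [mulmod 55 55 42, sub 51 1 50, sub 51 1 51, mul 55 55 51, .store 6 36 55]))))))

theorem fill_runs {P : Par} {σ : State} {M : ℕ → ℕ} (hP : P.Valid B L) (hσ : P.Holds M σ)
    (h27 : σ.reg 27 < P.Q) (h29 : σ.reg 29 < P.Q) :
    Runs B L fill σ (fun τ => ∀ i < P.n * P.n, τ.arr (6, i) < P.Q ∧ (τ.arr (6, i) : ZMod P.Q) =
      P.arc M (σ.reg 27 : ZMod P.Q) (σ.reg 29 : ZMod P.Q) i) (P.n * P.n * (60 * B + 46) + 3) := by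
  have hQ := hP.one_lt
  have hQQ := hP.sq_lt
  have hQ2 : P.Q * 2 ≤ P.Q * P.Q := Nat.mul_le_mul_left _ hQ
  refine Runs.loop (P.n * P.n) (fun k τ => ∀ i < P.n * P.n, k ≤ i → τ.arr (6, i) < P.Q ∧
      (τ.arr (6, i) : ZMod P.Q) = P.arc M (σ.reg 27 : ZMod P.Q) (σ.reg 29 : ZMod P.Q) i)
    (60 * B + 44) rfl rfl trivial hσ.r3 ?_ ?_ ?_ ?_ (by simp; ring_nf; omega)
  · intro k τ v h
    simpa using h
  · intro _ v h1 h2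
    omega
  · intro k τ hk hτ hfr hI h36
    have c := hσ.frame hfr rfl rfl
    have f27 := hfr.reg 27 rfl
    have f29 := hfr.reg 29 rfl
    have hM : M k < cap B := c.a0 k ▸ hτ.arr_lt _
    have hkB : k < cap B := h36 ▸ hτ.reg_lt 36
    have hub := hP.hub_le (k % P.n)
    have hlam := hP.s_lt
    have b1 : P.hub (k % P.n) * P.lam ≤ 1 * P.lam := Nat.mul_le_mul_right _ hub
    have b2 := Nat.div_mul_le_self (M k - 1) P.s
    have b3 := Nat.div_mul_le_self k P.n
    have b4 := Nat.mod_lt (M k - 1) hP.s_pos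
    have b5 := hτ.reg_lt 27
    have b6 := hτ.reg_lt 29
    have b7 := Nat.div_le_self (M k - 1) P.s
    refine Runs.cons' (60 * B + 31) ?_ (fun _ hf₁ => ?_) (by simp; omega)
    · simp [h36, c.r13, c.r0, c.r16, c.a0, c.a3, hτ.one, hτ.zero]
      rw [f27] at *
      omega
    set σ₁ := Prog.run _ τ with hσ₁
    have c₁ := c.frame hf₁ rfl rfl
    have g50 : σ₁.reg 50 = M k := by simp [hσ₁, h36, c.a0]
    have g52 : σ₁.reg 52 = (M k - 1) / P.s := by simp [hσ₁, h36, c.a0, hτ.one, c.r13]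
    have g40 : σ₁.reg 40 = σ.reg 27 := by simp [hσ₁, hτ.zero, f27]
    have g41 : σ₁.reg 41 = (M k - 1) % P.s + P.lam * P.hub (k % P.n) := by
      simp [hσ₁, h36, c.a0, c.a3, hτ.one, hτ.zero, c.r13, c.r0, c.r16]
      ring
    have g29 : σ₁.reg 29 = σ.reg 29 := (hf₁.reg 29 rfl).trans f29
    have g36 : σ₁.reg 36 = k := (hf₁.reg 36 rfl).trans h36
    have g6 := hf₁.arr 6 rfl
    clear_value σ₁
    refine Runs.seq' (30 * B + 10) (30 * B + 21)
      (powmod_runs hQ (by omega) c₁.r19 g40 h27 g41) ?_ (by omega)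
    rintro σ₂ ok₂ hf₂ ⟨h42, h42'⟩
    have c₂ := c₁.frame hf₂ rfl rfl
    have g52' := (hf₂.reg 52 rfl).trans g52
    have g29' := (hf₂.reg 29 rfl).trans g29
    refine Runs.cons' (30 * B + 18) ?_ (fun _ hf₃ => ?_) (by simp; omega)
    · simp [ok₂.zero, g29', g52']
      omega
    set σ₃ := Prog.run _ σ₂ with hσ₃
    have c₃ := c₂.frame hf₃ rfl rfl
    have k40 : σ₃.reg 40 = σ.reg 29 := by simp [hσ₃, ok₂.zero, g29']
    have k41 : σ₃.reg 41 = (M k - 1) / P.s := by simp [hσ₃, ok₂.zero, g52']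
    have k55 : σ₃.reg 55 = σ₂.reg 42 := by simp [hσ₃, ok₂.zero]
    have k50 : σ₃.reg 50 = M k := (hf₃.reg 50 rfl).trans ((hf₂.reg 50 rfl).trans g50)
    have k36 : σ₃.reg 36 = k := (hf₃.reg 36 rfl).trans ((hf₂.reg 36 rfl).trans g36)
    have k6 : ∀ i, σ₃.arr (6, i) = τ.arr (6, i) :=
      fun i => (hf₃.arr 6 rfl i).trans ((hf₂.arr 6 rfl i).trans (g6 i))
    clear_value σ₃
    refine Runs.seq' (30 * B + 10) 8
      (powmod_runs hQ (by omega) c₃.r19 k40 h29 k41) ?_ (by omega)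
    rintro σ₄ ok₄ hf₄ ⟨j42, j42'⟩
    have c₄ := c₃.frame hf₄ rfl rfl
    have k55 := (hf₄.reg 55 rfl).trans k55
    have k50 := (hf₄.reg 50 rfl).trans k50
    have k36 := (hf₄.reg 36 rfl).trans k36
    have k6 := fun i => (hf₄.arr 6 rfl i).trans (k6 i)
    have b8 := Nat.mul_lt_mul'' h42 j42
    have b9 : σ₂.reg 42 * σ₄.reg 42 % P.Q < P.Q := Nat.mod_lt _ (by omega)
    have b10 : σ₂.reg 42 * σ₄.reg 42 % P.Q * nz (M k) ≤ σ₂.reg 42 * σ₄.reg 42 % P.Q * 1 :=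
      Nat.mul_le_mul_left _ (nz_le_one _)
    have hL := hP.nn_le
    refine Runs.straight ?_ ?_ (by simp [mulmod])
    · simp [mulmod, k55, k50, k36, c₄.r19, ok₄.one, nz_def]
      omega
    · intro i hi hki
      by_cases hik : i = k
      · subst hik
        simp [mulmod, k55, k50, k36, c₄.r19, ok₄.one, nz_def]
        refine ⟨by omega, ?_⟩
        rw [h42', j42', Par.arc]
        ring
      · simpa [mulmod, k36, hik, k6] using hI i hi (by omega)
  · intro τ _ _ h i hi
    exact h i hi (Nat.zero_le i)

/-- The register `57` receives the sum of the first powers of the register `56`, modulo the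
register `19`; the number of powers is `2` to the register `15`. -/
def slack : Prog := .seq (.const 57 1) (forDown 37 15 (blk [add 58 56 1, mulmod 57 57 58,
  mulmod 56 56 56]))

/-- Doubling the number of terms makes a geometric sum of 2^b terms cost `b` rounds. The closed
formula is not available, since `z - 1` need not be a unit; it is zero at the root of unity `1`. -/
theorem sum_pow_double {R : Type*} [CommRing R] (z : R) (j : ℕ) :
    ∑ c ∈ Finset.range (2 ^ (j + 1)), z ^ c =
      (∑ c ∈ Finset.range (2 ^ j), z ^ c) * (z ^ 2 ^ j + 1) := by
  rw [pow_succ, mul_two, Finset.sum_range_add, mul_add, mul_one, add_comm, Finset.sum_mul]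
  simp only [pow_add, mul_comm]

theorem slack_runs {σ : State} {Q b z : ℕ} (hQ : 1 < Q) (hB : 2 * (Q * Q) < cap B)
    (h19 : σ.reg 19 = Q) (h15 : σ.reg 15 = b) (h56 : σ.reg 56 = z) (hz : z < Q) :
    Runs B L slack σ (fun τ => τ.reg 57 < Q ∧ (τ.reg 57 : ZMod Q) =
      ∑ c ∈ Finset.range (2 ^ b), (z : ZMod Q) ^ c) (b * 11 + 3) := by
  have hQ2 : Q * 2 ≤ Q * Q := Nat.mul_le_mul_left _ hQ
  refine Runs.loop b (fun k τ => k ≤ b → τ.reg 56 < Q ∧ τ.reg 57 < Q ∧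
      (τ.reg 56 : ZMod Q) = (z : ZMod Q) ^ 2 ^ (b - k) ∧ (τ.reg 57 : ZMod Q) =
      ∑ c ∈ Finset.range (2 ^ (b - k)), (z : ZMod Q) ^ c) 9
    rfl rfl ⟨rfl, by omega⟩ (by simpa using h15) ?_ ?_ ?_ ?_ (by simp; omega)
  · intro k τ v h
    simpa using h
  · simp [h56]
    omega
  · rintro k τ hk hτ hfr hI h37
    obtain ⟨h1, h2, h3, h4⟩ := hI hk
    have f19 := (hfr.reg 19 rfl).trans h19
    have b1 : τ.reg 57 * (τ.reg 56 + 1) ≤ Q * Q := Nat.mul_le_mul h2.le h1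
    have b2 : τ.reg 56 * τ.reg 56 ≤ Q * Q := Nat.mul_le_mul h1.le h1.le
    refine Runs.straight ?_ ?_ (by simp [mulmod])
    · simp [mulmod, f19, hτ.one]
      omega
    · simp [mulmod, f19, hτ.one]
      intro _
      refine ⟨Nat.mod_lt _ (by omega), Nat.mod_lt _ (by omega), ?_, ?_⟩
      · rw [h3, show b - k = b - (k + 1) + 1 by omega, pow_succ 2, pow_mul]
        ring
      · rw [h4, h3, show b - k = b - (k + 1) + 1 by omega, sum_pow_double]
  · rintro τ - - h
    obtain ⟨-, h2, -, h4⟩ := h (Nat.zero_le b)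
    exact ⟨h2, h4⟩

/-- The register `57` receives the sum of the first powers of the register `56`, modulo the
register `19`; the number of powers is in the register `21`. -/
def geom : Prog := .seq (blk [.const 57 0, .const 58 1]) (forDown 37 21 (blk [addmod 57 57 58,
  mulmod 58 58 56]))

theorem geom_runs {σ : State} {Q m z : ℕ} (hQ : 1 < Q) (hB : 2 * (Q * Q) < cap B)
    (h19 : σ.reg 19 = Q) (h21 : σ.reg 21 = m) (h56 : σ.reg 56 = z) (hz : z < Q) :
    Runs B L geom σ (fun τ => τ.reg 57 < Q ∧ (τ.reg 57 : ZMod Q) =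
      ∑ c ∈ Finset.range m, (z : ZMod Q) ^ c) (m * 10 + 4) := by
  have hQ2 : Q * 2 ≤ Q * Q := Nat.mul_le_mul_left _ hQ
  refine Runs.loop m (fun k τ => k ≤ m → τ.reg 58 < Q ∧ τ.reg 57 < Q ∧
      (τ.reg 58 : ZMod Q) = (z : ZMod Q) ^ (m - k) ∧ (τ.reg 57 : ZMod Q) =
      ∑ c ∈ Finset.range (m - k), (z : ZMod Q) ^ c) 8
    rfl rfl ⟨⟨rfl, by omega⟩, ⟨rfl, by omega⟩⟩ (by simpa using h21) ?_ ?_ ?_ ?_ (by simp; omega)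
  · intro k τ v h
    simpa using h
  · simp
    omega
  · rintro k τ hk hτ hfr hI h37
    obtain ⟨h1, h2, h3, h4⟩ := hI hk
    have f19 := (hfr.reg 19 rfl).trans h19
    have f56 := (hfr.reg 56 rfl).trans h56
    have b2 : τ.reg 58 * z ≤ Q * Q := Nat.mul_le_mul h1.le hz.le
    refine Runs.straight ?_ ?_ (by simp [mulmod, addmod])
    · simp [mulmod, addmod, f19, f56]
      omega
    · simp [mulmod, addmod, f19, f56]
      intro _
      refine ⟨Nat.mod_lt _ (by omega), Nat.mod_lt _ (by omega), ?_, ?_⟩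
      · rw [h3, show m - k = m - (k + 1) + 1 by omega, pow_succ]
      · rw [h4, h3, show m - k = m - (k + 1) + 1 by omega, Finset.sum_range_succ]
  · rintro τ - - h
    obtain ⟨-, h2, -, h4⟩ := h (Nat.zero_le m)
    exact ⟨h2, h4⟩

/-- The factor of the point `(ξ, η)` in the coefficient extraction for the exponents `ex`
and `ey`. -/
def Par.factor {R : Type*} [CommRing R] (P : Par) (ex ey : ℕ) (ξ η : R) : R :=
  (∑ c ∈ Finset.range (2 ^ P.b), ξ ^ c) * (∑ c ∈ Finset.range (2 ^ P.b), η ^ c) *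
    (∑ k ∈ Finset.range (P.n + 1), (ξ ^ (P.q - P.s) * η) ^ k) * ξ ^ ex * η ^ ey

/-- The register `30` receives the factor of the point in the registers `27` and `29`. -/
def functional : Prog := .seq (blk [add 56 27 2]) (.seq slack (.seq (blk [add 30 57 2, add 56 29 2])
  (.seq slack (.seq (blk [mulmod 30 30 57, add 40 27 2, sub 41 18 13]) (.seq powmod
  (.seq (blk [mulmod 56 42 29]) (.seq geom (.seq (blk [mulmod 30 30 57, add 40 27 2, add 41 24 2])
  (.seq powmod (.seq (blk [mulmod 30 30 42, add 40 29 2, add 41 25 2]) (.seq powmod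
  (blk [mulmod 30 30 42]))))))))))))

/-- The time for the factor of a point. -/
def Par.factorCost (P : Par) (B : ℕ) : ℕ := P.b * 22 + 90 * B + (P.n + 1) * 10 + 100

theorem functional_runs {P : Par} {σ : State} {M : ℕ → ℕ} {ex ey : ℕ} (hP : P.Valid B L)
    (hσ : P.Holds M σ) (h27 : σ.reg 27 < P.Q) (h29 : σ.reg 29 < P.Q) (h24 : σ.reg 24 = ex)
    (h25 : σ.reg 25 = ey) :
    Runs B L functional σ (fun τ => τ.reg 30 < P.Q ∧ (τ.reg 30 : ZMod P.Q) =
      P.factor ex ey (σ.reg 27 : ZMod P.Q) (σ.reg 29 : ZMod P.Q)) (P.factorCost B) := by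
  have hQ := hP.one_lt
  have hQQ := hP.sq_lt
  have hQ2 : P.Q * 2 ≤ P.Q * P.Q := Nat.mul_le_mul_left _ hQ
  have hmod : ∀ a, a % P.Q < P.Q := fun a => Nat.mod_lt _ (by omega)
  refine Runs.of_ok fun hok => ?_
  have hz := hok.zero
  unfold Par.factorCost
  refine Runs.cons' (P.b * 22 + 90 * B + (P.n + 1) * 10 + 99) ?_ (fun ok₁ hf₁ => ?_)
    (by simp; omega)
  · simp [hz]
    omega
  set σ₁ := Prog.run _ σ with hσ₁
  have c₁ := hσ.frame hf₁ rfl rfl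
  have g56 : σ₁.reg 56 = σ.reg 27 := by simp [hσ₁, hz]
  have g27 := hf₁.reg 27 rfl
  have g29 := hf₁.reg 29 rfl
  have g24 := (hf₁.reg 24 rfl).trans h24
  have g25 := (hf₁.reg 25 rfl).trans h25
  clear_value σ₁
  refine Runs.seq' (P.b * 11 + 3) (P.b * 11 + 90 * B + (P.n + 1) * 10 + 96)
    (slack_runs hQ hQQ c₁.r19 c₁.r15 g56 h27) ?_ (by omega)
  rintro σ₂ ok₂ hf₂ ⟨j57, j57'⟩
  have c₂ := c₁.frame hf₂ rfl rfl
  replace g27 := (hf₂.reg 27 rfl).trans g27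
  replace g29 := (hf₂.reg 29 rfl).trans g29
  replace g24 := (hf₂.reg 24 rfl).trans g24
  replace g25 := (hf₂.reg 25 rfl).trans g25
  refine Runs.cons' (P.b * 11 + 90 * B + (P.n + 1) * 10 + 94) ?_ (fun ok₃ hf₃ => ?_)
    (by simp; omega)
  · simp [ok₂.zero, g29]
    omega
  set σ₃ := Prog.run _ σ₂ with hσ₃
  have c₃ := c₂.frame hf₃ rfl rfl
  have k56 : σ₃.reg 56 = σ.reg 29 := by simp [hσ₃, ok₂.zero, g29]
  have k30 : σ₃.reg 30 = σ₂.reg 57 := by simp [hσ₃, ok₂.zero]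
  replace g27 := (hf₃.reg 27 rfl).trans g27
  replace g29 := (hf₃.reg 29 rfl).trans g29
  replace g24 := (hf₃.reg 24 rfl).trans g24
  replace g25 := (hf₃.reg 25 rfl).trans g25
  clear_value σ₃
  refine Runs.seq' (P.b * 11 + 3) (90 * B + (P.n + 1) * 10 + 91)
    (slack_runs hQ hQQ c₃.r19 c₃.r15 k56 h29) ?_ (by omega)
  rintro σ₄ ok₄ hf₄ ⟨l57, l57'⟩
  have c₄ := c₃.frame hf₄ rfl rfl
  replace g27 := (hf₄.reg 27 rfl).trans g27
  replace g29 := (hf₄.reg 29 rfl).trans g29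
  replace g24 := (hf₄.reg 24 rfl).trans g24
  replace g25 := (hf₄.reg 25 rfl).trans g25
  replace k30 := (hf₄.reg 30 rfl).trans k30
  have b1 := Nat.mul_lt_mul'' j57 l57
  refine Runs.cons' (90 * B + (P.n + 1) * 10 + 81) ?_ (fun ok₅ hf₅ => ?_) (by simp [mulmod]; omega)
  · simp [mulmod, ok₄.zero, g27, k30]
    omega
  set σ₅ := Prog.run _ σ₄ with hσ₅
  have c₅ := c₄.frame hf₅ rfl rfl
  have k40 : σ₅.reg 40 = σ.reg 27 := by simp [hσ₅, mulmod, ok₄.zero, g27]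
  have k41 : σ₅.reg 41 = P.q - P.s := by simp [hσ₅, mulmod, c₄.r18, c₄.r13]
  -- The partial product is made opaque, since each further multiplication would nest another
  -- remainder; its value is unfolded only at the end.
  obtain ⟨w₁, hw₁⟩ : ∃ w, w = σ₂.reg 57 * σ₄.reg 57 % P.Q := ⟨_, rfl⟩
  replace k30 : σ₅.reg 30 = w₁ := by simp [hσ₅, mulmod, k30, c₄.r19, hw₁]
  replace g27 := (hf₅.reg 27 rfl).trans g27
  replace g29 := (hf₅.reg 29 rfl).trans g29
  replace g24 := (hf₅.reg 24 rfl).trans g24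
  replace g25 := (hf₅.reg 25 rfl).trans g25
  clear_value σ₅
  refine Runs.seq' (30 * B + 10) (60 * B + (P.n + 1) * 10 + 71)
    (powmod_runs hQ (by omega) c₅.r19 k40 h27 k41) ?_ (by omega)
  rintro σ₆ ok₆ hf₆ ⟨l42, l42'⟩
  have c₆ := c₅.frame hf₆ rfl rfl
  replace g27 := (hf₆.reg 27 rfl).trans g27
  replace g29 := (hf₆.reg 29 rfl).trans g29
  replace g24 := (hf₆.reg 24 rfl).trans g24
  replace g25 := (hf₆.reg 25 rfl).trans g25
  replace k30 := (hf₆.reg 30 rfl).trans k30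
  have b2 := Nat.mul_lt_mul'' l42 h29
  refine Runs.cons' (60 * B + (P.n + 1) * 10 + 67) ?_ (fun ok₇ hf₇ => ?_) (by simp [mulmod]; omega)
  · simp [mulmod, g29]
    omega
  set σ₇ := Prog.run _ σ₆ with hσ₇
  have c₇ := c₆.frame hf₇ rfl rfl
  have m56 : σ₇.reg 56 = σ₆.reg 42 * σ.reg 29 % P.Q := by simp [hσ₇, mulmod, g29, c₆.r19]
  replace k30 := (hf₇.reg 30 rfl).trans k30
  replace g27 := (hf₇.reg 27 rfl).trans g27
  replace g29 := (hf₇.reg 29 rfl).trans g29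
  replace g24 := (hf₇.reg 24 rfl).trans g24
  replace g25 := (hf₇.reg 25 rfl).trans g25
  clear_value σ₇
  refine Runs.seq' ((P.n + 1) * 10 + 4) (60 * B + 63)
    (geom_runs hQ hQQ c₇.r19 c₇.r21 m56 (hmod _)) ?_ (by omega)
  rintro σ₈ ok₈ hf₈ ⟨m57, m57'⟩
  have c₈ := c₇.frame hf₈ rfl rfl
  replace g27 := (hf₈.reg 27 rfl).trans g27
  replace g29 := (hf₈.reg 29 rfl).trans g29
  replace g24 := (hf₈.reg 24 rfl).trans g24
  replace g25 := (hf₈.reg 25 rfl).trans g25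
  replace k30 := (hf₈.reg 30 rfl).trans k30
  have b3 := Nat.mul_lt_mul'' (hw₁.trans_lt (hmod _)) m57
  have b4 := ok₈.reg_lt 24
  refine Runs.cons' (60 * B + 55) ?_ (fun ok₉ hf₉ => ?_) (by simp [mulmod]; omega)
  · simp [mulmod, ok₈.zero, g27, k30]
    omega
  set σ₉ := Prog.run _ σ₈ with hσ₉
  have c₉ := c₈.frame hf₉ rfl rfl
  replace k40 : σ₉.reg 40 = σ.reg 27 := by simp [hσ₉, mulmod, ok₈.zero, g27]
  replace k41 : σ₉.reg 41 = ex := by simp [hσ₉, mulmod, ok₈.zero, g24]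
  obtain ⟨w₂, hw₂⟩ : ∃ w, w = w₁ * σ₈.reg 57 % P.Q := ⟨_, rfl⟩
  replace k30 : σ₉.reg 30 = w₂ := by simp [hσ₉, mulmod, k30, c₈.r19, hw₂]
  replace g29 := (hf₉.reg 29 rfl).trans g29
  replace g25 := (hf₉.reg 25 rfl).trans g25
  clear_value σ₉
  refine Runs.seq' (30 * B + 10) (30 * B + 40)
    (powmod_runs hQ (by omega) c₉.r19 k40 h27 k41) ?_ (by omega)
  rintro τ₁ oj₁ hg₁ ⟨n42, n42'⟩
  have d₁ := c₉.frame hg₁ rfl rfl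
  replace g29 := (hg₁.reg 29 rfl).trans g29
  replace g25 := (hg₁.reg 25 rfl).trans g25
  replace k30 := (hg₁.reg 30 rfl).trans k30
  have b5 := Nat.mul_lt_mul'' (hw₂.trans_lt (hmod _)) n42
  have b6 := oj₁.reg_lt 25
  refine Runs.cons' (30 * B + 30) ?_ (fun oj₂ hg₂ => ?_) (by simp [mulmod]; omega)
  · simp [mulmod, oj₁.zero, g29, k30]
    omega
  set τ₂ := Prog.run _ τ₁ with hτ₂
  have d₂ := d₁.frame hg₂ rfl rfl
  replace k40 : τ₂.reg 40 = σ.reg 29 := by simp [hτ₂, mulmod, oj₁.zero, g29]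
  replace k41 : τ₂.reg 41 = ey := by simp [hτ₂, mulmod, oj₁.zero, g25]
  obtain ⟨w₃, hw₃⟩ : ∃ w, w = w₂ * τ₁.reg 42 % P.Q := ⟨_, rfl⟩
  replace k30 : τ₂.reg 30 = w₃ := by simp [hτ₂, mulmod, k30, d₁.r19, hw₃]
  clear_value τ₂
  refine Runs.seq' (30 * B + 10) 20
    (powmod_runs hQ (by omega) d₂.r19 k40 h29 k41) ?_ (by omega)
  rintro τ₃ oj₃ hg₃ ⟨p42, p42'⟩
  replace k30 := (hg₃.reg 30 rfl).trans k30
  have d₃ := d₂.frame hg₃ rfl rfl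
  have b7 := Nat.mul_lt_mul'' (hw₃.trans_lt (hmod _)) p42
  refine Runs.straight ?_ ?_ (by simp [mulmod])
  · simp [mulmod, k30]
    omega
  · simp only [mulmod, blk, Prog.run, Op.eval, State.setReg_reg, k30, d₃.r19]
    norm_num
    refine ⟨hmod _, ?_⟩
    simp only [hw₃, hw₂, hw₁, ZMod.natCast_mod, Nat.cast_mul] at m57' ⊢
    rw [j57', l57', m57', n42', p42', l42', Par.factor]

/-- The inner loop of the evaluation: add the contribution of the point in the registers `27`
and `28`. -/
def evalStep : Prog := .seq (blk [add 40 28 1, add 41 20 2]) (.seq powmod (.seq (blk [add 29 42 2])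
  (.seq fill (.seq functional (.seq inner (blk [mulmod 50 30 31, addmod 23 23 50]))))))

/-- The contribution of a point. -/
def Par.point {R : Type*} [CommRing R] (P : Par) (M : ℕ → ℕ) (ex ey : ℕ) (ξ η : R) : R :=
  P.factor ex ey ξ η * innerSum P.n P.a P.pu P.pz M P.fl P.inf (P.arc M ξ η)

/-- The time for a point. -/
def Par.pointCost (P : Par) (M : ℕ → ℕ) (B : ℕ) : ℕ :=
  30 * B + 30 + (P.n * P.n * (60 * B + 46) + 3) + P.factorCost B +
    innerCost P.n P.a P.pu P.pz M P.fl P.inf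

theorem innerSum_congr {R : Type*} [CommRing R] {n a pu pz : ℕ} {M fl inf : ℕ → ℕ} (hn : 0 < n)
    {E E' : ℕ → R} (hE : ∀ i < n * n, E i = E' i) :
    innerSum n a pu pz M fl inf E = innerSum n a pu pz M fl inf E' := by
  refine Finset.sum_congr rfl fun Y _ => ?_
  split_ifs
  · exact Finset.sum_congr rfl fun Z _ => signedWalks_congr hn (fun _ _ => rfl) hE
  · rfl

/-- The base is `y + 1` because the residue `0` is not a unit. Its power with exponent `P.e` is the
root of unity that represents the residue class. -/
theorem evalStep_runs {P : Par} {σ : State} {M : ℕ → ℕ} {ex ey y : ℕ} (hP : P.Valid B L)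
    (hσ : P.Holds M σ) (h27 : σ.reg 27 < P.Q) (h24 : σ.reg 24 = ex) (h25 : σ.reg 25 = ey)
    (h28 : σ.reg 28 = y) (hy : y < P.q) (h23 : σ.reg 23 < P.Q) :
    Runs B L evalStep σ (fun τ => τ.reg 23 < P.Q ∧ (τ.reg 23 : ZMod P.Q) = σ.reg 23 +
      P.point M ex ey (σ.reg 27 : ZMod P.Q) (((y + 1 : ℕ) : ZMod P.Q) ^ P.e))
      (P.pointCost M B) := by
  have hQ := hP.one_lt
  have hQQ := hP.sq_lt
  have hq := hP.q_lt
  have hQ2 : P.Q * 2 ≤ P.Q * P.Q := Nat.mul_le_mul_left _ hQ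
  refine Runs.of_ok fun hok => ?_
  have b0 := hok.reg_lt 20
  refine Runs.cons' (30 * B + 28 + (P.n * P.n * (60 * B + 46) + 3) + P.factorCost B +
    innerCost P.n P.a P.pu P.pz M P.fl P.inf) ?_ (fun ok₁ hf₁ => ?_)
    (by simp [Par.pointCost]; omega)
  · simp [hok.one, hok.zero, h28]
    omega
  set σ₁ := Prog.run _ σ with hσ₁
  have c₁ := hσ.frame hf₁ rfl rfl
  have g40 : σ₁.reg 40 = y + 1 := by simp [hσ₁, hok.one, h28]
  have g41 : σ₁.reg 41 = P.e := by simp [hσ₁, hok.zero, hσ.r20]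
  clear_value σ₁
  refine Runs.seq' (30 * B + 10) (18 + (P.n * P.n * (60 * B + 46) + 3) + P.factorCost B +
    innerCost P.n P.a P.pu P.pz M P.fl P.inf)
    (powmod_runs hQ (by omega) c₁.r19 g40 (by omega) g41) ?_ (by omega)
  rintro σ₂ ok₂ hf₂ ⟨g42, g42'⟩
  have c₂ := c₁.frame hf₂ rfl rfl
  refine Runs.cons' (17 + (P.n * P.n * (60 * B + 46) + 3) + P.factorCost B +
    innerCost P.n P.a P.pu P.pz M P.fl P.inf) ?_ (fun ok₃ hf₃ => ?_)
    (by simp; omega)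
  · simp [ok₂.zero]
    omega
  set σ₃ := Prog.run _ σ₂ with hσ₃
  have c₃ := c₂.frame hf₃ rfl rfl
  have g29 : σ₃.reg 29 = σ₂.reg 42 := by simp [hσ₃, ok₂.zero]
  clear_value σ₃
  have hf : Frame evalStep σ σ₃ := hf₁.left.trans (hf₂.left.trans hf₃.left.right).right
  have g27 := hf.reg 27 rfl
  refine Runs.seq' (P.n * P.n * (60 * B + 46) + 3) (17 + P.factorCost B +
    innerCost P.n P.a P.pu P.pz M P.fl P.inf)
    (fill_runs hP c₃ (by omega) (by omega)) ?_ (by omega)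
  intro σ₄ ok₄ hf₄ h6
  have c₄ := c₃.frame hf₄ rfl rfl
  have k27 := (hf₄.reg 27 rfl).trans g27
  have k29 := (hf₄.reg 29 rfl).trans g29
  refine Runs.seq' (P.factorCost B) (17 + innerCost P.n P.a P.pu P.pz M P.fl P.inf)
    (functional_runs hP c₄ (by omega) (by omega)
      ((hf₄.reg 24 rfl).trans ((hf.reg 24 rfl).trans h24))
      ((hf₄.reg 25 rfl).trans ((hf.reg 25 rfl).trans h25))) ?_ (by omega)
  rintro σ₅ ok₅ hf₅ ⟨h30, h30'⟩
  have c₅ := c₄.frame hf₅ rfl rfl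
  have k6 := hf₅.arr 6 rfl
  refine Runs.seq' (innerCost P.n P.a P.pu P.pz M P.fl P.inf) 10
    (inner_runs (E := fun i => σ₅.arr (6, i)) hP.n_pos hQ hQQ hP.nn_lt
      ((Nat.le_mul_of_pos_left _ hP.n_pos).trans hP.nn_le)
      ⟨c₅.r0, c₅.r9, c₅.r11, c₅.r12, c₅.r19, c₅.a0, c₅.a4, c₅.a5, fun _ _ => rfl⟩
      hP.fl_le hP.inf_le fun i hi => (k6 i).trans_lt (h6 i hi).1) ?_ (by omega)
  rintro σ₆ ok₆ hf₆ ⟨h31, h31'⟩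
  have c₆ := c₅.frame hf₆ rfl rfl
  have k30 := hf₆.reg 30 rfl
  have k23 : σ₆.reg 23 = σ.reg 23 := (hf₆.reg 23 rfl).trans ((hf₅.reg 23 rfl).trans
    ((hf₄.reg 23 rfl).trans ((hf₃.reg 23 rfl).trans ((hf₂.reg 23 rfl).trans (hf₁.reg 23 rfl)))))
  have b1 := Nat.mul_lt_mul'' h30 h31
  have b2 : σ₅.reg 30 * σ₆.reg 31 % P.Q < P.Q := Nat.mod_lt _ (by omega)
  refine Runs.straight ?_ ?_ (by simp [mulmod, addmod])
  · simp [mulmod, addmod, k30, k23, c₆.r19]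
    omega
  · simp [mulmod, addmod, k30, k23, c₆.r19]
    refine ⟨Nat.mod_lt _ (by omega), ?_⟩
    rw [h30', h31', k27, k29, g42', Par.point]
    refine (congrArg₂ (· * ·) ?_ (innerSum_congr hP.n_pos fun i hi => ?_))
    · push_cast
      rfl
    · rw [k6, (h6 i hi).2, g27, g29, g42']
      push_cast
      rfl

/-- The evaluation for one residue `ξ`, which is given by the register `26`. -/
def evalRow : Prog := .seq (blk [add 40 26 1, add 41 20 2]) (.seq powmod (.seq (blk [add 27 42 2])
  (forDown 28 18 evalStep)))

theorem evalRow_runs {P : Par} {σ : State} {M : ℕ → ℕ} {ex ey x : ℕ} (hP : P.Valid B L)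
    (hσ : P.Holds M σ) (h24 : σ.reg 24 = ex) (h25 : σ.reg 25 = ey)
    (h26 : σ.reg 26 = x) (hx : x < P.q) (h23 : σ.reg 23 < P.Q) :
    Runs B L evalRow σ (fun τ => τ.reg 23 < P.Q ∧ (τ.reg 23 : ZMod P.Q) = σ.reg 23 +
      ∑ y ∈ Finset.range P.q, P.point M ex ey (((x + 1 : ℕ) : ZMod P.Q) ^ P.e)
        (((y + 1 : ℕ) : ZMod P.Q) ^ P.e))
      (P.q * (P.pointCost M B + 2) + 30 * B + 15) := by
  have hQ := hP.one_lt
  have hQQ := hP.sq_lt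
  have hq := hP.q_lt
  have hQ2 : P.Q * 2 ≤ P.Q * P.Q := Nat.mul_le_mul_left _ hQ
  refine Runs.of_ok fun hok => ?_
  have b0 := hok.reg_lt 20
  refine Runs.cons' (P.q * (P.pointCost M B + 2) + 30 * B + 13) ?_ (fun ok₁ hf₁ => ?_)
    (by simp; omega)
  · simp [hok.one, hok.zero, h26]
    omega
  set σ₁ := Prog.run _ σ with hσ₁
  have c₁ := hσ.frame hf₁ rfl rfl
  have g40 : σ₁.reg 40 = x + 1 := by simp [hσ₁, hok.one, h26]
  have g41 : σ₁.reg 41 = P.e := by simp [hσ₁, hok.zero, hσ.r20]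
  clear_value σ₁
  refine Runs.seq' (30 * B + 10) (P.q * (P.pointCost M B + 2) + 3)
    (powmod_runs hQ (by omega) c₁.r19 g40 (by omega) g41) ?_ (by omega)
  rintro σ₂ ok₂ hf₂ ⟨g42, g42'⟩
  have c₂ := c₁.frame hf₂ rfl rfl
  have e27 : (Prog.run (blk [add 27 42 2]) σ₂).reg 27 = σ₂.reg 42 := by simp [ok₂.zero]
  have k23 : σ₂.reg 23 = σ.reg 23 := (hf₂.reg 23 rfl).trans (hf₁.reg 23 rfl)
  refine Runs.loop P.q (fun k τ => τ.reg 23 < P.Q ∧ τ.reg 27 = σ₂.reg 42 ∧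
      (τ.reg 23 : ZMod P.Q) = σ.reg 23 +
      ∑ y ∈ Finset.Ico k P.q, P.point M ex ey (((x + 1 : ℕ) : ZMod P.Q) ^ P.e)
        (((y + 1 : ℕ) : ZMod P.Q) ^ P.e)) (P.pointCost M B) rfl rfl ?_ ?_ ?_ ?_ ?_ ?_ ?_
  · simp [ok₂.zero]
    omega
  · simpa using c₂.r18
  · intro k τ v h
    simpa using h
  · intro _
    simp [ok₂.zero, k23, h23]
  · rintro k τ hk hτ hfr ⟨h1, h2, h3⟩ h28
    refine (evalStep_runs hP (c₂.frame hfr rfl rfl) (by omega)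
      ((hfr.reg 24 rfl).trans ((hf₂.reg 24 rfl).trans ((hf₁.reg 24 rfl).trans h24)))
      ((hfr.reg 25 rfl).trans ((hf₂.reg 25 rfl).trans ((hf₁.reg 25 rfl).trans h25)))
      h28 hk h1).mono ?_ le_rfl
    rintro υ - hfu ⟨h4, h5⟩
    refine ⟨h4, (hfu.reg 27 rfl).trans h2, ?_⟩
    rw [h5, h3, h2, g42', Finset.sum_eq_sum_Ico_succ_bot hk]
    ring
  · rintro τ - - ⟨h1, -, h3⟩
    exact ⟨h1, by simpa using h3⟩
  · simp
    omega

/-! ### The oracle -/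

/-- The oracle: the register `23` is nonzero if there is a tour whose weight is at most the content
of the register `22`. -/
def oracle : Prog := .seq (blk [div 50 22 13, mul 51 50 13, sub 51 22 51, sub 25 18 50,
  sub 24 18 51, sub 52 18 16, mul 52 52 9, add 24 24 52, .const 23 0]) (forDown 26 18 evalRow)

/-- The value that the oracle computes for the threshold `T`. -/
def Par.value {R : Type*} [CommRing R] (P : Par) (M : ℕ → ℕ) (T : ℕ) : R :=
  ∑ x ∈ Finset.range P.q, ∑ y ∈ Finset.range P.q,
    P.point M (P.q - T % P.s + (P.q - P.lam) * P.a) (P.q - T / P.s)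
      (((x + 1 : ℕ) : R) ^ P.e) (((y + 1 : ℕ) : R) ^ P.e)

/-- The time of the oracle. -/
def Par.oracleCost (P : Par) (M : ℕ → ℕ) (B : ℕ) : ℕ :=
  P.q * (P.q * (P.pointCost M B + 2) + 30 * B + 17) + 11

/-- For sound data the points are `q`-th roots of unity, so an exponent `q - x` acts as `-x`. The
two exponents thus cancel the two digits of `T` and the additional weight `lam * a` of a walk with
`a` visits to hubs. -/
theorem oracle_runs {P : Par} {σ : State} {M : ℕ → ℕ} {T : ℕ} (hP : P.Valid B L)
    (hσ : P.Holds M σ) (h22 : σ.reg 22 = T) :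
    Runs B L oracle σ (fun τ => τ.reg 23 < P.Q ∧ (τ.reg 23 : ZMod P.Q) = P.value M T)
      (P.oracleCost M B) := by
  have hQ := hP.one_lt
  have hQQ := hP.sq_lt
  have hq := hP.q_lt
  have hQ2 : P.Q * 2 ≤ P.Q * P.Q := Nat.mul_le_mul_left _ hQ
  refine Runs.of_ok fun hok => ?_
  have hT := hok.reg_lt 22
  refine Runs.loop P.q (fun k τ => τ.reg 23 < P.Q ∧
      τ.reg 24 = P.q - T % P.s + (P.q - P.lam) * P.a ∧ τ.reg 25 = P.q - T / P.s ∧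
      (τ.reg 23 : ZMod P.Q) =
      ∑ x ∈ Finset.Ico k P.q, ∑ y ∈ Finset.range P.q,
        P.point M (P.q - T % P.s + (P.q - P.lam) * P.a) (P.q - T / P.s)
        (((x + 1 : ℕ) : ZMod P.Q) ^ P.e) (((y + 1 : ℕ) : ZMod P.Q) ^ P.e))
      (P.q * (P.pointCost M B + 2) + 30 * B + 15) rfl rfl ?_ ?_ ?_ ?_ ?_ ?_ ?_
  · have h1 := Nat.div_mul_le_self T P.s
    have h2 : (P.q - P.lam) * P.a ≤ P.q * P.a := Nat.mul_le_mul_right _ (Nat.sub_le _ _)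
    have h3 := hP.qa_lt
    simp [h22, hσ.r13, hσ.r18, hσ.r16, hσ.r9]
    omega
  · simpa using hσ.r18
  · intro k τ v h
    simpa using h
  · intro _
    simp [h22, hσ.r13, hσ.r18, hσ.r16, hσ.r9]
    omega
  · rintro k τ hk hτ hfr ⟨h1, h2, h3, h4⟩ h26
    refine (evalRow_runs hP (hσ.frame hfr rfl rfl) h2 h3 h26 hk h1).mono ?_ le_rfl
    rintro υ - hfu ⟨h5, h6⟩
    refine ⟨h5, (hfu.reg 24 rfl).trans h2, (hfu.reg 25 rfl).trans h3, ?_⟩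
    rw [h6, h4, Finset.sum_eq_sum_Ico_succ_bot hk]
    ring
  · rintro τ - - ⟨h1, -, -, h4⟩
    exact ⟨h1, by simpa [Par.value] using h4⟩
  · simp [Par.oracleCost]
    ring_nf
    omega

/-! ### Walk vectors as sums over sequences of vertices -/

/-- The total weight of the walks of `j` steps from `0` as a sum over sequences of vertices. -/
theorem wv_eq_sum {R : Type*} [CommRing R] {m : ℕ} (X E : ℕ → R) (j : ℕ) (v : Fin (m + 1)) :
    wv (m + 1) X E j v = ∑ t : Fin (j + 1) → Fin (m + 1), if t (Fin.last j) = v then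
      if t 0 = 0 then ∏ i : Fin j, X (t i.succ) * E (t i.castSucc * (m + 1) + t i.succ) else 0
      else 0 := by
  induction j generalizing v with
  | zero =>
    rw [wv, ← (Equiv.funUnique (Fin 1) (Fin (m + 1))).symm.sum_comp]
    simp
  | succ j ih =>
    rw [wv, Finset.sum_range, ← (Fin.snocEquiv fun _ : Fin (j + 2) => Fin (m + 1)).sum_comp,
      Fintype.sum_prod_type]
    simp only [ih]
    symm
    rw [Finset.sum_eq_single v]
    · symm
      simp only [Finset.sum_mul, Finset.mul_sum]
      rw [Finset.sum_comm]
      refine Finset.sum_congr rfl fun t _ => ?_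
      rw [Finset.sum_eq_single (t (Fin.last j))]
      · simp only [if_true, Fin.snocEquiv_apply, Fin.snoc_last]
        rw [show (0 : Fin (j + 2)) = (0 : Fin (j + 1)).castSucc from rfl, Fin.snoc_castSucc]
        split_ifs with h
        · rw [Fin.prod_univ_castSucc]
          simp only [← Fin.castSucc_succ, Fin.succ_last, Fin.snoc_castSucc, Fin.snoc_last]
          ring
        · simp
      · intro u _ hu
        rw [if_neg (Ne.symm hu)]
        simp
      · simp
    · intro u _ hu
      refine Finset.sum_eq_zero fun t _ => ?_
      simp [hu]
    · simp

/-- The closed walks of `n` steps from `0` as a sum over cyclic sequences of vertices. -/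
theorem wv_closed {R : Type*} [CommRing R] {m : ℕ} (X E : ℕ → R) :
    wv (m + 1) X E (m + 1) 0 = ∑ t : Fin (m + 1) → Fin (m + 1), if t 0 = 0 then
      (∏ i, X (t i)) * ∏ i, E (t i * (m + 1) + t (finRotate _ i)) else 0 := by
  rw [wv, Finset.sum_range]
  simp only [wv_eq_sum, Finset.sum_mul]
  rw [Finset.sum_comm, Finset.mul_sum]
  refine Finset.sum_congr rfl fun t _ => ?_
  rw [Finset.sum_eq_single (t (Fin.last m))]
  · rw [if_pos rfl]
    split_ifs with h
    -- The last step back to `0` supplies the factor `X (t 0)`; after a rotation every arc is paired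
    -- with the weight of its head.
    · rw [← Equiv.prod_comp (finRotate (m + 1)) fun i => X (t i), ← Finset.prod_mul_distrib,
        Fin.prod_univ_castSucc]
      simp only [finRotate_apply, Fin.last_add_one, Fin.coeSucc_eq_succ, h, Fin.val_zero,
        add_zero]
      ring
    · simp
  · intro u _ hu
    rw [if_neg (Ne.symm hu)]
    simp
  · simp

/-! ### The restricted inclusion-exclusion identity -/

/-- The indicator function of a finite set. -/
def ind (S : Finset ℕ) (v : ℕ) : ℕ := if v ∈ S then 1 else 0

/-- The flagged indices, read downwards, show the digits of `Y` from the lowest on, so equal spreads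
have equal digits up to the number of flags. The induction adds one index at a time from above. -/
theorem spread_mod_eq {n : ℕ} {fl : ℕ → ℕ} (hfl : ∀ v, fl v ≤ 1) {Y Y' : ℕ}
    (h : ∀ v < n, spread n fl Y v = spread n fl Y' v) :
    Y % 2 ^ ∑ v ∈ Finset.range n, fl v = Y' % 2 ^ ∑ v ∈ Finset.range n, fl v := by
  have key : ∀ j ≤ n, Y % 2 ^ ∑ v ∈ Finset.Ico (n - j) n, fl v =
      Y' % 2 ^ ∑ v ∈ Finset.Ico (n - j) n, fl v := by
    intro j
    induction j with
    | zero => simp [Nat.mod_one]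
    | succ j ih =>
      intro hj
      have ih := ih (by omega)
      have hlt : n - (j + 1) < n := by omega
      have e : n - (j + 1) + 1 = n - j := by omega
      have hv := h _ hlt
      rw [Finset.sum_eq_sum_Ico_succ_bot hlt, e]
      unfold spread rk at hv
      rw [e] at hv
      rcases Nat.le_one_iff_eq_zero_or_eq_one.1 (hfl (n - (j + 1))) with h0 | h0
      · simpa [h0] using ih
      · rw [h0] at hv ⊢
        rw [add_comm, Nat.mod_pow_succ, Nat.mod_pow_succ, ih]
        simpa using hv
  simpa using key n le_rfl

/-- The coding is injective by `spread_mod_eq`, on the flagged and the unflagged indices separately.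
Since there are 2^n pairs of codes, counting gives surjectivity onto the subsets. -/
theorem sum_code {R : Type*} [AddCommMonoid R] {n : ℕ} {fl : ℕ → ℕ} (hfl : ∀ v, fl v ≤ 1)
    (g : Finset ℕ → R) :
    ∑ Y ∈ Finset.range (2 ^ ∑ v ∈ Finset.range n, fl v),
      ∑ Z ∈ Finset.range (2 ^ ∑ v ∈ Finset.range n, (1 - fl v)),
        g ((Finset.range n).filter fun v => code n fl Y Z v = 1) =
      ∑ S ∈ (Finset.range n).powerset, g S := by
  rw [← Finset.sum_product']
  set D := Finset.range (2 ^ ∑ v ∈ Finset.range n, fl v) ×ˢ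
    Finset.range (2 ^ ∑ v ∈ Finset.range n, (1 - fl v)) with hD
  set F : ℕ × ℕ → Finset ℕ := fun p => (Finset.range n).filter fun v => code n fl p.1 p.2 v = 1
    with hF
  have hinj : Set.InjOn F D := by
    rintro ⟨Y, Z⟩ hp ⟨Y', Z'⟩ hp' he
    simp only [hD, Finset.coe_product, Set.mem_prod, Finset.coe_range, Set.mem_Iio] at hp hp'
    have hcode : ∀ v < n, code n fl Y Z v = code n fl Y' Z' v := by
      intro v hv
      have h1 := code_le_one (n := n) (hfl v) Y Z
      have h2 := code_le_one (n := n) (hfl v) Y' Z'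
      have := Finset.ext_iff.1 he v
      simp only [hF, Finset.mem_filter, Finset.mem_range, hv, true_and] at this
      omega
    have hY := spread_mod_eq (n := n) (Y := Y) (Y' := Y') hfl fun v hv => by
      have := hcode v hv
      rcases Nat.le_one_iff_eq_zero_or_eq_one.1 (hfl v) with h | h
      · simp [spread, h]
      · simpa [code, spread, h] using this
    have hZ := spread_mod_eq (n := n) (fl := fun v => 1 - fl v) (Y := Z) (Y' := Z')
      (fun v => Nat.sub_le _ _) fun v hv => by
      have := hcode v hv
      rcases Nat.le_one_iff_eq_zero_or_eq_one.1 (hfl v) with h | h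
      · simpa [code, spread, h] using this
      · simp [spread, h]
    rw [Nat.mod_eq_of_lt hp.1, Nat.mod_eq_of_lt hp'.1] at hY
    rw [Nat.mod_eq_of_lt hp.2, Nat.mod_eq_of_lt hp'.2] at hZ
    rw [hY, hZ]
  have himg : D.image F = (Finset.range n).powerset := by
    refine Finset.eq_of_subset_of_card_le ?_ ?_
    · intro S hS
      obtain ⟨p, -, rfl⟩ := Finset.mem_image.1 hS
      exact Finset.mem_powerset.2 (Finset.filter_subset _ _)
    · rw [Finset.card_image_of_injOn hinj, Finset.card_powerset, Finset.card_range, hD,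
        Finset.card_product, Finset.card_range, Finset.card_range, ← pow_add,
        ← Finset.sum_add_distrib, Finset.sum_congr rfl fun v _ => Nat.add_sub_of_le (hfl v)]
      simp
  rw [← himg, Finset.sum_image hinj]

theorem ind_filter_code {n : ℕ} {fl : ℕ → ℕ} (hfl : ∀ v, fl v ≤ 1) (Y Z : ℕ) {v : ℕ} (hv : v < n) :
    ind ((Finset.range n).filter fun v => code n fl Y Z v = 1) v = code n fl Y Z v := by
  have := code_le_one (n := n) (hfl v) Y Z
  simp only [ind, Finset.mem_filter, Finset.mem_range, hv, true_and]
  split_ifs <;> omega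

theorem starved_congr {n : ℕ} {inf M x x' : ℕ → ℕ} (h : ∀ v < n, x v = x' v) :
    starved n inf M x = starved n inf M x' := by
  refine Finset.sum_congr rfl fun r _ => ?_
  rw [Finset.sum_congr rfl fun v hv => by rw [h v (Finset.mem_range.1 hv)]]

/-- The test sees only the trace of `S` on the flagged indices, that is, only the code `Y`; it may
therefore be moved inside the sum over `Z`. -/
theorem innerSum_eq {R : Type*} [CommRing R] {n a : ℕ} {M fl inf : ℕ → ℕ} (hn : 0 < n)
    (hfl : ∀ v, fl v ≤ 1) (E : ℕ → R) :
    innerSum n a (2 ^ ∑ v ∈ Finset.range n, fl v) (2 ^ ∑ v ∈ Finset.range n, (1 - fl v)) M fl inf E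
      = ∑ S ∈ (Finset.range n).powerset, if starved n inf M (fun v => fl v * ind S v) ≤ a then
        signedWalks n E (ind S) else 0 := by
  rw [← sum_code hfl, innerSum]
  refine Finset.sum_congr rfl fun Y _ => ?_
  have h0 : ∀ (p : Prop) [Decidable p] (s : Finset ℕ) (f : ℕ → R),
      (if p then ∑ i ∈ s, f i else 0) = ∑ i ∈ s, if p then f i else 0 := by
    intro p _ s f
    split_ifs <;> simp
  rw [h0]
  refine Finset.sum_congr rfl fun Z _ => ?_
  have h1 : starved n inf M (fun v => fl v * ind ((Finset.range n).filter
      fun v => code n fl Y Z v = 1) v) = starved n inf M (spread n fl Y) := by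
    refine starved_congr fun v hv => ?_
    rw [ind_filter_code hfl Y Z hv]
    rcases Nat.le_one_iff_eq_zero_or_eq_one.1 (hfl v) with h | h <;> simp [code, spread, h]
  rw [h1, signedWalks_congr hn (fun v hv => (ind_filter_code hfl Y Z hv).symm) fun _ _ => rfl]
  rfl

/-- The sign of a set of vertices. -/
def sgn (n : ℕ) (S : Finset ℕ) : ℤ := ∏ v ∈ Finset.range n, (2 * (ind S v : ℤ) - 1)

/-- Insert or remove an element. -/
def toggle (r : ℕ) (S : Finset ℕ) : Finset ℕ := symmDiff S {r}

theorem mem_toggle {r v : ℕ} {S : Finset ℕ} (h : v ≠ r) : v ∈ toggle r S ↔ v ∈ S := by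
  simp [toggle, Finset.mem_symmDiff, h]

theorem mem_toggle_self {r : ℕ} {S : Finset ℕ} : r ∈ toggle r S ↔ r ∉ S := by
  simp [toggle, Finset.mem_symmDiff]

theorem sgn_toggle {n r : ℕ} (hr : r < n) (S : Finset ℕ) : sgn n (toggle r S) = - sgn n S := by
  have hr := Finset.mem_range.2 hr
  rw [sgn, sgn, ← Finset.mul_prod_erase _ _ hr, ← Finset.mul_prod_erase _ _ hr, ← neg_mul]
  congr 1
  · by_cases h : r ∈ S <;> simp [ind, mem_toggle_self, h]
  · refine Finset.prod_congr rfl fun v hv => ?_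
    simp [ind, mem_toggle (Finset.ne_of_mem_erase hv)]

/-- Toggling `r` is an involution without fixed points that respects `p` and reverses the sign. -/
theorem sum_sgn_eq_zero {n r : ℕ} (hr : r < n) (p : Finset ℕ → Prop) [DecidablePred p]
    (hp : ∀ S, p (toggle r S) ↔ p S) :
    ∑ S ∈ (Finset.range n).powerset, (if p S then sgn n S else 0) = 0 := by
  refine Finset.sum_involution (fun S _ => toggle r S) ?_ ?_ ?_ ?_
  · intro S _
    simp only [hp, sgn_toggle hr]
    split_ifs <;> simp
  · intro S _ _ h
    have := mem_toggle_self (r := r) (S := S)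
    rw [h] at this
    tauto
  · intro S hS
    rw [Finset.mem_powerset] at hS ⊢
    intro v hv
    by_cases h : v = r
    · exact h ▸ Finset.mem_range.2 hr
    · exact hS ((mem_toggle h).1 hv)
  · intro S _
    ext v
    by_cases h : v = r
    · subst h
      simp [mem_toggle_self]
    · simp [mem_toggle h]

/-- A closed walk that visits the hubs exactly as often as there are hubs is counted by the
restricted inclusion-exclusion sum just in case it is a Hamiltonian cycle. -/
theorem sum_good_sgn {m a : ℕ} {M fl inf hub : ℕ → ℕ}
    (hinf : ∀ v, inf v ≤ 1) (hdisj : ∀ v < m + 1, inf v = 1 → fl v = 0)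
    (hnb : ∀ r < m + 1, ∀ v < m + 1, inf r = 1 → M (r * (m + 1) + v) ≠ 0 → fl v = 1 ∨ hub v = 1)
    (t : Fin (m + 1) → Fin (m + 1))
    (ht : ∀ i, M (t i * (m + 1) + t (finRotate _ i)) ≠ 0) (hvis : ∑ i, hub (t i) = a) :
    ∑ S ∈ (Finset.range (m + 1)).powerset,
      (if (starved (m + 1) inf M fun v => fl v * ind S v) ≤ a ∧ ∀ i, (t i : ℕ) ∈ S
        then sgn (m + 1) S else 0) = if Function.Surjective t then 1 else 0 := by
  -- The successor of a visited infant on the walk lies in `S`. By `hnb` it is flagged, and then the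
  -- infant is not starved, or it is a hub. So starved infants are at most as many as visits to
  -- hubs, which are `a`.
  have hgood : (∀ r : Fin (m + 1), inf r = 1 → ∃ i, t i = r) → ∀ S : Finset ℕ,
      (∀ i, (t i : ℕ) ∈ S) → (starved (m + 1) inf M fun v => fl v * ind S v) ≤ a := by
    intro hr S hS
    rw [starved, Finset.sum_range, ← hvis,
      ← Equiv.sum_comp (finRotate (m + 1)) fun i => hub (t i)]
    set I := Finset.univ.filter fun i : Fin (m + 1) => hub (t (finRotate _ i)) = 1 with hI
    calc _ ≤ ∑ r : Fin (m + 1), if r ∈ I.image t then 1 else 0 := by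
          refine Finset.sum_le_sum fun r _ => ?_
          rcases Nat.le_one_iff_eq_zero_or_eq_one.1 (hinf r) with h | h
          · simp [h]
          · obtain ⟨i, hi⟩ := hr r h
            set v := t (finRotate _ i) with hv
            have hM := ht i
            rw [hi, ← hv] at hM
            rcases hnb r r.2 v v.2 h hM with h1 | h1
            · have : 1 ≤ ∑ v ∈ Finset.range (m + 1), nz (M (r * (m + 1) + v)) * (fl v * ind S v) := by
                refine le_trans ?_ (Finset.single_le_sum (fun _ _ => Nat.zero_le _)
                  (Finset.mem_range.2 v.2))
                have : (v : ℕ) ∈ S := hS _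
                simp [h1, ind, this, nz]
                omega
              simp [h]
              omega
            · have : r ∈ I.image t :=
                Finset.mem_image.2 ⟨i, Finset.mem_filter.2 ⟨Finset.mem_univ _, h1⟩, hi⟩
              simp [h, this]
      _ = (I.image t).card := by
          rw [Finset.sum_ite_mem, Finset.univ_inter, Finset.card_eq_sum_ones]
      _ ≤ I.card := Finset.card_image_le
      _ = ∑ i ∈ I, hub (t (finRotate _ i)) := by
          rw [Finset.card_eq_sum_ones]
          exact Finset.sum_congr rfl fun i hi => (Finset.mem_filter.1 hi).2.symm
      _ ≤ _ := Finset.sum_le_sum_of_subset (Finset.filter_subset _ _)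
  by_cases hs : Function.Surjective t
  -- Only the full vertex set contains a surjective walk, and its sign is `1`.
  · rw [if_pos hs, Finset.sum_eq_single (Finset.range (m + 1))]
    · have h1 : ∀ i, (t i : ℕ) ∈ Finset.range (m + 1) := fun i => Finset.mem_range.2 (t i).2
      rw [if_pos ⟨hgood (fun r _ => hs r) _ h1, h1⟩]
      exact Finset.prod_eq_one fun v hv => by simp [ind, Finset.mem_range.1 hv]
    · intro S hS hne
      refine if_neg fun h => hne (Finset.Subset.antisymm (Finset.mem_powerset.1 hS) fun v hv => ?_)
      obtain ⟨i, hi⟩ := hs ⟨v, Finset.mem_range.1 hv⟩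
      simpa [hi] using h.2 i
    · simp
  · rw [if_neg hs]
    have hmem : ∀ r : Fin (m + 1), (∀ i, t i ≠ r) → ∀ S, (∀ i, (t i : ℕ) ∈ toggle r S) ↔
        ∀ i, (t i : ℕ) ∈ S :=
      fun r hr S => forall_congr' fun i => mem_toggle fun h => hr i (Fin.ext h)
    by_cases hr : ∀ r : Fin (m + 1), inf r = 1 → ∃ i, t i = r
    -- All infants are visited, so the test is implied by containing the walk, and any unvisited
    -- vertex may be toggled.
    · simp only [Function.Surjective, not_forall, not_exists] at hs
      obtain ⟨r, hr'⟩ := hs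
      refine sum_sgn_eq_zero r.2 _ fun S => ?_
      rw [and_iff_right_of_imp (hgood hr _), and_iff_right_of_imp (hgood hr _), hmem r hr']
    -- An infant is missed. It is not flagged, so toggling it leaves the test unchanged, even though
    -- the test is not automatic here.
    · push Not at hr
      obtain ⟨r, hr1, hr'⟩ := hr
      refine sum_sgn_eq_zero r.2 _ fun S => ?_
      rw [hmem r hr', starved_congr fun v hv => ?_]
      by_cases h : v = r
      · subst h
        simp [hdisj _ r.2 hr1]
      · simp [ind, mem_toggle h]

/-! ### Roots of unity modulo a prime power -/

/-- Representatives of the residues modulo `p` as roots of unity modulo a power of `p`. -/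
theorem teichmuller_eq {p N : ℕ} {a b : ℕ} (h : a ≡ b [MOD p]) :
    (a : ZMod (p ^ (N + 1))) ^ p ^ N = (b : ZMod (p ^ (N + 1))) ^ p ^ N := by
  have h1 : ((p : ℕ) : ℤ) ∣ (a : ℤ) - b := (Nat.modEq_iff_dvd.1 h.symm)
  have h2 := dvd_sub_pow_of_dvd_sub h1 N
  have h3 := (ZMod.intCast_zmod_eq_zero_iff_dvd ((a : ℤ) ^ p ^ N - (b : ℤ) ^ p ^ N)
    (p ^ (N + 1))).2 (by exact_mod_cast h2)
  push_cast at h3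
  exact sub_eq_zero.1 h3

/-- The elements `x ^ p ^ N` form a copy of the cyclic group of units modulo `p`. If `g` generates
it and `p - 1` does not divide `j`, multiplication by `τ g ^ j` permutes the summands, and `τ g ^ j
- 1` is a unit because it is already nonzero modulo `p`; hence the sum vanishes. Invertibility, and
not just being nonzero, is needed since the ring is no domain. -/
theorem sum_teichmuller {p : ℕ} [hp : Fact p.Prime] (N j : ℕ) :
    ∑ x ∈ Finset.range (p - 1), ((((x + 1 : ℕ) : ZMod (p ^ (N + 1))) ^ p ^ N) ^ j) =
      if p - 1 ∣ j then ((p - 1 : ℕ) : ZMod (p ^ (N + 1))) else 0 := by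
  have hp1 := hp.out.one_lt
  set R := ZMod (p ^ (N + 1))
  have hunits : ∑ x ∈ Finset.range (p - 1), ((((x + 1 : ℕ) : R) ^ p ^ N) ^ j) =
      ∑ g : (ZMod p)ˣ, (((((g : ZMod p).val : ℕ) : R) ^ p ^ N) ^ j) := by
    symm
    refine Finset.sum_bij (fun g _ => (g : ZMod p).val - 1) ?_ ?_ ?_ ?_
    · intro g _
      have h1 := ZMod.val_lt (g : ZMod p)
      have h2 : (g : ZMod p).val ≠ 0 := by simp
      simp only [Finset.mem_range]
      omega
    · intro g _ g' _ h
      have h2 : (g : ZMod p).val ≠ 0 := by simp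
      have h3 : (g' : ZMod p).val ≠ 0 := by simp
      exact Units.ext (ZMod.val_injective p (by omega))
    · intro x hx
      rw [Finset.mem_range] at hx
      have h1 : ((x + 1 : ℕ) : ZMod p) ≠ 0 := by
        rw [Ne, ZMod.natCast_eq_zero_iff]
        exact fun h => absurd (Nat.le_of_dvd (by omega) h) (by omega)
      refine ⟨Units.mk0 _ h1, Finset.mem_univ _, ?_⟩
      rw [Units.val_mk0, ZMod.val_natCast, Nat.mod_eq_of_lt (by omega)]
      omega
    · intro g _
      have h2 : (g : ZMod p).val ≠ 0 := by simp
      rw [Nat.sub_add_cancel (by omega)]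
  rw [hunits]
  set τ : (ZMod p)ˣ → R := fun g => (((g : ZMod p).val : ℕ) : R) ^ p ^ N with hτ
  have hmul : ∀ g h, τ (g * h) = τ g * τ h := by
    intro g h
    simp only [hτ]
    rw [← mul_pow, ← Nat.cast_mul]
    refine teichmuller_eq ?_
    rw [Units.val_mul, ZMod.val_mul]
    exact Nat.mod_modEq _ _
  have hcast : ∀ g, ZMod.castHom (dvd_pow_self p (Nat.succ_ne_zero N)) (ZMod p) (τ g) = g := by
    intro g
    simp only [hτ, map_pow, map_natCast, ZMod.natCast_zmod_val, ZMod.pow_card_pow]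
  have hone : ∀ g, τ g ^ (p - 1) = 1 := by
    intro g
    simp only [hτ]
    have hc : Nat.Coprime (g : ZMod p).val (p ^ (N + 1)) :=
      Nat.Coprime.pow_right _ (ZMod.val_coe_unit_coprime g)
    have := congrArg Units.val (ZMod.pow_totient (ZMod.unitOfCoprime _ hc))
    rw [← pow_mul]
    rw [Nat.totient_prime_pow_succ hp.out] at this
    simpa using this
  split_ifs with hj
  · obtain ⟨c, rfl⟩ := hj
    rw [Finset.sum_congr rfl fun g _ => by rw [pow_mul, hone, one_pow]]
    simp [Nat.totient_prime hp.out]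
  · obtain ⟨g, hg⟩ := IsCyclic.exists_generator (α := (ZMod p)ˣ)
    have hne : (g : ZMod p) ^ j ≠ 1 := by
      intro h
      have h' : g ^ j = 1 := Units.ext (by simpa using h)
      have h2 := orderOf_dvd_of_pow_eq_one h'
      rw [orderOf_eq_card_of_forall_mem_zpowers hg, Nat.card_eq_fintype_card, ZMod.card_units] at h2
      exact hj h2
    have hu : IsUnit (τ g ^ j - 1) := by
      obtain ⟨z, hz⟩ := ZMod.natCast_zmod_surjective (n := p ^ (N + 1)) (τ g ^ j - 1)
      rw [← hz, ZMod.isUnit_iff_coprime]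
      refine Nat.Coprime.pow_right _ (Nat.Coprime.symm ((Nat.Prime.coprime_iff_not_dvd hp.out).2 ?_))
      intro hd
      have := congrArg (ZMod.castHom (dvd_pow_self p (Nat.succ_ne_zero N)) (ZMod p)) hz
      rw [map_natCast, (ZMod.natCast_eq_zero_iff z p).2 hd, map_sub, map_pow, hcast, map_one] at this
      exact hne (sub_eq_zero.1 this.symm)
    have hinv : τ g ^ j * ∑ h, τ h ^ j = ∑ h, τ h ^ j := by
      rw [Finset.mul_sum, ← Equiv.sum_comp (Equiv.mulLeft g) fun h => τ h ^ j]
      refine Finset.sum_congr rfl fun h _ => ?_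
      rw [Equiv.coe_mulLeft, hmul, mul_pow]
    have : (τ g ^ j - 1) * ∑ h, τ h ^ j = 0 := by rw [sub_mul, hinv, one_mul, sub_self]
    exact (hu.mul_right_eq_zero).1 this

/-! ### Coefficient extraction in two variables -/

/-- Modulo `q` the exponent is `d + 2 * S * (vis - a)` with `d = A + c - Ta - k * s`. It is less
than `q` in absolute value, so divisibility means that it is zero. As `d` lies strictly between `-S`
and `2 * S`, both summands then vanish. This dictates the hub weight `2 * S` and the size of `q`. -/
theorem dvd_first {q s S n a k c A vis Ta : ℕ} (hs : (n + 1) * s ≤ S) (hq : 2 * (n + 1) * S ≤ q)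
    (hA : A ≤ n * (s - 1)) (hc : c < S) (hk : k ≤ n) (hT : Ta < s) (hvis : vis ≤ n) (ha : a ≤ n) :
    q ∣ c + k * (q - s) + (q - Ta + (q - 2 * S) * a) + (A + 2 * S * vis) ↔
      A + c = Ta + k * s ∧ vis = a := by
  have hsS : s ≤ S := by nlinarith
  have hSq : 2 * S ≤ q := by nlinarith
  have hks : k * s ≤ n * s := Nat.mul_le_mul_right _ hk
  have hA' : A ≤ n * s := hA.trans (Nat.mul_le_mul_left _ (Nat.sub_le _ _))
  have hns : n * s + s ≤ S := by linarith
  have e : ((c + k * (q - s) + (q - Ta + (q - 2 * S) * a) + (A + 2 * S * vis) : ℕ) : ℤ) =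
      ((A + c : ℤ) - (Ta + k * s) + (2 * S : ℤ) * ((vis : ℤ) - a)) + (q : ℤ) * (k + 1 + a) := by
    push_cast [Nat.cast_sub (hsS.trans (by omega : S ≤ q)), Nat.cast_sub (by omega : Ta ≤ q),
      Nat.cast_sub hSq]
    ring
  rw [← Int.natCast_dvd_natCast, e, dvd_add_left (dvd_mul_right _ _)]
  zify at hks hA' hns hc hT hvis ha hq hk
  constructor
  · intro h
    set d : ℤ := (A + c : ℤ) - (Ta + k * s) with hd
    have hd1 : d < 2 * S := by linarith [Int.natCast_nonneg Ta, mul_nonneg (Int.natCast_nonneg k) (Int.natCast_nonneg s)]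
    have hd2 : -(S : ℤ) < d := by linarith [Int.natCast_nonneg A, Int.natCast_nonneg c]
    have hS0 : (0 : ℤ) < S := lt_of_le_of_lt (Int.natCast_nonneg c) hc
    have h0 : d + 2 * S * ((vis : ℤ) - a) = 0 := by
      refine Int.eq_zero_of_abs_lt_dvd h (abs_lt.2 ⟨?_, ?_⟩)
      · nlinarith [Int.natCast_nonneg vis]
      · nlinarith [Int.natCast_nonneg a]
    have h1 : d = 0 := by
      refine Int.eq_zero_of_abs_lt_dvd (m := 2 * S) ⟨(a : ℤ) - vis, by linarith⟩
        (abs_lt.2 ⟨by linarith, hd1⟩)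
    have h2 : (vis : ℤ) - a = 0 := by
      rw [h1, zero_add] at h0
      rcases mul_eq_zero.1 h0 with h | h
      · omega
      · exact h
    constructor
    · zify
      linarith
    · omega
  · rintro ⟨h1, h2⟩
    zify at h1 h2
    rw [h1, h2]
    simp

/-- The exponent lies strictly between `0` and `2 * q`, so `q` itself is the only possible multiple.
-/
theorem dvd_second {q s S n k c A Tb : ℕ} (hs : (n + 1) * s ≤ S) (hq : 2 * (n + 1) * S ≤ q)
    (hn : 0 < n) (hA : A ≤ n * (s - 1)) (hc : c < S) (hk : k ≤ n) (hT : Tb < n * s) :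
    q ∣ c + k + (q - Tb) + A ↔ A + c + k = Tb := by
  have hA' : A ≤ n * s := hA.trans (Nat.mul_le_mul_left _ (Nat.sub_le _ _))
  have h4 : 4 * S ≤ q := by nlinarith
  have hs0 : 0 < s := by
    rcases Nat.eq_zero_or_pos s with h | h
    · simp [h] at hT
    · exact h
  have h5 : n * s + s ≤ S := by linarith
  have h6 : n ≤ n * s := Nat.le_mul_of_pos_right _ hs0
  constructor
  · rintro ⟨z, hz⟩
    have : z = 1 := by
      rcases z with _ | _ | z
      · omega
      · rfl
      · exfalso
        have : q * 2 ≤ q * (z + 1 + 1) := Nat.mul_le_mul_left _ (by omega)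
        omega
    subst this
    omega
  · intro h
    exact ⟨1, by omega⟩

/-- The data fit the matrix `M` of an instance. -/
structure Par.Sound (P : Par) (M : ℕ → ℕ) (p : ℕ) : Prop where
  prime : p.Prime
  Q_eq : P.Q = p ^ (P.n + 3)
  e_eq : P.e = p ^ (P.n + 2)
  q_eq : P.q = p - 1
  pu_eq : P.pu = 2 ^ ∑ v ∈ Finset.range P.n, P.fl v
  pz_eq : P.pz = 2 ^ ∑ v ∈ Finset.range P.n, (1 - P.fl v)
  hub_le : ∀ v, P.hub v ≤ 1
  fl_le : ∀ v, P.fl v ≤ 1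
  inf_le : ∀ v, P.inf v ≤ 1
  hub_sum : ∑ v ∈ Finset.range P.n, P.hub v = P.a
  disj : ∀ v < P.n, P.inf v = 1 → P.fl v = 0
  nb : ∀ r < P.n, ∀ v < P.n, P.inf r = 1 → M (r * P.n + v) ≠ 0 → P.fl v = 1 ∨ P.hub v = 1
  s_pos : 0 < P.s
  s_le : (P.n + 1) * P.s ≤ 2 ^ P.b
  lam_eq : P.lam = 2 * 2 ^ P.b
  q_ge : 2 * (P.n + 1) * 2 ^ P.b ≤ P.q
  M_lt : ∀ i < P.n * P.n, M i - 1 < P.s * P.s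

/-- The matrix entry for the `i`-th arc of a cyclic sequence of vertices. -/
def ent {m : ℕ} (M : ℕ → ℕ) (t : Fin (m + 1) → Fin (m + 1)) (i : Fin (m + 1)) : ℕ :=
  M (t i * (m + 1) + t (finRotate _ i))

/-- The sequence `t` is a Hamiltonian cycle, with start `0`, for the matrix `M`. -/
def IsTour {m : ℕ} (M : ℕ → ℕ) (t : Fin (m + 1) → Fin (m + 1)) : Prop :=
  t 0 = 0 ∧ Function.Surjective t ∧ ∀ i, ent M t i ≠ 0

/-- The weight of a tour. -/
def tourWeight {m : ℕ} (M : ℕ → ℕ) (t : Fin (m + 1) → Fin (m + 1)) : ℕ := ∑ i, (ent M t i - 1)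

theorem ent_index_lt {m : ℕ} (t : Fin (m + 1) → Fin (m + 1)) (i : Fin (m + 1)) :
    (t i * (m + 1) + t (finRotate _ i) : ℕ) < (m + 1) * (m + 1) :=
  mul_add_lt_mul (t i).2 (t _).2

/-- Exchanging the sums over sets and over walks, each closed walk along existing arcs contributes
one monomial, which records the sums of its low and high digits and its visits to hubs. Its
coefficient is the restricted signed count of the sets that contain it. -/
theorem innerSum_arc {R : Type*} [CommRing R] {m : ℕ} {P : Par} {M : ℕ → ℕ} {p : ℕ}
    (hn : P.n = m + 1) (hP : P.Sound M p) (ξ η : R) :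
    innerSum P.n P.a P.pu P.pz M P.fl P.inf (P.arc M ξ η) =
      ∑ t : Fin (m + 1) → Fin (m + 1), if t 0 = 0 ∧ ∀ i, ent M t i ≠ 0 then
        ((∑ S ∈ (Finset.range (m + 1)).powerset,
          (if (starved (m + 1) P.inf M fun v => P.fl v * ind S v) ≤ P.a ∧ ∀ i, (t i : ℕ) ∈ S
            then sgn (m + 1) S else 0) : ℤ) : R) *
        (ξ ^ (∑ i, (ent M t i - 1) % P.s + P.lam * ∑ i, P.hub (t i)) *
          η ^ ∑ i, (ent M t i - 1) / P.s) else 0 := by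
  rw [hP.pu_eq, hP.pz_eq, innerSum_eq (by omega) hP.fl_le]
  simp only [signedWalks, hn, wv_closed]
  simp only [Finset.mul_sum]
  have h0 : ∀ (q : Prop) [Decidable q] (f : (Fin (m + 1) → Fin (m + 1)) → R),
      (if q then ∑ i, f i else 0) = ∑ i, if q then f i else 0 := by
    intro q _ f
    split_ifs <;> simp
  simp only [h0]
  rw [Finset.sum_comm]
  refine Finset.sum_congr rfl fun t _ => ?_
  have harc : ∀ i, P.arc M ξ η (t i * (m + 1) + t (finRotate _ i)) = nz (ent M t i) *
      (ξ ^ ((ent M t i - 1) % P.s + P.lam * P.hub (t (finRotate _ i))) *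
        η ^ ((ent M t i - 1) / P.s)) := by
    intro i
    have : ((t i * (m + 1) + t (finRotate _ i) : ℕ)) % (m + 1) = t (finRotate _ i) := by
      rw [mul_comm, Nat.mul_add_mod, Nat.mod_eq_of_lt (t _).2]
    simp only [Par.arc, hn, this, ent]
  by_cases ht : t 0 = 0
  swap
  · simp [ht]
  by_cases hM : ∀ i, ent M t i ≠ 0
  · rw [if_pos ⟨ht, hM⟩, Int.cast_sum, Finset.sum_mul]
    refine Finset.sum_congr rfl fun S _ => ?_
    rw [if_pos ht]
    have hE : ∏ i, P.arc M ξ η (t i * (m + 1) + t (finRotate _ i)) =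
        ξ ^ (∑ i, (ent M t i - 1) % P.s + P.lam * ∑ i, P.hub (t i)) *
          η ^ ∑ i, (ent M t i - 1) / P.s := by
      rw [Finset.prod_congr rfl fun i _ => harc i, Finset.prod_mul_distrib,
        Finset.prod_mul_distrib, Finset.prod_pow_eq_pow_sum, Finset.prod_pow_eq_pow_sum,
        Finset.sum_add_distrib, ← Finset.mul_sum, Equiv.sum_comp (finRotate (m + 1))
        fun i => P.hub (t i), Finset.prod_eq_one, one_mul]
      intro i _
      have := hM i
      rw [show nz (ent M t i) = 1 by unfold nz; omega, Nat.cast_one]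
    rw [hE]
    by_cases hS : ∀ i, (t i : ℕ) ∈ S
    · have h1 : ∏ i, (ind S (t i) : R) = 1 := Finset.prod_eq_one fun i _ => by simp [ind, hS i]
      rw [h1, one_mul]
      simp only [hS, implies_true, and_true]
      split_ifs <;> simp [sgn, Finset.mul_sum]
    · have : ∏ i, (ind S (t i) : R) = 0 := by
        push Not at hS
        obtain ⟨i, hi⟩ := hS
        exact Finset.prod_eq_zero (Finset.mem_univ i) (by simp [ind, hi])
      simp [hS, this]
  · rw [if_neg (fun h => hM h.2)]
    refine Finset.sum_eq_zero fun S _ => ?_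
    push Not at hM
    obtain ⟨i, hi⟩ := hM
    have h : ∏ i, P.arc M ξ η (t i * (m + 1) + t (finRotate _ i)) = 0 :=
      Finset.prod_eq_zero (Finset.mem_univ i) (by rw [harc, hi]; simp [nz])
    rw [h]
    simp

/-- The weights of a tour and a slack, written in the base `s`, add up to `T`. -/
def Par.Fits (P : Par) {m : ℕ} (M : ℕ → ℕ) (T : ℕ) (x : (ℕ × ℕ × ℕ) × (Fin (m + 1) → Fin (m + 1))) :
    Prop :=
  ∑ i, (ent M x.2 i - 1) % P.s + x.1.1 = T % P.s + x.1.2.2 * P.s ∧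
    ∑ i, (ent M x.2 i - 1) / P.s + x.1.2.1 + x.1.2.2 = T / P.s

/-- The range of the slack and the carry. -/
def Par.slacks (P : Par) : Finset (ℕ × ℕ × ℕ) :=
  Finset.range (2 ^ P.b) ×ˢ Finset.range (2 ^ P.b) ×ˢ Finset.range (P.n + 1)

/-- Expanded, the factor offers every slack in both digits and every carry. A carry of `k`
multiplies by `ξ ^ (k * (q - s))`, which removes `k * s` from the low digit once `ξ` is a `q`-th
root of unity, and by `η ^ k`, which adds `k` to the high one. -/
theorem Par.factor_eq {R : Type*} [CommRing R] (P : Par) (ex ey : ℕ) (ξ η : R) :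
    P.factor ex ey ξ η = ∑ x ∈ P.slacks, ξ ^ (x.1 + x.2.2 * (P.q - P.s) + ex) *
      η ^ (x.2.1 + x.2.2 + ey) := by
  have h : ∀ x ∈ P.slacks, ξ ^ (x.1 + x.2.2 * (P.q - P.s) + ex) * η ^ (x.2.1 + x.2.2 + ey) =
      ξ ^ x.1 * (η ^ x.2.1 * ((ξ ^ (P.q - P.s) * η) ^ x.2.2 * (ξ ^ ex * η ^ ey))) := by
    intro x _
    rw [mul_pow, ← pow_mul, mul_comm (P.q - P.s)]
    simp only [pow_add]
    ring
  rw [Finset.sum_congr rfl h]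
  simp only [Par.factor, Par.slacks, Finset.sum_product, ← Finset.mul_sum, ← Finset.sum_mul]
  ring

-- Summation over all pairs of roots of unity kills each monomial unless `q` divides both exponents,
-- and otherwise gives a factor `q * q`. By `dvd_first` and `dvd_second` divisibility means that
-- weight, slack and carry make up `T` and that there are exactly `a` visits to hubs. For such walks
-- `sum_good_sgn` turns the coefficient into the indicator of tours, so all surviving terms are
-- nonnegative.
open Classical in
theorem value_eq {m : ℕ} {P : Par} {M : ℕ → ℕ} {p T : ℕ} (hn : P.n = m + 1) (hP : P.Sound M p)
    (hT : T < P.n * (P.s * P.s)) :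
    (P.value M T : ZMod P.Q) = ((P.q * P.q * ((P.slacks ×ˢ
      (Finset.univ : Finset (Fin (m + 1) → Fin (m + 1)))).filter
        fun x => IsTour M x.2 ∧ P.Fits M T x).card : ℕ) : ZMod P.Q) := by
  have := Fact.mk hP.prime
  have hn0 : 0 < P.n := by omega
  have hTa := Nat.mod_lt T hP.s_pos
  have hTb : T / P.s < P.n * P.s := by
    rw [Nat.div_lt_iff_lt_mul hP.s_pos]
    linarith
  set C : (Fin (m + 1) → Fin (m + 1)) → ℤ := fun t =>
    ∑ S ∈ (Finset.range (m + 1)).powerset,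
      (if (starved (m + 1) P.inf M fun v => P.fl v * ind S v) ≤ P.a ∧ ∀ i, (t i : ℕ) ∈ S
        then sgn (m + 1) S else 0) with hC
  set al : (ℕ × ℕ × ℕ) × (Fin (m + 1) → Fin (m + 1)) → ℕ := fun x =>
    x.1.1 + x.1.2.2 * (P.q - P.s) + (P.q - T % P.s + (P.q - P.lam) * P.a) +
      (∑ i, (ent M x.2 i - 1) % P.s + P.lam * ∑ i, P.hub (x.2 i)) with hal
  set be : (ℕ × ℕ × ℕ) × (Fin (m + 1) → Fin (m + 1)) → ℕ := fun x =>
    x.1.2.1 + x.1.2.2 + (P.q - T / P.s) + ∑ i, (ent M x.2 i - 1) / P.s with hbe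
  have hpoint : ∀ ξ η : ZMod P.Q, P.point M (P.q - T % P.s + (P.q - P.lam) * P.a) (P.q - T / P.s)
      ξ η = ∑ x ∈ P.slacks ×ˢ (Finset.univ : Finset (Fin (m + 1) → Fin (m + 1))),
        if x.2 0 = 0 ∧ ∀ i, ent M x.2 i ≠ 0 then (C x.2 : ZMod P.Q) * (ξ ^ al x * η ^ be x)
        else 0 := by
    intro ξ η
    rw [Par.point, innerSum_arc hn hP, P.factor_eq, Finset.sum_mul_sum, Finset.sum_product]
    refine Finset.sum_congr rfl fun c _ => Finset.sum_congr rfl fun t _ => ?_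
    simp only [mul_ite, mul_zero]
    refine if_congr Iff.rfl ?_ rfl
    simp only [hal, hbe, hC, pow_add]
    ring
  have hroot := fun j => sum_teichmuller (p := p) (P.n + 2) j
  rw [← hP.e_eq, ← hP.q_eq, show P.n + 2 + 1 = P.n + 3 from rfl, ← hP.Q_eq] at hroot
  simp only [Par.value, hpoint]
  rw [Finset.sum_congr rfl fun x _ => Finset.sum_comm, Finset.sum_comm]
  rw [Finset.card_filter, Nat.cast_mul, Nat.cast_sum, Finset.mul_sum]
  refine Finset.sum_congr rfl fun x hx => ?_
  obtain ⟨hc, hc', hk⟩ : x.1.1 < 2 ^ P.b ∧ x.1.2.1 < 2 ^ P.b ∧ x.1.2.2 ≤ P.n := by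
    simp only [Par.slacks, Finset.mem_product, Finset.mem_range] at hx
    omega
  by_cases h0 : x.2 0 = 0 ∧ ∀ i, ent M x.2 i ≠ 0
  swap
  · rw [if_neg fun h => h0 ⟨h.1.1, h.1.2.2⟩]
    simp [h0]
  simp only [if_pos h0]
  have hpow : ∀ x' y' : ℕ, (C x.2 : ZMod P.Q) * (((((x' + 1 : ℕ) : ZMod P.Q) ^ P.e) ^ al x) *
      ((((y' + 1 : ℕ) : ZMod P.Q) ^ P.e) ^ be x)) = (C x.2 : ZMod P.Q) *
      ((((x' + 1 : ℕ) : ZMod P.Q) ^ P.e) ^ al x) * ((((y' + 1 : ℕ) : ZMod P.Q) ^ P.e) ^ be x) :=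
    fun _ _ => (mul_assoc _ _ _).symm
  simp only [hpow, ← Finset.mul_sum, ← Finset.sum_mul]
  rw [hroot, hroot]
  have hmod : ∑ i, (ent M x.2 i - 1) % P.s ≤ P.n * (P.s - 1) := by
    calc _ ≤ ∑ _i : Fin (m + 1), (P.s - 1) :=
          Finset.sum_le_sum fun i _ => Nat.le_pred_of_lt (Nat.mod_lt _ hP.s_pos)
      _ = _ := by simp [hn]
  have hdiv : ∑ i, (ent M x.2 i - 1) / P.s ≤ P.n * (P.s - 1) := by
    calc _ ≤ ∑ _i : Fin (m + 1), (P.s - 1) := by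
          refine Finset.sum_le_sum fun i _ => Nat.le_pred_of_lt ?_
          rw [Nat.div_lt_iff_lt_mul hP.s_pos]
          exact hP.M_lt _ (by rw [hn]; exact ent_index_lt _ _)
      _ = _ := by simp [hn]
  have hvis : ∑ i, P.hub (x.2 i) ≤ P.n := by
    calc _ ≤ ∑ _i : Fin (m + 1), 1 := Finset.sum_le_sum fun i _ => hP.hub_le _
      _ = _ := by simp [hn]
  have ha : P.a ≤ P.n := by
    rw [← hP.hub_sum]
    calc _ ≤ ∑ _v ∈ Finset.range P.n, 1 := Finset.sum_le_sum fun i _ => hP.hub_le _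
      _ = _ := by simp
  have hal' : P.q ∣ al x ↔ ∑ i, (ent M x.2 i - 1) % P.s + x.1.1 = T % P.s + x.1.2.2 * P.s ∧
      ∑ i, P.hub (x.2 i) = P.a :=
    by
      have h := dvd_first hP.s_le hP.q_ge hmod hc hk hTa hvis ha
      rw [← hP.lam_eq] at h
      exact h
  have hbe' : P.q ∣ be x ↔ ∑ i, (ent M x.2 i - 1) / P.s + x.1.2.1 + x.1.2.2 = T / P.s :=
    dvd_second hP.s_le hP.q_ge hn0 hdiv hc' hk hTb
  by_cases h1 : ∑ i, P.hub (x.2 i) = P.a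
  · have hCx : C x.2 = if Function.Surjective x.2 then 1 else 0 := by
      refine sum_good_sgn hP.inf_le (hub := P.hub) ?_ ?_ x.2 h0.2 h1
      · exact hn ▸ hP.disj
      · exact hn ▸ hP.nb
    have hF : P.Fits M T x ↔ P.q ∣ al x ∧ P.q ∣ be x := by
      rw [hal', hbe', Par.Fits]
      simp [h1]
    have hI : IsTour M x.2 ↔ Function.Surjective x.2 :=
      ⟨fun h => h.2.1, fun h => ⟨h0.1, h, h0.2⟩⟩
    rw [hCx, hF, hI]
    by_cases h2 : Function.Surjective x.2 <;> by_cases h3 : P.q ∣ al x <;>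
      by_cases h4 : P.q ∣ be x <;> simp [h2, h3, h4]
  · have h2 : ¬ P.q ∣ al x := fun h => h1 (hal'.1 h).2
    have h3 : ¬ (IsTour M x.2 ∧ P.Fits M T x) := by
      -- A tour visits each vertex once and so has exactly `a` visits to hubs.
      rintro ⟨⟨-, hs, -⟩, -⟩
      refine h1 ?_
      rw [← hP.hub_sum, hn, Finset.sum_range]
      exact (Equiv.ofBijective x.2 (Finite.injective_iff_bijective.1
        (Finite.injective_iff_surjective.2 hs))).sum_comp fun v => P.hub v
    rw [if_neg h2, if_neg h3]
    simp

/-- The value is nonzero just in case there is a tour of weight at most `T`. -/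
theorem value_ne_zero_iff {m : ℕ} {P : Par} {M : ℕ → ℕ} {p T : ℕ} (hn : P.n = m + 1)
    (hP : P.Sound M p) (hT : T < P.n * (P.s * P.s)) :
    (P.value M T : ZMod P.Q) ≠ 0 ↔ ∃ t : Fin (m + 1) → Fin (m + 1),
      IsTour M t ∧ tourWeight M t ≤ T := by
  classical
  rw [value_eq hn hP hT, Ne, ZMod.natCast_eq_zero_iff, hP.Q_eq]
  set F := (P.slacks ×ˢ (Finset.univ : Finset (Fin (m + 1) → Fin (m + 1)))).filter
    fun x => IsTour M x.2 ∧ P.Fits M T x with hF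
  have hp := hP.prime
  have hp1 := hp.one_lt
  -- The factor `q * q` is invertible modulo powers of `p`, because `q = p - 1`.
  have hcop : Nat.Coprime (p ^ (P.n + 3)) (P.q * P.q) := by
    have : Nat.Coprime p P.q := by
      rw [Nat.Prime.coprime_iff_not_dvd hp, hP.q_eq]
      exact fun h => absurd (Nat.le_of_dvd (by omega) h) (by omega)
    exact Nat.Coprime.pow_left _ (this.mul_right this)
  have hw : ∀ t : Fin (m + 1) → Fin (m + 1), tourWeight M t =
      ∑ i, (ent M t i - 1) % P.s + P.s * ∑ i, (ent M t i - 1) / P.s := by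
    intro t
    rw [Finset.mul_sum, ← Finset.sum_add_distrib]
    exact Finset.sum_congr rfl fun i _ => (Nat.mod_add_div _ _).symm
  have hb : 0 < 2 ^ P.b := by positivity
  have hqq := hP.q_ge
  have hqp := hP.q_eq
  -- There are fewer than `p ^ 3` triples of slacks and carry and at most `p ^ n` sequences. Hence
  -- the exponent `n + 3`: the count can vanish modulo `Q` only if it is zero.
  have hlt : F.card < p ^ (P.n + 3) := by
    have g1 : 2 ^ P.b ≤ (P.n + 1) * 2 ^ P.b := Nat.le_mul_of_pos_left _ (by omega)
    have g2 : P.n + 1 ≤ (P.n + 1) * 2 ^ P.b := Nat.le_mul_of_pos_right _ hb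
    have g3 : 2 * (P.n + 1) * 2 ^ P.b = 2 * ((P.n + 1) * 2 ^ P.b) := by ring
    have h1 : 2 ^ P.b < p := by omega
    have h2 : P.n + 1 ≤ p := by omega
    calc F.card ≤ (P.slacks ×ˢ (Finset.univ : Finset (Fin (m + 1) → Fin (m + 1)))).card :=
          Finset.card_filter_le _ _
      _ = 2 ^ P.b * (2 ^ P.b * (P.n + 1)) * P.n ^ P.n := by
          simp [Par.slacks, Finset.card_product, hn]
      _ < p * (p * p) * p ^ P.n := by
          have h3 : P.n ^ P.n ≤ p ^ P.n := Nat.pow_le_pow_left (by omega) _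
          refine Nat.mul_lt_mul_of_lt_of_le ?_ h3 (Nat.pow_pos (by omega))
          exact Nat.mul_lt_mul_of_lt_of_le h1 (Nat.mul_le_mul h1.le h2)
            (Nat.mul_pos (by omega) (by omega))
      _ = _ := by ring
  rw [hcop.dvd_mul_left]
  have : p ^ (P.n + 3) ∣ F.card ↔ F.card = 0 :=
    ⟨fun h => Nat.eq_zero_of_dvd_of_lt h hlt, fun h => h ▸ dvd_zero _⟩
  rw [this, Finset.card_eq_zero, ← Ne, ← Finset.nonempty_iff_ne_empty]
  have hdm := Nat.mod_add_div T P.s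
  constructor
  · rintro ⟨x, hx⟩
    obtain ⟨h1, h2, h3, h4⟩ := (Finset.mem_filter.1 hx)
    refine ⟨x.2, h2, ?_⟩
    rw [hw]
    rw [← h4] at hdm
    nlinarith [Nat.zero_le (P.s * x.1.2.1)]
  · rintro ⟨t, ht, hle⟩
    rw [hw] at hle
    set A := ∑ i, (ent M t i - 1) % P.s
    set D := ∑ i, (ent M t i - 1) / P.s
    obtain ⟨c, hc⟩ := Nat.exists_eq_add_of_le hle
    have hA : A ≤ P.n * (P.s - 1) := by
      calc _ ≤ ∑ _i : Fin (m + 1), (P.s - 1) :=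
            Finset.sum_le_sum fun i _ => Nat.le_pred_of_lt (Nat.mod_lt _ hP.s_pos)
        _ = _ := by simp [hn]
    have hs := hP.s_pos
    have hcd := Nat.mod_add_div c P.s
    have hcm := Nat.mod_lt c hs
    have e1 : T % P.s = (A + c % P.s) % P.s := by
      conv_lhs => rw [hc, ← hcd]
      rw [show A + P.s * D + (c % P.s + P.s * (c / P.s)) =
        A + c % P.s + P.s * (D + c / P.s) by ring, Nat.add_mul_mod_self_left]
    have e2 := Nat.mod_add_div (A + c % P.s) P.s
    have e3 : D + c / P.s + (A + c % P.s) / P.s = T / P.s := by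
      have h : P.s * (D + c / P.s + (A + c % P.s) / P.s) = P.s * (T / P.s) := by
        rw [e1] at hdm
        rw [mul_add, mul_add]
        omega
      exact Nat.eq_of_mul_eq_mul_left hs h
    have hsl := hP.s_le
    have hTs : T / P.s < P.n * P.s := by
      rw [Nat.div_lt_iff_lt_mul hs]
      linarith
    -- The slacks are the two digits of `T` minus the weight of the tour; the carry is what arises
    -- when the low digits are added.
    refine ⟨((c % P.s, c / P.s, (A + c % P.s) / P.s), t), Finset.mem_filter.2 ⟨?_, ht, ?_, ?_⟩⟩
    · simp only [Par.slacks, Finset.mem_product, Finset.mem_range, Finset.mem_univ, and_true]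
      refine ⟨?_, ?_, ?_⟩
      · have : P.s ≤ (P.n + 1) * P.s := Nat.le_mul_of_pos_left _ (by omega)
        omega
      · have h1 : c / P.s ≤ T / P.s := Nat.div_le_div_right (by omega)
        have h2 : P.n * P.s ≤ (P.n + 1) * P.s := Nat.mul_le_mul_right _ (by omega)
        omega
      · rw [Nat.div_lt_iff_lt_mul hs]
        have : P.n * (P.s - 1) ≤ P.n * P.s := Nat.mul_le_mul_left _ (Nat.sub_le _ _)
        linarith
    · change A + c % P.s = T % P.s + (A + c % P.s) / P.s * P.s
      rw [e1, mul_comm _ P.s, e2]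
    · exact e3

/-! ### Deleting arcs -/

/-- The matrix `M'` arises from the matrix `M` by deleting entries. -/
def Sub (M' M : ℕ → ℕ) : Prop := ∀ i, M' i = 0 ∨ M' i = M i

theorem Sub.refl (M : ℕ → ℕ) : Sub M M := fun _ => Or.inr rfl

theorem Sub.trans {M M' M'' : ℕ → ℕ} (h : Sub M'' M') (h' : Sub M' M) : Sub M'' M := by
  intro i
  rcases h i with h | h <;> rcases h' i with h' | h' <;> simp [h, h']

theorem Sub.update (M : ℕ → ℕ) (k : ℕ) : Sub (Function.update M k 0) M := by
  intro i
  by_cases h : i = k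
  · exact Or.inl (by simp [h])
  · exact Or.inr (by simp [h])

theorem Sub.eq {M M' : ℕ → ℕ} (h : Sub M' M) {i : ℕ} (hi : M' i ≠ 0) : M' i = M i :=
  (h i).resolve_left hi

theorem Sub.le {M M' : ℕ → ℕ} (h : Sub M' M) (i : ℕ) : M' i ≤ M i := by
  rcases h i with h | h <;> simp [h]

theorem Sub.ne_zero {M M' : ℕ → ℕ} (h : Sub M' M) {i : ℕ} (hi : M' i ≠ 0) : M i ≠ 0 :=
  h.eq hi ▸ hi

/-- Hubs and infants are computed once, from the original matrix. They stay usable after deletions,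
since the conditions on the matrix are inherited when entries become zero. -/
theorem Par.Sound.sub {P : Par} {M M' : ℕ → ℕ} {p : ℕ} (h : P.Sound M p) (hs : Sub M' M) :
    P.Sound M' p where
  __ := h
  nb r hr v hv h1 h2 := h.nb r hr v hv h1 (hs.ne_zero h2)
  M_lt i hi := (Nat.sub_le_sub_right (hs.le i) 1).trans_lt (h.M_lt i hi)

theorem nz_mono {x y : ℕ} (h : x ≤ y) : nz x ≤ nz y := by
  unfold nz
  omega

/-- Fewer arcs starve more infants, so fewer traces pass the test. The time bound for the original
matrix therefore covers every later call of the oracle. -/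
theorem starved_anti {n : ℕ} {inf M M' x : ℕ → ℕ} (h : Sub M' M) :
    starved n inf M x ≤ starved n inf M' x :=
  Finset.sum_le_sum fun _ _ => Nat.mul_le_mul_left _ (Nat.sub_le_sub_left
    (Finset.sum_le_sum fun _ _ => Nat.mul_le_mul_right _ (nz_mono (h.le _))) _)

theorem innerCost_mono {n a pu pz : ℕ} {M M' fl inf : ℕ → ℕ} (h : Sub M' M) :
    innerCost n a pu pz M' fl inf ≤ innerCost n a pu pz M fl inf := by
  have : ((Finset.range pu).filter (Good n a M' fl inf)).card ≤
      ((Finset.range pu).filter (Good n a M fl inf)).card :=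
    Finset.card_le_card (Finset.monotone_filter_right _ fun Y _ hY => (starved_anti h).trans hY)
  unfold innerCost
  gcongr

theorem Par.oracleCost_mono {P : Par} {M M' : ℕ → ℕ} (h : Sub M' M) :
    P.oracleCost M' B ≤ P.oracleCost M B := by
  unfold Par.oracleCost Par.pointCost
  have := innerCost_mono (n := P.n) (a := P.a) (pu := P.pu) (pz := P.pz) (fl := P.fl)
    (inf := P.inf) h
  gcongr

/-- There is a tour of weight at most `T`. -/
def Feas (m : ℕ) (M : ℕ → ℕ) (T : ℕ) : Prop :=
  ∃ t : Fin (m + 1) → Fin (m + 1), IsTour M t ∧ tourWeight M t ≤ T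

theorem tourWeight_sub {m : ℕ} {M M' : ℕ → ℕ} (h : Sub M' M) {t : Fin (m + 1) → Fin (m + 1)}
    (ht : IsTour M' t) : tourWeight M' t = tourWeight M t :=
  Finset.sum_congr rfl fun i _ => by rw [ent, h.eq (ht.2.2 i), ent]

theorem IsTour.of_sub {m : ℕ} {M M' : ℕ → ℕ} (h : Sub M' M) {t : Fin (m + 1) → Fin (m + 1)}
    (ht : IsTour M' t) : IsTour M t :=
  ⟨ht.1, ht.2.1, fun i => h.ne_zero (ht.2.2 i)⟩

theorem Feas.of_sub {m T : ℕ} {M M' : ℕ → ℕ} (h : Sub M' M) (hf : Feas m M' T) : Feas m M T := by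
  obtain ⟨t, ht, hw⟩ := hf
  exact ⟨t, ht.of_sub h, (tourWeight_sub h ht).symm.trans_le hw⟩

theorem oracle_feas {P : Par} {σ : State} {M₀ M : ℕ → ℕ} {m p T : ℕ} (hn : P.n = m + 1)
    (hP : P.Valid B L) (hS : P.Sound M₀ p) (hM : Sub M M₀) (hσ : P.Holds M σ)
    (h22 : σ.reg 22 = T) (hT : T < P.n * (P.s * P.s)) :
    Runs B L oracle σ (fun τ => τ.reg 23 ≠ 0 ↔ Feas m M T) (P.oracleCost M₀ B) := by
  refine (oracle_runs hP hσ h22).mono ?_ (Par.oracleCost_mono hM)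
  rintro τ - - ⟨h1, h2⟩
  rw [Feas, ← value_ne_zero_iff hn (hS.sub hM) hT, ← h2, not_iff_not]
  constructor
  · intro h
    simp [h]
  · intro h
    exact Nat.eq_zero_of_dvd_of_lt ((ZMod.natCast_eq_zero_iff _ _).1 h) h1

/-! ### Finding an optimal tour with the oracle -/

/-- One step of the binary search for the least weight. -/
def halve : Prog := .seq (blk [add 22 46 47, add 49 1 1, div 22 22 49]) (.seq oracle
  (.seq (.ite 23 (blk [add 47 22 2]) (blk [add 46 22 1])) (blk [sub 48 47 46])))

/-- Register `47` always holds a feasible threshold, and no threshold below register `46` is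
feasible. The midpoint replaces the upper end, or its successor the lower end, so the difference
loses a binary digit. -/
theorem halve_runs {P : Par} {σ : State} {M : ℕ → ℕ} {m p k : ℕ} (hn : P.n = m + 1)
    (hP : P.Valid B L) (hS : P.Sound M p) (hσ : P.Holds M σ) (h47 : Feas m M (σ.reg 47))
    (h46 : ∀ T < σ.reg 46, ¬ Feas m M T) (hlt : σ.reg 46 < σ.reg 47)
    (hk : σ.reg 47 - σ.reg 46 < 2 ^ (k + 1)) (hB : 2 * (P.n * (P.s * P.s)) < cap B)
    (hU : σ.reg 47 < P.n * (P.s * P.s)) :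
    Runs B L halve σ (fun τ => (Feas m M (τ.reg 47) ∧ (∀ T < τ.reg 46, ¬ Feas m M T) ∧
      τ.reg 46 ≤ τ.reg 47 ∧ τ.reg 47 - τ.reg 46 < 2 ^ k ∧ τ.reg 47 ≤ σ.reg 47) ∧
      τ.reg 48 = τ.reg 47 - τ.reg 46) (P.oracleCost M B + 6) := by
  refine Runs.of_ok fun hok => ?_
  refine Runs.cons' (P.oracleCost M B + 3) ?_ (fun ok₁ hf₁ => ?_) (by simp; omega)
  · simp [hok.one]
    omega
  set σ₁ := Prog.run _ σ with hσ₁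
  have c₁ := hσ.frame hf₁ rfl rfl
  have g22 : σ₁.reg 22 = (σ.reg 46 + σ.reg 47) / 2 := by simp [hσ₁, hok.one]
  have g46 := hf₁.reg 46 rfl
  have g47 := hf₁.reg 47 rfl
  clear_value σ₁
  rw [pow_succ] at hk
  refine Runs.seq' (P.oracleCost M B) 3 (oracle_feas hn hP hS (Sub.refl M) c₁ g22 (by omega)) ?_
    (by omega)
  intro σ₂ ok₂ hf₂ h23
  replace g46 := (hf₂.reg 46 rfl).trans g46
  replace g47 := (hf₂.reg 47 rfl).trans g47
  replace g22 := (hf₂.reg 22 rfl).trans g22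
  refine Runs.seq' 2 1 (Q := fun τ => Feas m M (τ.reg 47) ∧ (∀ T < τ.reg 46, ¬ Feas m M T) ∧
      τ.reg 46 ≤ τ.reg 47 ∧ τ.reg 47 - τ.reg 46 < 2 ^ k ∧ τ.reg 47 ≤ σ.reg 47) (Runs.ite ?_ ?_) ?_
    (by omega)
  · intro h
    refine Runs.straight ?_ ?_ le_rfl
    · simp [g22, ok₂.zero]
      omega
    · simp [g22, ok₂.zero, g46]
      exact ⟨h23.1 h, h46, by omega, by omega, by omega⟩
  · intro h
    have h' : ¬ Feas m M ((σ.reg 46 + σ.reg 47) / 2) := fun hf => h23.2 hf h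
    refine Runs.straight ?_ ?_ le_rfl
    · simp [g22, ok₂.one]
      omega
    · simp [g22, ok₂.one, g47]
      refine ⟨h47, fun T hT hf => h' ?_, by omega, by omega⟩
      obtain ⟨t, h1, h2⟩ := hf
      exact ⟨t, h1, h2.trans (by omega)⟩
  · intro σ₃ ok₃ hf₃ h
    refine Runs.straight ?_ ?_ le_rfl
    · simp
    · simpa using h

theorem bisect_runs {P : Par} {σ : State} {M : ℕ → ℕ} {m p : ℕ} (hn : P.n = m + 1)
    (hP : P.Valid B L) (hS : P.Sound M p) (hσ : P.Holds M σ) (h47 : Feas m M (σ.reg 47))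
    (h46 : σ.reg 46 = 0) (h48 : σ.reg 48 = σ.reg 47) (hB : 2 * (P.n * (P.s * P.s)) < cap B)
    (hU : σ.reg 47 < P.n * (P.s * P.s)) :
    Runs B L (.while 48 halve) σ (fun τ => Feas m M (τ.reg 47) ∧
      (∀ T < τ.reg 47, ¬ Feas m M T) ∧ τ.reg 47 < P.n * (P.s * P.s))
      (B * (P.oracleCost M B + 6 + 1) + 1) := by
  refine Runs.of_ok fun hok => ?_
  have hcap := hok.reg_lt 47
  refine (Runs.while (fun k τ => P.Holds M τ ∧ (Feas m M (τ.reg 47) ∧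
    (∀ T < τ.reg 46, ¬ Feas m M T) ∧ τ.reg 46 ≤ τ.reg 47 ∧ τ.reg 47 - τ.reg 46 < 2 ^ k ∧
    τ.reg 47 ≤ σ.reg 47) ∧ τ.reg 48 = τ.reg 47 - τ.reg 46) ?_ ?_ B σ ?_).mono ?_ le_rfl
  · rintro τ ⟨-, ⟨-, -, -, h, -⟩, h'⟩
    rw [pow_zero] at h
    omega
  · rintro k τ - ⟨h0, ⟨h1, h2, h3, h4, h5⟩, h6⟩ h7
    refine (halve_runs hn hP hS h0 h1 h2 (by omega) h4 hB (by omega)).mono ?_ le_rfl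
    rintro υ - hf ⟨⟨k1, k2, k3, k4, k5⟩, k6⟩
    exact ⟨h0.frame hf rfl rfl, ⟨k1, k2, k3, k4, k5.trans h5⟩, k6⟩
  · exact ⟨hσ, ⟨h47, by simp [h46], by omega, by rw [h46]; exact hcap, le_rfl⟩, by omega⟩
  · rintro τ - - ⟨h, k, -, -, ⟨h1, h2, h3, h4, h5⟩, h6⟩
    have : τ.reg 46 = τ.reg 47 := by omega
    exact ⟨h1, this ▸ h2, by omega⟩

/-- Delete the entry with the index in the register `49`, if a tour of the weight in the
register `22` remains. -/
def prune : Prog := .seq (blk [.load 62 0 49, .store 0 49 2]) (.seq oracle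
  (blk [sub 63 1 23, mul 63 63 62, .store 0 49 63]))

/-- An entry that could not be spared earlier cannot be spared after further deletions, since
feasibility passes to larger matrices; one pass is enough. The entry is restored without a branch by
storing `(1 - answer) * entry`, with truncated subtraction. -/
theorem prune_runs {P : Par} {σ : State} {M₀ M : ℕ → ℕ} {m p k T : ℕ} (hn : P.n = m + 1)
    (hP : P.Valid B L) (hS : P.Sound M₀ p) (hM : Sub M M₀) (hσ : P.Holds M σ)
    (h22 : σ.reg 22 = T) (hT : T < P.n * (P.s * P.s)) (hF : Feas m M T)
    (hmin : ∀ i, k + 1 ≤ i → i < P.n * P.n → M i ≠ 0 → ¬ Feas m (Function.update M i 0) T)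
    (h49 : σ.reg 49 = k) (hk : k < P.n * P.n) :
    Runs B L prune σ (fun τ => ∃ M', Sub M' M₀ ∧ P.Holds M' τ ∧ Feas m M' T ∧
      ∀ i, k ≤ i → i < P.n * P.n → M' i ≠ 0 → ¬ Feas m (Function.update M' i 0) T)
      (P.oracleCost M₀ B + 5) := by
  have hL := hP.nn_le
  refine Runs.cons' (P.oracleCost M₀ B + 3) ?_ (fun ok₁ hf₁ => ?_) (by simp; omega)
  · simp [h49]
    omega
  set σ₁ := Prog.run _ σ with hσ₁
  refine Runs.of_ok fun _ => ?_
  have hz2 : σ.reg 2 = 0 := (hf₁.reg 2 rfl).symm.trans ok₁.zero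
  have c₁ : P.Holds (Function.update M k 0) σ₁ := hσ.frame' hf₁ rfl rfl fun i => by
    by_cases h : i = k
    · simp [hσ₁, h49, h, hz2]
    · simp [hσ₁, h49, h, hσ.a0]
  have g22 := (hf₁.reg 22 rfl).trans h22
  have g49 := (hf₁.reg 49 rfl).trans h49
  have g62 : σ₁.reg 62 = M k := by simp [hσ₁, h49, hσ.a0]
  clear_value σ₁
  refine Runs.seq' (P.oracleCost M₀ B) 3
    (oracle_feas hn hP hS ((Sub.update M k).trans hM) c₁ g22 hT) ?_ (by omega)
  intro σ₂ ok₂ hf₂ h23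
  have c₂ := c₁.frame hf₂ rfl rfl
  replace g49 := (hf₂.reg 49 rfl).trans g49
  replace g62 := (hf₂.reg 62 rfl).trans g62
  have hMk := ok₂.reg_lt 62
  rw [g62] at hMk
  have hle : (1 - σ₂.reg 23) * M k ≤ 1 * M k := Nat.mul_le_mul_right _ (Nat.sub_le _ _)
  refine (Runs.run ?_).mono ?_ le_rfl
  · simp [g49, g62, ok₂.one]
    omega
  rintro τ - hfr rfl
  by_cases h : σ₂.reg 23 = 0
  · refine ⟨M, hM, c₂.frame' hfr rfl rfl fun i => ?_, hF, fun i hi hin h0 => ?_⟩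
    · by_cases hi : i = k
      · simp [g49, g62, ok₂.one, h, hi]
      · simp [g49, g62, ok₂.one, h, hi, c₂.a0]
    · by_cases hik : i = k
      · subst hik
        exact fun hf => h23.2 hf h
      · exact hmin i (by omega) hin h0
  · refine ⟨_, (Sub.update M k).trans hM, c₂.frame' hfr rfl rfl fun i => ?_, h23.1 h,
      fun i hi hin h0 => ?_⟩
    · have : 1 - σ₂.reg 23 = 0 := by omega
      by_cases hi : i = k
      · simp [g49, g62, ok₂.one, this, hi]
      · simp [g49, g62, ok₂.one, this, hi, c₂.a0]
    · have hik : i ≠ k := by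
        rintro rfl
        simp at h0
      rw [Function.update_of_ne hik] at h0
      -- Deletions at different places commute, and the matrix with both entries deleted is a
      -- submatrix of the one with only `i` deleted.
      refine fun hf => hmin i (by omega) hin h0 (hf.of_sub ?_)
      rw [Function.update_comm hik.symm]
      exact Sub.update _ _

theorem Par.Holds.setReg {P : Par} {M : ℕ → ℕ} {σ : State} (h : P.Holds M σ) {x : ℕ}
    (hx : 21 < x) (v : ℕ) : P.Holds M (σ.setReg x v) := by
  have hr : ∀ y ≤ 21, (σ.setReg x v).reg y = σ.reg y := fun y hy => by
    rw [State.setReg_reg, if_neg (by omega)]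
  exact ⟨(hr _ (by omega)).trans h.r0, (hr _ (by omega)).trans h.r3, (hr _ (by omega)).trans h.r9,
    (hr _ (by omega)).trans h.r11, (hr _ (by omega)).trans h.r12, (hr _ (by omega)).trans h.r13,
    (hr _ (by omega)).trans h.r15, (hr _ (by omega)).trans h.r16, (hr _ (by omega)).trans h.r18,
    (hr _ (by omega)).trans h.r19, (hr _ (by omega)).trans h.r20, (hr _ (by omega)).trans h.r21,
    h.a0, h.a3, h.a4, h.a5⟩

theorem pruneLoop_runs {P : Par} {σ : State} {M : ℕ → ℕ} {m p T : ℕ} (hn : P.n = m + 1)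
    (hP : P.Valid B L) (hS : P.Sound M p) (hσ : P.Holds M σ)
    (h22 : σ.reg 22 = T) (hT : T < P.n * (P.s * P.s)) (hF : Feas m M T) :
    Runs B L (.seq .skip (forDown 49 3 prune)) σ (fun τ => ∃ M', Sub M' M ∧ P.Holds M' τ ∧
      Feas m M' T ∧ ∀ i < P.n * P.n, M' i ≠ 0 → ¬ Feas m (Function.update M' i 0) T)
      (P.n * P.n * (P.oracleCost M B + 7) + 3) := by
  refine Runs.loop (P.n * P.n) (fun k τ => ∃ M', Sub M' M ∧ P.Holds M' τ ∧
      Feas m M' T ∧ ∀ i, k ≤ i → i < P.n * P.n → M' i ≠ 0 → ¬ Feas m (Function.update M' i 0) T)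
    (P.oracleCost M B + 5) rfl rfl trivial hσ.r3 ?_ ?_ ?_ ?_ ?_
  · rintro k τ v ⟨M', h1, h2, h3⟩
    exact ⟨M', h1, h2.setReg (by omega) v, h3⟩
  · exact fun _ => ⟨M, Sub.refl M, hσ, hF, fun i hi hi' => by omega⟩
  · rintro k τ hk - hfr ⟨M', h1, h2, h3, h4⟩ h49
    exact prune_runs hn hP hS h1 h2 ((hfr.reg 22 rfl).trans h22) hT h3 h4 h49 hk
  · rintro τ - - ⟨M', h1, h2, h3, h4⟩
    exact ⟨M', h1, h2, h3, fun i hi => h4 i (Nat.zero_le i) hi⟩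
  · change 1 + P.n * P.n * (P.oracleCost M B + 7) + 2 ≤ _
    omega

/-- A tour that avoids the entry would survive its deletion. -/
theorem exists_arc_of_minimal {m T : ℕ} {M : ℕ → ℕ} {t : Fin (m + 1) → Fin (m + 1)}
    (ht : IsTour M t) (hT : tourWeight M t ≤ T) {i : ℕ}
    (h : ¬ Feas m (Function.update M i 0) T) :
    ∃ j, (t j * (m + 1) + t (finRotate _ j) : ℕ) = i := by
  by_contra! hc
  have he : ∀ j, ent (Function.update M i 0) t j = ent M t j := fun j =>
    Function.update_of_ne (hc j) _ _
  refine h ⟨t, ⟨ht.1, ht.2.1, fun j => ?_⟩, ?_⟩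
  · rw [he]
    exact ht.2.2 j
  · simpa only [tourWeight, he] using hT

/-- After pruning each remaining arc lies on `t`, so the row of a vertex has a single nonzero entry
and the sum over its columns is the successor. -/
theorem sum_successor {m T : ℕ} {M : ℕ → ℕ} {t : Fin (m + 1) → Fin (m + 1)}
    (ht : IsTour M t) (hT : tourWeight M t ≤ T)
    (h : ∀ i < (m + 1) * (m + 1), M i ≠ 0 → ¬ Feas m (Function.update M i 0) T) (j : Fin (m + 1)) :
    ∑ v ∈ Finset.range (m + 1), nz (M (t j * (m + 1) + v)) * v = t (finRotate _ j) := by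
  rw [Finset.sum_eq_single (t (finRotate _ j) : ℕ)]
  · have := ht.2.2 j
    rw [ent] at this
    rw [show nz (M (t j * (m + 1) + t (finRotate _ j))) = 1 by unfold nz; omega, one_mul]
  · intro v hv hne
    rw [Finset.mem_range] at hv
    by_cases h0 : M (t j * (m + 1) + v) = 0
    · simp [h0, nz]
    · exfalso
      obtain ⟨k, hk⟩ := exists_arc_of_minimal ht hT (h _ (mul_add_lt_mul (t j).2 hv) h0)
      have h1 : (t k : ℕ) = t j := by
        have e : ∀ a b : ℕ, b < m + 1 → (a * (m + 1) + b) / (m + 1) = a := fun a b hb => by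
          rw [mul_comm, Nat.mul_add_div (by omega), Nat.div_eq_of_lt hb, add_zero]
        rw [← e (t k) _ (t (finRotate _ k)).2, hk, e _ _ hv]
      have h2 : k = j := Finite.injective_iff_surjective.2 ht.2.1 (Fin.ext h1)
      subst h2
      omega
  · intro h
    exact absurd (Finset.mem_range.2 (t _).2) h

/-- The register `53` receives the successor of the vertex in the register `50`. -/
def successor : Prog := .seq (blk [add 53 2 2, mul 54 50 0]) (forDown 52 0 (blk [add 55 54 52,
  .load 55 0 55, sub 55 1 55, sub 55 1 55, mul 55 55 52, add 53 53 55]))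

theorem successor_runs {σ : State} {M : ℕ → ℕ} {n u : ℕ} (hB : n * n < cap B) (h0 : σ.reg 0 = n)
    (h50 : σ.reg 50 = u) (hu : u < n) (hM : ∀ i, σ.arr (0, i) = M i) :
    Runs B L successor σ (fun τ => τ.reg 53 = ∑ v ∈ Finset.range n, nz (M (u * n + v)) * v)
      (n * 8 + 4) := by
  refine Runs.of_ok fun hok => ?_
  have hun : (u + 1) * n ≤ n * n := Nat.mul_le_mul_right _ hu
  have hun' : (u + 1) * n = u * n + n := by ring
  refine Runs.loop n (fun k τ => τ.reg 54 = u * n ∧ (k ≤ n → τ.reg 53 + k * k ≤ n * n ∧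
      τ.reg 53 = ∑ v ∈ Finset.Ico k n, nz (M (u * n + v)) * v)) 6 rfl rfl ?_ (by simpa using h0)
      ?_ ?_ ?_ ?_ (by simp; omega)
  · simp [h0, h50, hok.zero]
    omega
  · intro k τ v h
    simpa using h
  · intro _
    simp [h0, h50, hok.zero]
  · rintro k τ hk hτ hfr ⟨h1, hI⟩ h52
    obtain ⟨h2, h3⟩ := hI hk
    have g0 : ∀ i, τ.arr (0, i) = M i := fun i => (hfr.arr 0 rfl i).trans (hM i)
    have b1 : nz (M (u * n + k)) * k ≤ 1 * k := Nat.mul_le_mul_right _ (nz_le_one _)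
    have b2 : (k + 1) * (k + 1) = k * k + 2 * k + 1 := by ring
    refine Runs.straight ?_ ?_ (by simp)
    · simp [h1, h52, g0, hτ.one, nz_def]
      omega
    · simp [h1, h52, g0, hτ.one, nz_def]
      refine fun _ => ⟨by omega, ?_⟩
      rw [h3, Finset.sum_eq_sum_Ico_succ_bot hk, add_comm]
  · rintro τ - - ⟨-, h⟩
    simpa using (h (Nat.zero_le _)).2

/-- The array `1` receives the tour. -/
def output : Prog := .seq (blk [add 50 2 2]) (forDown 49 0 (.seq (blk [sub 51 0 49, sub 51 51 1,
  .store 1 51 50]) (.seq successor (blk [add 50 53 2]))))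

theorem output_runs {σ : State} {M : ℕ → ℕ} {m T : ℕ} (hB : (m + 1) * (m + 1) < cap B)
    (hL : m + 1 ≤ L) (h0 : σ.reg 0 = m + 1) (hM : ∀ i, σ.arr (0, i) = M i)
    {t : Fin (m + 1) → Fin (m + 1)} (ht : IsTour M t) (hT : tourWeight M t ≤ T)
    (h : ∀ i < (m + 1) * (m + 1), M i ≠ 0 → ¬ Feas m (Function.update M i 0) T) :
    Runs B L output σ (fun τ => ∀ i : Fin (m + 1), τ.arr (1, (i : ℕ)) = t i)
      ((m + 1) * ((m + 1) * 8 + 10) + 3) := by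
  refine Runs.of_ok fun hok => ?_
  have hn : m + 1 ≤ (m + 1) * (m + 1) := Nat.le_mul_self _
  -- The counter descends while the tour is written forwards, hence the position `m + 1 - k`. After
  -- the last round `Fin.ofNat` wraps around to `0`, in agreement with `finRotate`.
  refine Runs.loop (m + 1) (fun k τ => k ≤ m + 1 → (τ.reg 50 = t (Fin.ofNat (m + 1) (m + 1 - k)) ∧
      ∀ i : Fin (m + 1), (i : ℕ) + k < m + 1 → τ.arr (1, (i : ℕ)) = t i)) ((m + 1) * 8 + 8) rfl rfl
      ?_ (by simpa using h0) ?_ ?_ ?_ ?_ (by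
        change 1 + (m + 1) * ((m + 1) * 8 + 10) + 2 ≤ _
        omega)
  · simp [hok.zero]
    omega
  · intro k τ v h
    simpa using h
  · intro _
    simp [hok.zero, ht.1]
    intros
    omega
  · rintro k τ hk hτ hfr hI h49
    obtain ⟨h1, h2⟩ := hI hk
    have g0 := (hfr.reg 0 rfl).trans h0
    have gM : ∀ i, τ.arr (0, i) = M i := fun i => (hfr.arr 0 rfl i).trans (hM i)
    have hj : (Fin.ofNat (m + 1) (m + 1 - (k + 1)) : ℕ) = m - k := by
      rw [Fin.val_ofNat, Nat.mod_eq_of_lt (by omega)]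
      omega
    refine Runs.cons' ((m + 1) * 8 + 5) ?_ (fun ok₁ hf₁ => ?_) (by simp; omega)
    · simp [g0, h49, hτ.one]
      omega
    set σ₁ := Prog.run _ τ with hσ₁
    have k50 := (hf₁.reg 50 rfl).trans h1
    have k1 : ∀ i : Fin (m + 1), (i : ℕ) + k < m + 1 → σ₁.arr (1, (i : ℕ)) = t i := by
      intro i hi
      by_cases hik : (i : ℕ) = m - k
      · have e : i = Fin.ofNat (m + 1) (m + 1 - (k + 1)) := Fin.ext (hik.trans hj.symm)
        have e' : (i : ℕ) = m + 1 - k - 1 := by omega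
        simp [hσ₁, g0, h49, hτ.one, e']
        rw [h1, ← e]
      · have e' : (i : ℕ) ≠ m + 1 - k - 1 := by omega
        simp [hσ₁, g0, h49, hτ.one, e']
        exact h2 i (by omega)
    have l0 := (hf₁.reg 0 rfl).trans g0
    have lM : ∀ i, σ₁.arr (0, i) = M i := fun i => (hf₁.arr 0 rfl i).trans (gM i)
    clear_value σ₁
    refine Runs.seq' ((m + 1) * 8 + 4) 1 (successor_runs hB l0 k50 (t _).2 lM) ?_ (by omega)
    intro σ₂ ok₂ hf₂ h53
    rw [sum_successor ht hT h] at h53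
    have b53 := ok₂.reg_lt 53
    refine Runs.straight ?_ ?_ le_rfl
    · simp [ok₂.zero, b53]
    · intro _
      simp only [blk, Prog.run, Op.eval, State.setReg_reg, State.setReg_arr, if_true, ok₂.zero,
        add_zero]
      refine ⟨?_, fun i hi => ?_⟩
      · rw [h53]
        congr 2
        rw [finRotate_apply]
        refine Fin.ext ?_
        rw [Fin.val_add, hj, Fin.val_ofNat]
        simp
        congr 1
        omega
      · rw [hf₂.arr 1 rfl]
        exact k1 i hi
  · rintro τ - - h i
    exact (h (Nat.zero_le _)).2 i i.2

/-- The memory holds the answer for the matrix `M`. -/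
def Answer (m : ℕ) (M : ℕ → ℕ) (τ : State) : Prop :=
  (τ.reg 0 = 0 ∧ ∀ t : Fin (m + 1) → Fin (m + 1), ¬ IsTour M t) ∨
  (τ.reg 0 = 1 ∧ ∃ t : Fin (m + 1) → Fin (m + 1), IsTour M t ∧
    (∀ i : Fin (m + 1), τ.arr (1, (i : ℕ)) = t i) ∧
    ∀ t' : Fin (m + 1) → Fin (m + 1), IsTour M t' → tourWeight M t ≤ tourWeight M t')

/-- Find an optimal tour; the register `4` bounds the weights. -/
def search : Prog := .seq (blk [mul 47 0 4, add 46 2 2, add 22 47 2]) (.seq oracle (.ite 23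
  (.seq (blk [sub 48 47 46]) (.seq (.while 48 halve) (.seq (blk [add 22 47 2])
    (.seq (.seq .skip (forDown 49 3 prune)) (.seq output (.const 0 1))))))
  (.const 0 0)))

/-- The time for the search. -/
def searchCost (n B c : ℕ) : ℕ := (B + n * n + 1) * (c + 7) + (n * (n * 8 + 10) + 3) + 14

theorem search_runs {P : Par} {σ : State} {M : ℕ → ℕ} {m p : ℕ} (hn : P.n = m + 1)
    (hP : P.Valid B L) (hS : P.Sound M p) (hσ : P.Holds M σ) (hM : ∀ i, M i - 1 ≤ σ.reg 4)
    (hU : σ.reg 4 < P.s * P.s) (hB : 2 * (P.n * (P.s * P.s)) < cap B) :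
    Runs B L search σ (Answer m M) (searchCost P.n B (P.oracleCost M B)) := by
  refine Runs.of_ok fun hok => ?_
  have hUn : P.n * σ.reg 4 < P.n * (P.s * P.s) := (Nat.mul_lt_mul_left hP.n_pos).2 hU
  -- Every tour meets this threshold, so the first call of the oracle decides whether there is a
  -- tour at all.
  have hw : ∀ t : Fin (m + 1) → Fin (m + 1), tourWeight M t ≤ P.n * σ.reg 4 := fun t => by
    calc _ ≤ ∑ _i : Fin (m + 1), σ.reg 4 := Finset.sum_le_sum fun i _ => hM _
      _ = _ := by simp [hn]
  unfold searchCost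
  set c := P.oracleCost M B with hc
  set o := P.n * (P.n * 8 + 10) + 3 with ho
  have e1 : (B + P.n * P.n + 1) * (c + 7) = B * (c + 7) + P.n * P.n * (c + 7) + (c + 7) := by ring
  refine Runs.cons' (c + B * (c + 7) + P.n * P.n * (c + 7) + o + 10) ?_ (fun ok₁ hf₁ => ?_)
    (by simp; omega)
  · simp [hσ.r0, hok.zero]
    omega
  set σ₁ := Prog.run _ σ with hσ₁
  have c₁ := hσ.frame hf₁ rfl rfl
  have g22 : σ₁.reg 22 = P.n * σ.reg 4 := by simp [hσ₁, hok.zero, hσ.r0]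
  have g47 : σ₁.reg 47 = P.n * σ.reg 4 := by simp [hσ₁, hσ.r0]
  have g46 : σ₁.reg 46 = 0 := by simp [hσ₁, hok.zero]
  clear_value σ₁
  refine Runs.seq' c (B * (c + 7) + P.n * P.n * (c + 7) + o + 10)
    (oracle_feas hn hP hS (Sub.refl M) c₁ g22 hUn) ?_ (by omega)
  intro σ₂ ok₂ hf₂ h23
  have c₂ := c₁.frame hf₂ rfl rfl
  replace g46 := (hf₂.reg 46 rfl).trans g46
  replace g47 := (hf₂.reg 47 rfl).trans g47
  clear hf₂ hf₁
  refine (Runs.ite (N := B * (c + 7) + P.n * P.n * (c + 7) + o + 9) (fun h => ?_) fun h => ?_).mono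
    (fun _ _ _ h => h) (by omega)
  swap
  · refine Runs.straight ?_ (Or.inl ⟨by simp, fun t ht => h23.2 ⟨t, ht, hw t⟩ h⟩) (by simp)
    simp [cap]
  have hF := h23.1 h
  refine Runs.cons' (B * (c + 7) + P.n * P.n * (c + 7) + o + 8) (by simp) (fun ok₃ hf₃ => ?_)
    (by simp; omega)
  set σ₃ := Prog.run _ σ₂ with hσ₃
  have c₃ := c₂.frame hf₃ rfl rfl
  have g48 : σ₃.reg 48 = σ₃.reg 47 := by simp [hσ₃, g46]
  replace g46 := (hf₃.reg 46 rfl).trans g46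
  replace g47 := (hf₃.reg 47 rfl).trans g47
  clear_value σ₃
  refine Runs.seq' (B * (c + 7) + 1) (P.n * P.n * (c + 7) + o + 7)
    (bisect_runs hn hP hS c₃ (g47 ▸ hF) g46 g48 hB (g47 ▸ hUn)) ?_ (by omega)
  rintro σ₄ ok₄ hf₄ ⟨hT, hmin, hlt⟩
  have c₄ := c₃.frame hf₄ rfl rfl
  have b47 := ok₄.reg_lt 47
  refine Runs.cons' (P.n * P.n * (c + 7) + o + 6) ?_ (fun ok₅ hf₅ => ?_) (by simp; omega)
  · simp [ok₄.zero, b47]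
  set σ₅ := Prog.run _ σ₄ with hσ₅
  have c₅ := c₄.frame hf₅ rfl rfl
  have k22 : σ₅.reg 22 = σ₄.reg 47 := by simp [hσ₅, ok₄.zero]
  clear_value σ₅
  refine Runs.seq' (P.n * P.n * (c + 7) + 3) (o + 3) (pruneLoop_runs hn hP hS c₅ k22 hlt hT) ?_
    (by omega)
  rintro σ₆ ok₆ hf₆ ⟨M', hsub, c₆, ⟨t, ht, htT⟩, hd⟩
  rw [hn] at hd
  have hnn := hP.nn_lt
  have hnL := hP.nn_le
  rw [hn] at hnn hnL
  have hn1 : m + 1 ≤ (m + 1) * (m + 1) := Nat.le_mul_self _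
  refine Runs.seq' o 1 ((output_runs hnn (by omega) (c₆.r0.trans hn) c₆.a0 ht htT hd).mono
    (fun _ _ _ h => h) (by rw [ho, hn])) ?_ (by omega)
  intro σ₇ ok₇ hf₇ hout
  refine Runs.straight ?_ (Or.inr ⟨by simp, t, ht.of_sub hsub, by simpa using hout, fun t' ht' => ?_⟩)
    le_rfl
  · simp [ok₇.one ▸ ok₇.reg_lt 1]
  · rw [tourWeight_sub hsub ht] at htT
    by_contra! hlt'
    exact hmin _ (hlt'.trans_le htT) ⟨t', ht', le_rfl⟩

/-! ### Degrees and hubs -/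

/-- The number of arcs. -/
def arcs (n : ℕ) (M : ℕ → ℕ) : ℕ := ∑ i ∈ Finset.range (n * n), nz (M i)

/-- The number of arcs to the vertex `v`. -/
def indeg (n : ℕ) (M : ℕ → ℕ) (v : ℕ) : ℕ := ∑ u ∈ Finset.range n, nz (M (u * n + v))

/-- The number of arcs from the vertex `r`. -/
def outdeg (n : ℕ) (M : ℕ → ℕ) (r : ℕ) : ℕ := ∑ v ∈ Finset.range n, nz (M (r * n + v))

/-- The number of vertices of indegree greater than `c`. -/
def above (n : ℕ) (M : ℕ → ℕ) (c : ℕ) : ℕ := ∑ v ∈ Finset.range n, nz (indeg n M v - c)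

theorem sum_nz_le (n : ℕ) (f : ℕ → ℕ) : ∑ v ∈ Finset.range n, nz (f v) ≤ n := by
  calc _ ≤ ∑ _v ∈ Finset.range n, 1 := Finset.sum_le_sum fun _ _ => nz_le_one _
    _ = n := by simp

theorem indeg_le (n : ℕ) (M : ℕ → ℕ) (v : ℕ) : indeg n M v ≤ n := sum_nz_le n _

theorem above_le (n : ℕ) (M : ℕ → ℕ) (c : ℕ) : above n M c ≤ n := sum_nz_le n _

/-- This makes `n` an admissible hub degree, so the search for the least one has a starting value.
-/
theorem above_self (n : ℕ) (M : ℕ → ℕ) : above n M n = 0 := by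
  refine Finset.sum_eq_zero fun v _ => ?_
  rw [Nat.sub_eq_zero_of_le (indeg_le n M v)]
  rfl

/-- The registers `4` and `5` receive the sum of the entries and the number of arcs. -/
def stats : Prog := .seq (blk [mul 3 0 0, add 21 0 1, add 4 2 2, add 5 2 2]) (forDown 36 3
  (blk [.load 50 0 36, add 4 4 50, sub 50 1 50, sub 50 1 50, add 5 5 50]))

theorem stats_runs {σ : State} {n : ℕ} {M : ℕ → ℕ} (hB : n * n + n + 1 < cap B)
    (hU : ∑ i ∈ Finset.range (n * n), M i < cap B) (h0 : σ.reg 0 = n)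
    (hM : ∀ i, σ.arr (0, i) = M i) :
    Runs B L stats σ (fun τ => τ.reg 3 = n * n ∧ τ.reg 21 = n + 1 ∧
      τ.reg 4 = ∑ i ∈ Finset.range (n * n), M i ∧ τ.reg 5 = arcs n M) (n * n * 7 + 6) := by
  refine Runs.of_ok fun hok => ?_
  refine Runs.loop (n * n) (fun k τ => τ.reg 3 = n * n ∧ τ.reg 21 = n + 1 ∧ (k ≤ n * n →
      τ.reg 4 = ∑ i ∈ Finset.Ico k (n * n), M i ∧
      τ.reg 5 = ∑ i ∈ Finset.Ico k (n * n), nz (M i))) 5 rfl rfl ?_ ?_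
      ?_ ?_ ?_ ?_ (by simp; omega)
  · simp [h0, hok.one, hok.zero]
    omega
  · simp [h0]
  · intro k τ v h
    simpa using h
  · intro _
    simp [h0, hok.one, hok.zero]
  · rintro k τ hk hτ hfr ⟨h1, h2, hI⟩ h36
    obtain ⟨h4, h5⟩ := hI hk
    have g0 : ∀ i, τ.arr (0, i) = M i := fun i => (hfr.arr 0 rfl i).trans (hM i)
    have b1 : ∑ i ∈ Finset.Ico k (n * n), M i ≤ ∑ i ∈ Finset.range (n * n), M i := by
      rw [← Nat.Ico_zero_eq_range]
      exact Finset.sum_le_sum_of_subset (Finset.Ico_subset_Ico_left (Nat.zero_le k))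
    have b2 : ∑ i ∈ Finset.Ico k (n * n), nz (M i) ≤ ∑ i ∈ Finset.Ico 0 (n * n), nz (M i) :=
      Finset.sum_le_sum_of_subset (Finset.Ico_subset_Ico_left (Nat.zero_le k))
    have b3 := sum_nz_le (n * n) M
    rw [← Nat.Ico_zero_eq_range] at b3
    rw [Finset.sum_eq_sum_Ico_succ_bot hk] at b1 b2
    refine Runs.straight ?_ ?_ (by simp)
    · simp [h4, h5, h36, g0, hτ.one, nz_def]
      omega
    · simp [h4, h5, h36, g0, hτ.one, nz_def]
      refine ⟨h1, h2, fun _ => ⟨?_, ?_⟩⟩ <;>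
        rw [Finset.sum_eq_sum_Ico_succ_bot hk, add_comm]
  · rintro τ - - ⟨h1, h2, h3⟩
    obtain ⟨h4, h5⟩ := h3 (Nat.zero_le _)
    exact ⟨h1, h2, by simpa using h4, by simpa [arcs] using h5⟩

/-- The registers `6` and `7` receive a degree bound and a threshold. -/
def threshold : Prog := .seq (.seq (blk [add 6 5 5, div 6 6 0, .const 7 8])
  (forDown 36 6 (add 7 7 7))) (blk [add 50 6 1, mul 7 7 50])

theorem threshold_runs {σ : State} {n m : ℕ} (hB : 8 * 2 ^ (2 * m / n) * (2 * m / n + 1) < cap B)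
    (hm : 2 * m < cap B) (h0 : σ.reg 0 = n) (h5 : σ.reg 5 = m) :
    Runs B L threshold σ (fun τ => τ.reg 6 = 2 * m / n ∧
      τ.reg 7 = 8 * 2 ^ (2 * m / n) * (2 * m / n + 1)) (2 * m * 3 + 7) := by
  have hD : 2 * m / n ≤ 2 * m := Nat.div_le_self _ _
  obtain ⟨D, hD'⟩ : ∃ D, D = 2 * m / n := ⟨_, rfl⟩
  rw [← hD'] at hB hD ⊢
  have hmm : m + m = 2 * m := (two_mul m).symm
  have hp : 1 ≤ 2 ^ D := Nat.one_le_two_pow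
  have hpD : 8 * 2 ^ D * 1 ≤ 8 * 2 ^ D * (D + 1) := Nat.mul_le_mul_left _ (by omega)
  have hpE : 1 * (D + 1) ≤ 8 * 2 ^ D * (D + 1) := Nat.mul_le_mul_right _ (by omega)
  refine Runs.seq' (2 * m * 3 + 5) 2 (Q := fun τ => τ.reg 6 = D ∧ τ.reg 7 = 8 * 2 ^ D)
    (Runs.loop D (fun k τ => τ.reg 6 = D ∧ (k ≤ D → τ.reg 7 = 8 * 2 ^ (D - k))) 1 rfl rfl
      ?_ ?_ ?_ ?_ ?_ ?_ (by
        change 3 + D * (1 + 2) + 2 ≤ _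
        omega)) ?_ (by omega)
  · simp [h5, hmm]
    omega
  · simp [h0, h5, hmm, hD']
  · intro k τ v h
    simpa using h
  · intro _
    simp [h0, h5, hmm, hD']
  · rintro k τ hk hτ hfr ⟨h1, hI⟩ h36
    have h2 := hI hk
    have e : 8 * 2 ^ (D - (k + 1)) + 8 * 2 ^ (D - (k + 1)) = 8 * 2 ^ (D - k) := by
      rw [show D - k = D - (k + 1) + 1 by omega, pow_succ]
      ring
    have b : 2 ^ (D - k) ≤ 2 ^ D := Nat.pow_le_pow_right two_pos (Nat.sub_le _ _)
    refine Runs.straight ?_ ?_ le_rfl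
    · simp [h2, e]
      omega
    · simp [h1, h2, e]
  · rintro τ - - ⟨h1, h2⟩
    exact ⟨h1, by simpa using h2 (Nat.zero_le _)⟩
  · rintro τ hτ - ⟨h1, h2⟩
    refine Runs.straight ?_ ?_ le_rfl
    · simp [h1, h2, hτ.one]
      omega
    · simp [h1, h2, hτ.one]

/-- The array `2` receives the indegrees. -/
def indegrees : Prog := .seq .skip (forDown 36 0 (.seq (.seq (.const 51 0) (forDown 37 0
  (blk [mul 52 37 0, add 52 52 36, .load 52 0 52, sub 52 1 52, sub 52 1 52, add 51 51 52])))
  (blk [.store 2 36 51])))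

theorem indegrees_runs {σ : State} {n : ℕ} {M : ℕ → ℕ} (hB : n * n + n + 1 < cap B) (hL : n ≤ L)
    (h0 : σ.reg 0 = n) (hM : ∀ i, σ.arr (0, i) = M i) :
    Runs B L indegrees σ (fun τ => ∀ v < n, τ.arr (2, v) = indeg n M v)
      (n * (n * 8 + 6) + 3) := by
  refine Runs.loop n (fun k τ => ∀ v < n, k ≤ v → τ.arr (2, v) = indeg n M v) (n * 8 + 4) rfl rfl
    trivial h0 ?_ ?_ ?_ ?_ (by
      change 1 + n * (n * 8 + 6) + 2 ≤ _
      omega)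
  · intro k τ v h
    simpa using h
  · intro _ v h1 h2
    omega
  · rintro k τ hk hτ hfr hI h36
    have g0 := (hfr.reg 0 rfl).trans h0
    have gM : ∀ i, τ.arr (0, i) = M i := fun i => (hfr.arr 0 rfl i).trans (hM i)
    refine Runs.seq' (n * 8 + 3) 1 (Q := fun υ => υ.reg 51 = indeg n M k) (Runs.loop n (fun j υ =>
      j ≤ n → υ.reg 51 = ∑ u ∈ Finset.Ico j n, nz (M (u * n + k))) 6 rfl rfl ⟨rfl, by simp [cap]⟩
      (by simpa using g0) ?_ ?_ ?_ ?_ (by simp; omega)) ?_ (by omega)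
    · intro k τ v h
      simpa using h
    · simp
    · rintro j υ hj hυ hfu hJ h37
      have h51 := hJ hj
      have l0 := (hfu.reg 0 rfl).trans g0
      have lM : ∀ i, υ.arr (0, i) = M i := fun i => (hfu.arr 0 rfl i).trans (gM i)
      have l36 := (hfu.reg 36 rfl).trans h36
      have b1 := mul_add_lt_mul hj hk
      have b2 : ∑ u ∈ Finset.Ico (j + 1) n, nz (M (u * n + k)) ≤
          ∑ u ∈ Finset.range n, nz (M (u * n + k)) := by
        rw [← Nat.Ico_zero_eq_range]
        exact Finset.sum_le_sum_of_subset (Finset.Ico_subset_Ico_left (Nat.zero_le _))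
      have b3 := sum_nz_le n fun u => M (u * n + k)
      have b4 := nz_le_one (M (j * n + k))
      refine Runs.straight ?_ ?_ (by simp)
      · simp [h51, h37, l36, l0, lM, hυ.one, nz_def]
        omega
      · simp [h51, h37, l36, l0, lM, hυ.one, nz_def]
        intro _
        rw [Finset.sum_eq_sum_Ico_succ_bot hj, add_comm]
    · rintro υ - - h
      simpa [indeg] using h (Nat.zero_le _)
    · intro υ hυ hfu h51
      have l36 := (hfu.reg 36 rfl).trans h36
      refine Runs.straight ?_ ?_ le_rfl
      · simp [l36]
        omega
      · intro v hv hkv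
        simp [l36]
        split_ifs with h
        · rw [h51, h]
        · rw [hfu.arr 2 rfl]
          exact hI v hv (by omega)
  · rintro τ - - h v hv
    exact h v hv (Nat.zero_le _)

/-- The register `8` receives the indegree above which a vertex is a hub. -/
def hubDegree : Prog := .seq (blk [add 8 0 2]) (forDown 38 21 (.seq (.seq (.const 51 0)
  (forDown 37 0 (blk [.load 52 2 37, sub 52 52 38, sub 52 1 52, sub 52 1 52, add 51 51 52])))
  (.seq (blk [mul 52 51 7, add 53 38 1, mul 52 52 53, sub 52 52 0])
  (.ite 52 .skip (add 8 38 2)))))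

/-- The candidates descend from `n` to `0`, and each admissible one overwrites register `8`; the
last one written is the least. Its minimality is needed in `hubDegree_le`. -/
theorem hubDegree_runs {σ : State} {n K : ℕ} {M : ℕ → ℕ} (hB : n * K * (n + 1) + n + 1 < cap B)
    (h0 : σ.reg 0 = n) (h7 : σ.reg 7 = K) (h21 : σ.reg 21 = n + 1)
    (h2 : ∀ v < n, σ.arr (2, v) = indeg n M v) :
    Runs B L hubDegree σ (fun τ => above n M (τ.reg 8) * K * (τ.reg 8 + 1) ≤ n ∧
      ∀ c < τ.reg 8, n < above n M c * K * (c + 1)) ((n + 1) * (n * 7 + 11) + 3) := by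
  refine Runs.of_ok fun hok => ?_
  refine Runs.loop (n + 1) (fun k τ => τ.reg 8 ≤ n ∧ above n M (τ.reg 8) * K * (τ.reg 8 + 1) ≤ n ∧
    ∀ c < τ.reg 8, k ≤ c → n < above n M c * K * (c + 1)) (n * 7 + 9) rfl rfl
    ?_ ?_ ?_ ?_ ?_ ?_ (by
      change 1 + (n + 1) * (n * 7 + 11) + 2 ≤ _
      omega)
  · simp [h0, hok.zero]
    omega
  · simpa using h21
  · intro k τ v h
    simpa using h
  · intro _
    simp [h0, hok.zero, above_self]
    omega
  · rintro k τ hk hτ hfr ⟨hI0, hI1, hI2⟩ h38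
    have g0 := (hfr.reg 0 rfl).trans h0
    have g7 := (hfr.reg 7 rfl).trans h7
    have g2 : ∀ v < n, τ.arr (2, v) = indeg n M v := fun v hv => (hfr.arr 2 rfl v).trans (h2 v hv)
    have hab := above_le n M k
    have hK : n * K * 1 ≤ n * K * (n + 1) := Nat.mul_le_mul_left _ (by omega)
    have b1 : above n M k * K ≤ n * K := Nat.mul_le_mul_right _ hab
    have b2 : above n M k * K * (k + 1) ≤ n * K * (n + 1) := Nat.mul_le_mul b1 hk
    refine Runs.seq' (n * 7 + 3) 6 (Q := fun υ => υ.reg 51 = above n M k) (Runs.loop n (fun j υ =>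
      j ≤ n → υ.reg 51 = ∑ v ∈ Finset.Ico j n, nz (indeg n M v - k)) 5 rfl rfl ⟨rfl, by simp [cap]⟩
      (by simpa using g0) ?_ ?_ ?_ ?_ (by simp; omega)) ?_ (by omega)
    · intro k τ v h
      simpa using h
    · simp
    · rintro j υ hj hυ hfu hJ h37
      have h51 := hJ hj
      have l2 := (hfu.arr 2 rfl j).trans (g2 j hj)
      have l38 := (hfu.reg 38 rfl).trans h38
      have b3 : ∑ v ∈ Finset.Ico (j + 1) n, nz (indeg n M v - k) ≤ above n M k := by
        rw [above, ← Nat.Ico_zero_eq_range]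
        exact Finset.sum_le_sum_of_subset (Finset.Ico_subset_Ico_left (Nat.zero_le _))
      have b4 := nz_le_one (indeg n M j - k)
      refine Runs.straight ?_ ?_ (by simp)
      · simp [h51, h37, l38, l2, hυ.one, nz_def]
        omega
      · simp [h51, h37, l38, l2, hυ.one, nz_def]
        intro _
        rw [Finset.sum_eq_sum_Ico_succ_bot hj, add_comm]
    · rintro υ - - h
      simpa [above] using h (Nat.zero_le _)
    · intro υ hυ hfu h51
      have l0 := (hfu.reg 0 rfl).trans g0
      have l7 := (hfu.reg 7 rfl).trans g7
      have l8 := hfu.reg 8 rfl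
      have l38 := (hfu.reg 38 rfl).trans h38
      refine Runs.cons' 2 ?_ (fun ok₁ hf₁ => ?_) (by simp)
      · simp [h51, l7, l38, hυ.one]
        omega
      set υ₁ := Prog.run _ υ with hυ₁
      have m8 := (hf₁.reg 8 rfl).trans l8
      have m38 := (hf₁.reg 38 rfl).trans l38
      have m52 : υ₁.reg 52 = above n M k * K * (k + 1) - n := by
        simp [hυ₁, h51, l7, l38, hυ.one, l0]
      clear_value υ₁
      refine Runs.ite (fun h => ?_) fun h => ?_
      · refine Runs.straight trivial ?_ le_rfl
        rw [Prog.run, m8]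
        refine ⟨hI0, hI1, fun c hc hkc => ?_⟩
        rcases hkc.eq_or_lt with rfl | hlt
        · omega
        · exact hI2 c hc hlt
      · refine Runs.straight ?_ ?_ le_rfl
        · simp [m38, ok₁.zero]
          omega
        · simp [m38, ok₁.zero]
          refine ⟨by omega, by omega, fun c hc hkc => by omega⟩
  · rintro τ - - ⟨-, h1, h2⟩
    exact ⟨h1, fun c hc => h2 c hc (Nat.zero_le _)⟩

/-- The array `3` receives the indicator function of the hubs, and the register `9` their
number. -/
def hubs : Prog := .seq (blk [add 9 2 2]) (forDown 36 0 (blk [.load 52 2 36, sub 52 52 8,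
  sub 52 1 52, sub 52 1 52, .store 3 36 52, add 9 9 52]))

theorem hubs_runs {σ : State} {n c : ℕ} {M : ℕ → ℕ} (hB : n + 1 < cap B) (hL : n ≤ L)
    (h0 : σ.reg 0 = n) (h8 : σ.reg 8 = c) (h2 : ∀ v < n, σ.arr (2, v) = indeg n M v)
    (h3 : ∀ i, σ.arr (3, i) = 0) :
    Runs B L hubs σ (fun τ => τ.reg 9 = above n M c ∧
      ∀ v, τ.arr (3, v) = if v < n then nz (indeg n M v - c) else 0) (n * 8 + 3) := by
  refine Runs.of_ok fun hok => ?_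
  refine Runs.loop n (fun k τ => (∀ v, τ.arr (3, v) = if k ≤ v ∧ v < n then nz (indeg n M v - c)
    else 0) ∧ (k ≤ n → τ.reg 9 = ∑ v ∈ Finset.Ico k n, nz (indeg n M v - c))) 6 rfl rfl ?_
    (by simpa using h0) ?_ ?_ ?_ ?_ (by simp; omega)
  · simp [hok.zero]
    omega
  · intro k τ v h
    simpa using h
  · intro _
    simp [hok.zero, h3]
  · rintro k τ hk hτ hfr ⟨hI1, hI2⟩ h36
    have h9 := hI2 hk
    have g2 := (hfr.arr 2 rfl k).trans (h2 k hk)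
    have g8 := (hfr.reg 8 rfl).trans h8
    have b3 : ∑ v ∈ Finset.Ico (k + 1) n, nz (indeg n M v - c) ≤ above n M c := by
      rw [above, ← Nat.Ico_zero_eq_range]
      exact Finset.sum_le_sum_of_subset (Finset.Ico_subset_Ico_left (Nat.zero_le _))
    have b4 := nz_le_one (indeg n M k - c)
    have hab := above_le n M c
    refine Runs.straight ?_ ?_ (by simp)
    · simp [h9, h36, g8, g2, hτ.one, nz_def]
      omega
    · simp [h9, h36, g8, g2, hτ.one, nz_def]
      refine ⟨fun v => ?_, fun _ => ?_⟩
      · by_cases hv : v = k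
        · subst hv
          simp [hk]
        · rw [if_neg hv, hI1]
          refine if_congr ?_ rfl rfl
          omega
      · rw [Finset.sum_eq_sum_Ico_succ_bot hk, add_comm]
  · rintro τ - - ⟨h1, h2⟩
    exact ⟨by simpa [above] using h2 (Nat.zero_le _), by simpa using h1⟩

/-! ### The greedy choice of infants -/

/-- The infants, flagged in `inf`, and their neighbors that are not hubs, flagged in `fl`: the
infants are vertices `≥ k` of outdegree at most `D`, they have disjoint neighborhoods, and there is
no further vertex `≥ k` that could be added. -/
structure Greedy (n D : ℕ) (M hub fl inf : ℕ → ℕ) (k : ℕ) : Prop where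
  fl_le : ∀ v, fl v ≤ 1
  inf_le : ∀ v, inf v ≤ 1
  inf_ge : ∀ r, inf r = 1 → k ≤ r ∧ r < n ∧ outdeg n M r ≤ D
  source : ∀ v, fl v = 1 → v < n ∧ hub v = 0 ∧ ∃ r, inf r = 1 ∧ M (r * n + v) ≠ 0
  nb : ∀ r, inf r = 1 → ∀ v < n, M (r * n + v) ≠ 0 → fl v = 1 ∨ hub v = 1
  disj : ∀ r, inf r = 1 → fl r = 0
  disjoint : ∀ r r', inf r = 1 → inf r' = 1 → r ≠ r' → ∀ v < n, M (r * n + v) ≠ 0 →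
    M (r' * n + v) ≠ 0 → hub v = 1
  maximal : ∀ r, k ≤ r → r < n → outdeg n M r ≤ D →
    ∃ v < n, (v = r ∨ M (r * n + v) ≠ 0 ∧ hub v = 0) ∧ (fl v = 1 ∨ inf v = 1)

/-- The indicator function of the arcs from `r` to vertices that are not hubs. -/
def nbr (n : ℕ) (M hub : ℕ → ℕ) (r v : ℕ) : ℕ := nz (M (r * n + v)) * (1 - hub v)

theorem nbr_le_one (n : ℕ) (M hub : ℕ → ℕ) (r v : ℕ) : nbr n M hub r v ≤ 1 := by
  have h1 := nz_le_one (M (r * n + v))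
  have h2 : 1 - hub v ≤ 1 := Nat.sub_le _ _
  unfold nbr
  nlinarith

theorem nbr_ne_zero {n r v : ℕ} {M hub : ℕ → ℕ} :
    nbr n M hub r v ≠ 0 ↔ M (r * n + v) ≠ 0 ∧ hub v = 0 := by
  rw [nbr, mul_ne_zero_iff]
  unfold nz
  omega

/-- The obstructions against making `r` an infant. -/
def conflict (n : ℕ) (M hub fl inf : ℕ → ℕ) (r : ℕ) : ℕ :=
  fl r + inf r + ∑ v ∈ Finset.range n, nbr n M hub r v * (fl v + inf v)

/-- If `k` has small outdegree, a positive `conflict` names a flagged vertex or infant that is `k`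
or one of its out-neighbors outside the hubs. That is the witness for maximality. -/
theorem Greedy.skip {n D k : ℕ} {M hub fl inf : ℕ → ℕ} (h : Greedy n D M hub fl inf (k + 1))
    (hk : k < n) (hc : outdeg n M k - D + conflict n M hub fl inf k ≠ 0) :
    Greedy n D M hub fl inf k where
  fl_le := h.fl_le
  inf_le := h.inf_le
  inf_ge r hr := ⟨by have := (h.inf_ge r hr).1; omega, (h.inf_ge r hr).2⟩
  source := h.source
  nb := h.nb
  disj := h.disj
  disjoint := h.disjoint
  maximal r hkr hr ho := by
    rcases hkr.eq_or_lt with rfl | hlt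
    swap
    · exact h.maximal r hlt hr ho
    have hu : ∀ v, fl v + inf v ≠ 0 → fl v = 1 ∨ inf v = 1 := fun v hv => by
      have := h.fl_le v
      have := h.inf_le v
      omega
    by_cases h0 : fl k + inf k = 0
    · have hs : ∑ v ∈ Finset.range n, nbr n M hub k v * (fl v + inf v) ≠ 0 := by
        unfold conflict at hc
        omega
      obtain ⟨v, hv, hne⟩ := Finset.exists_ne_zero_of_sum_ne_zero hs
      obtain ⟨h1, h2⟩ := mul_ne_zero_iff.1 hne
      exact ⟨v, Finset.mem_range.1 hv, Or.inr (nbr_ne_zero.1 h1), hu v h2⟩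
    · exact ⟨k, hk, Or.inl rfl, hu k h0⟩

/-- Without conflict, neither `k` nor an out-neighbor outside the hubs is flagged or an infant. So
the new neighbors are disjoint from the old ones and no infant becomes flagged; `hl` excludes that
`k` flags itself. -/
theorem Greedy.take {n D k : ℕ} {M hub fl inf fl' inf' : ℕ → ℕ}
    (h : Greedy n D M hub fl inf (k + 1)) (hub_le : ∀ v, hub v ≤ 1)
    (hk : k < n) (hc : outdeg n M k - D + conflict n M hub fl inf k = 0) (hl : M (k * n + k) = 0)
    (hfl : ∀ v, fl' v = fl v + if v < n then nbr n M hub k v else 0)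
    (hinf : ∀ v, inf' v = if v = k then 1 else inf v) :
    Greedy n D M hub fl' inf' k := by
  have hc1 : fl k = 0 ∧ inf k = 0 := by
    unfold conflict at hc
    omega
  have hc2 : ∀ v < n, nbr n M hub k v ≠ 0 → fl v = 0 ∧ inf v = 0 := by
    intro v hv hne
    have h1 : ∑ v ∈ Finset.range n, nbr n M hub k v * (fl v + inf v) = 0 := by
      unfold conflict at hc
      omega
    have h2 := (Finset.sum_eq_zero_iff.1 h1) v (Finset.mem_range.2 hv)
    rcases mul_eq_zero.1 h2 with h3 | h3 <;> omega
  have hfl1 : ∀ v, fl' v = 1 ↔ fl v = 1 ∨ v < n ∧ nbr n M hub k v ≠ 0 := by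
    intro v
    have b1 := nbr_le_one n M hub k v
    have b2 := h.fl_le v
    have b3 := hc2 v
    rw [hfl]
    split_ifs <;> omega
  have hinf1 : ∀ v, inf' v = 1 ↔ v = k ∨ inf v = 1 := by
    intro v
    rw [hinf]
    split_ifs with hv <;> simp [hv]
  refine ⟨fun v => ?_, fun v => ?_, fun r hr => ?_, fun v hv => ?_, fun r hr v hv hM => ?_,
    fun r hr => ?_, fun r r' hr hr' hne v hv h1 h2 => ?_, fun r hkr hr ho => ?_⟩
  · have b1 := nbr_le_one n M hub k v
    have b2 := h.fl_le v
    have b3 := hc2 v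
    rw [hfl]
    split_ifs <;> omega
  · have := h.inf_le v
    rw [hinf]
    split_ifs <;> omega
  · rcases (hinf1 r).1 hr with rfl | hr
    · exact ⟨le_rfl, hk, by omega⟩
    · exact ⟨by have := (h.inf_ge r hr).1; omega, (h.inf_ge r hr).2⟩
  · rcases (hfl1 v).1 hv with hv | ⟨hv, hne⟩
    · obtain ⟨h1, h2, r, h3, h4⟩ := h.source v hv
      exact ⟨h1, h2, r, (hinf1 r).2 (Or.inr h3), h4⟩
    · obtain ⟨h1, h2⟩ := nbr_ne_zero.1 hne
      exact ⟨hv, h2, k, (hinf1 k).2 (Or.inl rfl), h1⟩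
  · rw [hfl1]
    rcases (hinf1 r).1 hr with rfl | hr
    · by_cases hh : hub v = 0
      · exact Or.inl (Or.inr ⟨hv, nbr_ne_zero.2 ⟨hM, hh⟩⟩)
      · have := hub_le v
        omega
    · rcases h.nb r hr v hv hM with h1 | h1
      · exact Or.inl (Or.inl h1)
      · exact Or.inr h1
  · have : ¬ fl' r = 1 := by
      rw [hfl1]
      rcases (hinf1 r).1 hr with rfl | hr
      · rintro (h1 | ⟨-, h1⟩)
        · omega
        · exact (nbr_ne_zero.1 h1).1 hl
      · rintro (h1 | ⟨h1, h2⟩)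
        · have := h.disj r hr
          omega
        · have := hc2 r h1 h2
          omega
    have b1 := nbr_le_one n M hub k r
    have b2 := h.fl_le r
    have b3 := hc2 r
    rw [hfl] at this ⊢
    split_ifs at this ⊢ <;> omega
  · have key : ∀ r, inf r = 1 → M (r * n + v) ≠ 0 → M (k * n + v) ≠ 0 → hub v = 1 := by
      intro r hr h1 h2
      rcases h.nb r hr v hv h1 with h3 | h3
      · by_contra hh
        have := hub_le v
        have := hc2 v hv (nbr_ne_zero.2 ⟨h2, by omega⟩)
        omega
      · exact h3
    rcases (hinf1 r).1 hr with rfl | hr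
    · rcases (hinf1 r').1 hr' with rfl | hr'
      · exact absurd rfl hne
      · exact key r' hr' h2 h1
    · rcases (hinf1 r').1 hr' with rfl | hr'
      · exact key r hr h1 h2
      · exact h.disjoint r r' hr hr' hne v hv h1 h2
  · rcases hkr.eq_or_lt with rfl | hlt
    · exact ⟨k, hk, Or.inl rfl, Or.inr ((hinf1 k).2 (Or.inl rfl))⟩
    · obtain ⟨v, hv, h1, h2⟩ := h.maximal r hlt hr ho
      exact ⟨v, hv, h1, h2.imp (fun h => (hfl1 v).2 (Or.inl h)) fun h => (hinf1 v).2 (Or.inr h)⟩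

theorem Greedy.init (n D : ℕ) (M hub : ℕ → ℕ) : Greedy n D M hub (fun _ => 0) (fun _ => 0) n :=
  ⟨by simp, by simp, by simp, by simp, by simp, by simp, by simp,
    fun r h1 h2 => absurd h2 (by omega)⟩

/-- The register `50` receives zero if the vertex in the register `36` can be an infant. -/
def infantTest : Prog := .seq (.seq (blk [.load 54 4 36, .load 53 5 36, add 54 54 53, add 50 2 2])
  (forDown 37 0 (blk [mul 51 36 0, add 51 51 37, .load 51 0 51, sub 51 1 51, sub 51 1 51,
  add 50 50 51, .load 52 3 37, sub 52 1 52, mul 51 51 52, .load 52 4 37, .load 53 5 37,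
  add 52 52 53, mul 51 51 52, add 54 54 51]))) (blk [sub 50 50 6, add 50 50 54])

theorem infantTest_runs {σ : State} {n D r : ℕ} {M hub fl inf : ℕ → ℕ}
    (hB : n * n + 4 * n + 4 < cap B) (hr : r < n) (h0 : σ.reg 0 = n)
    (h6 : σ.reg 6 = D) (h36 : σ.reg 36 = r) (hM : ∀ i, σ.arr (0, i) = M i)
    (h3 : ∀ i, σ.arr (3, i) = hub i) (h4 : ∀ i, σ.arr (4, i) = fl i)
    (h5 : ∀ i, σ.arr (5, i) = inf i) (hfl : ∀ v, fl v ≤ 1) (hinf : ∀ v, inf v ≤ 1) :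
    Runs B L infantTest σ (fun τ => τ.reg 50 = outdeg n M r - D + conflict n M hub fl inf r)
      (n * 16 + 8) := by
  have c1 := hfl r
  have c2 := hinf r
  refine Runs.of_ok fun hok => ?_
  refine Runs.seq' (n * 16 + 6) 2 (Q := fun τ => τ.reg 50 ≤ n ∧ τ.reg 50 = outdeg n M r ∧
    τ.reg 54 ≤ 2 * n + 2 ∧ τ.reg 54 = conflict n M hub fl inf r) (Runs.loop n (fun j υ => j ≤ n →
      υ.reg 50 + j ≤ n ∧ υ.reg 50 = ∑ v ∈ Finset.Ico j n, nz (M (r * n + v)) ∧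
      υ.reg 54 + 2 * j ≤ 2 * n + 2 ∧
      υ.reg 54 = fl r + inf r + ∑ v ∈ Finset.Ico j n, nbr n M hub r v * (fl v + inf v)) 14 rfl rfl
      ?_ ?_ ?_ ?_ ?_ ?_ (by simp; omega)) ?_ (by omega)
  · simp [h36, h4, h5, hok.zero]
    omega
  · simpa using h0
  · intro k τ v h
    simpa using h
  · intro _
    simp [h36, h4, h5, hok.zero]
    omega
  · rintro j υ hj hυ hfu hJ h37
    obtain ⟨k1, k2, k3, k4⟩ := hJ hj
    have l0 := (hfu.reg 0 rfl).trans h0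
    have lM : ∀ i, υ.arr (0, i) = M i := fun i => (hfu.arr 0 rfl i).trans (hM i)
    have l3 : ∀ i, υ.arr (3, i) = hub i := fun i => (hfu.arr 3 rfl i).trans (h3 i)
    have l4 : ∀ i, υ.arr (4, i) = fl i := fun i => (hfu.arr 4 rfl i).trans (h4 i)
    have l5 : ∀ i, υ.arr (5, i) = inf i := fun i => (hfu.arr 5 rfl i).trans (h5 i)
    have l36 := (hfu.reg 36 rfl).trans h36
    have b1 := mul_add_lt_mul hr hj
    have b2 := nz_le_one (M (r * n + j))
    have b3 := nbr_le_one n M hub r j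
    have d1 := hfl j
    have d2 := hinf j
    have b4 : nbr n M hub r j * (fl j + inf j) ≤ 1 * 2 := Nat.mul_le_mul b3 (by omega)
    have e : nz (M (r * n + j)) * (1 - hub j) = nbr n M hub r j := rfl
    refine Runs.straight ?_ ?_ (by simp)
    · simp [h37, l36, l0, lM, l3, l4, l5, hυ.one, nz_def, e]
      omega
    · simp [h37, l36, l0, lM, l3, l4, l5, hυ.one, nz_def, e]
      refine fun _ => ⟨by omega, ?_, by omega, ?_⟩
      · rw [Finset.sum_eq_sum_Ico_succ_bot hj, k2, add_comm]
      · rw [Finset.sum_eq_sum_Ico_succ_bot hj, k4]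
        ring
  · rintro τ - - h
    obtain ⟨k1, k2, k3, k4⟩ := h (Nat.zero_le _)
    exact ⟨by omega, by simpa [outdeg] using k2, by omega, by simpa [conflict] using k4⟩
  · rintro τ hτ hf ⟨k1, k2, k3, k4⟩
    have g6 := (hf.reg 6 rfl).trans h6
    refine Runs.straight ?_ ?_ le_rfl
    · simp
      omega
    · simp [k2, k4, g6]

/-- Make the vertex in the register `36` an infant. -/
def infantMark : Prog := .seq (blk [.store 5 36 1]) (forDown 37 0 (blk [mul 51 36 0, add 51 51 37,
  .load 51 0 51, sub 51 1 51, sub 51 1 51, .load 52 3 37, sub 52 1 52, mul 51 51 52, .load 52 4 37,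
  add 52 52 51, .store 4 37 52]))

theorem infantMark_runs {σ : State} {n r : ℕ} {M hub fl inf : ℕ → ℕ}
    (hB : n * n + 4 * n + 4 < cap B) (hL : n ≤ L) (hr : r < n) (h0 : σ.reg 0 = n)
    (h36 : σ.reg 36 = r) (hM : ∀ i, σ.arr (0, i) = M i)
    (h3 : ∀ i, σ.arr (3, i) = hub i) (h4 : ∀ i, σ.arr (4, i) = fl i)
    (h5 : ∀ i, σ.arr (5, i) = inf i) (hfl : ∀ v, fl v ≤ 1) :
    Runs B L infantMark σ (fun τ =>
      (∀ v, τ.arr (4, v) = fl v + if v < n then nbr n M hub r v else 0) ∧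
      ∀ v, τ.arr (5, v) = if v = r then 1 else inf v) (n * 13 + 3) := by
  refine Runs.of_ok fun hok => ?_
  refine Runs.loop n (fun j υ => (∀ v, υ.arr (4, v) = fl v + if j ≤ v ∧ v < n then nbr n M hub r v
    else 0) ∧ ∀ v, υ.arr (5, v) = if v = r then 1 else inf v) 11 rfl rfl
      ?_ ?_ ?_ ?_ ?_ ?_ (by simp; omega)
  · simp [h36]
    omega
  · simpa using h0
  · intro k τ v h
    simpa using h
  · intro _
    simp [h36, h4, h5, hok.one]
  · rintro j υ hj hυ hfu ⟨k4, k5⟩ h37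
    have l0 := (hfu.reg 0 rfl).trans h0
    have lM : ∀ i, υ.arr (0, i) = M i := fun i => (hfu.arr 0 rfl i).trans (hM i)
    have l3 : ∀ i, υ.arr (3, i) = hub i := fun i => (hfu.arr 3 rfl i).trans (h3 i)
    have l36 := (hfu.reg 36 rfl).trans h36
    have b1 := mul_add_lt_mul hr hj
    have b2 := nz_le_one (M (r * n + j))
    have b3 := nbr_le_one n M hub r j
    have d1 := hfl j
    have k4j := k4 j
    rw [if_neg (by omega)] at k4j
    have e : nz (M (r * n + j)) * (1 - hub j) = nbr n M hub r j := rfl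
    refine Runs.straight ?_ ?_ (by simp)
    · simp [h37, l36, l0, lM, l3, k4j, hυ.one, nz_def, e]
      omega
    · simp [h37, l36, l0, lM, l3, k4j, hυ.one, nz_def, e]
      refine ⟨fun v => ?_, k5⟩
      by_cases hv : v = j
      · subst hv
        simp [hj]
      · rw [if_neg hv, k4]
        congr 1
        refine if_congr ?_ rfl rfl
        omega
  · rintro τ - - ⟨k4, k5⟩
    exact ⟨by simpa using k4, k5⟩

/-- The arrays `4` and `5` receive the flags of the infants and their neighbors. -/
def greedy : Prog := .seq .skip (forDown 36 0 (.seq infantTest (.ite 50 .skip infantMark)))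

theorem greedy_runs {σ : State} {n D : ℕ} {M hub : ℕ → ℕ}
    (hB : n * n + 4 * n + 4 < cap B) (hL : n ≤ L) (h0 : σ.reg 0 = n) (h6 : σ.reg 6 = D)
    (hM : ∀ i, σ.arr (0, i) = M i) (h3 : ∀ i, σ.arr (3, i) = hub i) (h4 : ∀ i, σ.arr (4, i) = 0)
    (h5 : ∀ i, σ.arr (5, i) = 0) (hl : ∀ v < n, M (v * n + v) = 0) (hub_le : ∀ v, hub v ≤ 1) :
    Runs B L greedy σ (fun τ => Greedy n D M hub (fun v => τ.arr (4, v)) (fun v => τ.arr (5, v)) 0)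
      (n * (n * 29 + 14) + 3) := by
  refine Runs.loop n (fun k τ => Greedy n D M hub (fun v => τ.arr (4, v)) (fun v => τ.arr (5, v)) k)
    (n * 29 + 12) rfl rfl trivial h0 ?_ ?_ ?_ ?_ (by
      change 1 + n * (n * 29 + 14) + 2 ≤ _
      omega)
  · intro k τ v h
    simpa using h
  · intro _
    simpa [h4, h5] using Greedy.init n D M hub
  · intro k τ hk hτ hfr hI h36
    have g0 := (hfr.reg 0 rfl).trans h0
    have g6 := (hfr.reg 6 rfl).trans h6
    have gM : ∀ i, τ.arr (0, i) = M i := fun i => (hfr.arr 0 rfl i).trans (hM i)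
    have g3 : ∀ i, τ.arr (3, i) = hub i := fun i => (hfr.arr 3 rfl i).trans (h3 i)
    refine Runs.seq' (n * 16 + 8) (n * 13 + 4) (infantTest_runs hB hk g0 g6 h36 gM g3
      (fun _ => rfl) (fun _ => rfl) hI.fl_le hI.inf_le) ?_ (by omega)
    intro υ hυ hf h50
    have e4 := hf.arr 4 rfl
    have e5 := hf.arr 5 rfl
    refine Runs.ite (fun h => ?_) fun h => ?_
    · refine Runs.straight trivial ?_ (by simp)
      simp only [Prog.run, e4, e5]
      exact hI.skip hk (h50 ▸ h)
    · refine (infantMark_runs hB hL hk ((hf.reg 0 rfl).trans g0) ((hf.reg 36 rfl).trans h36)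
        (fun i => (hf.arr 0 rfl i).trans (gM i)) (fun i => (hf.arr 3 rfl i).trans (g3 i))
        e4 e5 hI.fl_le).mono ?_ le_rfl
      rintro ω - - ⟨k4, k5⟩
      exact hI.take hub_le hk (h50 ▸ h) (hl k hk) k4 k5
  · exact fun _ _ _ h => h

/-! ### The numerical parameters -/

/-- The registers `10`, `11`, `12` receive the number of flags, and the numbers of sets of flagged
and unflagged vertices. -/
def powers : Prog := .seq (.seq (blk [add 10 2 2]) (forDown 36 0 (blk [.load 50 4 36, add 10 10 50])))
  (.seq (blk [sub 51 0 10]) (.seq (.seq (.const 11 1) (forDown 36 10 (add 11 11 11)))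
  (.seq (.const 12 1) (forDown 36 51 (add 12 12 12)))))

theorem double_runs {c₀ : Prog} {σ : State} {x y n : ℕ} (hB : 2 ^ n < cap B)
    (hc : c₀.safe B L σ) (hm : (c₀.run σ).reg y = n) (hx : okReg x = true) (hx36 : x ≠ 36)
    (h1 : (c₀.run σ).reg x = 1) :
    Runs B L (.seq c₀ (forDown 36 y (add x x x))) σ (fun τ => τ.reg x = 2 ^ n)
      (c₀.len + n * 3 + 2) := by
  refine Runs.loop n (fun k τ => k ≤ n → τ.reg x = 2 ^ (n - k)) 1 rfl ?_ hc hm ?_ ?_ ?_ ?_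
    (by omega)
  · rw [Bool.eq_false_iff]
    simpa [Prog.wr] using hx36
  · intro k τ v h
    simpa [hx36] using h
  · intro _ _
    simpa using h1
  · intro k τ hk hτ _ hI _
    have h2 := hI hk
    have e : 2 ^ (n - (k + 1)) + 2 ^ (n - (k + 1)) = 2 ^ (n - k) := by
      rw [show n - k = n - (k + 1) + 1 by omega, pow_succ]
      ring
    have b : 2 ^ (n - k) ≤ 2 ^ n := Nat.pow_le_pow_right two_pos (Nat.sub_le _ _)
    refine Runs.straight ⟨hx, ?_⟩ ?_ le_rfl
    · simp [h2, e]
      omega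
    · simp [h2, e]
  · intro τ _ _ h
    simpa using h (Nat.zero_le _)

theorem powers_runs {σ : State} {n : ℕ} {fl : ℕ → ℕ} (hB : 2 ^ n < cap B) (h0 : σ.reg 0 = n)
    (h4 : ∀ i, σ.arr (4, i) = fl i) (hfl : ∀ v, fl v ≤ 1) :
    Runs B L powers σ (fun τ => τ.reg 11 = 2 ^ ∑ v ∈ Finset.range n, fl v ∧
      τ.reg 12 = 2 ^ ∑ v ∈ Finset.range n, (1 - fl v)) (n * 10 + 11) := by
  refine Runs.of_ok fun hok => ?_
  have hn : n < 2 ^ n := Nat.lt_two_pow_self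
  have hsum : ∑ v ∈ Finset.range n, fl v + ∑ v ∈ Finset.range n, (1 - fl v) = n := by
    rw [← Finset.sum_add_distrib]
    calc _ = ∑ _v ∈ Finset.range n, 1 := Finset.sum_congr rfl fun v _ => by have := hfl v; omega
      _ = n := by simp
  set u := ∑ v ∈ Finset.range n, fl v with hu
  set z := ∑ v ∈ Finset.range n, (1 - fl v) with hz
  have hp : ∀ {a}, a ≤ n → 2 ^ a < cap B := fun h => (Nat.pow_le_pow_right two_pos h).trans_lt hB
  refine Runs.seq' (n * 4 + 3) (n * 6 + 8) (Q := fun τ => τ.reg 10 = u)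
    (Runs.loop n (fun k τ => k ≤ n → τ.reg 10 = ∑ v ∈ Finset.Ico k n, fl v) 2 rfl rfl
      ?_ ?_ ?_ ?_ ?_ ?_ (by simp; omega)) ?_ (by omega)
  · simp [hok.zero]
    omega
  · simpa using h0
  · intro k τ v h
    simpa using h
  · intro _
    simp [hok.zero]
  · intro k τ hk hτ hfr hI h36
    have h10 := hI hk
    have g4 := (hfr.arr 4 rfl k).trans (h4 k)
    have b1 : ∑ v ∈ Finset.Ico k n, fl v ≤ u := by
      rw [hu, ← Nat.Ico_zero_eq_range]
      exact Finset.sum_le_sum_of_subset (Finset.Ico_subset_Ico_left (Nat.zero_le _))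
    rw [Finset.sum_eq_sum_Ico_succ_bot hk] at b1
    refine Runs.straight ?_ ?_ le_rfl
    · simp [h36, g4, h10]
      omega
    · simp [h36, g4, h10]
      intro _
      rw [Finset.sum_eq_sum_Ico_succ_bot hk, add_comm]
  · intro τ _ _ h
    simpa [hu] using h (Nat.zero_le _)
  intro σ₁ ok₁ hf₁ h10
  have g0 := (hf₁.reg 0 rfl).trans h0
  refine Runs.cons' (u * 3 + z * 3 + 6) (by simp) (fun ok₂ hf₂ => ?_) (by simp; omega)
  set σ₂ := Prog.run _ σ₁ with hσ₂
  have h51 : σ₂.reg 51 = z := by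
    simp [hσ₂, g0, h10]
    omega
  replace h10 := (hf₂.reg 10 rfl).trans h10
  clear_value σ₂
  have h1 := ok₂.one ▸ ok₂.reg_lt 1
  refine Runs.seq' (1 + u * 3 + 2) (z * 3 + 3) (double_runs (n := u) (x := 11) (hp (by omega))
    (by simpa using h1) (by simpa using h10) rfl (by omega) (by simp)) ?_ (by omega)
  rintro σ₃ ok₃ hf₃ h11
  replace h51 := (hf₃.reg 51 rfl).trans h51
  exact (double_runs (n := z) (x := 12) (hp (by omega)) (by simpa using h1) (by simpa using h51) rfl
    (by omega) (by simp)).mono (fun τ _ hf h => ⟨(hf.reg 11 rfl).trans h11, h⟩) (by simp; omega)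

/-- The register `13` receives the least number whose square exceeds the register `4`. -/
def base : Prog := .seq (blk [.const 13 1, add 50 4 1, sub 50 50 1]) (.while 50 (blk [add 13 13 1,
  add 50 4 1, mul 51 13 13, sub 50 50 51]))

/-- A linear search suffices: a number of rounds proportional to the total weight is within the
allowed time. -/
theorem base_runs {σ : State} {U : ℕ} (hB : (U + 1) * (U + 1) < cap B) (h4 : σ.reg 4 = U) :
    Runs B L base σ (fun τ => 0 < τ.reg 13 ∧ U < τ.reg 13 * τ.reg 13 ∧
      (τ.reg 13 - 1) * (τ.reg 13 - 1) ≤ U) (U * 5 + 4) := by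
  refine Runs.of_ok fun hok => ?_
  have hU : (U + 1) * 1 ≤ (U + 1) * (U + 1) := Nat.mul_le_mul_left _ (by omega)
  refine Runs.cons' (U * 5 + 1) ?_ (fun ok₁ hf₁ => ?_) (by simp; omega)
  · simp [h4, hok.one]
    omega
  set σ₁ := Prog.run _ σ with hσ₁
  refine (Runs.while (fun k τ => τ.reg 4 = U ∧ 0 < τ.reg 13 ∧ τ.reg 13 + k = U + 1 ∧
    τ.reg 50 = U + 1 - τ.reg 13 * τ.reg 13 ∧ (τ.reg 13 - 1) * (τ.reg 13 - 1) ≤ U) (N := 4)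
    ?_ ?_ U σ₁ ?_).mono ?_ (by omega)
  · rintro τ ⟨-, h1, h2, h3, -⟩
    rw [h3, show τ.reg 13 = U + 1 by omega]
    omega
  · rintro k τ hτ ⟨h0, h1, h2, h3, h5⟩ h6
    have b1 : (τ.reg 13 + 1) * (τ.reg 13 + 1) ≤ (U + 1) * (U + 1) :=
      Nat.mul_le_mul (by omega) (by omega)
    refine Runs.straight ?_ ?_ le_rfl
    · simp [h0, hτ.one]
      omega
    · simp [h0, hτ.one]
      omega
  · simp [hσ₁, h4, hok.one]
    omega
  · rintro τ - - ⟨h, k, -, h0, h1, h2, h3, h5⟩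
    exact ⟨h1, by omega, h5⟩

/-- The registers `14`, `15`, `16` receive a power of two above the product of the registers `13`
and `21`, its exponent, and its double. -/
def slackRange : Prog := .seq (.seq (blk [mul 53 21 13, .const 14 1, add 15 2 2, sub 50 53 14])
  (.while 50 (blk [add 14 14 14, add 15 15 1, sub 50 53 14]))) (blk [add 16 14 14])

/-- The exponent `b` serves as fuel through `b < 2 ^ b`. Having a power of two as the range of the
slacks allows the doubling in `slack`. -/
theorem slackRange_runs {σ : State} {x : ℕ} (hx : 0 < x) (hB : 4 * x < cap B)
    (h : σ.reg 21 * σ.reg 13 = x) :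
    Runs B L slackRange σ (fun τ => x ≤ 2 ^ τ.reg 15 ∧ 2 ^ τ.reg 15 < 2 * x ∧
      τ.reg 16 = 2 * 2 ^ τ.reg 15) (x * 4 + 6) := by
  refine Runs.of_ok fun hok => ?_
  refine Runs.seq' (x * 4 + 5) 1 (Q := fun τ => τ.reg 14 = 2 ^ τ.reg 15 ∧ x ≤ 2 ^ τ.reg 15 ∧
    2 ^ τ.reg 15 < 2 * x) ?_ ?_ (by omega)
  · refine Runs.cons' (x * 4 + 1) ?_ (fun ok₁ hf₁ => ?_) (by simp; omega)
    · simp [h, hok.zero]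
      omega
    set σ₁ := Prog.run _ σ with hσ₁
    refine (Runs.while (fun k τ => τ.reg 53 = x ∧ τ.reg 15 + k = x ∧ τ.reg 14 = 2 ^ τ.reg 15 ∧
      2 ^ τ.reg 15 < 2 * x ∧ τ.reg 50 = x - τ.reg 14) (N := 3)
      ?_ ?_ x σ₁ ?_).mono ?_ (by omega)
    · rintro τ ⟨-, h1, h2, h3, h4⟩
      have : τ.reg 15 < 2 ^ τ.reg 15 := Nat.lt_two_pow_self
      omega
    · rintro k τ hτ ⟨h0, h1, h2, h3, h4⟩ h5
      refine Runs.straight ?_ ?_ le_rfl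
      · simp [hτ.one]
        omega
      · simp [h0, hτ.one, pow_succ]
        omega
    · simp [hσ₁, h, hok.zero]
      omega
    · rintro τ - - ⟨h, k, -, h0, h1, h2, h3, h4⟩
      exact ⟨h2, by omega, h3⟩
  · rintro τ - - ⟨h1, h2, h3⟩
    refine Runs.straight ?_ ?_ le_rfl
    · simp
      omega
    · simp [h1]
      omega

/-- The register `50` receives the number of divisors of the register `17` between `2` and the
predecessor of the register `17`. -/
def divisors : Prog := .seq (blk [sub 52 17 1, sub 52 52 1, add 50 2 2]) (forDown 37 52
  (blk [add 53 37 1, add 53 53 1, div 54 17 53, mul 54 54 53, sub 54 17 54, sub 54 1 54,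
  add 50 50 54]))

theorem divisors_runs {σ : State} {x : ℕ} (hB : 2 < cap B) (hx : 2 ≤ x) (h17 : σ.reg 17 = x) :
    Runs B L divisors σ (fun τ => τ.reg 50 = 0 ↔ x.Prime) (x * 9 + 5) := by
  refine Runs.of_ok fun hok => ?_
  have hxB := h17 ▸ hok.reg_lt 17
  refine Runs.loop (x - 2) (fun k τ => k ≤ x - 2 → τ.reg 50 + k ≤ x - 2 ∧ (τ.reg 50 = 0 ↔
      ∀ d, k + 2 ≤ d → d < x → ¬ d ∣ x)) 7 rfl rfl ?_ ?_ ?_ ?_ ?_ ?_ (by simp; omega)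
  · simp [h17, hok.zero]
    omega
  · simp [h17, hok.one]
    omega
  · intro k τ v h
    simpa using h
  · intro _
    simp [hok.zero]
    intro d _ _
    omega
  · intro k τ hk hτ hfr hI h37
    obtain ⟨h1, h2⟩ := hI hk
    have g17 := (hfr.reg 17 rfl).trans h17
    have b1 := Nat.div_mul_le_self x (k + 1 + 1)
    have b2 : 1 - x % (k + 1 + 1) ≤ 1 := Nat.sub_le _ _
    refine Runs.straight ?_ ?_ (by simp)
    · simp [g17, h37, hτ.one]
      generalize 1 - x % (k + 1 + 1) = y at b2 ⊢
      omega
    · simp [g17, h37, hτ.one]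
      refine fun _ => ⟨by generalize 1 - x % (k + 1 + 1) = y at b2 ⊢; omega, ?_⟩
      have h5 : 1 - x % (k + 1 + 1) = 0 ↔ ¬ k + 2 ∣ x := by
        rw [Nat.dvd_iff_mod_eq_zero, Nat.sub_eq_zero_iff_le, Nat.one_le_iff_ne_zero]
      rw [h2, h5]
      constructor
      · rintro ⟨h3, h4⟩ d hd hdx
        rcases hd.eq_or_lt with rfl | hlt
        · exact h4
        · exact h3 d hlt hdx
      · intro h3
        exact ⟨fun d hd hdx => h3 d (by omega) hdx, h3 (k + 2) le_rfl (by omega)⟩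
  · intro τ _ _ h
    rw [(h (Nat.zero_le _)).2, Nat.prime_def_lt']
    exact ⟨fun h => ⟨hx, fun d hd => h d (by omega)⟩, fun h d hd => h.2 d (by omega)⟩

/-- The register `17` receives a prime above the product of the registers `21` and `16`. -/
def findPrime : Prog := .seq (blk [mul 17 21 16, .const 50 1]) (.while 50
  (.seq (add 17 17 1) divisors))

/-- Bertrand's postulate supplies a prime between `K` and `2 * K`, and each candidate is tested by
trial division. The quadratic time is affordable because `K` is only of the order of the base `s`,
up to a polynomial in `n`. -/
theorem findPrime_runs {σ : State} {K : ℕ} (hK : 0 < K) (hB : 2 * K + 2 < cap B)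
    (h : σ.reg 21 * σ.reg 16 = K) :
    Runs B L findPrime σ (fun τ => (τ.reg 17).Prime ∧ K < τ.reg 17 ∧ τ.reg 17 ≤ 2 * K)
      (K * (2 * K * 9 + 8) + 3) := by
  refine Runs.of_ok fun hok => ?_
  obtain ⟨p, hp, hKp, hp2⟩ := Nat.exists_prime_lt_and_le_two_mul K hK.ne'
  refine Runs.cons' ((p - K) * (2 * K * 9 + 8) + 1) ?_ (fun ok₁ hf₁ => ?_) ?_
  · simp [h]
    omega
  · set σ₁ := Prog.run _ σ with hσ₁
    refine (Runs.while (fun k τ => τ.reg 17 + k = p ∧ K ≤ τ.reg 17 ∧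
      (τ.reg 50 = 0 ↔ K < τ.reg 17 ∧ (τ.reg 17).Prime)) (N := 2 * K * 9 + 6 + 1)
      ?_ ?_ (p - K) σ₁ ?_).mono ?_ le_rfl
    · rintro τ ⟨h1, h2, h3⟩
      rw [add_zero] at h1
      rw [h3, h1]
      exact ⟨hKp, hp⟩
    · rintro k τ hτ ⟨h1, h2, h3⟩ h4
      refine Runs.cons' ((τ.reg 17 + 1) * 9 + 5) ?_ (fun ok₂ hf₂ => ?_) (by simp; omega)
      · simp [hτ.one]
        omega
      · have e : (Prog.run (add 17 17 1) τ).reg 17 = τ.reg 17 + 1 := by simp [hτ.one]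
        refine (divisors_runs (by omega) (by omega) e).mono ?_ le_rfl
        intro υ _ hf hd
        have e' := (hf.reg 17 rfl).trans e
        refine ⟨by omega, by omega, ?_⟩
        rw [hd, e']
        exact ⟨fun h => ⟨by omega, h⟩, fun h => h.2⟩
    · simp [hσ₁, h]
      omega
    · rintro τ - - ⟨h, k, -, h1, h2, h3⟩
      have := h3.1 h
      exact ⟨this.2, this.1, by omega⟩
  · have : (p - K) * (2 * K * 9 + 8) ≤ K * (2 * K * 9 + 8) := Nat.mul_le_mul_right _ (by omega)
    simp
    omega

/-- The registers `18`, `19`, `20` receive the number of evaluation points, the modulus and the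
exponent for the roots of unity. -/
def modulus : Prog := .seq (.seq (blk [sub 18 17 1, mul 20 17 17]) (forDown 36 0 (mul 20 20 17)))
  (blk [mul 19 20 17])

theorem modulus_runs {σ : State} {n p : ℕ} (hp : 0 < p) (hB : p ^ (n + 3) < cap B)
    (h0 : σ.reg 0 = n) (h17 : σ.reg 17 = p) :
    Runs B L modulus σ (fun τ => τ.reg 18 = p - 1 ∧ τ.reg 19 = p ^ (n + 3) ∧
      τ.reg 20 = p ^ (n + 2)) (n * 3 + 5) := by
  refine Runs.of_ok fun hok => ?_
  have hpow : ∀ a ≤ n + 3, p ^ a < cap B := fun a ha => (Nat.pow_le_pow_right hp ha).trans_lt hB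
  refine Runs.seq' (n * 3 + 4) 1 (Q := fun τ => τ.reg 18 = p - 1 ∧ τ.reg 20 = p ^ (n + 2))
    (Runs.loop n (fun k τ => τ.reg 18 = p - 1 ∧ (k ≤ n → τ.reg 20 = p ^ (n - k + 2))) 1 rfl rfl
      ?_ ?_ ?_ ?_ ?_ ?_ (by simp; omega)) ?_ (by omega)
  · have := hpow 2 (by omega)
    simp [h17, ← sq, this]
  · simpa using h0
  · intro k τ v h
    simpa using h
  · intro _
    simp [h17, sq, hok.one]
  · rintro k τ hk hτ hfr ⟨h1, hI⟩ h36
    have h20 := hI hk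
    have g17 := (hfr.reg 17 rfl).trans h17
    have e : p ^ (n - (k + 1) + 2) * p = p ^ (n - k + 2) := by
      rw [← pow_succ]
      congr 1
      omega
    refine Runs.straight ?_ ?_ le_rfl
    · simpa [h20, g17, e] using hpow (n - k + 2) (by omega)
    · simp [h1, h20, g17, e]
  · rintro τ - - ⟨h1, h2⟩
    exact ⟨h1, by simpa using h2 (Nat.zero_le _)⟩
  · rintro τ - hf ⟨h1, h2⟩
    have g17 := (hf.reg 17 rfl).trans h17
    have e : p ^ (n + 2) * p = p ^ (n + 3) := (pow_succ _ _).symm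
    refine Runs.straight ?_ ?_ le_rfl
    · simpa [h2, g17, e] using hB
    · simp [h1, h2, g17, e]

/-! ### The set-up as a whole -/

/-- The sum of the entries of the matrix. -/
def total (n : ℕ) (M : ℕ → ℕ) : ℕ := ∑ i ∈ Finset.range (n * n), M i

/-- The bound on the outdegree of infants. -/
def degBound (n : ℕ) (M : ℕ → ℕ) : ℕ := 2 * arcs n M / n

/-- The threshold for hubs. -/
def hubFactor (D : ℕ) : ℕ := 8 * 2 ^ D * (D + 1)

/-- The data `P` are computed from the matrix `M`, with the hub degree `Δ` and the prime `p`. -/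
structure Computed (n : ℕ) (M : ℕ → ℕ) (P : Par) (Δ p : ℕ) : Prop where
  n_eq : P.n = n
  sound : P.Sound M p
  lt_sq : total n M < P.s * P.s
  sq_le : (P.s - 1) * (P.s - 1) ≤ total n M
  p_le : p ≤ 8 * (n + 1) ^ 2 * P.s
  greedy : Greedy n (degBound n M) M P.hub P.fl P.inf 0
  a_eq : P.a = above n M Δ
  hub_eq : ∀ v < n, P.hub v = nz (indeg n M v - Δ)
  above_le : above n M Δ * hubFactor (degBound n M) * (Δ + 1) ≤ n
  lt_above : ∀ c < Δ, n < above n M c * hubFactor (degBound n M) * (c + 1)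

/-- Compute the hubs and the infants. -/
def graphPart : Prog := .seq stats (.seq threshold (.seq indegrees (.seq hubDegree (.seq hubs
  greedy))))

/-- Compute the numbers for the search. -/
def numberPart : Prog := .seq powers (.seq base (.seq slackRange (.seq findPrime modulus)))

/-- Compute the data for the search. -/
def setup : Prog := .seq graphPart numberPart

/-- A bound for the values in memory. -/
def bigBound (n U : ℕ) : ℕ := (8 * (n + 1) ^ 2 * (U + 1)) ^ (n + 3)

theorem le_bigBound (n U : ℕ) : 8 * (n + 1) ^ 2 * (U + 1) ≤ bigBound n U :=
  Nat.le_self_pow (by omega) _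

theorem arcs_le (n : ℕ) (M : ℕ → ℕ) : arcs n M ≤ n * n := sum_nz_le _ _

theorem degBound_le (n : ℕ) (M : ℕ → ℕ) : degBound n M ≤ 2 * n := by
  have := arcs_le n M
  refine Nat.div_le_of_le_mul ?_
  nlinarith

theorem hubFactor_le {n D : ℕ} (h : D ≤ 2 * n) : hubFactor D ≤ 8 * 4 ^ n * (2 * n + 1) := by
  have : 2 ^ D ≤ 4 ^ n := by
    rw [show 4 = 2 ^ 2 by norm_num, ← pow_mul]
    exact Nat.pow_le_pow_right two_pos h
  exact Nat.mul_le_mul (Nat.mul_le_mul_left _ this) (by omega)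

/-- Here costs that are quadratic in the base become linear in the total weight. -/
theorem base_facts {U s : ℕ} (h : (s - 1) * (s - 1) ≤ U) :
    s ≤ U + 1 ∧ s * s ≤ 2 * U + 2 := by
  rcases Nat.eq_zero_or_pos s with rfl | hs
  · omega
  obtain ⟨r, rfl⟩ : ∃ r, s = r + 1 := ⟨s - 1, by omega⟩
  rw [Nat.add_sub_cancel] at h
  have := Nat.le_mul_self r
  refine ⟨by omega, ?_⟩
  zify at *
  nlinarith [sq_nonneg ((r : ℤ) - 1)]

theorem graphPart_runs {σ : State} {n : ℕ} {M : ℕ → ℕ} (hn : 0 < n) (hL : n * n ≤ L)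
    (hB : 8 * (n + 1) ^ 2 < cap B) (hU : total n M < cap B)
    (hB' : n * (8 * 4 ^ n * (2 * n + 1)) * (n + 1) + n + 1 < cap B)
    (h0 : σ.reg 0 = n) (hM : ∀ i, σ.arr (0, i) = M i) (hl : ∀ v < n, M (v * n + v) = 0)
    (h3 : ∀ i, σ.arr (3, i) = 0) (h4 : ∀ i, σ.arr (4, i) = 0) (h5 : ∀ i, σ.arr (5, i) = 0) :
    Runs B L graphPart σ (fun τ => (τ.reg 3 = n * n ∧ τ.reg 4 = total n M ∧ τ.reg 21 = n + 1) ∧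
      (∀ v, τ.arr (3, v) ≤ 1) ∧ Greedy n (degBound n M) M (fun v => τ.arr (3, v))
        (fun v => τ.arr (4, v)) (fun v => τ.arr (5, v)) 0 ∧
      ∃ Δ, τ.reg 9 = above n M Δ ∧ (∀ v < n, τ.arr (3, v) = nz (indeg n M v - Δ)) ∧
        above n M Δ * hubFactor (degBound n M) * (Δ + 1) ≤ n ∧
        ∀ c < Δ, n < above n M c * hubFactor (degBound n M) * (c + 1))
      (100 * (n + 1) ^ 2) := by
  have hnL : n ≤ L := (Nat.le_mul_self n).trans hL
  have e2 : (n + 1) ^ 2 = n * n + 2 * n + 1 := by ring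
  have hD := degBound_le n M
  have hm := arcs_le n M
  have hK := hubFactor_le hD
  have hK1 : n * hubFactor (degBound n M) * (n + 1) ≤ n * (8 * 4 ^ n * (2 * n + 1)) * (n + 1) :=
    Nat.mul_le_mul_right _ (Nat.mul_le_mul_left _ hK)
  have hK2 : 1 * hubFactor (degBound n M) * 1 ≤ n * hubFactor (degBound n M) * (n + 1) :=
    Nat.mul_le_mul (Nat.mul_le_mul_right _ hn) (by omega)
  rw [e2] at hB ⊢
  have e3 : ∀ c d : ℕ, n * (n * c + d) = (n * n) * c + n * d := fun c d => by ring
  have e4 : (n + 1) * (n * 7 + 11) = (n * n) * 7 + n * 18 + 11 := by ring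
  refine Runs.seq' (n * n * 7 + 6) (84 * (n * n) + 100 * n + 50) (stats_runs (by omega) hU h0 hM) ?_
    (by omega)
  rintro σ₁ ok₁ hf₁ ⟨a3, a21, a4, a5⟩
  have a0 := (hf₁.reg 0 rfl).trans h0
  refine Runs.seq' (2 * arcs n M * 3 + 7) (72 * (n * n) + 100 * n + 40) (threshold_runs
    (by rw [← degBound, ← hubFactor]; omega) (by omega) a0 a5) ?_ (by omega)
  rintro σ₂ ok₂ hf₂ ⟨b6, b7⟩
  rw [← degBound] at b6 b7
  have b0 := (hf₂.reg 0 rfl).trans a0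
  have b3 := (hf₂.reg 3 rfl).trans a3
  have b4 := (hf₂.reg 4 rfl).trans a4
  have b21 := (hf₂.reg 21 rfl).trans a21
  have bM : ∀ i, σ₂.arr (0, i) = M i := fun i =>
    ((hf₂.arr 0 rfl i).trans (hf₁.arr 0 rfl i)).trans (hM i)
  refine Runs.seq' (n * (n * 8 + 6) + 3) (60 * (n * n) + 80 * n + 35)
    (indegrees_runs (by omega) hnL b0 bM) ?_ (by rw [e3]; omega)
  rintro σ₃ ok₃ hf₃ c2
  have c0 := (hf₃.reg 0 rfl).trans b0
  refine Runs.seq' ((n + 1) * (n * 7 + 11) + 3) (50 * (n * n) + 50 * n + 20) (hubDegree_runs (by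
    rw [← hubFactor]; omega) c0 ((hf₃.reg 7 rfl).trans b7)
    ((hf₃.reg 21 rfl).trans b21) c2) ?_ (by rw [e4]; omega)
  rintro σ₄ ok₄ hf₄ ⟨d1, d2⟩
  have d0 := (hf₄.reg 0 rfl).trans c0
  refine Runs.seq' (n * 8 + 3) (40 * (n * n) + 40 * n + 10) (hubs_runs (by omega) hnL d0 rfl
    (fun v hv => (hf₄.arr 2 rfl v).trans (c2 v hv)) (fun i => by
      rw [hf₄.arr 3 rfl, hf₃.arr 3 rfl, hf₂.arr 3 rfl, hf₁.arr 3 rfl, h3])) ?_ (by omega)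
  rintro σ₅ ok₅ hf₅ ⟨e9, e3'⟩
  have e0 := (hf₅.reg 0 rfl).trans d0
  have eM : ∀ i, σ₅.arr (0, i) = M i := fun i => by
    rw [hf₅.arr 0 rfl, hf₄.arr 0 rfl, hf₃.arr 0 rfl, bM]
  have hub_le : ∀ v, σ₅.arr (3, v) ≤ 1 := fun v => by
    rw [e3']
    split_ifs
    exacts [nz_le_one _, Nat.zero_le 1]
  refine (greedy_runs (D := degBound n M) (by omega) hnL e0
    (by rw [hf₅.reg 6 rfl, hf₄.reg 6 rfl, hf₃.reg 6 rfl, b6]) eM (fun _ => rfl)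
    (fun i => by
      rw [hf₅.arr 4 rfl, hf₄.arr 4 rfl, hf₃.arr 4 rfl, hf₂.arr 4 rfl, hf₁.arr 4 rfl, h4])
    (fun i => by
      rw [hf₅.arr 5 rfl, hf₄.arr 5 rfl, hf₃.arr 5 rfl, hf₂.arr 5 rfl, hf₁.arr 5 rfl, h5]) hl
    hub_le).mono ?_ (by rw [e3]; omega)
  intro τ ok₆ hf₆ hG
  have k3 : ∀ v, τ.arr (3, v) = σ₅.arr (3, v) := hf₆.arr 3 rfl
  refine ⟨⟨?_, ?_, ?_⟩, fun v => by rw [k3]; exact hub_le v, ?_, σ₄.reg 8,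
    (hf₆.reg 9 rfl).trans e9, fun v hv => by rw [k3, e3', if_pos hv], d1, d2⟩
  · rw [hf₆.reg 3 rfl, hf₅.reg 3 rfl, hf₄.reg 3 rfl, hf₃.reg 3 rfl, b3]
  · rw [hf₆.reg 4 rfl, hf₅.reg 4 rfl, hf₄.reg 4 rfl, hf₃.reg 4 rfl, b4, total]
  · rw [hf₆.reg 21 rfl, hf₅.reg 21 rfl, hf₄.reg 21 rfl, hf₃.reg 21 rfl, b21]
  · simp only [k3]
    exact hG

theorem numberPart_runs {σ : State} {n U : ℕ} {fl : ℕ → ℕ} (hn : 0 < n)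
    (hB : 2 * (bigBound n U * bigBound n U) < cap B) (h2n : 2 ^ n < cap B)
    (h0 : σ.reg 0 = n) (hr4 : σ.reg 4 = U) (h21 : σ.reg 21 = n + 1)
    (h4 : ∀ i, σ.arr (4, i) = fl i) (hfl : ∀ v, fl v ≤ 1) :
    Runs B L numberPart σ (fun τ => ∃ s b p, (p.Prime ∧ 0 < s ∧ U < s * s ∧
        (s - 1) * (s - 1) ≤ U ∧ (n + 1) * s ≤ 2 ^ b ∧ 2 * (n + 1) * 2 ^ b < p ∧
        p ≤ 8 * (n + 1) ^ 2 * s ∧ p ^ (n + 3) ≤ bigBound n U ∧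
        8 * (n + 1) ^ 2 * s ≤ bigBound n U) ∧
      (τ.reg 11 = 2 ^ ∑ v ∈ Finset.range n, fl v ∧
        τ.reg 12 = 2 ^ ∑ v ∈ Finset.range n, (1 - fl v)) ∧ τ.reg 13 = s ∧ τ.reg 15 = b ∧
        τ.reg 16 = 2 * 2 ^ b ∧ τ.reg 18 = p - 1 ∧ τ.reg 19 = p ^ (n + 3) ∧ τ.reg 20 = p ^ (n + 2))
      (900 * ((n + 1) ^ 4 * (U + 1))) := by
  obtain ⟨X, hX⟩ : ∃ X, X = bigBound n U := ⟨_, rfl⟩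
  have hN := le_bigBound n U
  rw [← hX] at hN hB ⊢
  have i2 : 8 * 1 * (U + 1) ≤ 8 * (n + 1) ^ 2 * (U + 1) :=
    Nat.mul_le_mul_right _ (Nat.mul_le_mul_left _ (Nat.one_le_pow _ _ (by omega)))
  have hXX : X * 1 ≤ X * X := Nat.mul_le_mul_left _ (by omega)
  obtain ⟨F, hF⟩ : ∃ F, F = (n + 1) ^ 4 * (U + 1) := ⟨_, rfl⟩
  rw [← hF]
  have i4 : (n + 1) * 1 ≤ F := hF ▸ Nat.mul_le_mul (Nat.le_self_pow (by omega) _) (by omega)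
  have i5 : 1 * (U + 1) ≤ F := hF ▸ Nat.mul_le_mul_right _ (Nat.one_le_pow _ _ (by omega))
  refine Runs.seq' (n * 10 + 11) (860 * F) (powers_runs h2n h0 h4 hfl) ?_ (by omega)
  rintro σ₇ ok₇ hf₇ ⟨g11, g12⟩
  refine Runs.seq' (U * 5 + 4) (850 * F) (base_runs (U := U) (by
      have : (U + 1) * (U + 1) ≤ X * X := Nat.mul_le_mul (by omega) (by omega)
      omega)
    (by rw [hf₇.reg 4 rfl, hr4])) ?_ (by omega)
  rintro σ₈ ok₈ hf₈ ⟨k1, k2, k3⟩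
  obtain ⟨s, hs⟩ : ∃ s, σ₈.reg 13 = s := ⟨_, rfl⟩
  rw [hs] at k1 k2 k3
  obtain ⟨s1, s2⟩ := base_facts k3
  have g21 : σ₈.reg 21 = n + 1 := by rw [hf₈.reg 21 rfl, hf₇.reg 21 rfl, h21]
  have j1 : 8 * (n + 1) ^ 2 * s ≤ 8 * (n + 1) ^ 2 * (U + 1) := Nat.mul_le_mul_left _ s1
  have j2 : (n + 1) * s ≤ (n + 1) ^ 2 * s :=
    Nat.mul_le_mul_right _ (Nat.le_self_pow (by omega) _)
  have j3 : (n + 1) * s ≤ F := hF ▸ Nat.mul_le_mul (Nat.le_self_pow (by omega) _) s1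
  have j5 : 8 * (n + 1) ^ 2 * s = 8 * ((n + 1) ^ 2 * s) := mul_assoc _ _ _
  obtain ⟨Y, hY⟩ : ∃ Y, Y = 8 * (n + 1) ^ 2 * s := ⟨_, rfl⟩
  -- `Y` will bound the prime. The use of two digits pays off here: `s * s` is at most `2 * U + 2`.
  have j4 : Y * Y ≤ 128 * F := by
    calc _ = 64 * (n + 1) ^ 4 * (s * s) := by rw [hY]; ring
      _ ≤ 64 * (n + 1) ^ 4 * (2 * U + 2) := Nat.mul_le_mul_left _ s2
      _ = 128 * F := by rw [hF]; ring
  have j6 := Nat.le_mul_self Y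
  refine Runs.seq' ((n + 1) * s * 4 + 6) (840 * F) (slackRange_runs (x := (n + 1) * s)
    (Nat.mul_pos (by omega) k1) (by omega) (by rw [g21, hs])) ?_ (by omega)
  rintro σ₉ ok₉ hf₉ ⟨l1, l2, l16⟩
  obtain ⟨b, hb⟩ : ∃ b, σ₉.reg 15 = b := ⟨_, rfl⟩
  rw [hb] at l1 l2 l16
  have l21 := (hf₉.reg 21 rfl).trans g21
  obtain ⟨K, hK⟩ : ∃ K, K = (n + 1) * (2 * 2 ^ b) := ⟨_, rfl⟩
  have hb1 : 1 ≤ 2 ^ b := Nat.one_le_two_pow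
  have hK0 : 0 < K := hK ▸ Nat.mul_pos (by omega) (by omega)
  -- The power `2 ^ b` is less than twice `(n + 1) * s`, which makes `K` less than `4 * (n + 1) ^ 2
  -- * s`.
  have hKY : 2 * K + 2 ≤ Y := by
    have h1 : (n + 1) * (2 ^ b + 1) ≤ (n + 1) * (2 * ((n + 1) * s)) := Nat.mul_le_mul_left _ l2
    have h2 : (n + 1) * (2 * ((n + 1) * s)) = 2 * ((n + 1) ^ 2 * s) := by ring
    have h3 : K = 2 * ((n + 1) * 2 ^ b) := by rw [hK]; ring
    have h4 : (n + 1) * (2 ^ b + 1) = (n + 1) * 2 ^ b + (n + 1) := by ring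
    omega
  have hKK : K * (2 * K * 9 + 8) ≤ 640 * F := by
    have : K * (2 * K * 9 + 8) ≤ 5 * (Y * Y) := by
      have h1 : (2 * K) * (2 * K * 9 + 8) ≤ Y * (9 * Y) := Nat.mul_le_mul (by omega) (by omega)
      have h2 : (2 * K) * (2 * K * 9 + 8) = 2 * (K * (2 * K * 9 + 8)) := by ring
      have h3 : Y * (9 * Y) = 9 * (Y * Y) := by ring
      omega
    omega
  refine Runs.seq' (K * (2 * K * 9 + 8) + 3) (20 * F) (findPrime_runs hK0 (by omega)
    (by rw [l21, l16, hK])) ?_ (by omega)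
  rintro τ₁ oj₁ hg₁ ⟨hp, hKp, hpK⟩
  obtain ⟨p, hp17⟩ : ∃ p, τ₁.reg 17 = p := ⟨_, rfl⟩
  rw [hp17] at hp hKp hpK
  have hpX : p ^ (n + 3) ≤ X := hX ▸ Nat.pow_le_pow_left (by omega) _
  have m0 : τ₁.reg 0 = n := by
    rw [hg₁.reg 0 rfl, hf₉.reg 0 rfl, hf₈.reg 0 rfl, hf₇.reg 0 rfl, h0]
  refine (modulus_runs hp.pos (by omega) m0 hp17).mono ?_ (by omega)
  rintro υ ou hh ⟨n18, n19, n20⟩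
  refine ⟨s, b, p, ⟨hp, k1, k2, k3, l1, ?_, by omega, hpX, by omega⟩, ⟨?_, ?_⟩, ?_, ?_, ?_,
    n18, n19, n20⟩
  · have : 2 * (n + 1) * 2 ^ b = K := by rw [hK]; ring
    omega
  · rw [hh.reg _ rfl, hg₁.reg _ rfl, hf₉.reg _ rfl, hf₈.reg _ rfl, g11]
  · rw [hh.reg _ rfl, hg₁.reg _ rfl, hf₉.reg _ rfl, hf₈.reg _ rfl, g12]
  · rw [hh.reg _ rfl, hg₁.reg _ rfl, hf₉.reg _ rfl, hs]
  · rw [hh.reg _ rfl, hg₁.reg _ rfl, hb]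
  · rw [hh.reg _ rfl, hg₁.reg _ rfl, l16]

theorem setup_runs {σ : State} {n : ℕ} {M : ℕ → ℕ} (hn : 0 < n) (hL : n * n ≤ L)
    (hB : 2 * (bigBound n (total n M) * bigBound n (total n M)) < cap B)
    (hB' : n * (8 * 4 ^ n * (2 * n + 1)) * (n + 1) + n + 1 < cap B)
    (h0 : σ.reg 0 = n) (hM : ∀ i, σ.arr (0, i) = M i) (hl : ∀ v < n, M (v * n + v) = 0)
    (h3 : ∀ i, σ.arr (3, i) = 0) (h4 : ∀ i, σ.arr (4, i) = 0) (h5 : ∀ i, σ.arr (5, i) = 0) :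
    Runs B L setup σ (fun τ => ∃ P Δ p, Computed n M P Δ p ∧ P.Valid B L ∧ P.Holds M τ ∧
      τ.reg 4 = total n M ∧ 2 * (P.n * (P.s * P.s)) < cap B)
      (1000 * ((n + 1) ^ 4 * (total n M + 1))) := by
  obtain ⟨U, hU⟩ : ∃ U, U = total n M := ⟨_, rfl⟩
  have hMU : ∀ i < n * n, M i ≤ U := fun i hi =>
    hU ▸ Finset.single_le_sum (fun _ _ => Nat.zero_le _) (Finset.mem_range.2 hi)
  obtain ⟨X, hX⟩ : ∃ X, X = bigBound n U := ⟨_, rfl⟩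
  have hN := le_bigBound n U
  rw [← hU] at hB ⊢
  rw [← hX] at hN hB
  have i1 : 8 * (n + 1) ^ 2 * 1 ≤ 8 * (n + 1) ^ 2 * (U + 1) := Nat.mul_le_mul_left _ (by omega)
  have i2 : 8 * 1 * (U + 1) ≤ 8 * (n + 1) ^ 2 * (U + 1) :=
    Nat.mul_le_mul_right _ (Nat.mul_le_mul_left _ (Nat.one_le_pow _ _ (by omega)))
  have hXX : X * 1 ≤ X * X := Nat.mul_le_mul_left _ (by omega)
  have e2 : (n + 1) ^ 2 = n * n + 2 * n + 1 := by ring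
  have hF : (n + 1) ^ 2 * 1 ≤ (n + 1) ^ 4 * (U + 1) :=
    Nat.mul_le_mul (Nat.pow_le_pow_right (by omega) (by omega)) (by omega)
  have h2n : 2 ^ n < cap B := by
    have h1 : 2 ^ n ≤ 4 ^ n := Nat.pow_le_pow_left (by omega) n
    have h2 : 1 * (8 * 4 ^ n * 1) * 1 ≤ n * (8 * 4 ^ n * (2 * n + 1)) * (n + 1) :=
      Nat.mul_le_mul (Nat.mul_le_mul hn (Nat.mul_le_mul_left _ (by omega))) (by omega)
    omega
  refine Runs.seq' (100 * (n + 1) ^ 2) (900 * ((n + 1) ^ 4 * (U + 1)))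
    (graphPart_runs hn hL (by omega) (by omega) hB' h0 hM hl h3 h4 h5) ?_ (by omega)
  rintro σ₁ ok₁ hf₁ ⟨⟨a3, a4, a21⟩, hub_le, hG, Δ, a9, ahub, d1, d2⟩
  rw [← hU] at a4
  have a0 := (hf₁.reg 0 rfl).trans h0
  refine (numberPart_runs hn (by rw [← hX]; exact hB) h2n a0 a4 a21 (fun _ => rfl) hG.fl_le).mono ?_ le_rfl
  rintro τ ok₂ hf₂ ⟨s, b, p, ⟨hp, k1, k2, k3, l1, hKp, hpY, hpX, hYX⟩, ⟨r11, r12⟩, r13, r15, r16,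
    r18, r19, r20⟩
  rw [← hX] at hpX hYX
  have hpp : p ≤ p ^ (n + 3) := Nat.le_self_pow (by omega) _
  have hp2 := hp.two_le
  have haa : above n M Δ ≤ n := above_le n M Δ
  have hub_sum : ∑ v ∈ Finset.range n, σ₁.arr (3, v) = above n M Δ :=
    Finset.sum_congr rfl fun v hv => ahub v (Finset.mem_range.1 hv)
  have hs8 : 8 * (n + 1) ^ 2 * s = 8 * ((n + 1) ^ 2 * s) := mul_assoc _ _ _
  have hs1 : 1 * s ≤ (n + 1) ^ 2 * s := Nat.mul_le_mul_right _ (by omega)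
  have hs2 : (n + 1) * s ≤ (n + 1) ^ 2 * s := Nat.mul_le_mul_right _ (Nat.le_self_pow (by omega) _)
  refine ⟨⟨n, above n M Δ, 2 ^ ∑ v ∈ Finset.range n, σ₁.arr (4, v),
    2 ^ ∑ v ∈ Finset.range n, (1 - σ₁.arr (4, v)), s, b, 2 * 2 ^ b, p - 1, p ^ (n + 3), p ^ (n + 2),
    fun v => σ₁.arr (3, v), fun v => σ₁.arr (4, v), fun v => σ₁.arr (5, v)⟩, Δ, p,
    ⟨rfl, ⟨hp, rfl, rfl, rfl, rfl, rfl, hub_le, hG.fl_le, hG.inf_le, hub_sum,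
      fun v _ => hG.disj v, fun r _ v hv h1 h2 => hG.nb r h1 v hv h2, k1, l1, rfl, ?_, fun i hi => ?_⟩,
      hU ▸ k2, hU ▸ k3, hpY, hG, rfl, ahub, d1, d2⟩,
    ⟨hn, ?_, ?_, k1, ?_, ?_, hL, ?_, ?_, hub_le, hG.fl_le, hG.inf_le⟩,
    ⟨(hf₂.reg 0 rfl).trans a0, (hf₂.reg 3 rfl).trans a3, (hf₂.reg 9 rfl).trans a9, r11, r12, r13,
      r15, r16, r18, r19, r20, (hf₂.reg 21 rfl).trans a21,
      fun i => ((hf₂.arr 0 rfl i).trans (hf₁.arr 0 rfl i)).trans (hM i),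
      hf₂.arr 3 rfl, hf₂.arr 4 rfl, hf₂.arr 5 rfl⟩, (hf₂.reg 4 rfl).trans a4, ?_⟩
  · change 2 * (n + 1) * 2 ^ b ≤ p - 1
    omega
  · change M i - 1 < s * s
    have := hMU i hi
    omega
  · change 1 < p ^ (n + 3)
    omega
  · change p - 1 < p ^ (n + 3)
    omega
  · change 2 * (p ^ (n + 3) * p ^ (n + 3)) < cap B
    have := Nat.mul_le_mul hpX hpX
    omega
  · change n * n < cap B
    omega
  · change s + 2 * 2 ^ b < cap B
    have : 1 * 2 ^ b ≤ (n + 1) * 2 ^ b := Nat.mul_le_mul_right _ (by omega)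
    have : 2 * (n + 1) * 2 ^ b = 2 * ((n + 1) * 2 ^ b) := mul_assoc _ _ _
    omega
  · change p - 1 + (p - 1) * above n M Δ < cap B
    have : (p - 1) * above n M Δ ≤ X * X := Nat.mul_le_mul (by omega) (by omega)
    omega
  · change 2 * (n * (s * s)) < cap B
    have : n * (s * s) ≤ X * X := by
      have h1 : n * s ≤ (n + 1) * s := Nat.mul_le_mul_right _ (by omega)
      calc n * (s * s) = (n * s) * s := by ring
        _ ≤ X * X := Nat.mul_le_mul (by omega) (by omega)
    omega

/-! ### The program for directed graphs -/

/-- The program for the traveling salesman problem on directed graphs. -/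
def solve : Prog := .seq (.const 1 1) (.seq setup search)

/-- The time of the program, in units of `(1 + B) ^ 2`. -/
def solveCost (n B U c : ℕ) : ℕ := 1000 * ((n + 1) ^ 4 * (U + 1)) + searchCost n B c + 1

/-- The memory holds the matrix `M` of an instance on `n` vertices, and nothing else. -/
structure Initial (n : ℕ) (M : ℕ → ℕ) (σ : State) : Prop where
  r0 : σ.reg 0 = n
  reg_eq : ∀ x ≠ 0, σ.reg x = 0
  a0 : ∀ i, σ.arr (0, i) = M i
  arr_eq : ∀ a ≠ 0, ∀ i, σ.arr (a, i) = 0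
  M_eq : ∀ i, n * n ≤ i → M i = 0
  loopless : ∀ v < n, M (v * n + v) = 0

theorem le_total {n i : ℕ} {M : ℕ → ℕ} (hi : i < n * n) : M i ≤ total n M :=
  Finset.single_le_sum (fun _ _ => Nat.zero_le _) (Finset.mem_range.2 hi)

theorem solve_exec {σ : State} {m : ℕ} {M : ℕ → ℕ} (hσ : Initial (m + 1) M σ)
    (hL : L = (m + 1) * (m + 1))
    (hB : 2 * (bigBound (m + 1) (total (m + 1) M) * bigBound (m + 1) (total (m + 1) M)) < cap B)
    (hB' : (m + 1) * (8 * 4 ^ (m + 1) * (2 * (m + 1) + 1)) * (m + 1 + 1) + (m + 1) + 1 < cap B) :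
    ∃ P Δ p τ t s, Computed (m + 1) M P Δ p ∧ P.Valid B L ∧ Exec solve σ τ t s ∧ Answer m M τ ∧ s ≤ spc B L ∧
      t ≤ solveCost (m + 1) B (total (m + 1) M) (P.oracleCost M B) * (1 + B) ^ 2 := by
  have hU : total (m + 1) M < cap B := by
    have h1 := le_bigBound (m + 1) (total (m + 1) M)
    have h2 := Nat.le_mul_self (bigBound (m + 1) (total (m + 1) M))
    have h3 : 1 * (total (m + 1) M + 1) ≤ 8 * (m + 1 + 1) ^ 2 * (total (m + 1) M + 1) :=
      Nat.mul_le_mul_right _ (Nat.mul_pos (by omega) (by positivity))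
    omega
  have hM : ∀ i, M i ≤ total (m + 1) M := by
    intro i
    by_cases hi : i < (m + 1) * (m + 1)
    · exact le_total hi
    · simp [hσ.M_eq i (by omega)]
  have e : ∀ x, (σ.setReg 1 1).reg x = if x = 1 then 1 else if x = 0 then m + 1 else 0 := by
    intro x
    rw [State.setReg_reg]
    split_ifs with h1 h2
    exacts [rfl, h2 ▸ hσ.r0, hσ.reg_eq x h2]
  have hreg : ∀ x, σ.reg x < cap B := by
    intro x
    by_cases hx : x = 0
    · rw [hx, hσ.r0]
      omega
    · rw [hσ.reg_eq x hx]
      omega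
  have hsupp : ∀ x, 64 ≤ x → σ.reg x = 0 := fun x hx => hσ.reg_eq x (by omega)
  have harr : ∀ q, σ.arr q < cap B := by
    rintro ⟨a, i⟩
    by_cases ha : a = 0
    · rw [ha, hσ.a0]
      exact (hM i).trans_lt hU
    · rw [hσ.arr_eq a ha]
      omega
  have harr' : ∀ q, σ.arr q ≠ 0 → q.1 < 16 ∧ q.2 < L := by
    rintro ⟨a, i⟩ h
    have ha : a = 0 := by
      by_contra ha
      exact h (hσ.arr_eq a ha i)
    subst ha
    rw [hσ.a0] at h
    refine ⟨by simp, ?_⟩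
    by_contra hi
    exact h (hσ.M_eq i (by omega))
  -- The initial memory is not well-formed, since register `1` is empty; the first instruction
  -- repairs this.
  have hok : Ok B L (σ.setReg 1 1) := by
    refine ⟨fun x => ?_, fun x hx => ?_, harr, harr', by rw [e]; rfl, by rw [e]; rfl⟩
    · rw [e]
      split_ifs <;> omega
    · rw [e, if_neg (by omega), if_neg (by omega)]
  obtain ⟨τ, t, s, h1, h2, ⟨P, Δ, p, hC, hV, hH, h4, hs⟩, h5, h6⟩ := setup_runs (σ := σ.setReg 1 1) (by omega) hL.ge hB hB'
    (by rw [e]; rfl) hσ.a0 hσ.loopless (hσ.arr_eq 3 (by omega)) (hσ.arr_eq 4 (by omega))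
    (hσ.arr_eq 5 (by omega)) hok
  obtain ⟨υ, t', s', k1, k2, k3, k4, k5⟩ := search_runs hC.n_eq hV hC.sound hH
    (fun i => by rw [h4]; exact (Nat.sub_le _ _).trans (hM i)) (by rw [h4]; exact hC.lt_sq) hs h2
  refine ⟨P, Δ, p, υ, _, _, hC, hV, .seq (.const σ 1 1) (.seq h1 k1), k3, ?_, ?_⟩
  · exact max_le (max_le (space_le hreg hsupp harr harr') hok.space_le) (max_le h6 k5)
  · have h7 : 1 + Nat.size 1 ≤ 1 * (1 + B) ^ 2 := by
      have := one_add_size_le (hok.one ▸ hok.reg_lt 1)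
      omega
    rw [hC.n_eq] at k4
    calc _ ≤ 1 * (1 + B) ^ 2 + (1000 * ((m + 1 + 1) ^ 4 * (total (m + 1) M + 1)) * (1 + B) ^ 2 +
          searchCost (m + 1) B (P.oracleCost M B) * (1 + B) ^ 2) :=
          add_le_add h7 (add_le_add h5 k4)
      _ = _ := by rw [solveCost]; ring

/-! ### Counting the sets that pass the test -/

/-- The set of traces that pass the test, times the number of subsets of the remaining vertices. -/
theorem card_good_mul {n a : ℕ} {M fl inf : ℕ → ℕ} (hfl : ∀ v, fl v ≤ 1) :
    ((Finset.range (2 ^ ∑ v ∈ Finset.range n, fl v)).filter (Good n a M fl inf)).card *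
      2 ^ ∑ v ∈ Finset.range n, (1 - fl v) =
    ((Finset.range n).powerset.filter fun S =>
      starved n inf M (fun v => fl v * ind S v) ≤ a).card := by
  rw [Finset.card_filter, Finset.card_filter, ← sum_code hfl, Finset.sum_mul]
  refine Finset.sum_congr rfl fun Y _ => ?_
  have h1 : ∀ Z, starved n inf M (fun v => fl v * ind ((Finset.range n).filter
      fun v => code n fl Y Z v = 1) v) = starved n inf M (spread n fl Y) := by
    intro Z
    refine starved_congr fun v hv => ?_
    rw [ind_filter_code hfl Y Z hv]
    rcases Nat.le_one_iff_eq_zero_or_eq_one.1 (hfl v) with h | h <;> simp [code, spread, h]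
  simp only [h1, Finset.sum_const, Finset.card_range, smul_eq_mul]
  rw [mul_comm]
  rfl

theorem sum_powerset_split {R : Type*} [CommSemiring R] {A N : Finset ℕ} (h : N ⊆ A)
    (f g : Finset ℕ → R) :
    ∑ S ∈ A.powerset, f (S ∩ N) * g (S \ N) =
      (∑ S ∈ N.powerset, f S) * ∑ S ∈ (A \ N).powerset, g S := by
  rw [Finset.sum_mul_sum, ← Finset.sum_product']
  refine Finset.sum_nbij' (fun S => (S ∩ N, S \ N)) (fun p => p.1 ∪ p.2) ?_ ?_ ?_ ?_ ?_
  · intro S hS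
    rw [Finset.mem_powerset] at hS
    simp only [Finset.mem_product, Finset.mem_powerset]
    exact ⟨Finset.inter_subset_right, Finset.sdiff_subset_sdiff hS le_rfl⟩
  · rintro ⟨S, T⟩ hp
    simp only [Finset.mem_product, Finset.mem_powerset] at hp ⊢
    exact Finset.union_subset (hp.1.trans h) (hp.2.trans Finset.sdiff_subset)
  · intro S _
    rw [Finset.union_comm]
    exact Finset.sdiff_union_inter S N
  · rintro ⟨S, T⟩ hp
    simp only [Finset.mem_product, Finset.mem_powerset] at hp
    refine Prod.ext (Finset.ext fun x => ?_) (Finset.ext fun x => ?_)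
    · have h1 := @hp.1 x
      have h2 := @hp.2 x
      simp only [Finset.mem_sdiff, Finset.mem_inter, Finset.mem_union] at h1 h2 ⊢
      tauto
    · have h1 := @hp.1 x
      have h2 := @hp.2 x
      simp only [Finset.mem_sdiff, Finset.mem_union] at h1 h2 ⊢
      tauto
  · intro S _
    rfl

/-- The average over all sets `S` of the number `2` to the minus number of blocks that `S`
misses. -/
theorem sum_prod_disjoint_le {D : ℕ} (N : ℕ → Finset ℕ) (I A : Finset ℕ)
    (hN : ∀ r ∈ I, N r ⊆ A ∧ (N r).card ≤ D)
    (hd : ∀ r ∈ I, ∀ r' ∈ I, r ≠ r' → Disjoint (N r) (N r')) :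
    ∑ S ∈ A.powerset, ∏ r ∈ I, (if Disjoint S (N r) then (1 / 2 : ℝ) else 1) ≤
      2 ^ A.card * (1 - (1 / 2) ^ (D + 1)) ^ I.card := by
  induction I using Finset.induction_on generalizing A with
  | empty => simp [Finset.card_powerset]
  | insert r I hr ih =>
    obtain ⟨h1, h2⟩ := hN r (Finset.mem_insert_self r I)
    have e : ∀ S ∈ A.powerset, ∏ r ∈ insert r I, (if Disjoint S (N r) then (1 / 2 : ℝ) else 1) =
        (if Disjoint (S ∩ N r) (N r) then (1 / 2 : ℝ) else 1) *
          ∏ r' ∈ I, (if Disjoint (S \ N r) (N r') then (1 / 2 : ℝ) else 1) := by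
      intro S _
      rw [Finset.prod_insert hr]
      congr 1
      · refine if_congr ?_ rfl rfl
        rw [Finset.disjoint_iff_inter_eq_empty, Finset.disjoint_iff_inter_eq_empty,
          Finset.inter_assoc, Finset.inter_self]
      · refine Finset.prod_congr rfl fun r' hr' => if_congr ?_ rfl rfl
        have := hd r (Finset.mem_insert_self r I) r' (Finset.mem_insert_of_mem hr')
          (by rintro rfl; exact hr hr')
        constructor
        · exact fun h => h.mono_left Finset.sdiff_subset
        · intro h
          rw [Finset.disjoint_left] at *
          intro x hx hx'
          by_cases hxr : x ∈ N r
          · exact this hxr hx'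
          · exact h (Finset.mem_sdiff.2 ⟨hx, hxr⟩) hx'
    rw [Finset.sum_congr rfl e, sum_powerset_split h1
      (fun S => if Disjoint S (N r) then (1 / 2 : ℝ) else 1)
      (fun S => ∏ r' ∈ I, if Disjoint S (N r') then (1 / 2 : ℝ) else 1)]
    -- Within one block only the empty trace is discounted, by `1 / 2`, and it is at least one of
    -- 2^D traces. The other blocks lie in `A \ N r`, to which the induction applies.
    have h3 : ∑ S ∈ (N r).powerset, (if Disjoint S (N r) then (1 / 2 : ℝ) else 1) ≤
        2 ^ (N r).card * (1 - (1 / 2) ^ (D + 1)) := by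
      have h4 : ∀ S ∈ (N r).powerset, (if Disjoint S (N r) then (1 / 2 : ℝ) else 1) =
          1 - if S = ∅ then 1 / 2 else 0 := by
        intro S hS
        have : Disjoint S (N r) ↔ S = ∅ :=
          ⟨fun h => Finset.disjoint_self_iff_empty S |>.1 (h.mono_right (Finset.mem_powerset.1 hS)),
            fun h => h ▸ Finset.disjoint_empty_left _⟩
        simp only [this]
        split_ifs <;> norm_num
      rw [Finset.sum_congr rfl h4, Finset.sum_sub_distrib, Finset.sum_ite_eq' _ ∅, if_pos
        (Finset.empty_mem_powerset _)]
      simp only [Finset.sum_const, Finset.card_powerset, nsmul_eq_mul, mul_one, Nat.cast_pow,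
        Nat.cast_ofNat]
      have h5 : (2 : ℝ) ^ (N r).card * (1 / 2) ^ (D + 1) ≤ 1 / 2 := by
        have : (2 : ℝ) ^ (N r).card ≤ 2 ^ D := pow_le_pow_right₀ (by norm_num) h2
        calc (2 : ℝ) ^ (N r).card * (1 / 2) ^ (D + 1) ≤ 2 ^ D * (1 / 2) ^ (D + 1) := by gcongr
          _ = 1 / 2 := by rw [pow_succ, ← mul_assoc, ← mul_pow]; norm_num
      linarith
    have h6 : ∀ k, (0 : ℝ) ≤ 1 - (1 / 2) ^ k := fun k =>
      sub_nonneg.2 (pow_le_one₀ (by norm_num) (by norm_num))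
    have h7 := ih (A \ N r)
      (fun r' hr' => ⟨Finset.subset_sdiff.2 ⟨(hN r' (Finset.mem_insert_of_mem hr')).1,
        hd r' (Finset.mem_insert_of_mem hr') r (Finset.mem_insert_self r I)
          (by rintro rfl; exact hr hr')⟩, (hN r' (Finset.mem_insert_of_mem hr')).2⟩)
      (fun r hr r' hr' => hd r (Finset.mem_insert_of_mem hr) r' (Finset.mem_insert_of_mem hr'))
    have h8 : A.card = (N r).card + (A \ N r).card := by
      rw [Finset.card_sdiff_of_subset h1]
      have := Finset.card_le_card h1
      omega
    have h9 := h6 (D + 1)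
    rw [Finset.card_insert_of_notMem hr, h8, pow_add, pow_succ _ I.card]
    refine (mul_le_mul h3 h7 (Finset.sum_nonneg fun S _ => Finset.prod_nonneg fun r _ => ?_)
      (by positivity)).trans (le_of_eq (by ring))
    split_ifs <;> norm_num

theorem nz_eq_ite (x : ℕ) : nz x = if x ≠ 0 then 1 else 0 := by
  unfold nz
  split_ifs <;> omega

theorem sum_nz_eq_card (n : ℕ) (f : ℕ → ℕ) :
    ∑ v ∈ Finset.range n, nz (f v) = ((Finset.range n).filter fun v => f v ≠ 0).card := by
  rw [Finset.card_filter]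
  exact Finset.sum_congr rfl fun v _ => nz_eq_ite _

theorem sum_range_mul (n k : ℕ) (f : ℕ → ℕ) :
    ∑ i ∈ Finset.range (k * n), f i = ∑ r ∈ Finset.range k, ∑ v ∈ Finset.range n, f (r * n + v) := by
  induction k with
  | zero => simp
  | succ k ih => rw [Finset.sum_range_succ, ← ih, Nat.succ_mul, Finset.sum_range_add]

theorem sum_outdeg (n : ℕ) (M : ℕ → ℕ) : ∑ r ∈ Finset.range n, outdeg n M r = arcs n M :=
  (sum_range_mul n n fun i => nz (M i)).symm

theorem sum_indeg (n : ℕ) (M : ℕ → ℕ) : ∑ v ∈ Finset.range n, indeg n M v = arcs n M := by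
  rw [← sum_outdeg]
  exact Finset.sum_comm

/-- The infants. -/
def infants (n : ℕ) (inf : ℕ → ℕ) : Finset ℕ := (Finset.range n).filter fun r => inf r = 1

/-- The indicator of starving at most `a` infants is bounded by 2^(a - number of starved infants).
This is a product over the infants up to the factor 2^a, and it factorizes on average because the
flagged neighborhoods are disjoint and have at most `D` elements. -/
theorem card_good_le {n D a : ℕ} {M hub fl inf : ℕ → ℕ} (h : Greedy n D M hub fl inf 0) :
    ((((Finset.range (2 ^ ∑ v ∈ Finset.range n, fl v)).filter (Good n a M fl inf)).card *
      2 ^ ∑ v ∈ Finset.range n, (1 - fl v) : ℕ) : ℝ) ≤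
    2 ^ a * (2 ^ n * (1 - (1 / 2) ^ (D + 1)) ^ (infants n inf).card) := by
  rw [card_good_mul h.fl_le, Finset.card_filter, Nat.cast_sum]
  set N : ℕ → Finset ℕ := fun r => (Finset.range n).filter fun v => nz (M (r * n + v)) * fl v ≠ 0
    with hN
  have key := sum_prod_disjoint_le (D := D) N (infants n inf) (Finset.range n)
    (fun r hr => ⟨Finset.filter_subset _ _, ?_⟩) (fun r hr r' hr' hne => ?_)
  · rw [Finset.card_range] at key
    refine le_trans ?_ (mul_le_mul_of_nonneg_left key (by positivity))
    rw [Finset.mul_sum]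
    refine Finset.sum_le_sum fun S _ => ?_
    have e : starved n inf M (fun v => fl v * ind S v) =
        ((infants n inf).filter fun r => Disjoint S (N r)).card := by
      rw [starved, infants, Finset.card_filter, Finset.sum_filter]
      refine Finset.sum_congr rfl fun r _ => ?_
      have h1 : ∑ v ∈ Finset.range n, nz (M (r * n + v)) * (fl v * ind S v) = 0 ↔
          Disjoint S (N r) := by
        rw [Finset.sum_eq_zero_iff, Finset.disjoint_right]
        simp only [hN, Finset.mem_filter, and_imp, ← mul_assoc]
        refine forall_congr' fun v => forall_congr' fun _ => ?_
        rw [mul_eq_zero, ind]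
        by_cases hv : v ∈ S <;> simp [hv, or_iff_not_imp_left]
      have h2 := h.inf_le r
      by_cases hd : Disjoint S (N r)
      · rw [h1.2 hd, if_pos hd]
        split_ifs <;> omega
      · rw [Nat.sub_eq_zero_of_le (Nat.one_le_iff_ne_zero.2 fun h => hd (h1.1 h)), if_neg hd]
        simp
    have e2 : ∏ r ∈ infants n inf, (if Disjoint S (N r) then (1 / 2 : ℝ) else 1) =
        (1 / 2) ^ starved n inf M fun v => fl v * ind S v := by
      rw [e, Finset.prod_ite, Finset.prod_const, Finset.prod_const_one, mul_one]
    rw [e2]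
    split_ifs with hs
    · rw [Nat.cast_one, one_div, inv_pow, ← div_eq_mul_inv, one_le_div (by positivity)]
      exact pow_le_pow_right₀ (by norm_num) hs
    · rw [Nat.cast_zero]
      positivity
  · have h1 := (Finset.mem_filter.1 hr).2
    refine le_trans ?_ (h.inf_ge r h1).2.2
    rw [outdeg, sum_nz_eq_card]
    refine Finset.card_le_card fun v hv => ?_
    simp only [hN, Finset.mem_filter, mul_ne_zero_iff] at hv ⊢
    refine ⟨hv.1, fun h0 => hv.2.1 ?_⟩
    rw [h0]
    rfl
  · have h1 := (Finset.mem_filter.1 hr).2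
    have h1' := (Finset.mem_filter.1 hr').2
    rw [Finset.disjoint_left]
    intro v hv hv'
    simp only [hN, Finset.mem_filter, mul_ne_zero_iff, nz_eq_ite, Finset.mem_range] at hv hv'
    have h2 := h.disjoint r r' h1 h1' hne v hv.1 (by have := hv.2.1; simp_all)
      (by have := hv'.2.1; simp_all)
    have h3 := h.fl_le v
    have h4 := (h.source v (by omega)).2.1
    omega

/-- At least half of the vertices have outdegree at most `D`, by averaging. By maximality each of
them is a flagged vertex or an infant, or has an arc to one of these that is not a hub. There are at
most `D + 1` such vertices per infant, and each that is not a hub has at most `Δ` in-neighbors. -/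
theorem le_infants {n D Δ : ℕ} {M hub fl inf : ℕ → ℕ} (h : Greedy n D M hub fl inf 0) (hn : 0 < n)
    (hD : D = degBound n M) (hub_eq : ∀ v < n, hub v = nz (indeg n M v - Δ)) :
    n ≤ 2 * ((infants n inf).card * (D + 1) * (Δ + 1)) := by
  set Lo := (Finset.range n).filter fun r => outdeg n M r ≤ D with hLo
  set Wd := (Finset.range n).filter fun v => fl v = 1 ∨ inf v = 1 with hWd
  have h1 : n ≤ 2 * Lo.card := by
    have e1 : Lo.card + ((Finset.range n).filter fun r => ¬ outdeg n M r ≤ D).card = n := by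
      rw [Finset.card_filter_add_card_filter_not, Finset.card_range]
    set Hi := (Finset.range n).filter fun r => ¬ outdeg n M r ≤ D with hHi
    have e2 : Hi.card * (D + 1) ≤ arcs n M := by
      rw [← sum_outdeg, ← smul_eq_mul]
      refine (Finset.card_nsmul_le_sum _ _ _ fun r hr => ?_).trans
        (Finset.sum_le_sum_of_subset (Finset.filter_subset _ _))
      have := (Finset.mem_filter.1 hr).2
      omega
    have e3 : 2 * arcs n M < n * (D + 1) := by
      rw [hD, degBound]
      exact Nat.lt_mul_div_succ _ hn
    have e4 : 2 * Hi.card < n := by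
      by_contra! hc
      have := Nat.mul_le_mul_right (D + 1) hc
      nlinarith
    omega
  have h2 : Wd.card ≤ (infants n inf).card * (D + 1) := by
    have : Wd ⊆ (infants n inf).biUnion fun r =>
        insert r ((Finset.range n).filter fun v => M (r * n + v) ≠ 0) := by
      intro v hv
      obtain ⟨hv, hv'⟩ := Finset.mem_filter.1 hv
      rw [Finset.mem_biUnion]
      rcases hv' with hv' | hv'
      · obtain ⟨-, -, r, hr, hM⟩ := h.source v hv'
        exact ⟨r, Finset.mem_filter.2 ⟨Finset.mem_range.2 (h.inf_ge r hr).2.1, hr⟩,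
          Finset.mem_insert_of_mem (Finset.mem_filter.2 ⟨hv, hM⟩)⟩
      · exact ⟨v, Finset.mem_filter.2 ⟨hv, hv'⟩, Finset.mem_insert_self _ _⟩
    refine (Finset.card_le_card this).trans (Finset.card_biUnion_le_card_mul _ _ _ fun r hr => ?_)
    refine (Finset.card_insert_le _ _).trans (Nat.succ_le_succ ?_)
    rw [← sum_nz_eq_card]
    exact (h.inf_ge r (Finset.mem_filter.1 hr).2).2.2
  have h3 : Lo.card ≤ Wd.card * (Δ + 1) := by
    have : Lo ⊆ Wd.biUnion fun v =>
        insert v ((Finset.range n).filter fun r => M (r * n + v) ≠ 0 ∧ hub v = 0) := by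
      intro r hr
      obtain ⟨hr, hr'⟩ := Finset.mem_filter.1 hr
      obtain ⟨v, hv, hvr, hvf⟩ := h.maximal r (Nat.zero_le r) (Finset.mem_range.1 hr) hr'
      rw [Finset.mem_biUnion]
      refine ⟨v, Finset.mem_filter.2 ⟨Finset.mem_range.2 hv, hvf⟩, Finset.mem_insert.2 ?_⟩
      rcases hvr with hvr | hvr
      · exact Or.inl hvr.symm
      · exact Or.inr (Finset.mem_filter.2 ⟨hr, hvr⟩)
    refine (Finset.card_le_card this).trans (Finset.card_biUnion_le_card_mul _ _ _ fun v hv => ?_)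
    refine (Finset.card_insert_le _ _).trans (Nat.succ_le_succ ?_)
    by_cases hh : hub v = 0
    · have e1 := hub_eq v (Finset.mem_range.1 (Finset.mem_filter.1 hv).1)
      rw [hh] at e1
      have e2 : indeg n M v ≤ Δ := by
        unfold nz at e1
        omega
      refine le_trans ?_ e2
      rw [indeg, sum_nz_eq_card]
      exact Finset.card_le_card (Finset.monotone_filter_right _ fun r _ h => h.1)
    · simp [hh]
  calc n ≤ 2 * Lo.card := h1
    _ ≤ 2 * (Wd.card * (Δ + 1)) := Nat.mul_le_mul_left _ h3
    _ ≤ _ := Nat.mul_le_mul_left _ (Nat.mul_le_mul_right _ h2)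

/-- Infants are not flagged. Hence even the loop over all traces, good or bad, has at most 2^(n - f)
rounds for `f` infants. -/
theorem sum_fl_add_card_infants_le {n D : ℕ} {M hub fl inf : ℕ → ℕ}
    (h : Greedy n D M hub fl inf 0) :
    ∑ v ∈ Finset.range n, fl v + (infants n inf).card ≤ n := by
  rw [infants, Finset.card_filter, ← Finset.sum_add_distrib]
  calc _ ≤ ∑ _v ∈ Finset.range n, 1 := by
        refine Finset.sum_le_sum fun v _ => ?_
        have h1 := h.fl_le v
        have h2 := h.disj v
        split_ifs with h3 <;> omega
    _ = n := by simp

/-- The number of subsets that are tested or summed over. -/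
def Par.load (P : Par) (M : ℕ → ℕ) : ℕ :=
  P.pu + ((Finset.range P.pu).filter (Good P.n P.a M P.fl P.inf)).card * P.pz

/-- Let `f` be the number of infants. The choice of the hub degree and `le_infants` give `a ≤ f / (4
* 2 ^ D)`, whereas the gain in `card_good_le` is at least exp(-f / (2 * 2^D)), in the sense that its
factor is no larger than this. So half of the exponent survives the factor 2^a, and f / (4 * 2^D) is
at least n / (8 * 2^D (D+1)(Δ+1)). This is the origin of `hubFactor`. The loop over the traces is
smaller still by the preceding lemma. -/
theorem load_le {n Δ p : ℕ} {M : ℕ → ℕ} {P : Par} (h : Computed n M P Δ p) (hn : 0 < n) :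
    (P.load M : ℝ) ≤ 2 * (2 ^ n * Real.exp (-(n / (hubFactor (degBound n M) * (Δ + 1))))) := by
  obtain ⟨D, hD⟩ : ∃ D, D = degBound n M := ⟨_, rfl⟩
  have hG := h.greedy
  rw [← hD] at hG ⊢
  have h1 := le_infants hG hn hD h.hub_eq
  have h2 := sum_fl_add_card_infants_le hG
  have h3 := card_good_le (a := P.a) hG
  have h4 := h.above_le
  rw [← h.a_eq, ← hD, hubFactor] at h4
  rw [Par.load, h.sound.pu_eq, h.sound.pz_eq, h.n_eq, Nat.cast_add]
  set f := (infants n P.inf).card with hf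
  have hq : (0 : ℝ) < 2 ^ D := by positivity
  have h5 : P.a * (4 * 2 ^ D) ≤ f := by
    have e1 : P.a * (8 * 2 ^ D * (D + 1)) * (Δ + 1) = 2 * (P.a * (4 * 2 ^ D)) * ((D + 1) * (Δ + 1)) := by
      ring
    have e2 : 2 * (f * (D + 1) * (Δ + 1)) = 2 * f * ((D + 1) * (Δ + 1)) := by ring
    have e3 : 2 * (P.a * (4 * 2 ^ D)) * ((D + 1) * (Δ + 1)) ≤ 2 * f * ((D + 1) * (Δ + 1)) := by
      omega
    have e4 := Nat.le_of_mul_le_mul_right e3 (by positivity)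
    omega
  have h5' : (P.a : ℝ) ≤ f / (4 * 2 ^ D) := by
    rw [le_div_iff₀ (by positivity)]
    exact_mod_cast h5
  have h6 : (n : ℝ) / (hubFactor D * (Δ + 1)) ≤ f / (4 * 2 ^ D) := by
    rw [div_le_div_iff₀ (by unfold hubFactor; positivity) (by positivity)]
    have : n * (4 * 2 ^ D) ≤ f * (hubFactor D * (Δ + 1)) := by
      calc n * (4 * 2 ^ D) ≤ 2 * (f * (D + 1) * (Δ + 1)) * (4 * 2 ^ D) := Nat.mul_le_mul_right _ h1
        _ = _ := by unfold hubFactor; ring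
    exact_mod_cast this
  have hlog : (1 : ℝ) / 2 ≤ Real.log 2 := by
    have := Real.log_two_gt_d9
    norm_num at this ⊢
    linarith
  have hlog' : Real.log 2 ≤ 1 := by
    have := Real.log_two_lt_d9
    norm_num at this ⊢
    linarith
  have e2 : ∀ k : ℕ, (2 : ℝ) ^ k = Real.exp (k * Real.log 2) := fun k => by
    rw [Real.exp_nat_mul, Real.exp_log (by norm_num)]
  have hf0 : (0 : ℝ) ≤ f / (4 * 2 ^ D) := by positivity
  have hone : (1 : ℝ) ≤ 2 ^ D := one_le_pow₀ (by norm_num)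
  have h7 : (2 : ℝ) ^ (∑ v ∈ Finset.range n, P.fl v) ≤
      2 ^ n * Real.exp (-(n / (hubFactor D * (Δ + 1)))) := by
    have h8 : (2 : ℝ) ^ (∑ v ∈ Finset.range n, P.fl v) * 2 ^ f ≤ 2 ^ n := by
      rw [← pow_add]
      exact pow_le_pow_right₀ (by norm_num) h2
    have h9 : Real.exp (n / (hubFactor D * (Δ + 1))) ≤ 2 ^ f := by
      rw [e2 f]
      refine Real.exp_le_exp.2 (h6.trans ?_)
      calc (f : ℝ) / (4 * 2 ^ D) ≤ f / 2 := by
            gcongr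
            linarith
        _ ≤ f * Real.log 2 := by nlinarith [(Nat.cast_nonneg f : (0 : ℝ) ≤ f)]
    rw [Real.exp_neg, ← div_eq_mul_inv, le_div_iff₀ (Real.exp_pos _)]
    exact (mul_le_mul_of_nonneg_left h9 (by positivity)).trans h8
  have h10 : (2 : ℝ) ^ P.a * (2 ^ n * (1 - (1 / 2) ^ (D + 1)) ^ f) ≤
      2 ^ n * Real.exp (-(n / (hubFactor D * (Δ + 1)))) := by
    have e3 : (1 - (1 / 2 : ℝ) ^ (D + 1)) ^ f ≤ Real.exp (-(f / (2 * 2 ^ D))) := by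
      have e4 : 1 - (1 / 2 : ℝ) ^ (D + 1) ≤ Real.exp (-(1 / 2) ^ (D + 1)) := by
        have := Real.add_one_le_exp (-(1 / 2 : ℝ) ^ (D + 1))
        linarith
      calc _ ≤ Real.exp (-(1 / 2) ^ (D + 1)) ^ f :=
            pow_le_pow_left₀ (sub_nonneg.2 (pow_le_one₀ (by norm_num) (by norm_num))) e4 f
        _ = Real.exp (-(f / (2 * 2 ^ D))) := by
            rw [← Real.exp_nat_mul]
            congr 1
            rw [one_div, inv_pow, pow_succ]
            field_simp
    have e5 : (2 : ℝ) ^ P.a ≤ Real.exp (f / (4 * 2 ^ D)) := by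
      rw [e2]
      refine Real.exp_le_exp.2 (le_trans ?_ h5')
      nlinarith [(Nat.cast_nonneg P.a : (0 : ℝ) ≤ P.a)]
    calc (2 : ℝ) ^ P.a * (2 ^ n * (1 - (1 / 2) ^ (D + 1)) ^ f)
        = 2 ^ n * (2 ^ P.a * (1 - (1 / 2) ^ (D + 1)) ^ f) := by ring
      _ ≤ 2 ^ n * (Real.exp (f / (4 * 2 ^ D)) * Real.exp (-(f / (2 * 2 ^ D)))) := by
          have := pow_nonneg (sub_nonneg.2 (pow_le_one₀ (n := D + 1) (a := (1 / 2 : ℝ))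
            (by norm_num) (by norm_num))) f
          gcongr
      _ = 2 ^ n * Real.exp (-(f / (4 * 2 ^ D))) := by
          rw [← Real.exp_add]
          congr 2
          field_simp
          ring
      _ ≤ _ := by
          gcongr
  have h11 := h3.trans h10
  push_cast at h11 ⊢
  linarith

/-! ### The exponential rate as a function of the average degree -/

theorem sum_nz_sub_le (Δ x : ℕ) : ∑ c ∈ Finset.range Δ, nz (x - c) ≤ x := by
  rw [sum_nz_eq_card]
  calc _ ≤ (Finset.range x).card := Finset.card_le_card fun c hc => by
        have := (Finset.mem_filter.1 hc).2
        exact Finset.mem_range.2 (by omega)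
    _ = x := Finset.card_range x

/-- Each `c < Δ` is inadmissible and so has more than n / (K (c+1)) vertices of indegree above `c`.
Summed over `c`, these numbers are at most the sum of the indegrees, hence at most `d * n`. So the
harmonic sum up to `Δ`, which is at least log(Δ+1), is at most `d * K`. -/
theorem hubDegree_le {n Δ : ℕ} {K : ℕ} {M : ℕ → ℕ} {d : ℝ} (hn : 0 < n)
    (hd : (arcs n M : ℝ) ≤ d * n) (h : ∀ c < Δ, n < above n M c * K * (c + 1)) :
    (Δ : ℝ) + 1 ≤ Real.exp (d * K) := by
  have h1 : ∑ c ∈ Finset.range Δ, above n M c ≤ arcs n M := by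
    rw [← sum_indeg]
    unfold above
    rw [Finset.sum_comm]
    exact Finset.sum_le_sum fun v _ => sum_nz_sub_le Δ _
  have hn' : (0 : ℝ) < n := by exact_mod_cast hn
  have h2 : (n : ℝ) * ∑ c ∈ Finset.range Δ, ((c + 1 : ℕ) : ℝ)⁻¹ ≤ K * (d * n) := by
    calc (n : ℝ) * ∑ c ∈ Finset.range Δ, ((c + 1 : ℕ) : ℝ)⁻¹
        = ∑ c ∈ Finset.range Δ, (n : ℝ) * ((c + 1 : ℕ) : ℝ)⁻¹ := Finset.mul_sum _ _ _
      _ ≤ ∑ c ∈ Finset.range Δ, (above n M c : ℝ) * K := by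
          refine Finset.sum_le_sum fun c hc => ?_
          rw [← div_eq_mul_inv, div_le_iff₀ (by positivity)]
          exact_mod_cast (h c (Finset.mem_range.1 hc)).le
      _ = K * ((∑ c ∈ Finset.range Δ, above n M c : ℕ) : ℝ) := by
          rw [← Finset.sum_mul, mul_comm]
          push_cast
          rfl
      _ ≤ K * (d * n) := by
          refine mul_le_mul_of_nonneg_left (le_trans ?_ hd) (Nat.cast_nonneg _)
          exact_mod_cast h1
  have h3 : Real.log ((Δ + 1 : ℕ) : ℝ) ≤ d * K := by
    refine (log_add_one_le_harmonic Δ).trans ?_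
    have h4 : ((harmonic Δ : ℚ) : ℝ) = ∑ c ∈ Finset.range Δ, ((c + 1 : ℕ) : ℝ)⁻¹ := by
      simp [harmonic]
    rw [h4]
    have h5 : (n : ℝ) * ∑ c ∈ Finset.range Δ, ((c + 1 : ℕ) : ℝ)⁻¹ ≤ n * (d * K) := by
      linarith
    exact le_of_mul_le_mul_left h5 hn'
  have h6 : (0 : ℝ) < ((Δ + 1 : ℕ) : ℝ) := by positivity
  have := (Real.log_le_iff_le_exp h6).1 h3
  push_cast at this
  exact this

theorem hubFactor_mono : Monotone hubFactor := by
  intro D D' h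
  unfold hubFactor
  have : 2 ^ D ≤ 2 ^ D' := Nat.pow_le_pow_right (by omega) h
  gcongr

theorem one_le_hubFactor (D : ℕ) : 8 ≤ hubFactor D := by
  have : 1 ≤ 2 ^ D * (D + 1) := Nat.mul_pos (by positivity) (by omega)
  unfold hubFactor
  nlinarith

/-- The exponential rate that is gained at average degree `d`. -/
noncomputable def rate (d : ℝ) : ℝ :=
  1 / (hubFactor ⌊2 * d⌋₊ * Real.exp (max d 0 * hubFactor ⌊2 * d⌋₊))

/-- The gain in the base of the exponential at average degree `d`. -/
noncomputable def gap (d : ℝ) : ℝ := 2 - 2 * Real.exp (-rate d)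

theorem rate_pos (d : ℝ) : 0 < rate d := by
  have : (8 : ℝ) ≤ hubFactor ⌊2 * d⌋₊ := by exact_mod_cast one_le_hubFactor _
  unfold rate
  positivity

theorem rate_le (d : ℝ) : rate d ≤ 1 / 8 := by
  have h : (8 : ℝ) ≤ hubFactor ⌊2 * d⌋₊ := by exact_mod_cast one_le_hubFactor _
  have h' : 1 ≤ Real.exp (max d 0 * hubFactor ⌊2 * d⌋₊) :=
    Real.one_le_exp (mul_nonneg (le_max_right _ _) (by positivity))
  unfold rate
  apply one_div_le_one_div_of_le (by norm_num)
  nlinarith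

theorem gap_pos (d : ℝ) : 0 < gap d := by
  have : Real.exp (-rate d) < 1 := Real.exp_lt_one_iff.2 (by linarith [rate_pos d])
  unfold gap
  linarith

theorem gap_lt_one (d : ℝ) : gap d < 1 := by
  have := Real.add_one_le_exp (-rate d)
  have := rate_le d
  unfold gap
  linarith

/-- Both parameters of the instance are bounded in terms of `d`: `D` by the floor of `2 * d`, and `Δ
+ 1` by `hubDegree_le`. Since the estimate in `load_le` is monotone in them, it depends on `d`
alone; the algorithm never uses `d`. -/
theorem load_le_gap {n Δ p : ℕ} {M : ℕ → ℕ} {P : Par} {d : ℝ} (h : Computed n M P Δ p)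
    (hn : 0 < n) (hd : (arcs n M : ℝ) ≤ d * n) : (P.load M : ℝ) ≤ 2 * (2 - gap d) ^ n := by
  have hn' : (0 : ℝ) < n := by exact_mod_cast hn
  have hd0 : 0 ≤ d := by
    by_contra! hc
    have : (0 : ℝ) ≤ arcs n M := Nat.cast_nonneg _
    nlinarith
  have h1 : degBound n M ≤ ⌊2 * d⌋₊ := by
    refine Nat.le_floor (Nat.cast_div_le.trans ?_)
    rw [div_le_iff₀ hn']
    push_cast
    linarith
  have h2 : (hubFactor (degBound n M) : ℝ) ≤ hubFactor ⌊2 * d⌋₊ := by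
    exact_mod_cast hubFactor_mono h1
  have h3 := hubDegree_le hn hd h.lt_above
  have h4 : (Δ : ℝ) + 1 ≤ Real.exp (max d 0 * hubFactor ⌊2 * d⌋₊) := by
    rw [max_eq_left hd0]
    exact h3.trans (Real.exp_le_exp.2 (mul_le_mul_of_nonneg_left h2 hd0))
  have h5 : (8 : ℝ) ≤ hubFactor (degBound n M) := by exact_mod_cast one_le_hubFactor _
  have h6 : n * rate d ≤ n / (hubFactor (degBound n M) * (Δ + 1)) := by
    rw [rate, mul_one_div]
    gcongr
  have h7 : (2 - gap d) ^ n = 2 ^ n * Real.exp (-(n * rate d)) := by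
    have : 2 - gap d = 2 * Real.exp (-rate d) := by
      unfold gap
      ring
    rw [this, mul_pow, ← Real.exp_nat_mul, mul_neg]
  rw [h7]
  refine (load_le h hn).trans ?_
  gcongr

/-! ### Explicit bounds on time and space -/

/-- With `x = B + 1`, the oracle is called about `x ^ 2` times, each call has on the order of `x ^
4` times the total weight many points, and a point costs `x ^ 3` times the load. -/
theorem solveCost_le {n B L Δ p : ℕ} {M : ℕ → ℕ} {P : Par} (h : Computed n M P Δ p)
    (hV : P.Valid B L) (hnB : n ≤ B) :
    solveCost n B (total n M) (P.oracleCost M B) ≤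
      170000 * ((B + 1) ^ 9 * (total n M + 1) * P.load M) := by
  obtain ⟨x, hx⟩ : ∃ x, x = B + 1 := ⟨_, rfl⟩
  have hx1 : 1 ≤ x := by omega
  obtain ⟨l, hl⟩ : ∃ l, l = P.load M := ⟨_, rfl⟩
  have hpu : 1 ≤ P.pu := by rw [h.sound.pu_eq]; exact Nat.one_le_two_pow
  have hpz : 1 ≤ P.pz := by rw [h.sound.pz_eq]; exact Nat.one_le_two_pow
  have hl1 : 1 ≤ l := by
    rw [hl, Par.load]
    omega
  have hb : P.b ≤ x := by
    have h1 := hV.s_lt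
    rw [h.sound.lam_eq, cap] at h1
    have h2 : 2 ^ P.b < 2 ^ B := by omega
    have := (Nat.pow_lt_pow_iff_right (by omega : 1 < 2)).1 h2
    omega
  have hn : n ≤ x := by omega
  have hB : B ≤ x := by omega
  have x2 : x ≤ x ^ 2 := Nat.le_self_pow (by omega) _
  have x3 : x ^ 2 ≤ x ^ 3 := Nat.pow_le_pow_right hx1 (by omega)
  have n2 : n * n ≤ x ^ 2 := by rw [pow_two]; exact Nat.mul_le_mul hn hn
  have n3 : n * n * n ≤ x ^ 3 := by rw [pow_succ]; exact Nat.mul_le_mul n2 hn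
  have nB : n * n * B ≤ x ^ 3 := by rw [pow_succ]; exact Nat.mul_le_mul n2 hB
  have hz : zCost n + 2 ≤ 87 * x ^ 3 := by
    rw [zCost]
    ring_nf at n2 n3 ⊢
    omega
  have hy : yCost n + 2 ≤ 41 * x ^ 3 := by
    rw [yCost]
    ring_nf at n2 n3 ⊢
    omega
  have hin : innerCost n P.a P.pu P.pz M P.fl P.inf ≤ 93 * (x ^ 3 * l) := by
    rw [innerCost, hl, Par.load, h.n_eq]
    set G := ((Finset.range P.pu).filter (Good n P.a M P.fl P.inf)).card
    have e1 : P.pu * (yCost n + 2) ≤ P.pu * (41 * x ^ 3) := Nat.mul_le_mul_left _ hy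
    have e2 : P.pz * (zCost n + 2) + 3 ≤ P.pz * (90 * x ^ 3) := by
      calc _ ≤ P.pz * (87 * x ^ 3) + P.pz * (3 * x ^ 3) :=
            add_le_add (Nat.mul_le_mul_left _ hz) (by nlinarith)
        _ = _ := by ring
    have e3 := Nat.mul_le_mul_left G e2
    have e4 : 3 ≤ P.pu * (3 * x ^ 3) := by nlinarith
    calc _ ≤ P.pu * (41 * x ^ 3) + G * (P.pz * (90 * x ^ 3)) + P.pu * (3 * x ^ 3) :=
          add_le_add (add_le_add e1 e3) e4
      _ ≤ _ := by ring_nf; omega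
  have h3l : x ^ 3 ≤ x ^ 3 * l := Nat.le_mul_of_pos_right _ hl1
  have hpt : P.pointCost M B + 2 ≤ 500 * (x ^ 3 * l) := by
    rw [Par.pointCost, Par.factorCost, h.n_eq]
    ring_nf at n2 nB hin ⊢ h3l

    omega
  have hq1 : 1 ≤ P.q := by
    have h1 := h.sound.q_ge
    have : 1 ≤ 2 * (P.n + 1) * 2 ^ P.b := Nat.mul_pos (by omega) (by positivity)
    omega
  have hor : P.oracleCost M B + 7 ≤ 600 * (P.q * P.q * (x ^ 3 * l)) := by
    have e0 : 1 ≤ x ^ 3 * l := Nat.mul_pos (by positivity) hl1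
    have e1 : P.q * (P.pointCost M B + 2) + 30 * B + 17 ≤ P.q * (560 * (x ^ 3 * l)) := by
      calc _ ≤ P.q * (500 * (x ^ 3 * l)) + P.q * (47 * (x ^ 3 * l)) := by
            rw [add_assoc]
            refine add_le_add (Nat.mul_le_mul_left _ hpt) ?_
            calc 30 * B + 17 ≤ 47 * (x ^ 3 * l) := by omega
              _ ≤ _ := Nat.le_mul_of_pos_left _ hq1
        _ ≤ _ := by
          rw [← mul_add]
          exact Nat.mul_le_mul_left _ (by omega)
    calc _ ≤ P.q * (P.q * (560 * (x ^ 3 * l))) + 18 * (P.q * P.q * (x ^ 3 * l)) := by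
          rw [Par.oracleCost, add_assoc]
          refine add_le_add (Nat.mul_le_mul_left _ e1) ?_
          have := Nat.mul_pos (Nat.mul_pos hq1 hq1) e0
          omega
      _ ≤ _ := by ring_nf; omega
  have hqq : P.q * P.q ≤ 128 * (x ^ 4 * (total n M + 1)) := by
    have e1 : P.q ≤ 8 * (n + 1) ^ 2 * P.s := by
      have := h.p_le
      have := h.sound.q_eq
      omega
    have e2 := (base_facts h.sq_le).2
    calc P.q * P.q ≤ (8 * (n + 1) ^ 2 * P.s) * (8 * (n + 1) ^ 2 * P.s) := Nat.mul_le_mul e1 e1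
      _ = 64 * ((n + 1) ^ 4 * (P.s * P.s)) := by ring
      _ ≤ 64 * (x ^ 4 * (2 * total n M + 2)) := by
          have : (n + 1) ^ 4 ≤ x ^ 4 := Nat.pow_le_pow_left (by omega) 4
          gcongr
      _ = _ := by ring
  set V := total n M + 1 with hVd
  have hor' : P.oracleCost M B + 7 ≤ 76800 * (x ^ 7 * V * l) := by
    refine hor.trans ((Nat.mul_le_mul_left _ (Nat.mul_le_mul_right _ hqq)).trans (le_of_eq ?_))
    ring
  have hbn : B + n * n + 1 ≤ 2 * x ^ 2 := by
    omega
  have hVl : 1 ≤ V * l := Nat.mul_pos (by omega) hl1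
  have hx9 : x ^ 4 ≤ x ^ 9 := Nat.pow_le_pow_right hx1 (by omega)
  have hx2 : x ^ 2 ≤ x ^ 9 := Nat.pow_le_pow_right hx1 (by omega)
  have h9 : x ^ 9 ≤ x ^ 9 * (V * l) := Nat.le_mul_of_pos_right _ hVl
  have hs1 : (B + n * n + 1) * (P.oracleCost M B + 7) ≤ 153600 * (x ^ 9 * (V * l)) := by
    refine (Nat.mul_le_mul hbn hor').trans (le_of_eq ?_)
    ring
  have hs2 : 1000 * ((n + 1) ^ 4 * V) ≤ 1000 * (x ^ 9 * (V * l)) := by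
    refine Nat.mul_le_mul_left _ (Nat.mul_le_mul ?_ (Nat.le_mul_of_pos_right _ hl1))
    exact (Nat.pow_le_pow_left (by omega) 4).trans hx9
  have hs3 : n * (n * 8 + 10) + 3 ≤ 21 * x ^ 2 := by
    ring_nf at n2 ⊢
    omega
  rw [solveCost, searchCost, ← hx, ← hl, ← hVd, mul_assoc (x ^ 9)]
  omega

/-- A bound on the number of bits of all numbers, for instances of size `z`. -/
def bits (z : ℕ) : ℕ := 100 * z ^ 2

/-- The largest numbers are products of residues modulo p^(n+3), whose length is about `n` times
that of `p`. This makes the number of bits quadratic in `z`. -/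
theorem bits_bounds {n U W z : ℕ} (hn : 0 < n) (hz : z = n + Nat.size W)
    (hU : U ≤ n * n * (W + 1)) :
    2 * (bigBound n U * bigBound n U) < cap (bits z) ∧
      n * (8 * 4 ^ n * (2 * n + 1)) * (n + 1) + n + 1 < cap (bits z) := by
  have hzn : n ≤ z := by omega
  have two : ∀ {a b : ℕ}, a ≤ b → 2 ^ a ≤ 2 ^ b := fun h => Nat.pow_le_pow_right (by omega) h
  have hn2 : n + 1 ≤ 2 ^ n := Nat.lt_two_pow_self
  have hW : W + 1 ≤ 2 ^ Nat.size W := Nat.lt_size_self W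
  have hz1 : 1 ≤ z := by omega
  have hzz : z ≤ z ^ 2 := Nat.le_self_pow (by omega) z
  have hU' : U + 1 ≤ 2 ^ (2 * z) := by
    calc U + 1 ≤ (n + 1) * (n + 1) * (W + 1) := by nlinarith
      _ ≤ 2 ^ n * 2 ^ n * 2 ^ Nat.size W := by gcongr
      _ = 2 ^ (n + n + Nat.size W) := by rw [pow_add, pow_add]
      _ ≤ _ := two (by omega)
  constructor
  · have h1 : 8 * (n + 1) ^ 2 * (U + 1) ≤ 2 ^ (7 * z) := by
      calc 8 * (n + 1) ^ 2 * (U + 1) ≤ 8 * (2 ^ n) ^ 2 * 2 ^ (2 * z) := by gcongr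
        _ = 2 ^ (3 + n * 2 + 2 * z) := by
            rw [pow_add, pow_add, pow_mul 2 n 2]
            norm_num
        _ ≤ _ := two (by omega)
    have h2 : bigBound n U ≤ 2 ^ (28 * z ^ 2) := by
      calc bigBound n U ≤ (2 ^ (7 * z)) ^ (n + 3) := Nat.pow_le_pow_left h1 _
        _ = 2 ^ (7 * z * (n + 3)) := by rw [← pow_mul]
        _ ≤ _ := two (by nlinarith)
    calc 2 * (bigBound n U * bigBound n U) ≤ 2 * (2 ^ (28 * z ^ 2) * 2 ^ (28 * z ^ 2)) := by gcongr
      _ = 2 ^ (1 + (28 * z ^ 2 + 28 * z ^ 2)) := by rw [pow_add, pow_add, pow_one]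
      _ < _ := Nat.pow_lt_pow_right (by omega) (by unfold bits; omega)
  · have h1 : 2 * n + 1 ≤ 2 ^ (n + 1) := by
      rw [pow_succ]
      omega
    have h2 : n ≤ 2 ^ n := by omega
    have h3 : n * (8 * 4 ^ n * (2 * n + 1)) * (n + 1) ≤ 2 ^ (4 + 5 * n) := by
      calc n * (8 * 4 ^ n * (2 * n + 1)) * (n + 1)
          ≤ 2 ^ n * (2 ^ 3 * (2 ^ 2) ^ n * 2 ^ (n + 1)) * 2 ^ n := by
            gcongr
            · norm_num
            · norm_num
        _ = 2 ^ (4 + 5 * n) := by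
            rw [← pow_mul]
            simp only [← pow_add]
            congr 1
            ring
    have h4 : 2 ^ n ≤ 2 ^ (4 + 5 * n) := two (by omega)
    calc _ ≤ 2 ^ (4 + 5 * n) + 2 ^ (4 + 5 * n) := by omega
      _ = 2 ^ (4 + 5 * n + 1) := by
          rw [pow_succ]
          omega
      _ < _ := Nat.pow_lt_pow_right (by omega) (by unfold bits; omega)

/-- The constant in the bounds on time and space. -/
def bigConst : ℕ := 340000 * 101 ^ 13

theorem bits_succ_le {z : ℕ} (hz : 1 ≤ z) : bits z + 1 ≤ 101 * z ^ 2 := by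
  have : 1 ≤ z ^ 2 := Nat.one_le_pow _ _ hz
  unfold bits
  omega

theorem spc_le {n z : ℕ} (hn : 0 < n) (hz : n ≤ z) :
    spc (bits z) (n * n) ≤ bigConst * z ^ 26 := by
  have hz1 : 1 ≤ z := by omega
  have h1 := bits_succ_le hz1
  have h2 : n * n ≤ z ^ 2 := by rw [pow_two]; exact Nat.mul_le_mul hz hz
  have h3 : z ^ 2 ≤ z ^ 4 := Nat.pow_le_pow_right hz1 (by omega)
  calc spc (bits z) (n * n) ≤ 64 * (101 * z ^ 2) + 16 * z ^ 2 * (z ^ 2 + 101 * z ^ 2) := by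
        unfold spc
        refine add_le_add (by omega) (Nat.mul_le_mul (by omega) (by omega))
    _ = 64 * 101 * z ^ 2 + 16 * 102 * z ^ 4 := by ring
    _ ≤ bigConst * z ^ 4 := by
        unfold bigConst
        norm_num
        omega
    _ ≤ _ := Nat.mul_le_mul_left _ (Nat.pow_le_pow_right hz1 (by omega))

theorem solve_bounded {σ : State} {m W : ℕ} {M : ℕ → ℕ} (hσ : Initial (m + 1) M σ)
    (hU : total (m + 1) M ≤ (m + 1) * (m + 1) * (W + 1)) :
    ∃ τ t s, Exec solve σ τ t s ∧ Answer m M τ ∧ s ≤ bigConst * (m + 1 + Nat.size W) ^ 26 ∧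
      ∀ d : ℝ, (arcs (m + 1) M : ℝ) ≤ d * (m + 1 : ℕ) →
        (t : ℝ) ≤ bigConst * (((m + 1 : ℕ) : ℝ) + Nat.size W) ^ 26 * ((W : ℝ) + 1) *
          (2 - gap d) ^ (m + 1) := by
  obtain ⟨z, hz⟩ : ∃ z, z = m + 1 + Nat.size W := ⟨_, rfl⟩
  have hz1 : 1 ≤ z := by omega
  obtain ⟨hb1, hb2⟩ := bits_bounds (Nat.succ_pos m) hz hU
  obtain ⟨P, Δ, p, τ, t, s, hC, hV, h1, h2, h3, h4⟩ := solve_exec hσ rfl hb1 hb2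
  refine ⟨τ, t, s, h1, h2, ?_, fun d hd => ?_⟩
  · rw [← hz]
    exact h3.trans (spc_le (Nat.succ_pos m) (by omega))
  · have hl := load_le_gap hC (Nat.succ_pos m) hd
    set l := P.load M
    have hb := bits_succ_le hz1
    have hnB : m + 1 ≤ bits z := by
      have : z ≤ z ^ 2 := Nat.le_self_pow (by omega) z
      unfold bits
      omega
    have h5 := solveCost_le hC hV hnB
    have hUx : total (m + 1) M + 1 ≤ (bits z + 1) ^ 2 * (W + 1) := by
      calc total (m + 1) M + 1 ≤ (m + 1 + 1) * (m + 1 + 1) * (W + 1) := by nlinarith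
        _ ≤ (bits z + 1) * (bits z + 1) * (W + 1) := by gcongr
        _ = _ := by rw [pow_two]
    -- The exponent 13 of `bits z + 1` is 9 from `solveCost_le`, 2 from the total weight and 2 from
    -- the unit of time; each factor is at most `101 * z ^ 2`, which gives the final exponent 26.
    have h6 : t ≤ 170000 * (101 ^ 13 * z ^ 26 * (W + 1) * l) := by
      calc t ≤ 170000 * ((bits z + 1) ^ 9 * (total (m + 1) M + 1) * l) * (1 + bits z) ^ 2 :=
            h4.trans (Nat.mul_le_mul_right _ h5)
        _ ≤ 170000 * ((bits z + 1) ^ 9 * ((bits z + 1) ^ 2 * (W + 1)) * l) * (1 + bits z) ^ 2 := by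
            gcongr
        _ = 170000 * ((bits z + 1) ^ 13 * (W + 1) * l) := by ring
        _ ≤ 170000 * ((101 * z ^ 2) ^ 13 * (W + 1) * l) := by gcongr
        _ = _ := by
            rw [mul_pow, ← pow_mul]
    have h7 : ((m + 1 : ℕ) : ℝ) + Nat.size W = z := by
      rw [hz]
      push_cast
      rfl
    rw [h7]
    calc (t : ℝ) ≤ 170000 * (101 ^ 13 * z ^ 26 * (W + 1) * l) := by exact_mod_cast h6
      _ ≤ 170000 * (101 ^ 13 * z ^ 26 * (W + 1) * (2 * (2 - gap d) ^ (m + 1))) := by gcongr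
      _ = _ := by
          unfold bigConst
          push_cast
          ring

end RAM

namespace TSP
open RAM

/-! ### Directed instances -/

/-- The adjacency matrix of an instance, as a sequence. -/
noncomputable def matrix {n : ℕ} (adj : Fin n → Fin n → Prop) (w : Fin n → Fin n → ℕ) (i : ℕ) : ℕ :=
  (input adj w).arr (0, i)

theorem row_col_inj {n : ℕ} {u v u' v' : Fin n} (h : (u : ℕ) * n + v = u' * n + v') :
    u = u' ∧ v = v' := by
  have hn : 0 < n := u.pos
  have h1 : ∀ a b : Fin n, ((a : ℕ) * n + b) / n = a := fun a b => by
    rw [Nat.mul_comm, Nat.mul_add_div hn, Nat.div_eq_of_lt b.2, add_zero]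
  have h2 : ∀ a b : Fin n, ((a : ℕ) * n + b) % n = b := fun a b => by
    rw [Nat.mul_comm, Nat.mul_add_mod, Nat.mod_eq_of_lt b.2]
  exact ⟨Fin.ext (by rw [← h1 u v, h, h1]), Fin.ext (by rw [← h2 u v, h, h2])⟩

open Classical in
theorem input_arr {n : ℕ} (adj : Fin n → Fin n → Prop) (w : Fin n → Fin n → ℕ) (q : ℕ × ℕ) :
    (input adj w).arr q = ∑ u : Fin n, ∑ v : Fin n,
      if ((0 : ℕ), (u : ℕ) * n + v) = q then (if adj u v then w u v + 1 else 0) else 0 := by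
  simp only [input, Finsupp.finsetSum_apply, Finsupp.single_apply]

open Classical in
theorem matrix_apply {n : ℕ} (adj : Fin n → Fin n → Prop) (w : Fin n → Fin n → ℕ) (u v : Fin n) :
    matrix adj w (u * n + v) = if adj u v then w u v + 1 else 0 := by
  rw [matrix, input_arr, Finset.sum_eq_single u, Finset.sum_eq_single v, if_pos rfl]
  · intro v' _ h
    exact if_neg fun e => h (row_col_inj (Prod.ext_iff.1 e).2).2
  · simp
  · intro u' _ h
    exact Finset.sum_eq_zero fun v' _ => if_neg fun e => h (row_col_inj (Prod.ext_iff.1 e).2).1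
  · simp

theorem initial_input {n : ℕ} (adj : Fin n → Fin n → Prop) (w : Fin n → Fin n → ℕ)
    (h : ∀ v, ¬ adj v v) : Initial n (matrix adj w) (input adj w) := by
  refine ⟨by simp [input], fun x hx => by simp [input, Ne.symm hx], fun i => rfl, ?_, ?_, ?_⟩
  · intro a ha i
    rw [input_arr]
    exact Finset.sum_eq_zero fun u _ => Finset.sum_eq_zero fun v _ =>
      if_neg fun e => ha (Prod.ext_iff.1 e).1.symm
  · intro i hi
    rw [matrix, input_arr]
    refine Finset.sum_eq_zero fun u _ => Finset.sum_eq_zero fun v _ => if_neg fun e => ?_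
    have := mul_add_lt_mul u.2 v.2
    have := (Prod.ext_iff.1 e).2
    simp only at this
    omega
  · intro v hv
    rw [matrix_apply adj w ⟨v, hv⟩ ⟨v, hv⟩, if_neg (h _)]

theorem total_matrix_le {n W : ℕ} (adj : Fin n → Fin n → Prop) (w : Fin n → Fin n → ℕ)
    (h : ∀ u v, adj u v → w u v ≤ W) : total n (matrix adj w) ≤ n * n * (W + 1) := by
  rw [total, sum_range_mul]
  calc _ ≤ ∑ _u ∈ Finset.range n, ∑ _v ∈ Finset.range n, (W + 1) := by
        refine Finset.sum_le_sum fun u hu => Finset.sum_le_sum fun v hv => ?_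
        rw [matrix_apply adj w ⟨u, Finset.mem_range.1 hu⟩ ⟨v, Finset.mem_range.1 hv⟩]
        split_ifs with hh
        · exact Nat.succ_le_succ (h _ _ hh)
        · omega
    _ = _ := by simp [mul_assoc]

theorem arcs_matrix {n : ℕ} (adj : Fin n → Fin n → Prop) (w : Fin n → Fin n → ℕ) :
    arcs n (matrix adj w) = {p : Fin n × Fin n | adj p.1 p.2}.ncard := by
  classical
  rw [arcs, sum_range_mul, Finset.sum_range]
  simp only [Finset.sum_range, matrix_apply]
  rw [Set.ncard_eq_toFinset_card', Set.toFinset_ofPred, Finset.card_filter,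
    Fintype.sum_prod_type]
  refine Finset.sum_congr rfl fun u _ => Finset.sum_congr rfl fun v _ => ?_
  split_ifs <;> simp [nz]

theorem ent_matrix {m : ℕ} (adj : Fin (m + 1) → Fin (m + 1) → Prop)
    (w : Fin (m + 1) → Fin (m + 1) → ℕ) (t : Fin (m + 1) → Fin (m + 1)) (i : Fin (m + 1)) :
    (ent (matrix adj w) t i ≠ 0 ↔ adj (t i) (t (finRotate _ i))) ∧
      (adj (t i) (t (finRotate _ i)) →
        ent (matrix adj w) t i - 1 = w (t i) (t (finRotate _ i))) := by
  rw [ent, matrix_apply]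
  split_ifs with h
  · exact ⟨iff_of_true (Nat.succ_ne_zero _) h, fun _ => rfl⟩
  · exact ⟨iff_of_false (fun h' => h' rfl) h, fun h' => (h h').elim⟩

theorem isTour_matrix_iff {m : ℕ} (G : Digraph (Fin (m + 1))) (w : Fin (m + 1) → Fin (m + 1) → ℕ)
    (t : Fin (m + 1) → Fin (m + 1)) :
    IsTour (matrix G.Adj w) t ↔ IsHamCycleDir G t ∧ t 0 = 0 := by
  unfold IsTour IsHamCycleDir
  simp only [(ent_matrix G.Adj w t _).1, ← Finite.injective_iff_surjective, Function.Bijective]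
  tauto

theorem tourWeight_matrix {m : ℕ} {G : Digraph (Fin (m + 1))} (w : Fin (m + 1) → Fin (m + 1) → ℕ)
    {t : Fin (m + 1) → Fin (m + 1)} (h : IsHamCycleDir G t) :
    tourWeight (matrix G.Adj w) t = cycleWeightDir w t :=
  Finset.sum_congr rfl fun i _ => (ent_matrix G.Adj w t i).2 (h.2 i)

/-- The search considers only tours that start at `0`; rotating a cycle changes neither its arcs nor
its weight. -/
theorem exists_rotation {m : ℕ} {G : Digraph (Fin (m + 1))} (w : Fin (m + 1) → Fin (m + 1) → ℕ)
    {t : Fin (m + 1) → Fin (m + 1)} (h : IsHamCycleDir G t) :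
    ∃ t', IsHamCycleDir G t' ∧ t' 0 = 0 ∧ cycleWeightDir w t' = cycleWeightDir w t := by
  obtain ⟨k, hk⟩ := h.1.2 0
  have e : ∀ i, finRotate (m + 1) i + k = finRotate (m + 1) (i + k) := fun i => by
    rw [finRotate_apply, finRotate_apply, add_right_comm]
  refine ⟨fun i => t (i + k), ⟨h.1.comp (Equiv.addRight k).bijective, fun i => ?_⟩, ?_, ?_⟩
  · simp only [e]
    exact h.2 _
  · simpa using hk
  · unfold cycleWeightDir
    simp only [e]
    exact Equiv.sum_comp (Equiv.addRight k) fun i => w (t i) (t (finRotate (m + 1) i))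

theorem solvesDir_of_answer {m : ℕ} {G : Digraph (Fin (m + 1))}
    {w : Fin (m + 1) → Fin (m + 1) → ℕ} {τ : State} (h : Answer m (matrix G.Adj w) τ) :
    SolvesDir G w τ := by
  rcases h with ⟨h0, h1⟩ | ⟨h0, t, h1, h2, h3⟩
  · refine Or.inl ⟨h0, fun t ht => ?_⟩
    obtain ⟨t', k1, k2, -⟩ := exists_rotation w ht
    exact h1 t' ((isTour_matrix_iff G w t').2 ⟨k1, k2⟩)
  · have h4 := ((isTour_matrix_iff G w t).1 h1).1
    refine Or.inr ⟨h0, t, h4, h2, fun t' ht' => ?_⟩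
    obtain ⟨t'', k1, k2, k3⟩ := exists_rotation w ht'
    rw [← k3, ← tourWeight_matrix w h4, ← tourWeight_matrix w k1]
    exact h3 t'' ((isTour_matrix_iff G w t'').2 ⟨k1, k2⟩)

theorem solve_solvesDir {n : ℕ} (hn : 0 < n) (G : Digraph (Fin n)) (hG : ∀ v, ¬ G.Adj v v)
    (w : Fin n → Fin n → ℕ) (W : ℕ) (hW : ∀ u v, G.Adj u v → w u v ≤ W) :
    ∃ (σ : State) (t s : ℕ), Exec solve (inputDir G w) σ t s ∧ SolvesDir G w σ ∧
      s ≤ bigConst * (n + Nat.size W) ^ 26 ∧ ∀ d : ℝ, avgDegreeDir G ≤ d →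
        (t : ℝ) ≤ bigConst * ((n : ℝ) + Nat.size W) ^ 26 * ((W : ℝ) + 1) * (2 - gap d) ^ n := by
  obtain ⟨m, rfl⟩ : ∃ m, n = m + 1 := ⟨n - 1, by omega⟩
  obtain ⟨σ, t, s, h1, h2, h3, h4⟩ := solve_bounded (initial_input G.Adj w hG)
    (total_matrix_le G.Adj w hW)
  refine ⟨σ, t, s, h1, solvesDir_of_answer h2, h3, fun d hd => h4 d ?_⟩
  rw [arcs_matrix]
  exact (div_le_iff₀ (by positivity)).1 hd

/-! ### Undirected instances -/

theorem walkWeight_eq_sum {n : ℕ} {G : SimpleGraph (Fin n)} (w : Sym2 (Fin n) → ℕ) {u v : Fin n}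
    (p : G.Walk u v) :
    walkWeight w p = ∑ i ∈ Finset.range p.length, w s(p.getVert i, p.getVert (i + 1)) := by
  induction p with
  | nil => rfl
  | cons h p ih =>
    rw [SimpleGraph.Walk.length_cons, Finset.sum_range_succ', add_comm]
    simp only [SimpleGraph.Walk.getVert_cons_succ, SimpleGraph.Walk.getVert_zero]
    rw [← ih]
    rfl

theorem exists_walk {V : Type*} {G : SimpleGraph V} (f : ℕ → V) (k : ℕ)
    (h : ∀ i < k, G.Adj (f i) (f (i + 1))) :
    ∃ p : G.Walk (f 0) (f k), p.length = k ∧ ∀ i ≤ k, p.getVert i = f i := by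
  induction k generalizing f with
  | zero => exact ⟨.nil, rfl, fun i hi => by simp [Nat.le_zero.1 hi]⟩
  | succ k ih =>
    obtain ⟨p, h1, h2⟩ := ih (fun i => f (i + 1)) fun i hi => h (i + 1) (by omega)
    refine ⟨.cons (h 0 (by omega)) p, by simp [h1], fun i hi => ?_⟩
    cases i with
    | zero => rfl
    | succ i =>
      rw [SimpleGraph.Walk.getVert_cons_succ]
      exact h2 i (by omega)

/-- The tail of the walk visits the same vertices with `0` replaced by `n`, so it is a path. A
length of at least three then excludes running back and forth along one edge. -/
theorem isHamiltonianCycle_of_injOn {n : ℕ} (hn : 3 ≤ n) {G : SimpleGraph (Fin n)} {u : Fin n}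
    {p : G.Walk u u} (hl : p.length = n) (h : Set.InjOn p.getVert {i | i < n}) :
    p.IsHamiltonianCycle := by
  rw [SimpleGraph.Walk.isHamiltonianCycle_iff_isCycle_and_length_eq, Fintype.card_fin]
  refine ⟨SimpleGraph.Walk.isCycle_iff_isPath_tail_and_le_length.2 ⟨?_, by omega⟩, hl⟩
  rw [← SimpleGraph.Walk.IsPath.getVert_injOn_iff]
  have hnil : ¬ p.Nil := by
    rw [← SimpleGraph.Walk.length_eq_zero_iff]
    omega
  have h1 := SimpleGraph.Walk.length_tail_add_one hnil
  have h0 : p.getVert n = p.getVert 0 :=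
    (congrArg p.getVert hl.symm).trans (p.getVert_length.trans p.getVert_zero.symm)
  intro i hi j hj hij
  simp only [Set.mem_ofPred_eq, SimpleGraph.Walk.getVert_tail] at hi hj hij
  rcases Nat.lt_or_ge (i + 1) n with hi' | hi' <;> rcases Nat.lt_or_ge (j + 1) n with hj' | hj'
  · have := h hi' hj' hij
    omega
  · rw [show j + 1 = n by omega, h0] at hij
    have := h hi' (show 0 < n by omega) hij
    omega
  · rw [show i + 1 = n by omega, h0] at hij
    have := h (show 0 < n by omega) hj' hij
    omega
  · omega

theorem cyclic_succ {n : ℕ} {V : Type*} (f : ℕ → V) (hf : f n = f 0) (i : Fin n) :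
    f (i + 1) = f (finRotate n i) := by
  obtain ⟨m, rfl⟩ : ∃ m, n = m + 1 := ⟨n - 1, by have := i.2; omega⟩
  rw [coe_finRotate]
  split_ifs with h
  · rw [h, Fin.val_last, hf]
  · rfl

theorem sum_cyclic {n : ℕ} {V : Type*} (f : ℕ → V) (g : V → V → ℕ) (hf : f n = f 0) :
    ∑ i ∈ Finset.range n, g (f i) (f (i + 1)) = ∑ i : Fin n, g (f i) (f (finRotate n i)) := by
  rw [Finset.sum_range]
  refine Finset.sum_congr rfl fun i _ => ?_
  rw [cyclic_succ f hf]

theorem exists_cycle_of_isHamCycleDir {n : ℕ} (hn : 3 ≤ n) {G : SimpleGraph (Fin n)}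
    (w : Sym2 (Fin n) → ℕ) {t : Fin n → Fin n} (h : IsHamCycleDir ⟨G.Adj⟩ t) :
    ∃ (u : Fin n) (p : G.Walk u u), p.IsHamiltonianCycle ∧ (∀ i : Fin n, p.getVert i = t i) ∧
      walkWeight w p = cycleWeightDir (fun u v => w s(u, v)) t := by
  have hn0 : 0 < n := by omega
  set f : ℕ → Fin n := fun i => t ⟨i % n, Nat.mod_lt i hn0⟩ with hf
  have hft : ∀ i : Fin n, f i = t i := fun i => by simp [hf, Nat.mod_eq_of_lt i.2]
  have hfn : f n = f 0 := by simp [hf]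
  obtain ⟨p, h1, h2⟩ := exists_walk (G := G) f n fun i hi => by
    have := h.2 ⟨i, hi⟩
    rw [← hft, ← hft, ← cyclic_succ f hfn] at this
    exact this
  obtain ⟨q, hq⟩ : ∃ q : G.Walk (f 0) (f 0), q.length = n ∧ ∀ i ≤ n, q.getVert i = f i := by
    refine ⟨p.copy rfl hfn, by simpa using h1, fun i hi => by simpa using h2 i hi⟩
  refine ⟨f 0, q, isHamiltonianCycle_of_injOn hn hq.1 ?_, fun i => ?_, ?_⟩
  · intro i hi j hj hij
    rw [hq.2 i (le_of_lt hi), hq.2 j (le_of_lt hj), hft ⟨i, hi⟩, hft ⟨j, hj⟩] at hij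
    exact Fin.ext_iff.1 (h.1.1 hij)
  · rw [hq.2 i i.2.le, hft]
  · rw [walkWeight_eq_sum, hq.1, cycleWeightDir]
    calc _ = ∑ i ∈ Finset.range n, w s(f i, f (i + 1)) := by
          refine Finset.sum_congr rfl fun i hi => ?_
          have := Finset.mem_range.1 hi
          rw [hq.2 i (by omega), hq.2 (i + 1) (by omega)]
      _ = _ := by
          rw [sum_cyclic f (fun u v => w s(u, v)) hfn]
          simp only [hft]

theorem isHamCycleDir_of_cycle {n : ℕ} {G : SimpleGraph (Fin n)} (w : Sym2 (Fin n) → ℕ)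
    {u : Fin n} {p : G.Walk u u} (h : p.IsHamiltonianCycle) :
    IsHamCycleDir ⟨G.Adj⟩ (fun i : Fin n => p.getVert i) ∧
      cycleWeightDir (fun u v => w s(u, v)) (fun i : Fin n => p.getVert i) = walkWeight w p := by
  have hl := h.length_eq
  rw [Fintype.card_fin] at hl
  have h0 : p.getVert n = p.getVert 0 :=
    (congrArg p.getVert hl.symm).trans (p.getVert_length.trans p.getVert_zero.symm)
  refine ⟨⟨Finite.injective_iff_bijective.1 fun i j hij => ?_, fun i => ?_⟩, ?_⟩
  · refine Fin.ext (h.isCycle.getVert_injOn' ?_ ?_ hij)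
    · have := i.2
      exact (by omega : (i : ℕ) ≤ p.length - 1)
    · have := j.2
      exact (by omega : (j : ℕ) ≤ p.length - 1)
  · have := p.adj_getVert_succ (i := i) (by omega)
    rw [cyclic_succ p.getVert h0] at this
    exact this
  · rw [walkWeight_eq_sum, hl, sum_cyclic p.getVert (fun u v => w s(u, v)) h0]
    rfl

theorem solvesUndir_of_solvesDir {n : ℕ} (hn : 3 ≤ n) {G : SimpleGraph (Fin n)}
    {w : Sym2 (Fin n) → ℕ} {σ : State} (h : SolvesDir ⟨G.Adj⟩ (fun u v => w s(u, v)) σ) :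
    SolvesUndir G w σ := by
  rcases h with ⟨h0, h1⟩ | ⟨h0, t, h1, h2, h3⟩
  · exact Or.inl ⟨h0, fun u p hp => h1 _ (isHamCycleDir_of_cycle w hp).1⟩
  · obtain ⟨u, p, k1, k2, k3⟩ := exists_cycle_of_isHamCycleDir hn w h1
    refine Or.inr ⟨h0, u, p, k1, fun i => by rw [h2, k2], fun v q hq => ?_⟩
    obtain ⟨j1, j2⟩ := isHamCycleDir_of_cycle w hq
    rw [k3, ← j2]
    exact h3 _ j1

/-- On two vertices an edge would give a directed cycle of length two, but an undirected cycle has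
length at least three. Such instances are therefore rejected without a search. -/
theorem solvesUndir_of_le_two {n : ℕ} (hn : n ≤ 2) {G : SimpleGraph (Fin n)}
    {w : Sym2 (Fin n) → ℕ} {σ : State} (h : σ.reg 0 = 0) : SolvesUndir G w σ := by
  refine Or.inl ⟨h, fun u p hp => ?_⟩
  have h1 := hp.length_eq
  have h2 := hp.isCycle.three_le_length
  rw [Fintype.card_fin] at h1
  omega

/-- Each edge yields two arcs, which is the handshake lemma; so the same `gap` serves both kinds of
graphs. -/
theorem avgDegreeDir_eq_avgDegree {n : ℕ} (G : SimpleGraph (Fin n)) :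
    avgDegreeDir ⟨G.Adj⟩ = avgDegree G := by
  classical
  rw [avgDegreeDir, avgDegree]
  congr 1
  have h : {p : Fin n × Fin n | G.Adj p.1 p.2}.ncard = 2 * G.edgeSet.ncard := by
    rw [← SimpleGraph.coe_edgeFinset, Set.ncard_coe_finset, ← G.sum_degrees_eq_twice_card_edges,
      Set.ncard_eq_toFinset_card', Set.toFinset_ofPred, Finset.card_filter, Fintype.sum_prod_type]
    refine Finset.sum_congr rfl fun u _ => ?_
    rw [← SimpleGraph.card_neighborFinset_eq_degree, SimpleGraph.neighborFinset_eq_filter,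
      Finset.card_filter]
  exact_mod_cast h

/-- The program for the traveling salesman problem on undirected graphs. -/
def solveUndir : Prog := .seq (.const 5 2) (.seq (.arith .sub 5 0 5)
  (.ite 5 (.seq (.const 5 0) solve) (.const 0 0)))

/-- The test for few vertices borrows register `5` and clears it again. This identity shows that
`solve` then starts from exactly the initial memory. -/
theorem setReg_setReg (σ : State) (x v v' : ℕ) : (σ.setReg x v).setReg x v' = σ.setReg x v' := by
  simp [State.setReg]

theorem setReg_self (σ : State) (x : ℕ) : σ.setReg x (σ.reg x) = σ := by
  simp [State.setReg]

theorem setReg_space_le {n B x v : ℕ} {M : ℕ → ℕ} {σ : State} (hσ : Initial n M σ)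
    (hn : n < cap B) (hM : ∀ i, M i < cap B) (hx : x < 64) (hv : v < cap B) :
    (σ.setReg x v).space ≤ spc B (n * n) := by
  refine space_le (fun y => ?_) (fun y hy => ?_) ?_ ?_
  · rw [State.setReg_reg]
    split_ifs with h
    · exact hv
    · by_cases hy : y = 0
      · rw [hy, hσ.r0]
        exact hn
      · rw [hσ.reg_eq y hy]
        omega
  · rw [State.setReg_reg, if_neg (by omega), hσ.reg_eq y (by omega)]
  · rintro ⟨a, i⟩
    change σ.arr (a, i) < _
    by_cases ha : a = 0
    · rw [ha, hσ.a0]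
      exact hM i
    · rw [hσ.arr_eq a ha]
      omega
  · rintro ⟨a, i⟩ h
    change σ.arr (a, i) ≠ 0 at h
    have ha : a = 0 := by
      by_contra ha
      exact h (hσ.arr_eq a ha i)
    subst ha
    rw [hσ.a0] at h
    refine ⟨by simp, ?_⟩
    by_contra hi
    exact h (hσ.M_eq i (by omega))

theorem solveUndir_solvesUndir {n : ℕ} (hn : 0 < n) (G : SimpleGraph (Fin n))
    (w : Sym2 (Fin n) → ℕ) (W : ℕ) (hW : ∀ e ∈ G.edgeSet, w e ≤ W) :
    ∃ (σ : State) (t s : ℕ), Exec solveUndir (inputUndir G w) σ t s ∧ SolvesUndir G w σ ∧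
      s ≤ (bigConst + 12) * (n + Nat.size W) ^ 26 ∧ ∀ d : ℝ, avgDegree G ≤ d →
        (t : ℝ) ≤ (bigConst + 12 : ℕ) * ((n : ℝ) + Nat.size W) ^ 26 * ((W : ℝ) + 1) *
          (2 - gap d) ^ n := by
  have hG : ∀ v, ¬ G.Adj v v := fun v => G.irrefl
  have hW' : ∀ u v, G.Adj u v → w s(u, v) ≤ W := fun u v h => hW _ h
  have hI : Initial n (matrix G.Adj fun u v => w s(u, v)) (inputUndir G w) :=
    initial_input G.Adj _ hG
  have hU := total_matrix_le G.Adj (fun u v => w s(u, v)) hW'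
  obtain ⟨z, hz⟩ : ∃ z, z = n + Nat.size W := ⟨_, rfl⟩
  obtain ⟨hb1, hb2⟩ := bits_bounds hn hz hU
  have hM : ∀ i, matrix G.Adj (fun u v => w s(u, v)) i < cap (bits z) := by
    intro i
    by_cases hi : i < n * n
    · have h1 := le_bigBound n (total n (matrix G.Adj fun u v => w s(u, v)))
      have h2 := Nat.le_mul_self (bigBound n (total n (matrix G.Adj fun u v => w s(u, v))))
      have h3 : 1 * (total n (matrix G.Adj fun u v => w s(u, v)) + 1) ≤
          8 * (n + 1) ^ 2 * (total n (matrix G.Adj fun u v => w s(u, v)) + 1) :=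
        Nat.mul_le_mul_right _ (Nat.mul_pos (by omega) (by positivity))
      have := le_total (M := matrix G.Adj fun u v => w s(u, v)) hi
      omega
    · rw [hI.M_eq i (by omega)]
      omega
  have hnc : n < cap (bits z) := by omega
  have h2c : 2 < cap (bits z) := by
    have : 0 < n * (8 * 4 ^ n * (2 * n + 1)) * (n + 1) := by positivity
    omega
  have hz1 : 1 ≤ z := by omega
  have hs : ∀ x v, x < 64 → v < cap (bits z) →
      ((inputUndir G w).setReg x v).space ≤ (bigConst + 12) * z ^ 26 := fun x v hx hv =>
    (setReg_space_le hI hnc hM hx hv).trans ((spc_le hn (by omega)).trans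
      (Nat.mul_le_mul_right _ (by omega)))
  set σ₀ := inputUndir G w with hσ₀
  have e0 : σ₀.reg 0 = n := hI.r0
  have e5 : σ₀.reg 5 = 0 := hI.reg_eq 5 (by omega)
  have hs0 : σ₀.space ≤ (bigConst + 12) * z ^ 26 := by
    have := hs 5 0 (by omega) (by omega)
    rwa [← e5, setReg_self] at this
  have x1 := Exec.const σ₀ 5 2
  have x2 := Exec.arith (σ₀.setReg 5 2) .sub 5 0 5
  have r1 : (σ₀.setReg 5 2).reg 0 = n := by rw [State.setReg_reg, if_neg (by omega), e0]
  have r2 : (σ₀.setReg 5 2).reg 5 = 2 := by rw [State.setReg_reg, if_pos rfl]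
  rw [r1, r2, setReg_setReg, Op.eval] at x2
  have r3 : (σ₀.setReg 5 (n - 2)).reg 5 = n - 2 := by rw [State.setReg_reg, if_pos rfl]
  have s2 : Nat.size 2 = 2 := by decide
  have sn := size_le_self n
  have hone : ∀ d, (1 : ℝ) ≤ ((W : ℝ) + 1) * (2 - gap d) ^ n := fun d => by
    have h1 : (1 : ℝ) ≤ (2 - gap d) ^ n := one_le_pow₀ (by linarith [gap_lt_one d])
    have h2 : (0 : ℝ) ≤ W := Nat.cast_nonneg W
    nlinarith
  have hzc : (n : ℝ) + Nat.size W = z := by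
    rw [hz]
    push_cast
    rfl
  have hz26 : z ≤ z ^ 26 := Nat.le_self_pow (by omega) z
  -- The test adds at most `12 * z` to the time, which accounts for the `12` in the constant.
  have hsmall : ∀ (d : ℝ) (t : ℕ), t ≤ 12 * z → (t : ℝ) ≤ 12 * (z : ℝ) ^ 26 *
      (((W : ℝ) + 1) * (2 - gap d) ^ n) := fun d t ht => by
    have h1 : (t : ℝ) ≤ 12 * (z : ℝ) ^ 26 := by
      exact_mod_cast ht.trans (Nat.mul_le_mul_left 12 hz26)
    exact h1.trans (le_mul_of_one_le_right (by positivity) (hone d))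
  have hbig : ∀ d, (0 : ℝ) ≤ bigConst * (z : ℝ) ^ 26 * (((W : ℝ) + 1) * (2 - gap d) ^ n) :=
    fun d => mul_nonneg (by positivity) (zero_le_one.trans (hone d))
  rw [← hz, hzc]
  by_cases h3 : n ≤ 2
  · refine ⟨_, _, _, .seq x1 (.seq x2 (.ite_false (by rw [r3]; omega) (Exec.const _ 0 0))),
      solvesUndir_of_le_two h3 (by rw [State.setReg_reg, if_pos rfl]), ?_, fun d _ => ?_⟩
    · have e : σ₀.setReg 5 (n - 2) = σ₀ := by
        rw [show n - 2 = σ₀.reg 5 by rw [e5]; omega, setReg_self]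
      rw [e]
      exact max_le (max_le hs0 (hs _ _ (by omega) h2c)) (max_le (max_le (hs _ _ (by omega) h2c) hs0)
        (max_le hs0 (hs _ _ (by omega) (by omega))))
    · refine (hsmall d _ ?_).trans ?_
      · rw [s2, Nat.size_zero]
        omega
      · have := hbig d
        push_cast
        linarith
  · obtain ⟨σ, t, s, k1, k2, k3, k4⟩ := solve_solvesDir hn ⟨G.Adj⟩ hG (fun u v => w s(u, v)) W hW'
    have x3 := Exec.const (σ₀.setReg 5 (n - 2)) 5 0
    have e : σ₀.setReg 5 0 = σ₀ := by rw [← e5, setReg_self]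
    rw [setReg_setReg, e] at x3
    refine ⟨σ, _, _, .seq x1 (.seq x2 (.ite_true (by rw [r3]; omega) (.seq x3 k1))),
      solvesUndir_of_solvesDir (by omega) k2, ?_, fun d hd => ?_⟩
    · have hs3 := hs 5 (n - 2) (by omega) (by omega)
      rw [← hz] at k3
      exact max_le (max_le hs0 (hs _ _ (by omega) h2c)) (max_le (max_le (hs _ _ (by omega) h2c) hs3)
        (max_le (max_le hs3 hs0) (k3.trans (Nat.mul_le_mul_right _ (by omega)))))
    · have h4 := k4 d (by rwa [avgDegreeDir_eq_avgDegree])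
      rw [hzc] at h4
      rw [r3]
      have sn2 := size_le_self (n - 2)
      have h5 := hsmall d (1 + Nat.size 2 + ((1 + n.size) * (1 + Nat.size 2) +
        (1 + Nat.size (n - 2) + (1 + Nat.size 0)))) (by rw [s2, Nat.size_zero]; omega)
      push_cast at h5 ⊢
      linarith

end TSP

theorem mainTheorem2 :
    ∃ ε : ℝ → ℝ, (∀ d : ℝ, 0 < ε d ∧ ε d < 1) ∧
      -- undirected graphs
      (∃ (P : RAM.Prog) (C k : ℕ), ∀ (n : ℕ), 0 < n →
        ∀ (G : SimpleGraph (Fin n)) (w : Sym2 (Fin n) → ℕ) (W : ℕ),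
          (∀ e ∈ G.edgeSet, w e ≤ W) →
          ∃ (σ : RAM.State) (t s : ℕ),
            RAM.Exec P (TSP.inputUndir G w) σ t s ∧
            TSP.SolvesUndir G w σ ∧
            s ≤ C * (n + Nat.size W) ^ k ∧
            ∀ d : ℝ, TSP.avgDegree G ≤ d →
              (t : ℝ) ≤ C * ((n : ℝ) + Nat.size W) ^ k * ((W : ℝ) + 1) * (2 - ε d) ^ n) ∧
      -- directed graphs
      (∃ (P : RAM.Prog) (C k : ℕ), ∀ (n : ℕ), 0 < n →
        ∀ (G : Digraph (Fin n)), (∀ v, ¬ G.Adj v v) →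
        ∀ (w : Fin n → Fin n → ℕ) (W : ℕ),
          (∀ u v, G.Adj u v → w u v ≤ W) →
          ∃ (σ : RAM.State) (t s : ℕ),
            RAM.Exec P (TSP.inputDir G w) σ t s ∧
            TSP.SolvesDir G w σ ∧
            s ≤ C * (n + Nat.size W) ^ k ∧
            ∀ d : ℝ, TSP.avgDegreeDir G ≤ d →
              (t : ℝ) ≤ C * ((n : ℝ) + Nat.size W) ^ k * ((W : ℝ) + 1) * (2 - ε d) ^ n) := by

  refine ⟨RAM.gap, fun d => ⟨RAM.gap_pos d, RAM.gap_lt_one d⟩,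
    ⟨TSP.solveUndir, RAM.bigConst + 12, 26, fun n hn G w W hW =>
      TSP.solveUndir_solvesUndir hn G w W hW⟩,
    ⟨RAM.solve, RAM.bigConst, 26, fun n hn G hG w W hW => TSP.solve_solvesDir hn G hG w W hW⟩⟩
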